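/- **Parity games.** A (finite) parity game $G=(V,V_0,V_1,E,c)$ has a finite, possibly empty, node set $V=V_0\uplus V_1$, edges $E\subseteq V\times V$ such that every node has a successor, and a coloring $c\colon V\to\mathbb N$; $|c|$ is the number of different colors of nodes. Write $v.E$ for the set of successors of $v$ and $p\in\{0,1\}$ for a player. For node sets $A,X$ and $d\in\mathbb N$ let $$\mathrm{cpre}_p(X)=\{v\in V_p: v.E\cap X\neq\emptyset\}\cup\{v\in V_{1-p}: v.E\subseteq X\},\qquad \mathrm{Attr}_p[G,X]=\mu Z.\,X\cup\mathrm{cpre}_p(Z),$$ $$\mathrm{MAttr}_p(X,d)=\mu Z.\,\{v\in \mathrm{cpre}_p(Z\cup X): c(v)\ge d\},\qquad \mathrm{PMAttr}_p(X,d)=\mu Z.\,\{v\in \mathrm{cpre}_p(Z\cup X): c(v)\ge d\text{ or }v\in X\}.$$ Let $G\setminus A$ be $G$ without the nodes in $A$ and their edges. For a non-empty set $X$ of nodes whose colors all have parity $p$, $\mathrm{layeredAttr}(G,p,X)$ is the final value of $A$ when one starts with $A=\emptyset$ and sets $A:=\mathrm{PMAttr}_p(A\cup\{v\in X: c(v)\le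 d\},d)$ for $d=p,p+2,\dots$ up to $\max_{v\in X}c(v)$. **Partial solvers.** Each returns a residual game, and the node sets classified as won by player $0$ and by player $1$; whenever $G\setminus\mathrm{Attr}_p[G,W]$ is formed below, $\mathrm{Attr}_p[G,W]$ is added to the nodes won by $p$. * `psol`$(G)$: for the nodes $k\in V$ in descending order of color (ties in any order), let $p=c(k)\bmod 2$ and $M=\mathrm{MAttr}_p(\{k\},c(k))$. If $k\in M$, return `psol`$(G\setminus\mathrm{Attr}_p[G,M])$; otherwise remove all edges $(k,w)$ with $w\in M$ from $G$ and continue. After the loop return $G$. * `psolB`$(G)$: for the colors $d$ of $G$ in descending order, let $p=d\bmod 2$ and $X=\{v: c(v)=d\}$. While $X\ne\emptyset$, let $M=\mathrm{MAttr}_p(X,d)$; if $X\subseteq M$, return `psolB`$(G\setminus\mathrm{Attr}_p[G,M])$, otherwise set $X:=X\cap M$. After the loop over the colors return $G$. * `psolQ`$(G)$: for the colors $b$ of $G$ in ascending order, let $p=b\bmod 2$ and $X=\{v: c(v)\le b,\ c(v)\equiv b \pmod 2\}$. While $X\neq\emptyset$, let $W=\mathrm{layeredAttr}(G,p,X)$;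 if $X\subseteq W$, return `psolQ`$(G\setminus\mathrm{Attr}_p[G,W])$, otherwise set $X:=X\cap W$. After the loop over the colors return $G$. **Machine model.** Running times are numbers of steps of a unit-cost random access machine (registers and arrays of natural numbers; successor, predecessor, parity, comparison, array access). A game is given by its number of nodes and arrays with the color, the owner and the list of successors of each node. **Theorem.** Let $G$ be a finite parity game with node set $V$, edge set $E$ and $|c|$ different colors. 1. `psol` and `psolB`, that is, the pseudo-code above with each attractor computed backwards from its target along predecessor lists with one counter for each node, run in time $O(|V|^2\cdot|E|)$. 2. `psol` and `psolB` can be implemented to run in time $O(|V|^3)$: there are programs that halt within $O(|V|^3)$ steps on every such $G$ and return an outcome of `psol`, respectively of `psolB`, on $G$. 3. `psolQ`, with attractors computed in the same way, runs in time $O(|V|^2\cdot|E|\cdot|c|)$. The programs in 1 and 3 also return an outcome of the respective solver. All constants are absolute; for the empty game the bounds are to be read as $O(1)$. -/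

import Mathlib

namespace ParityGames

/-! ## Parity games, attractors, monotone attractors -/

/-- The data of a parity game: `V p` is the set of nodes owned by player `p`, `E` is the edge
relation and `c` is the coloring (only its values on nodes matter). -/
structure Arena (α : Type*) where
  V : Fin 2 → Set α
  E : Set (α × α)
  c : α → ℕ

variable {α : Type*}

namespace Arena

/-- The node set `V = V₀ ∪ V₁`. -/
def nodes (G : Arena α) : Set α := G.V 0 ∪ G.V 1

/-- The successors `v.E` of `v`. -/
def succs (G : Arena α) (v : α) : Set α := {w | (v, w) ∈ G.E}

/-- The set of colors that occur in `G`. -/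
def colors (G : Arena α) : Set ℕ := G.c '' G.nodes

/-- Finite parity games: the two node sets partition the (possibly empty) finite set of nodes,
edges run between nodes, and every node has a successor. -/
structure IsParityGame (G : Arena α) : Prop where
  finite : G.nodes.Finite
  disjoint : Disjoint (G.V 0) (G.V 1)
  edges : G.E ⊆ G.nodes ×ˢ G.nodes
  total : ∀ v ∈ G.nodes, (G.succs v).Nonempty

/-- `|V|`. -/
noncomputable def numNodes (G : Arena α) : ℕ := G.nodes.ncard

/-- `|E|`. -/
noncomputable def numEdges (G : Arena α) : ℕ := G.E.ncard

/-- `|c|`, the number of different colors. -/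
noncomputable def numColors (G : Arena α) : ℕ := G.colors.ncard

/-- `G ∖ A`: remove the nodes in `A` together with their incoming and outgoing edges. -/
def removeNodes (G : Arena α) (A : Set α) : Arena α where
  V p := G.V p \ A
  E := {e ∈ G.E | e.1 ∉ A ∧ e.2 ∉ A}
  c := G.c

/-- Remove the edges in `F`. -/
def removeEdges (G : Arena α) (F : Set (α × α)) : Arena α where
  V := G.V
  E := G.E \ F
  c := G.c

/-- The control predecessor of `X` for player `p`. -/
def cpre (G : Arena α) (p : Fin 2) (X : Set α) : Set α :=
  {v ∈ G.V p | (G.succs v ∩ X).Nonempty} ∪ {v ∈ G.V (1 - p) | G.succs v ⊆ X}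

theorem cpre_mono (G : Arena α) (p : Fin 2) : Monotone (G.cpre p) := by
  rintro X Y h v (⟨h1, h2⟩ | ⟨h1, h2⟩)
  · exact Or.inl ⟨h1, h2.mono (Set.inter_subset_inter_right _ h)⟩
  · exact Or.inr ⟨h1, h2.trans h⟩

/-- The attractor `Attr_p(X) = μZ. X ∪ cpre_p(Z)`. -/
def attr (G : Arena α) (p : Fin 2) (X : Set α) : Set α :=
  OrderHom.lfp ⟨fun Z => X ∪ G.cpre p Z, fun _ _ h => Set.union_subset_union_right _ (G.cpre_mono p h)⟩

/-- The monotone control predecessor of `A` for `p` with target `X` and color `d`. -/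
def mpre (G : Arena α) (p : Fin 2) (A X : Set α) (d : ℕ) : Set α :=
  {v ∈ G.V p | d ≤ G.c v ∧ (G.succs v ∩ (A ∪ X)).Nonempty} ∪
    {v ∈ G.V (1 - p) | d ≤ G.c v ∧ G.succs v ⊆ A ∪ X}

theorem mpre_mono (G : Arena α) (p : Fin 2) (X : Set α) (d : ℕ) :
    Monotone fun A => G.mpre p A X d := by
  rintro A B h v (⟨h1, h2, h3⟩ | ⟨h1, h2, h3⟩)
  · exact Or.inl ⟨h1, h2, h3.mono (Set.inter_subset_inter_right _ (Set.union_subset_union_left _ h))⟩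
  · exact Or.inr ⟨h1, h2, h3.trans (Set.union_subset_union_left _ h)⟩

/-- The monotone attractor `MAttr_p(X, d) = μZ. mpre_p(Z, X, d)`. -/
def mattr (G : Arena α) (p : Fin 2) (X : Set α) (d : ℕ) : Set α :=
  OrderHom.lfp ⟨fun Z => G.mpre p Z X d, G.mpre_mono p X d⟩

/-- The permissive monotone control predecessor of `A` for `p` with target `X` and color `d`. -/
def pmpre (G : Arena α) (p : Fin 2) (A X : Set α) (d : ℕ) : Set α :=
  {v ∈ G.V p | (d ≤ G.c v ∨ v ∈ X) ∧ (G.succs v ∩ (A ∪ X)).Nonempty} ∪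
    {v ∈ G.V (1 - p) | (d ≤ G.c v ∨ v ∈ X) ∧ G.succs v ⊆ A ∪ X}

theorem pmpre_mono (G : Arena α) (p : Fin 2) (X : Set α) (d : ℕ) :
    Monotone fun A => G.pmpre p A X d := by
  rintro A B h v (⟨h1, h2, h3⟩ | ⟨h1, h2, h3⟩)
  · exact Or.inl ⟨h1, h2, h3.mono (Set.inter_subset_inter_right _ (Set.union_subset_union_left _ h))⟩
  · exact Or.inr ⟨h1, h2, h3.trans (Set.union_subset_union_left _ h)⟩

/-- The permissive monotone attractor `PMAttr_p(X, d) = μZ. pmpre_p(Z, X, d)`. -/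
def pmattr (G : Arena α) (p : Fin 2) (X : Set α) (d : ℕ) : Set α :=
  OrderHom.lfp ⟨fun Z => G.pmpre p Z X d, G.pmpre_mono p X d⟩

/-- The player `d % 2`. -/
def player (d : ℕ) : Fin 2 := ⟨d % 2, Nat.mod_lt d two_pos⟩

/-- The monotone attractor to one node `k`, for the player and with the color of `k`. -/
def fattr (G : Arena α) (k : α) : Set α := G.mattr (player (G.c k)) {k} (G.c k)

/-- The value of `A` in `layeredAttr(G, p, X)` after `i` iterations of its for-loop; iteration
number `i` (counted from `0`) has `d = p + 2 * i`. -/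
def layer (G : Arena α) (p : Fin 2) (X : Set α) : ℕ → Set α
  | 0 => ∅
  | i + 1 => G.pmattr p (G.layer p X i ∪ {v ∈ X | G.c v ≤ p.val + 2 * i}) (p.val + 2 * i)

/-- `layeredAttr(G, p, X)`, for a non-empty set `X` of nodes whose colors have parity `p`: the
for-loop runs through all `d = p, p + 2, …` up to the maximal color `b` in `X`. -/
noncomputable def layeredAttr (G : Arena α) (p : Fin 2) (X : Set α) : Set α :=
  G.layer p X ((sSup (G.c '' X) - p.val) / 2 + 1)

end Arena

/-! ## The pseudo-code of the partial solvers

Each solver is a relation between an input game and an outcome. -/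

/-- What a partial solver returns: the residual game, and the sets of nodes that it has
classified as won by player `0` and by player `1`. -/
structure Outcome (α : Type*) where
  residual : Arena α
  won : Fin 2 → Set α

/-- Record the nodes in `A` as won by player `p`. -/
def Outcome.record (r : Outcome α) (p : Fin 2) (A : Set α) : Outcome α where
  residual := r.residual
  won q := {v | v ∈ r.won q ∨ (q = p ∧ v ∈ A)}

open Arena

/-- `l` lists the nodes of `G`, each once, in descending color ordering (ties in any order). -/
def NodeOrder (G : Arena α) (l : List α) : Prop :=
  l.Nodup ∧ (∀ v, v ∈ l ↔ v ∈ G.nodes) ∧ l.Pairwise fun v w => G.c w ≤ G.c v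

/-- The for-loop of `psol`: `PsolLoop l G r` says that the loop, with the nodes in `l` still to be
visited in this order and with current game `G`, can return `r`. -/
inductive PsolLoop : List α → Arena α → Outcome α → Prop
  | done (G : Arena α) : PsolLoop [] G ⟨G, fun _ => ∅⟩
  | fatal {k : α} {l l' : List α} {G : Arena α} {r : Outcome α} {A : Set α}
      (hk : k ∈ G.fattr k)
      (hA : A = G.attr (player (G.c k)) (G.fattr k))
      (hl : NodeOrder (G.removeNodes A) l')
      (hr : PsolLoop l' (G.removeNodes A) r) :
      PsolLoop (k :: l) G (r.record (player (G.c k)) A)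
  | next {k : α} {l : List α} {G : Arena α} {r : Outcome α}
      (hk : k ∉ G.fattr k)
      (hr : PsolLoop l (G.removeEdges {e | e.1 = k ∧ e.2 ∈ G.fattr k}) r) :
      PsolLoop (k :: l) G r

/-- `psol` on input `G` can return `r`. -/
def Psol (G : Arena α) (r : Outcome α) : Prop :=
  ∃ l, NodeOrder G l ∧ PsolLoop l G r

/-- The while-loop in `psolB` and `psolQ` for an attractor operator `F`, with current values `X`
and `cache`: it is either left normally (`none`), or it reaches the return statement with
attractor `W` (`some W`). -/
inductive FatalSearch (F : Set α → Set α) : Set α → Set α → Option (Set α) → Prop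
  | exit {X cache : Set α} (h : X = ∅ ∨ X = cache) : FatalSearch F X cache none
  | found {X cache : Set α} (h : X ≠ ∅ ∧ X ≠ cache) (hX : X ⊆ F X) :
      FatalSearch F X cache (some (F X))
  | shrink {X cache : Set α} {o : Option (Set α)} (h : X ≠ ∅ ∧ X ≠ cache) (hX : ¬ X ⊆ F X)
      (ho : FatalSearch F (X ∩ F X) X o) : FatalSearch F X cache o

/-- The for-loop over colors that `psolB` and `psolQ` share. `order G ds` says that `ds` is the
order in which the colors of `G` are explored, `init G d` is the initial value of `X`, and `F G d`
is the attractor operator that is used for color `d`. -/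
inductive ColorLoop (order : Arena α → List ℕ → Prop) (init : Arena α → ℕ → Set α)
    (F : Arena α → ℕ → Set α → Set α) : List ℕ → Arena α → Outcome α → Prop
  | done (G : Arena α) : ColorLoop order init F [] G ⟨G, fun _ => ∅⟩
  | fatal {d : ℕ} {ds ds' : List ℕ} {G : Arena α} {r : Outcome α} {W A : Set α}
      (hW : FatalSearch (F G d) (init G d) ∅ (some W))
      (hA : A = G.attr (player d) W)
      (hds : order (G.removeNodes A) ds')
      (hr : ColorLoop order init F ds' (G.removeNodes A) r) :
      ColorLoop order init F (d :: ds) G (r.record (player d) A)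
  | next {d : ℕ} {ds : List ℕ} {G : Arena α} {r : Outcome α}
      (hW : FatalSearch (F G d) (init G d) ∅ none)
      (hr : ColorLoop order init F ds G r) :
      ColorLoop order init F (d :: ds) G r

/-- The colors of `G` in descending order. -/
def Descending (G : Arena α) (ds : List ℕ) : Prop :=
  (∀ d, d ∈ ds ↔ d ∈ G.colors) ∧ ds.Pairwise fun d e => e < d

/-- The colors of `G` in ascending order. -/
def Ascending (G : Arena α) (ds : List ℕ) : Prop :=
  (∀ d, d ∈ ds ↔ d ∈ G.colors) ∧ ds.Pairwise fun d e => d < e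

/-- `psolB` on input `G` returns `r`. -/
def PsolB (G : Arena α) (r : Outcome α) : Prop :=
  ∃ ds, Descending G ds ∧
    ColorLoop Descending (fun G d => {v ∈ G.nodes | G.c v = d})
      (fun G d X => G.mattr (player d) X d) ds G r

/-- `psolQ` on input `G` returns `r`. -/
def PsolQ (G : Arena α) (r : Outcome α) : Prop :=
  ∃ ds, Ascending G ds ∧
    ColorLoop Ascending (fun G b => {v ∈ G.nodes | G.c v ≤ b ∧ G.c v % 2 = b % 2})
      (fun G b X => G.layeredAttr (player b) X) ds G r

/-! ## The machine model

A random access machine with unit costs, programmed in a structured language. Memory consists of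
registers and of arrays with two indices; every cell holds a natural number. The only arithmetic is
successor, predecessor, parity and comparison, so that no number in memory ever exceeds the numbers
in the input and the constants in the program by more than the number of steps. -/

/-- Expressions. Truth values are `0` (false) and `1` (true); any non-zero number counts as true. -/
inductive Expr
  | const (k : ℕ)
  | reg (x : ℕ)
  | get (a : ℕ) (i j : Expr)
  | succ (e : Expr)
  | pred (e : Expr)
  | parity (e : Expr)
  | lt (e f : Expr)
  | eq (e f : Expr)
  | and (e f : Expr)
  | or (e f : Expr)

/-- Commands. -/
inductive Cmd
  | skip
  | set (x : ℕ) (e : Expr)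
  | put (a : ℕ) (i j e : Expr)
  | seq (c d : Cmd)
  | ite (b : Expr) (c d : Cmd)
  | while (b : Expr) (c : Cmd)

/-- Memory: `reg x` is the content of register `x`, and `arr a i j` is that of cell `(i, j)` of
array `a`. -/
structure Store where
  reg : ℕ → ℕ
  arr : ℕ → ℕ → ℕ → ℕ

/-- The value of an expression. -/
def Expr.eval (s : Store) : Expr → ℕ
  | const k => k
  | reg x => s.reg x
  | get a i j => s.arr a (i.eval s) (j.eval s)
  | succ e => e.eval s + 1
  | pred e => e.eval s - 1
  | parity e => e.eval s % 2
  | lt e f => if e.eval s < f.eval s then 1 else 0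
  | eq e f => if e.eval s = f.eval s then 1 else 0
  | and e f => if e.eval s ≠ 0 ∧ f.eval s ≠ 0 then 1 else 0
  | or e f => if e.eval s ≠ 0 ∨ f.eval s ≠ 0 then 1 else 0

/-- The number of steps for the evaluation of an expression: one for each operation. -/
def Expr.cost : Expr → ℕ
  | const _ => 1
  | reg _ => 1
  | get _ i j => i.cost + j.cost + 1
  | succ e => e.cost + 1
  | pred e => e.cost + 1
  | parity e => e.cost + 1
  | lt e f => e.cost + f.cost + 1
  | eq e f => e.cost + f.cost + 1
  | and e f => e.cost + f.cost + 1
  | or e f => e.cost + f.cost + 1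

/-- Overwrite register `x`. -/
def Store.setReg (s : Store) (x n : ℕ) : Store where
  reg := Function.update s.reg x n
  arr := s.arr

/-- Overwrite cell `(i, j)` of array `a`. -/
def Store.setArr (s : Store) (a i j n : ℕ) : Store where
  reg := s.reg
  arr := Function.update s.arr a
    (Function.update (s.arr a) i (Function.update (s.arr a i) j n))

/-- `Exec c s t s'`: command `c`, started in memory `s`, halts after exactly `t` steps, with
memory `s'`. -/
inductive Exec : Cmd → Store → ℕ → Store → Prop
  | skip (s : Store) : Exec .skip s 1 s
  | set (x : ℕ) (e : Expr) (s : Store) : Exec (.set x e) s (e.cost + 1) (s.setReg x (e.eval s))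
  | put (a : ℕ) (i j e : Expr) (s : Store) :
      Exec (.put a i j e) s (i.cost + j.cost + e.cost + 1)
        (s.setArr a (i.eval s) (j.eval s) (e.eval s))
  | seq {c d : Cmd} {s s' s'' : Store} {t t' : ℕ} (h : Exec c s t s') (h' : Exec d s' t' s'') :
      Exec (.seq c d) s (t + t') s''
  | iteTrue {b : Expr} {c d : Cmd} {s s' : Store} {t : ℕ} (hb : b.eval s ≠ 0)
      (h : Exec c s t s') : Exec (.ite b c d) s (b.cost + 1 + t) s'
  | iteFalse {b : Expr} {c d : Cmd} {s s' : Store} {t : ℕ} (hb : b.eval s = 0)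
      (h : Exec d s t s') : Exec (.ite b c d) s (b.cost + 1 + t) s'
  | whileTrue {b : Expr} {c : Cmd} {s s' s'' : Store} {t t' : ℕ} (hb : b.eval s ≠ 0)
      (h : Exec c s t s') (h' : Exec (.while b c) s' t' s'') :
      Exec (.while b c) s (b.cost + 1 + t + t') s''
  | whileFalse {b : Expr} {c : Cmd} {s : Store} (hb : b.eval s = 0) :
      Exec (.while b c) s (b.cost + 1) s

/-! ## Games in memory

The nodes are numbered `0, …, n - 1` by `ν`, and `n` is in register `0`. For a node with number `i`,
`colA[i, 0]` is its color, `ownA[i, 0]` is its owner, `degA[i, 0]` is its out-degree, and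
`sucA[i, 0], sucA[i, 1], …` lists (the numbers of) its successors in some order. Output goes to
the same arrays, and to `winA`: there `winA[i, 0]` is `0` if the node is still in the residual
game, and `p + 1` if it was classified as won by player `p`. -/

abbrev colA : ℕ := 0
abbrev ownA : ℕ := 1
abbrev degA : ℕ := 2
abbrev sucA : ℕ := 3
abbrev winA : ℕ := 4

/-- The arrays in `s` describe the game `G`, whose nodes are numbered by `ν`. -/
structure Describes (s : Store) (ν : α → ℕ) (G : Arena α) : Prop where
  color : ∀ v ∈ G.nodes, s.arr colA (ν v) 0 = G.c v
  owner : ∀ p, ∀ v ∈ G.V p, s.arr ownA (ν v) 0 = p.val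
  nodup : ∀ v ∈ G.nodes, ((List.range (s.arr degA (ν v) 0)).map (s.arr sucA (ν v))).Nodup
  succs : ∀ v ∈ G.nodes, ∀ i,
    i ∈ (List.range (s.arr degA (ν v) 0)).map (s.arr sucA (ν v)) ↔ i ∈ ν '' G.succs v

/-- Memory `s` holds the input `G`; memory outside of the input is arbitrary. -/
def IsInput (s : Store) (ν : α → ℕ) (G : Arena α) : Prop :=
  Set.BijOn ν G.nodes (Set.Iio (s.reg 0)) ∧ Describes s ν G

/-- Memory `s` holds the outcome `r` for input `G`. -/
def IsOutput (s : Store) (ν : α → ℕ) (G : Arena α) (r : Outcome α) : Prop :=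
  Describes s ν r.residual ∧
    (∀ v ∈ G.nodes, s.arr winA (ν v) 0 = 0 ↔ v ∈ r.residual.nodes) ∧
    ∀ p : Fin 2, ∀ v ∈ G.nodes, s.arr winA (ν v) 0 = p.val + 1 ↔ v ∈ r.won p

/-- Program `P`, started on any representation of `G` in memory, halts after at most `T` steps and
has then computed an outcome of the given solver on `G`. -/
def RunsWithin (P : Cmd) (solver : Arena α → Outcome α → Prop) (G : Arena α) (T : ℕ) : Prop :=
  ∀ (ν : α → ℕ) (s : Store), IsInput s ν G →
    ∃ (t : ℕ) (s' : Store), Exec P s t s' ∧ t ≤ T ∧ ∃ r, solver G r ∧ IsOutput s' ν G r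

/-! ## The partial solvers as programs

The pseudo-code, spelled out for the machine. Each attractor is computed backwards from its
target along predecessor lists, with one counter for each node. -/

namespace Code

infixr:35 " ;; " => Cmd.seq

open ParityGames.Expr

/-- The entry `a[i]` of an array that is used with one index. -/
abbrev at1 (a : ℕ) (i : Expr) : Expr := get a i (const 0)

/-- The assignment `a[i] := e`. -/
abbrev put1 (a : ℕ) (i e : Expr) : Cmd := .put a i (const 0) e

/-- `x := x + 1`. -/
abbrev incr (x : ℕ) : Cmd := .set x (succ (reg x))

/-- `if b then c`. -/
abbrev when (b : Expr) (c : Cmd) : Cmd := .ite b c .skip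

/-- `e ≤ f`. -/
abbrev le (e f : Expr) : Expr := lt e (succ f)

/-- `for x = 0, …, e - 1 do c`. -/
abbrev for' (x : ℕ) (e : Expr) (c : Cmd) : Cmd :=
  .set x (const 0) ;; .while (lt (reg x) e) (c ;; incr x)

/-! Work arrays: `ordA` nodes sorted by color; `pdgA`, `preA` in-degrees and predecessor lists; `tgtA`
nodes that have been put into the queue (targets and attracted nodes); `attA` attracted
nodes; `cntA` number of successors in `tgtA`; `satA` nodes from which the attracting player
forces to get to `tgtA` in one move; `queA` the queue; `setA` the set `X`; `cchA` the set
`cache`. -/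

abbrev ordA : ℕ := 5
abbrev pdgA : ℕ := 6
abbrev preA : ℕ := 7
abbrev tgtA : ℕ := 8
abbrev attA : ℕ := 9
abbrev cntA : ℕ := 10
abbrev satA : ℕ := 11
abbrev queA : ℕ := 12
abbrev setA : ℕ := 13
abbrev cchA : ℕ := 14

/-! Registers: `nR` number of nodes; `pR` attracting player; `dR` current color; `thR` least color
that may be attracted; `hdR`, `tlR` head and tail of the queue; `iR` position in the for-loop of a
solver; `goR` whether the body of the solver is to be run (again); `okR`, `neR`, `nwR` results of
tests; `lsR` successor of the last color that was treated, and `0` if there is none; the others are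
scratch. -/

abbrev nR : ℕ := 0
abbrev pR : ℕ := 1
abbrev dR : ℕ := 2
abbrev thR : ℕ := 3
abbrev hdR : ℕ := 4
abbrev tlR : ℕ := 5
abbrev iR : ℕ := 6
abbrev goR : ℕ := 7
abbrev okR : ℕ := 8
abbrev neR : ℕ := 9
abbrev nwR : ℕ := 10
abbrev lsR : ℕ := 11
abbrev kR : ℕ := 12
abbrev vR : ℕ := 13
abbrev wR : ℕ := 14
abbrev jR : ℕ := 15
abbrev lR : ℕ := 16
abbrev xR : ℕ := 17

/-- `v` is in the current game. -/
abbrev alive (v : Expr) : Expr := eq (at1 winA v) (const 0)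

/-- Sort the nodes by color into `ordA`, by insertion; `before e f` says that color `e` has to come
before color `f`. -/
def sortNodes (before : Expr → Expr → Expr) : Cmd :=
  for' vR (reg nR)
    (.set jR (reg vR) ;;
     .set xR (const 1) ;;
     .while (and (reg xR) (lt (const 0) (reg jR)))
       (.ite (before (at1 colA (reg vR)) (at1 colA (at1 ordA (pred (reg jR)))))
         (put1 ordA (reg jR) (at1 ordA (pred (reg jR))) ;;
          .set jR (pred (reg jR)))
         (.set xR (const 0))) ;;
     put1 ordA (reg jR) (reg vR))

/-- Compute the predecessor lists of the current game. -/
def listPreds : Cmd :=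
  for' vR (reg nR) (put1 pdgA (reg vR) (const 0)) ;;
  for' vR (reg nR)
    (when (alive (reg vR))
      (for' jR (at1 degA (reg vR))
        (.set wR (get sucA (reg vR) (reg jR)) ;;
         .put preA (reg wR) (at1 pdgA (reg wR)) (reg vR) ;;
         put1 pdgA (reg wR) (succ (at1 pdgA (reg wR))))))

/-- Remove from the successor list of node `v` all nodes `w` that fail the test `keep w`. -/
def filterSuccs (v : Expr) (keep : Expr → Expr) : Cmd :=
  .set lR (const 0) ;;
  for' jR (at1 degA v)
    (.set wR (get sucA v (reg jR)) ;;
     when (keep (reg wR))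
       (.put sucA v (reg lR) (reg wR) ;;
        incr lR)) ;;
  put1 degA v (reg lR)

/-- All nodes in the current game, no result of the solver so far. -/
def start : Cmd :=
  for' vR (reg nR) (put1 winA (reg vR) (const 0)) ;;
  listPreds

/-- Prepare for the computation of an attractor. -/
def clear : Cmd :=
  for' vR (reg nR)
    (put1 tgtA (reg vR) (const 0) ;;
     put1 attA (reg vR) (const 0) ;;
     put1 cntA (reg vR) (const 0) ;;
     put1 satA (reg vR) (const 0)) ;;
  .set hdR (const 0) ;;
  .set tlR (const 0)

/-- Add `v` to the targets, if it is not there yet. -/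
def push (v : Expr) : Cmd :=
  when (eq (at1 tgtA v) (const 0))
    (put1 tgtA v (const 1) ;;
     put1 queA (reg tlR) v ;;
     incr tlR)

/-- Attract nodes for player `pR` to the targets, where nodes that are no targets must have color at
least `thR`. -/
def propagate : Cmd :=
  .while (lt (reg hdR) (reg tlR))
    (.set wR (at1 queA (reg hdR)) ;;
     incr hdR ;;
     for' jR (at1 pdgA (reg wR))
       (.set vR (get preA (reg wR) (reg jR)) ;;
        when (eq (at1 satA (reg vR)) (const 0))
          (put1 cntA (reg vR) (succ (at1 cntA (reg vR))) ;;
           when (or (eq (at1 ownA (reg vR)) (reg pR))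
                (eq (at1 cntA (reg vR)) (at1 degA (reg vR))))
             (put1 satA (reg vR) (const 1) ;;
              when (or (le (reg thR) (at1 colA (reg vR))) (at1 tgtA (reg vR)))
                (put1 attA (reg vR) (const 1) ;;
                 push (reg vR))))))

/-- Compute the monotone attractor of the set `setA`, all of whose nodes have color `dR`, into
`attA`. -/
def computeMAttr : Cmd :=
  clear ;;
  .set pR (parity (reg dR)) ;;
  .set thR (reg dR) ;;
  for' vR (reg nR) (when (at1 setA (reg vR)) (push (reg vR))) ;;
  propagate

/-- Compute the layered attractor of the set `setA` for player `dR % 2` into `attA`. The nodes in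
`setA` are visited in ascending order of their colors, as given by `ordA`; values of the loop variable
that are not the color of a node in `setA` do not change the result and are skipped. -/
def computeLayeredAttr : Cmd :=
  clear ;;
  .set pR (parity (reg dR)) ;;
  .set lR (const 0) ;;
  .while (lt (reg lR) (reg nR))
    (.set xR (at1 ordA (reg lR)) ;;
     .ite (at1 setA (reg xR))
       (.set thR (at1 colA (reg xR)) ;;
        .while (and (lt (reg lR) (reg nR)) (eq (at1 colA (at1 ordA (reg lR))) (reg thR)))
          (.set xR (at1 ordA (reg lR)) ;;
           when (at1 setA (reg xR)) (push (reg xR)) ;;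
           incr lR) ;;
        propagate)
       (incr lR))

/-- Remove the attractor of `attA` for player `pR` from the current game, and record its nodes as
won by this player. -/
def removeAttr : Cmd :=
  for' vR (reg nR) (put1 setA (reg vR) (at1 attA (reg vR))) ;;
  clear ;;
  .set thR (const 0) ;;
  for' vR (reg nR) (when (at1 setA (reg vR)) (push (reg vR))) ;;
  propagate ;;
  for' vR (reg nR) (when (at1 tgtA (reg vR)) (put1 winA (reg vR) (succ (reg pR)))) ;;
  for' vR (reg nR) (when (alive (reg vR)) (filterSuccs (reg vR) alive)) ;;
  listPreds

/-- The recursive call: leave the for-loop of the solver, and run its body again. -/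
def recurse : Cmd :=
  .set goR (const 1) ;;
  .set iR (reg nR)

/-- The solver `psol`. -/
def psol : Cmd :=
  start ;;
  sortNodes (fun e f => lt f e) ;;
  .set goR (const 1) ;;
  .while (reg goR)
    (.set goR (const 0) ;;
     .set iR (const 0) ;;
     .while (lt (reg iR) (reg nR))
       (.set kR (at1 ordA (reg iR)) ;;
        incr iR ;;
        when (alive (reg kR))
          (.set dR (at1 colA (reg kR)) ;;
           for' vR (reg nR) (put1 setA (reg vR) (const 0)) ;;
           put1 setA (reg kR) (const 1) ;;
           computeMAttr ;;
           .ite (at1 attA (reg kR))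
             (removeAttr ;;
              recurse)
             (filterSuccs (reg kR) (fun w => eq (at1 attA w) (const 0)) ;;
              listPreds))))

/-- `okR := [setA ⊆ attA]`. -/
def testFatal : Cmd :=
  .set okR (const 1) ;;
  for' vR (reg nR)
    (when (and (at1 setA (reg vR)) (eq (at1 attA (reg vR)) (const 0)))
      (.set okR (const 0)))

/-- `neR := [setA ≠ ∅]` and `nwR := [setA ≠ cchA]`. -/
def testSet : Cmd :=
  .set neR (const 0) ;;
  .set nwR (const 0) ;;
  for' vR (reg nR)
    (when (at1 setA (reg vR)) (.set neR (const 1)) ;;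
     when (eq (eq (at1 setA (reg vR)) (at1 cchA (reg vR))) (const 0)) (.set nwR (const 1)))

/-- The common structure of `psolB` and `psolQ`: the colors are explored in the order that is
given by `before`, `member v` is the test whether node `v` is in the initial set `X` for color
`dR`, and `computeAttr` is the attractor computation. -/
def colorSolver (before : Expr → Expr → Expr) (member : Expr → Expr) (computeAttr : Cmd) : Cmd :=
  start ;;
  sortNodes before ;;
  .set goR (const 1) ;;
  .while (reg goR)
    (.set goR (const 0) ;;
     .set iR (const 0) ;;
     .set lsR (const 0) ;;
     .while (lt (reg iR) (reg nR))
       (.set kR (at1 ordA (reg iR)) ;;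
        incr iR ;;
        .set dR (at1 colA (reg kR)) ;;
        when (and (alive (reg kR)) (eq (eq (reg lsR) (succ (reg dR))) (const 0)))
          (.set lsR (succ (reg dR)) ;;
           for' vR (reg nR)
             (put1 setA (reg vR) (and (alive (reg vR)) (member (reg vR))) ;;
              put1 cchA (reg vR) (const 0)) ;;
           testSet ;;
           .while (and (reg neR) (reg nwR))
             (for' vR (reg nR) (put1 cchA (reg vR) (at1 setA (reg vR))) ;;
              computeAttr ;;
              testFatal ;;
              .ite (reg okR)
                (removeAttr ;;
                 recurse ;;
                 .set neR (const 0))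
                (for' vR (reg nR)
                   (put1 setA (reg vR) (and (at1 setA (reg vR)) (at1 attA (reg vR)))) ;;
                 testSet)))))

/-- The solver `psolB`. -/
def psolB : Cmd :=
  colorSolver (fun e f => lt f e) (fun v => eq (at1 colA v) (reg dR)) computeMAttr

/-- The solver `psolQ`. -/
def psolQ : Cmd :=
  colorSolver (fun e f => lt e f)
    (fun v => and (le (at1 colA v) (reg dR)) (eq (parity (at1 colA v)) (parity (reg dR))))
    computeLayeredAttr

end Code

end ParityGames

open ParityGames

namespace ParityGames

/-! ## Reasoning about programs -/

/-! Write n = |V| and m = |E|. Call a run of a solver's body between two recursive calls a pass.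
Each recursive call removes at least one node, so there are at most n + 1 passes, and the first and
third bounds are a product: passes, times attractor computations in a pass, times the cost of one
attractor. A backward computation touches each edge a bounded number of times, and n ≤ m because
every node has a successor, so one attractor costs O(m). In a pass, `psol` computes n attractors. In
`psolB` every unsuccessful round at color d drops a node of color d from X, so summing over the
colors gives O(n) rounds. In `psolQ` the set X may have n nodes for each color, which gives O(n |c|)
rounds. A layered attractor costs O(m) as well, since the layers increase and the queue and the
counters of one layer are simply continued in the next (`runs_propagate`,
`runs_computeLayeredAttr`). Correctness of an attractor computation has two sides: the attracted
nodes never leave any set that is closed under the operator, and once the queue is empty they form a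
closed set themselves; so they are the least fixed point. The recursion of the solvers is tail
recursion. Hence the loops carry the invariant that every outcome of the remaining computation,
extended by the nodes won so far, is an outcome for the input game. For the cubic bounds attractor
computations are not restarted but resumed. There is one row of data for each node (`psol`) or for
each position in the sorted list of nodes (`psolB`). A row has a mark for each node and a pointer
for each node into its row of the adjacency matrix. Marks are set once and pointers only advance, so
a row costs O(n²) in the whole run and all rows cost O(n³); to this come O(n) for each of the O(n²)
visits and O(n²) for each of the at most n removals. Resuming is sound if attracted nodes that
survive remain attracted in all later games. For `psol` this is `fattr_subset_pruned` and
`fattr_sdiff_subset`. For `psolB` it is `levelSet_sdiff_subset`, which needs a removed set that is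
closed for the same player. Therefore all fatal sets of player 0 are removed before those of player
1. This does not change the result: `psolB_solved` characterizes the outcome by `fatalRegion`,
without reference to an order, and `Arena.Solved.unique` then identifies the two outcomes. -/

/-- `c.writesReg x`: command `c` contains an assignment to register `x`. -/
def Cmd.writesReg : Cmd → ℕ → Bool
  | skip, _ => false
  | set y _, x => x == y
  | put _ _ _ _, _ => false
  | seq c d, x => c.writesReg x || d.writesReg x
  | ite _ c d, x => c.writesReg x || d.writesReg x
  | .while _ c, x => c.writesReg x

/-- `c.writesArr a`: command `c` contains an assignment to array `a`. -/
def Cmd.writesArr : Cmd → ℕ → Bool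
  | skip, _ => false
  | set _ _, _ => false
  | put b _ _ _, a => a == b
  | seq c d, a => c.writesArr a || d.writesArr a
  | ite _ c d, a => c.writesArr a || d.writesArr a
  | .while _ c, a => c.writesArr a

/-- The registers and arrays that `c` does not write to agree in `s` and `s'`. -/
structure Frame (c : Cmd) (s s' : Store) : Prop where
  reg : ∀ x, c.writesReg x = false → s'.reg x = s.reg x
  arr : ∀ a, c.writesArr a = false → s'.arr a = s.arr a

theorem Frame.refl (c : Cmd) (s : Store) : Frame c s s := ⟨fun _ _ => rfl, fun _ _ => rfl⟩

theorem Frame.trans {c : Cmd} {s s' s'' : Store} (h : Frame c s s') (h' : Frame c s' s'') :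
    Frame c s s'' :=
  ⟨fun x hx => (h'.reg x hx).trans (h.reg x hx), fun a ha => (h'.arr a ha).trans (h.arr a ha)⟩

theorem Frame.of_le {c d : Cmd} {s s' : Store} (h : Frame c s s')
    (hr : ∀ x, d.writesReg x = false → c.writesReg x = false)
    (ha : ∀ a, d.writesArr a = false → c.writesArr a = false) : Frame d s s' :=
  ⟨fun x hx => h.reg x (hr x hx), fun a hx => h.arr a (ha a hx)⟩

/-- Data that a subprogram does not touch come for free: for a concrete command `writesReg` and
`writesArr` are evaluated by computation, so the later side conditions are closed by `rfl` or
`decide`. -/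
theorem Exec.frame {c : Cmd} {s s' : Store} {t : ℕ} (h : Exec c s t s') : Frame c s s' := by
  induction h with
  | skip => exact .refl _ _
  | set x e s =>
    refine ⟨fun y hy => ?_, fun _ _ => rfl⟩
    simp only [Cmd.writesReg, beq_eq_false_iff_ne] at hy
    simp [Store.setReg, hy]
  | put a i j e s =>
    refine ⟨fun _ _ => rfl, fun b hb => ?_⟩
    simp only [Cmd.writesArr, beq_eq_false_iff_ne] at hb
    simp [Store.setArr, hb]
  | seq _ _ h h' =>
    refine (h.of_le ?_ ?_).trans (h'.of_le ?_ ?_) <;> intro x hx <;>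
      simp_all [Cmd.writesReg, Cmd.writesArr]
  | iteTrue _ _ h => refine h.of_le ?_ ?_ <;> intro x hx <;> simp_all [Cmd.writesReg, Cmd.writesArr]
  | iteFalse _ _ h => refine h.of_le ?_ ?_ <;> intro x hx <;> simp_all [Cmd.writesReg, Cmd.writesArr]
  | whileTrue _ _ _ h h' =>
    exact Frame.trans (h.of_le (fun _ hx => hx) (fun _ hx => hx) : Frame (.while _ _) _ _) h'
  | whileFalse => exact .refl _ _

@[simp] theorem Store.setReg_reg (s : Store) (x n y : ℕ) :
    (s.setReg x n).reg y = if y = x then n else s.reg y := by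
  simp [setReg, Function.update_apply]

@[simp] theorem Store.setReg_arr (s : Store) (x n : ℕ) : (s.setReg x n).arr = s.arr := rfl

@[simp] theorem Store.setArr_reg (s : Store) (a i j n : ℕ) : (s.setArr a i j n).reg = s.reg := rfl

theorem Store.setArr_arr (s : Store) (a i j n b : ℕ) :
    (s.setArr a i j n).arr b = if b = a then
      (fun i' j' => if i' = i ∧ j' = j then n else s.arr a i' j') else s.arr b := by
  by_cases hb : b = a
  · subst hb
    ext i' j'
    by_cases hi : i' = i
    · subst hi; simp [setArr, Function.update_apply]
    · simp [setArr, hi]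
  · simp [setArr, hb]

/-- `Runs c s t₀ Q`: command `c`, started in `s` at time `t₀`, halts with time and memory that
satisfy `Q`. -/
def Runs (c : Cmd) (s : Store) (t₀ : ℕ) (Q : ℕ → Store → Prop) : Prop :=
  ∃ t s', Exec c s t s' ∧ Q (t₀ + t) s'

variable {c d : Cmd} {s : Store} {t₀ : ℕ} {Q : ℕ → Store → Prop}

-- This equivalence and the following ones act as weakest preconditions: rewriting with them
-- executes loop-free code symbolically and keeps the clock.
@[simp] theorem runs_skip : Runs .skip s t₀ Q ↔ Q (t₀ + 1) s :=
  ⟨fun ⟨_, _, h, hQ⟩ => by cases h; exact hQ, fun h => ⟨_, _, .skip s, h⟩⟩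

@[simp] theorem runs_set {x : ℕ} {e : Expr} :
    Runs (.set x e) s t₀ Q ↔ Q (t₀ + (e.cost + 1)) (s.setReg x (e.eval s)) :=
  ⟨fun ⟨_, _, h, hQ⟩ => by cases h; exact hQ, fun h => ⟨_, _, .set x e s, h⟩⟩

@[simp] theorem runs_put {a : ℕ} {i j e : Expr} :
    Runs (.put a i j e) s t₀ Q ↔ Q (t₀ + (i.cost + j.cost + e.cost + 1))
      (s.setArr a (i.eval s) (j.eval s) (e.eval s)) :=
  ⟨fun ⟨_, _, h, hQ⟩ => by cases h; exact hQ, fun h => ⟨_, _, .put a i j e s, h⟩⟩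

@[simp] theorem runs_seq :
    Runs (.seq c d) s t₀ Q ↔ Runs c s t₀ fun t s' => Runs d s' t Q := by
  constructor
  · rintro ⟨_, _, h, hQ⟩
    cases h with
    | seq h h' => exact ⟨_, _, h, _, _, h', by rwa [add_assoc]⟩
  · rintro ⟨_, _, h, _, _, h', hQ⟩
    exact ⟨_, _, .seq h h', by rwa [← add_assoc]⟩

@[simp] theorem runs_ite {b : Expr} :
    Runs (.ite b c d) s t₀ Q ↔
      (b.eval s ≠ 0 → Runs c s (t₀ + (b.cost + 1)) Q) ∧
      (b.eval s = 0 → Runs d s (t₀ + (b.cost + 1)) Q) := by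
  constructor
  · rintro ⟨_, _, h, hQ⟩
    cases h with
    | iteTrue hb h => exact ⟨fun _ => ⟨_, _, h, by rwa [add_assoc]⟩, fun h => absurd h hb⟩
    | iteFalse hb h => exact ⟨fun h => absurd hb h, fun _ => ⟨_, _, h, by rwa [add_assoc]⟩⟩
  · rintro ⟨h, h'⟩
    by_cases hb : b.eval s = 0
    · obtain ⟨_, _, h, hQ⟩ := h' hb
      exact ⟨_, _, .iteFalse hb h, by rwa [← add_assoc]⟩
    · obtain ⟨_, _, h, hQ⟩ := h hb
      exact ⟨_, _, .iteTrue hb h, by rwa [← add_assoc]⟩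

/-- A conditional whose test decides `P`. -/
theorem Runs.ite {b : Expr} {P : Prop} (hb : b.eval s ≠ 0 ↔ P)
    (h : P → Runs c s (t₀ + (b.cost + 1)) Q) (h' : ¬ P → Runs d s (t₀ + (b.cost + 1)) Q) :
    Runs (.ite b c d) s t₀ Q :=
  runs_ite.2 ⟨fun hp => h (hb.1 hp), fun hp => h' fun hP => hb.2 hP hp⟩

theorem Runs.mono {R : ℕ → Store → Prop} (h : Runs c s t₀ Q) (hQ : ∀ t s', Q t s' → R t s') :
    Runs c s t₀ R :=
  let ⟨_, _, h, hq⟩ := h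
  ⟨_, _, h, hQ _ _ hq⟩

/-- Use the specification of a subprogram. -/
theorem Runs.call {P : ℕ → Store → Prop} (h : Runs c s 0 P)
    (hR : ∀ t s', P t s' → Frame c s s' → Q (t₀ + t) s') : Runs c s t₀ Q :=
  let ⟨_, _, h, hq⟩ := h
  ⟨_, _, h, hR _ _ (by simpa using hq) h.frame⟩

theorem Runs.call_seq {P : ℕ → Store → Prop} (h : Runs c s 0 P)
    (hR : ∀ t s', P t s' → Frame c s s' → Runs d s' (t₀ + t) Q) : Runs (.seq c d) s t₀ Q :=
  runs_seq.2 (h.call hR)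

theorem Runs.withFrame (h : Runs c s t₀ Q) : Runs c s t₀ fun t s' => Q t s' ∧ Frame c s s' :=
  let ⟨_, _, h, hq⟩ := h
  ⟨_, _, h, hq, h.frame⟩

/-- A while-loop with invariant `I`, in which the steps of each round are paid by a decrease of the
potential `φ`. -/
theorem runs_while {b : Expr} (I : Store → Prop) (φ : Store → ℕ) (hI : I s)
    (hbody : ∀ s', I s' → Frame (.while b c) s s' → b.eval s' ≠ 0 →
      Runs c s' 0 fun t s'' => I s'' ∧ t + (b.cost + 1) + φ s'' ≤ φ s') :
    Runs (.while b c) s 0 fun t s' => I s' ∧ b.eval s' = 0 ∧ t + φ s' ≤ φ s + (b.cost + 1) := by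
  -- Induction on a bound for the potential. It also yields termination, because every round pays at
  -- least one step for its test.
  suffices ∀ N, ∀ s', I s' → Frame (.while b c) s s' → φ s' ≤ N →
      Runs (.while b c) s' 0 fun t s'' => I s'' ∧ b.eval s'' = 0 ∧ t + φ s'' ≤ φ s' + (b.cost + 1)
    from this _ s hI (.refl _ _) le_rfl
  intro N
  induction N with
  | zero =>
    intro s' hs hf hN
    by_cases hb : b.eval s' = 0
    · exact ⟨_, _, .whileFalse hb, hs, hb, by omega⟩
    · obtain ⟨t, s'', -, -, h⟩ := hbody s' hs hf hb
      omega
  | succ N ih =>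
    intro s' hs hf hN
    by_cases hb : b.eval s' = 0
    · exact ⟨_, _, .whileFalse hb, hs, hb, by omega⟩
    · obtain ⟨t, s'', hx, hI', h⟩ := hbody s' hs hf hb
      have hf' : Frame (.while b c) s' s'' := hx.frame.of_le (fun _ h => h) (fun _ h => h)
      obtain ⟨t', s₃, hx', hI₃, hb₃, h₃⟩ := ih s'' hI' (hf.trans hf') (by omega)
      exact ⟨_, _, .whileTrue hb hx hx', hI₃, hb₃, by omega⟩

open Code

/-- A for-loop with invariant `I`, in which round `k` takes at most `B k` steps in addition to those
that are paid by a decrease of the potential `φ`. -/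
theorem runs_for {x N : ℕ} {e : Expr} (I : ℕ → Store → Prop) (φ : Store → ℕ) (B : ℕ → ℕ)
    (hx : c.writesReg x = false)
    (hIx : ∀ k s m, I k s → I k (s.setReg x m))
    (hφx : ∀ s m, φ (s.setReg x m) = φ s)
    (h0 : I 0 s)
    (he : ∀ k s', k ≤ N → I k s' → s'.reg x = k → Frame (for' x e c) s s' → e.eval s' = N)
    (hbody : ∀ k s', k < N → I k s' → s'.reg x = k → Frame (for' x e c) s s' →
      Runs c s' 0 fun t s'' => I (k + 1) s'' ∧ t + φ s'' ≤ φ s' + B k) :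
    Runs (for' x e c) s 0 fun t s' => (I N s' ∧ s'.reg x = N) ∧
      t + φ s' ≤ φ s + ∑ k ∈ Finset.range N, B k + (N + 1) * (e.cost + 6) := by
  have hsub : Frame (for' x e c) s (s.setReg x 0) :=
    (Exec.set x (.const 0) s).frame.of_le
      (fun y hy => by simp_all [Cmd.writesReg]) (fun y hy => by simp_all [Cmd.writesArr])
  have key := runs_while (s := s.setReg x 0) (b := .lt (.reg x) e) (c := c ;; incr x)
    (fun s' => s'.reg x ≤ N ∧ I (s'.reg x) s')
    -- The overhead of a round is `e.cost + 3` for the test and 3 for the increment. One more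
    -- portion `e.cost + 6` in the result covers the initialization and the last, failing test.
    (fun s' => φ s' + ∑ k ∈ Finset.Ico (s'.reg x) N, B k + (N - s'.reg x) * (e.cost + 6))
    (by simpa using hIx _ _ _ h0)
    (by
      rintro s' ⟨hk, hI⟩ hf hb
      have hf' : Frame (for' x e c) s s' := by
        refine hsub.trans (hf.of_le ?_ ?_) <;> intro y hy <;> simp_all [Cmd.writesReg, Cmd.writesArr]
      have hev := he _ _ hk hI rfl hf'
      have hlt : s'.reg x < N := by
        by_contra hlt
        simp [Expr.eval, hev, hlt] at hb
      rw [runs_seq]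
      refine (hbody _ _ hlt hI rfl hf').withFrame.mono ?_
      rintro t s'' ⟨⟨hI', ht⟩, hfr⟩
      have hxx := hfr.reg x hx
      rw [runs_set]
      simp only [Expr.eval, Store.setReg_reg, if_true, Expr.cost, hφx, hxx]
      refine ⟨⟨hlt, hIx _ _ _ hI'⟩, ?_⟩
      rw [Finset.sum_eq_sum_Ico_succ_bot hlt]
      obtain ⟨m, hm⟩ : ∃ m, N - s'.reg x = m + 1 := ⟨N - s'.reg x - 1, by omega⟩
      have hm' : N - (s'.reg x + 1) = m := by omega
      rw [hm, hm']
      ring_nf at ht ⊢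
      omega)
  refine runs_seq.2 (runs_set.2 (key.call ?_))
  rintro t s' ⟨⟨hk, hI⟩, hb, ht⟩ hf
  have hf' : Frame (for' x e c) s s' := by
    refine hsub.trans (hf.of_le ?_ ?_) <;> intro y hy <;> simp_all [Cmd.writesReg, Cmd.writesArr]
  have hev := he _ _ hk hI rfl hf'
  have hN : s'.reg x = N := by
    by_contra hne
    have : s'.reg x < N := by omega
    simp [Expr.eval, hev, this] at hb
  rw [hN] at hI
  refine ⟨⟨hI, hN⟩, ?_⟩
  simp only [hφx, Store.setReg_reg, if_true, Expr.cost, Finset.range_eq_Ico, Nat.sub_zero] at ht ⊢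
  rw [Nat.succ_mul]
  omega

/-- A for-loop with rounds of at most `B` steps. -/
theorem runs_for_const {x N : ℕ} {e : Expr} (I : ℕ → Store → Prop) (B : ℕ)
    (hx : c.writesReg x = false)
    (hIx : ∀ k s m, I k s → I k (s.setReg x m))
    (h0 : I 0 s)
    (he : ∀ k s', k ≤ N → I k s' → s'.reg x = k → Frame (for' x e c) s s' → e.eval s' = N)
    (hbody : ∀ k s', k < N → I k s' → s'.reg x = k → Frame (for' x e c) s s' →
      Runs c s' 0 fun t s'' => I (k + 1) s'' ∧ t ≤ B) :
    Runs (for' x e c) s 0 fun t s' => I N s' ∧ t ≤ N * B + (N + 1) * (e.cost + 6) := by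
  refine (runs_for I (fun _ => 0) (fun _ => B) hx hIx (fun _ _ => rfl) h0 he ?_).mono ?_
  · simpa using hbody
  · rintro t s' ⟨⟨h, -⟩, ht⟩
    exact ⟨h, by simpa using ht⟩

end ParityGames

namespace ParityGames

open Code

attribute [simp] Store.setArr_arr Expr.eval Expr.cost

/-! ## Lists in memory -/

/-- The list with length `a[i, 0]` and entries `b[i, 0], b[i, 1], …`. -/
def Store.list (s : Store) (a b i : ℕ) : List ℕ := (List.range (s.arr a i 0)).map (s.arr b i)

/-- Memory holds a list of the elements of `F`, each once. -/
def Lists (s : Store) (a b i : ℕ) (F : Set ℕ) : Prop :=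
  (s.list a b i).Nodup ∧ ∀ j, j ∈ s.list a b i ↔ j ∈ F

theorem Store.mem_list {s : Store} {a b i j : ℕ} :
    j ∈ s.list a b i ↔ ∃ l < s.arr a i 0, s.arr b i l = j := by
  simp [list]

theorem Lists.injOn {s : Store} {a b i : ℕ} {F : Set ℕ} (h : Lists s a b i F) :
    ∀ l < s.arr a i 0, ∀ l' < s.arr a i 0, s.arr b i l = s.arr b i l' → l = l' := by
  have := List.inj_on_of_nodup_map h.1
  simpa using this

theorem Lists.mem {s : Store} {a b i : ℕ} {F : Set ℕ} (h : Lists s a b i F) (j : ℕ) :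
    j ∈ F ↔ ∃ l < s.arr a i 0, s.arr b i l = j := by
  rw [← h.2, Store.mem_list]

theorem Lists.intro {s : Store} {a b i : ℕ} {F : Set ℕ}
    (h : ∀ l < s.arr a i 0, ∀ l' < s.arr a i 0, s.arr b i l = s.arr b i l' → l = l')
    (h' : ∀ j, j ∈ F ↔ ∃ l < s.arr a i 0, s.arr b i l = j) : Lists s a b i F :=
  ⟨List.Nodup.map_on (by simpa using h) List.nodup_range, fun j => by rw [h', Store.mem_list]⟩

theorem Lists.congr {s s' : Store} {a b i : ℕ} {F F' : Set ℕ} (h : Lists s a b i F)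
    (ha : s'.arr a i = s.arr a i) (hb : s'.arr b i = s.arr b i) (hF : F' = F) :
    Lists s' a b i F' := by
  subst hF
  unfold Lists Store.list
  rw [ha, hb]
  exact h

theorem Lists.snoc {s s' : Store} {a b i v : ℕ} {F F' : Set ℕ} (h : Lists s a b i F) (hv : v ∉ F)
    (ha : s'.arr a i 0 = s.arr a i 0 + 1)
    (hb : ∀ j < s.arr a i 0, s'.arr b i j = s.arr b i j)
    (hb' : s'.arr b i (s.arr a i 0) = v)
    (hF : ∀ j, j ∈ F' ↔ j ∈ F ∨ j = v) : Lists s' a b i F' := by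
  have hl : s'.list a b i = s.list a b i ++ [v] := by
    unfold Store.list
    rw [ha, List.range_succ, List.map_append, List.map_singleton, hb']
    congr 1
    exact List.map_congr_left (by simpa using hb)
  refine ⟨?_, fun j => ?_⟩
  · rw [hl, List.nodup_append]
    refine ⟨h.1, by simp, ?_⟩
    rintro x hx y hy rfl
    simp only [List.mem_singleton] at hy
    subst hy
    exact hv ((h.2 _).1 hx)
  · rw [hl, hF]
    simp [h.2]

/-- Lists are free of repetitions, so their lengths are cardinalities. This turns the degree entries
in memory into numbers of neighbours. -/
theorem Lists.encard {s : Store} {a b i : ℕ} {F : Set ℕ} (h : Lists s a b i F) :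
    F.encard = s.arr a i 0 := by
  have : F = ((s.list a b i).toFinset : Set ℕ) := by ext j; simp [h.2]
  rw [this, Set.encard_coe_eq_coe_finsetCard, List.toFinset_card_of_nodup h.1]
  simp [Store.list]

theorem Lists.ncard {s : Store} {a b i : ℕ} {F : Set ℕ} (h : Lists s a b i F) :
    F.ncard = s.arr a i 0 := by
  rw [Set.ncard, h.encard]; rfl

theorem Lists.finite {s : Store} {a b i : ℕ} {F : Set ℕ} (h : Lists s a b i F) : F.Finite := by
  have : F = ((s.list a b i).toFinset : Set ℕ) := by ext j; simp [h.2]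
  rw [this]; exact Finset.finite_toSet _

/-! ## Auxiliary programs -/

theorem runs_clear (s : Store) : Runs clear s 0 fun t s' =>
    t ≤ 100 * (s.reg nR + 1) ∧
    (∀ i < s.reg nR, s'.arr tgtA i 0 = 0 ∧ s'.arr attA i 0 = 0 ∧ s'.arr cntA i 0 = 0 ∧
      s'.arr satA i 0 = 0) ∧ s'.reg hdR = 0 ∧ s'.reg tlR = 0 := by
  refine Runs.call_seq (runs_for_const (N := s.reg nR)
    (fun k s' => ∀ i < k, s'.arr tgtA i 0 = 0 ∧ s'.arr attA i 0 = 0 ∧ s'.arr cntA i 0 = 0 ∧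
      s'.arr satA i 0 = 0) 20 rfl (fun _ _ _ h => h) (by simp) ?_ ?_) ?_
  · rintro k s' - - - hf
    exact hf.reg nR rfl
  · rintro k s' hk hI hx hf
    simp [hx]
    intro i hi
    rcases hi.lt_or_eq with h | rfl
    · simp [hI i h]
    · simp
  · rintro t s' ⟨hI, ht⟩ hf
    simp
    refine ⟨by simp at ht; omega, hI⟩

/-- Set all entries of an array to the values of an expression. -/
theorem runs_fill (s : Store) (a : ℕ) (e : Expr) (f : ℕ → ℕ) (he : e.cost ≤ 50)
    (hf : ∀ s' : Store, ∀ k < s.reg nR, s'.reg vR = k → (∀ i, i ≠ vR → s'.reg i = s.reg i) →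
      (∀ b, b ≠ a → s'.arr b = s.arr b) → s'.arr a k 0 = s.arr a k 0 → e.eval s' = f k) :
    Runs (for' vR (.reg nR) (put1 a (.reg vR) e)) s 0 fun t s' =>
      t ≤ 100 * (s.reg nR + 1) ∧ ∀ i < s.reg nR, s'.arr a i 0 = f i := by
  refine (runs_for_const (N := s.reg nR)
    (fun k s' => (∀ i < k, s'.arr a i 0 = f i) ∧ ∀ i, k ≤ i → s'.arr a i 0 = s.arr a i 0)
    60 rfl (fun _ _ _ h => h) (by simp) ?_ ?_).mono ?_
  · rintro k s' - - - hf
    exact hf.reg nR rfl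
  · rintro k s' hk hI hx hfr
    have := hf s' k hk hx (fun i hi => hfr.reg i (by simp [Cmd.writesReg, hi]))
      (fun b hb => hfr.arr b (by simp [Cmd.writesArr, hb])) (hI.2 k le_rfl)
    simp [hx, this]
    refine ⟨⟨?_, ?_⟩, by omega⟩
    · intro i hi
      rcases hi.lt_or_eq with h | rfl
      · simp [hI.1 i h, h.ne]
      · simp
    · intro i hi
      rw [if_neg (by omega), hI.2 i (by omega)]
  · rintro t s' ⟨hI, ht⟩
    refine ⟨by simp at ht; omega, hI.1⟩

/-- The sum of the lengths of the successor lists of the nodes that are alive. -/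
def Store.size (s : Store) : ℕ :=
  ∑ i ∈ Finset.range (s.reg nR), if s.arr winA i 0 = 0 then s.arr degA i 0 else 0

/-- Round `k` is charged the out-degree of node `k`, so the total is linear in the number of nodes
and the length of all successor lists. By `hlt` every list that is extended has been emptied before.
-/
theorem runs_listPreds (s : Store) (out : ℕ → Set ℕ)
    (hout : ∀ i < s.reg nR, s.arr winA i 0 = 0 → Lists s degA sucA i (out i))
    (hlt : ∀ i < s.reg nR, s.arr winA i 0 = 0 → ∀ j ∈ out i, j < s.reg nR) :
    Runs listPreds s 0 fun t s' => t ≤ 200 * (s.reg nR + s.size + 1) ∧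
      ∀ i < s.reg nR,
        Lists s' pdgA preA i {u | u < s.reg nR ∧ s.arr winA u 0 = 0 ∧ i ∈ out u} := by
  refine Runs.call_seq (runs_fill s pdgA (.const 0) (fun _ => 0) (by simp) (by simp)) ?_
  rintro t₁ s₁ ⟨ht₁, h₁⟩ hf₁
  have hn : s₁.reg nR = s.reg nR := hf₁.reg nR rfl
  refine (runs_for (N := s.reg nR)
    (fun k s' => ∀ i < s.reg nR,
      Lists s' pdgA preA i {u | u < k ∧ s.arr winA u 0 = 0 ∧ i ∈ out u}) (fun _ => 0)
    (fun k => 40 + 40 * (if s.arr winA k 0 = 0 then s.arr degA k 0 else 0)) rfl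
    (fun _ _ _ h => h) (fun _ _ => rfl) ?_ ?_ ?_).call ?_
  · intro i hi
    exact .intro (by simp [h₁ i hi]) (by simp [h₁ i hi])
  · rintro k s' - - - hf
    exact (hf.reg nR rfl).trans hn
  · rintro k s' hk hI hx hf
    have hwin : s'.arr winA = s.arr winA := (hf.arr winA rfl).trans (hf₁.arr winA rfl)
    have hdeg : s'.arr degA = s.arr degA := (hf.arr degA rfl).trans (hf₁.arr degA rfl)
    have hsuc : s'.arr sucA = s.arr sucA := (hf.arr sucA rfl).trans (hf₁.arr sucA rfl)
    rw [runs_ite]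
    have hal : (alive (.reg vR)).eval s' = if s.arr winA k 0 = 0 then 1 else 0 := by
      simp [hx, hwin]
    rw [hal]
    refine ⟨fun hk0 => ?_, fun hk0 => ?_⟩
    · have hk0 : s.arr winA k 0 = 0 := by by_contra h; simp [h] at hk0
      have hL := hout k hk hk0
      refine Runs.call (runs_for_const (N := s.arr degA k 0)
        (fun j s' => ∀ i < s.reg nR, Lists s' pdgA preA i {u | s.arr winA u 0 = 0 ∧
          (u < k ∧ i ∈ out u ∨ u = k ∧ ∃ l < j, s.arr sucA k l = i)}) 25 rfl
        (fun _ _ _ h => h) ?_ ?_ ?_) ?_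
      · intro i hi
        refine (hI i hi).congr rfl rfl ?_
        ext u; simp; tauto
      · rintro j s₂ - - - hf₂
        have h1 : s₂.reg vR = k := (hf₂.reg vR rfl).trans hx
        have h2 : s₂.arr degA = s.arr degA := (hf₂.arr degA rfl).trans hdeg
        simp [h1, h2]
      · rintro j s₂ hj hJ hjx hf₂
        have h1 : s₂.reg vR = k := (hf₂.reg vR rfl).trans hx
        have h2 : s₂.arr sucA = s.arr sucA := (hf₂.arr sucA rfl).trans hsuc
        have hw : s.arr sucA k j < s.reg nR :=
          hlt k hk hk0 _ ((hL.mem _).2 ⟨j, hj, rfl⟩)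
        simp [h1, h2, hjx]
        intro i hi
        -- Only the list of the head of the current edge grows. Node `k` is not on it yet, because
        -- the successor list of `k` has no repetitions.
        by_cases hiw : i = s.arr sucA k j
        · refine (hJ i hi).snoc (v := k) ?_ ?_ ?_ ?_ ?_
          · rintro ⟨-, ⟨h, -⟩ | ⟨-, l, hl, h⟩⟩
            · exact absurd h (lt_irrefl _)
            · rw [hiw] at h
              have := hL.injOn l (hl.trans hj) j hj h
              omega
          · simp [hiw]
          · simp [hiw]
            intro j' h h'; omega
          · simp [hiw]
          · intro u
            simp only [Set.mem_ofPred_eq]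
            grind
        · refine (hJ i hi).congr (by ext; simp [hiw]) (by ext; simp [hiw]) ?_
          ext u
          simp only [Set.mem_ofPred_eq]
          grind
      · rintro t s₂ ⟨hJ, ht⟩ hf₂
        refine ⟨fun i hi => (hJ i hi).congr rfl rfl ?_, ?_⟩
        · ext u
          simp only [Set.mem_ofPred_eq, ← hL.mem, Nat.lt_succ_iff_lt_or_eq]
          grind
        · simp [hk0] at ht ⊢
          omega
    · have hk0 : ¬ s.arr winA k 0 = 0 := by rintro h; simp [h] at hk0
      rw [runs_skip]
      refine ⟨fun i hi => (hI i hi).congr rfl rfl ?_, by simp; omega⟩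
      ext u
      simp only [Set.mem_ofPred_eq, Nat.lt_succ_iff_lt_or_eq]
      grind
  · rintro t s' ⟨⟨hI, -⟩, ht⟩ hf
    refine ⟨?_, hI⟩
    rw [Finset.sum_add_distrib, ← Finset.mul_sum] at ht
    simp [Store.size] at ht ⊢
    omega

/-- Filtering in place is safe because the write position never overtakes the read position, so
unread entries are intact. The condition `x < 14` keeps the register of the node apart from the
scratch registers `wR`, `jR` and `lR`. -/
theorem runs_filterSuccs (s : Store) (x : ℕ) (keep : Expr → Expr) (K : ℕ → Prop) [DecidablePred K]
    (hx : x < 14) (hc : (keep (.reg wR)).cost ≤ 10)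
    (hK : ∀ s' : Store, s'.arr winA = s.arr winA → s'.arr attA = s.arr attA →
      ((keep (.reg wR)).eval s' ≠ 0 ↔ K (s'.reg wR))) :
    Runs (filterSuccs (.reg x) keep) s 0 fun t s' =>
      t ≤ 50 * (s.arr degA (s.reg x) 0 + 1) ∧
      s'.list degA sucA (s.reg x) = (s.list degA sucA (s.reg x)).filter (fun w => decide (K w)) ∧
      ∀ i, i ≠ s.reg x → s'.arr degA i = s.arr degA i ∧ s'.arr sucA i = s.arr sucA i := by
  set v := s.reg x with hv
  rw [filterSuccs, runs_seq, runs_set]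
  refine Runs.call_seq (runs_for_const (N := s.arr degA v 0)
    (fun j s' => s'.reg lR ≤ j ∧
      (List.range (s'.reg lR)).map (s'.arr sucA v) =
        ((List.range j).map (s.arr sucA v)).filter (fun w => decide (K w)) ∧
      (∀ l, j ≤ l → s'.arr sucA v l = s.arr sucA v l) ∧
      ∀ i, i ≠ v → s'.arr sucA i = s.arr sucA i) 35 rfl ?_ ?_ ?_ ?_) ?_
  · exact fun _ _ _ h => h
  · simp
  · rintro j s₁ - - - hf
    have h1 : s₁.reg x = v := by
      rw [hf.reg x (by simp [Cmd.writesReg, lR, jR, wR]; omega)]; simp [hv, lR]; omega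
    have h2 : s₁.arr degA = s.arr degA := hf.arr degA rfl
    simp [h1, h2]
  · rintro j s₁ hj ⟨hl, hL, hr, ho⟩ hjx hf
    have h1 : s₁.reg x = v := by
      rw [hf.reg x (by simp [Cmd.writesReg, lR, jR, wR]; omega)]; simp [hv, lR]; omega
    rw [runs_seq, runs_set]
    have hw : (Expr.get sucA (.reg x) (.reg jR)).eval s₁ = s.arr sucA v j := by
      simp [h1, hjx, hr j le_rfl]
    rw [hw]
    have hL' : (List.range (j + 1)).map (s.arr sucA v) =
      (List.range j).map (s.arr sucA v) ++ [s.arr sucA v j] := by simp [List.range_succ]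
    have hxw : x ≠ wR := by simp [wR]; omega
    refine Runs.ite (P := K (s.arr sucA v j)) ?_ (fun hk => ?_) (fun hk => ?_)
    · rw [hK]
      · simp
      · exact hf.arr winA rfl
      · exact hf.arr attA rfl
    · have hmap : ∀ m, (List.range (s₁.reg lR)).map
          (fun j' => if j' = s₁.reg lR then m else s₁.arr sucA v j') =
          (List.range (s₁.reg lR)).map (s₁.arr sucA v) :=
        fun m => List.map_congr_left (by simp; intro a ha h; omega)
      simp [h1, hxw]
      refine ⟨⟨hl, ?_, ?_, ?_⟩, by omega⟩
      · rw [hL', List.filter_append, ← hL, List.range_succ, List.map_append, hmap]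
        simp [hk]
      · intro l hjl
        rw [if_neg (by omega), hr l (by omega)]
      · intro i hi
        simp [hi, ho i hi]
    · rw [hL', List.filter_append, ← hL]
      simp [hk]
      exact ⟨⟨by omega, fun l hl => hr l (by omega), ho⟩, by omega⟩
  · rintro t s₁ ⟨⟨hl, hL, hr, ho⟩, ht⟩ hf
    have h1 : s₁.reg x = v := by
      rw [hf.reg x (by simp [Cmd.writesReg, lR, jR, wR]; omega)]; simp [hv, lR]; omega
    have h2 : s₁.arr degA = s.arr degA := hf.arr degA rfl
    simp [h1, Store.list] at ht ⊢
    refine ⟨by omega, hL, fun i hi => ?_⟩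
    simp [hi, h2, ho i hi]

end ParityGames

namespace ParityGames

open Code Arena

/-! ## Games in memory -/

variable {α : Type*}

/-- The nodes whose entry in array `a` is not zero. -/
def marked (s : Store) (e : ℕ → α) (a : ℕ) : Set α :=
  {v | ∃ i < s.reg nR, e i = v ∧ s.arr a i 0 ≠ 0}

/-- Memory holds the current game `H` of a solver, with `e i` for node number `i`. -/
structure Holds (s : Store) (e : ℕ → α) (H : Arena α) : Prop where
  inj : ∀ i < s.reg nR, ∀ j < s.reg nR, e i = e j → i = j
  surj : ∀ v ∈ H.nodes, ∃ i < s.reg nR, e i = v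
  alive : ∀ i < s.reg nR, s.arr winA i 0 = 0 ↔ e i ∈ H.nodes
  col : ∀ i < s.reg nR, s.arr colA i 0 = H.c (e i)
  own : ∀ i < s.reg nR, ∀ p, e i ∈ H.V p → s.arr ownA i 0 = p.val

/-- The successor lists of the current game. -/
def HoldsSuccs (s : Store) (e : ℕ → α) (H : Arena α) : Prop :=
  ∀ i < s.reg nR, e i ∈ H.nodes → Lists s degA sucA i {j | j < s.reg nR ∧ (e i, e j) ∈ H.E}

/-- The predecessor lists of the current game. -/
def HoldsPreds (s : Store) (e : ℕ → α) (H : Arena α) : Prop :=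
  ∀ i < s.reg nR, Lists s pdgA preA i {j | j < s.reg nR ∧ (e j, e i) ∈ H.E}

theorem Holds.congr {s s' : Store} {e : ℕ → α} {H : Arena α} (h : Holds s e H)
    (hn : s'.reg nR = s.reg nR) (hw : s'.arr winA = s.arr winA) (hc : s'.arr colA = s.arr colA)
    (ho : s'.arr ownA = s.arr ownA) : Holds s' e H := by
  obtain ⟨h1, h2, h3, h4, h5⟩ := h
  constructor <;> rw [hn] <;> first | rw [hw] | rw [hc] | rw [ho] | skip
  all_goals assumption

theorem HoldsSuccs.congr {s s' : Store} {e : ℕ → α} {H : Arena α} (h : HoldsSuccs s e H)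
    (hn : s'.reg nR = s.reg nR) (hd : s'.arr degA = s.arr degA) (hs : s'.arr sucA = s.arr sucA) :
    HoldsSuccs s' e H := by
  intro i hi hv
  rw [hn] at hi
  exact (h i hi hv).congr (by rw [hd]) (by rw [hs]) (by rw [hn])

theorem HoldsPreds.congr {s s' : Store} {e : ℕ → α} {H : Arena α} (h : HoldsPreds s e H)
    (hn : s'.reg nR = s.reg nR) (hd : s'.arr pdgA = s.arr pdgA) (hs : s'.arr preA = s.arr preA) :
    HoldsPreds s' e H := by
  intro i hi
  rw [hn] at hi
  exact (h i hi).congr (by rw [hd]) (by rw [hs]) (by rw [hn])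

theorem Holds.mem_marked {s : Store} {e : ℕ → α} {H : Arena α} (h : Holds s e H) {a i : ℕ}
    (hi : i < s.reg nR) : e i ∈ marked s e a ↔ s.arr a i 0 ≠ 0 := by
  constructor
  · rintro ⟨j, hj, hji, hja⟩
    rwa [h.inj j hj i hi hji] at hja
  · exact fun h' => ⟨i, hi, rfl, h'⟩

theorem marked_congr {s s' : Store} (e : ℕ → α) {a : ℕ} (hn : s'.reg nR = s.reg nR)
    (ha : s'.arr a = s.arr a) : marked s' e a = marked s e a := by
  simp [marked, hn, ha]

theorem mem_nodes_of_V {H : Arena α} {v : α} {p : Fin 2} (h : v ∈ H.V p) : v ∈ H.nodes := by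
  fin_cases p
  · exact Or.inl h
  · exact Or.inr h

theorem fin2_eq_or (p q : Fin 2) : q = p ∨ q = 1 - p := by
  fin_cases p <;> fin_cases q <;> simp

theorem fin2_sub_ne (p : Fin 2) : 1 - p ≠ p := by fin_cases p <;> simp

theorem fin2_sub_sub (p : Fin 2) : 1 - (1 - p) = p := by fin_cases p <;> simp

theorem mem_V_or {H : Arena α} {v : α} (h : v ∈ H.nodes) (p : Fin 2) :
    v ∈ H.V p ∨ v ∈ H.V (1 - p) := by
  rcases h with h | h <;> fin_cases p <;> simp [h]

theorem Arena.IsParityGame.not_mem_V {H : Arena α} (hH : H.IsParityGame) {v : α} {p : Fin 2}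
    (h : v ∈ H.V p) : v ∉ H.V (1 - p) := by
  have := Set.disjoint_left.1 hH.disjoint
  fin_cases p
  · exact this h
  · exact fun h' => this h' h

theorem Holds.own_iff {s : Store} {e : ℕ → α} {H : Arena α} (h : Holds s e H)
    {i : ℕ} (hi : i < s.reg nR) (hv : e i ∈ H.nodes) (p : Fin 2) :
    s.arr ownA i 0 = p.val ↔ e i ∈ H.V p := by
  refine ⟨fun h' => ?_, h.own i hi p⟩
  rcases mem_V_or hv p with h1 | h1
  · exact h1
  · have := h.own i hi _ h1
    rw [h', Fin.val_inj] at this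
    exact absurd this.symm (fin2_sub_ne p)

theorem Arena.mem_cpre_of_succs {H : Arena α} {v : α} {p : Fin 2} {X : Set α} (hv : v ∈ H.nodes)
    (hne : (H.succs v).Nonempty) (h : H.succs v ⊆ X) : v ∈ H.cpre p X := by
  rcases mem_V_or hv p with h1 | h1
  · exact Or.inl ⟨h1, hne.imp fun w hw => ⟨hw, h hw⟩⟩
  · exact Or.inr ⟨h1, h⟩

theorem cpre_subset_nodes {H : Arena α} {p : Fin 2} {X : Set α} : H.cpre p X ⊆ H.nodes := by
  rintro v (h | h) <;> exact mem_nodes_of_V h.1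

/-! ## Attractor computation -/

/-- The invariant of the attractor computation, where `R i` is the set of nodes whose effect on
node `i` has been taken into account. -/
structure AttrInv (s : Store) (e : ℕ → α) (H : Arena α) (p : Fin 2) (th : ℕ) (R : ℕ → Set α) :
    Prop where
  player : s.reg pR = p.val
  le : s.reg hdR ≤ s.reg tlR
  queue_lt : ∀ l < s.reg tlR, s.arr queA l 0 < s.reg nR
  queue_inj : ∀ l < s.reg tlR, ∀ l' < s.reg tlR, s.arr queA l 0 = s.arr queA l' 0 → l = l'
  tgt : ∀ i < s.reg nR, s.arr tgtA i 0 ≠ 0 ↔ ∃ l < s.reg tlR, s.arr queA l 0 = i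
  tgt_nodes : ∀ i < s.reg nR, s.arr tgtA i 0 ≠ 0 → e i ∈ H.nodes
  sat : ∀ i < s.reg nR, s.arr satA i 0 ≠ 0 ↔ e i ∈ H.cpre p (R i)
  cnt : ∀ i < s.reg nR, s.arr satA i 0 = 0 →
    s.arr cntA i 0 = {j | (j < s.reg nR ∧ (e i, e j) ∈ H.E) ∧ e j ∈ R i}.ncard
  att : ∀ i < s.reg nR, s.arr attA i 0 ≠ 0 → s.arr satA i 0 ≠ 0 ∧ s.arr tgtA i 0 ≠ 0
  closed : ∀ i < s.reg nR, s.arr satA i 0 ≠ 0 →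
    s.arr attA i 0 ≠ 0 ∨ s.arr colA i 0 < th ∧ s.arr tgtA i 0 = 0

/-- The nodes that have left the queue. -/
def processed (s : Store) (e : ℕ → α) : Set α := {v | ∃ l < s.reg hdR, e (s.arr queA l 0) = v}

/-- The number of steps that may still be needed for nodes that have not left the queue. -/
def attrPot (s : Store) : ℕ :=
  ∑ i ∈ Finset.range (s.reg nR),
    if ∃ l < s.reg hdR, s.arr queA l 0 = i then 0 else 100 * (s.arr pdgA i 0 + 1)

/-- Only those members of `R i` that are successors of node `i` matter. This converts between the
sets `R i` in the middle of a predecessor list, which differ from node to node, and the uniform set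
of processed nodes. -/
theorem AttrInv.congr_R {s : Store} {e : ℕ → α} {H : Arena α} {p : Fin 2} {th : ℕ}
    {R R' : ℕ → Set α} (h : AttrInv s e H p th R)
    (hsat : ∀ i < s.reg nR, e i ∈ H.cpre p (R i) ↔ e i ∈ H.cpre p (R' i))
    (hcnt : ∀ i < s.reg nR, ∀ j < s.reg nR, (e i, e j) ∈ H.E → (e j ∈ R i ↔ e j ∈ R' i)) :
    AttrInv s e H p th R' := by
  refine { h with sat := fun i hi => (h.sat i hi).trans (hsat i hi), cnt := fun i hi h0 => ?_ }
  rw [h.cnt i hi h0]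
  congr 1
  ext j
  constructor
  · rintro ⟨⟨h1, h2⟩, h3⟩; exact ⟨⟨h1, h2⟩, (hcnt i hi j h1 h2).1 h3⟩
  · rintro ⟨⟨h1, h2⟩, h3⟩; exact ⟨⟨h1, h2⟩, (hcnt i hi j h1 h2).2 h3⟩

theorem cpre_congr {H : Arena α} {p : Fin 2} {v : α} {X Y : Set α}
    (h : ∀ w ∈ H.succs v, w ∈ X ↔ w ∈ Y) : v ∈ H.cpre p X ↔ v ∈ H.cpre p Y := by
  have h1 : H.succs v ∩ X = H.succs v ∩ Y := by
    ext w; constructor <;> rintro ⟨a, b⟩ <;> exact ⟨a, by simpa [h w a] using b⟩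
  have h2 : H.succs v ⊆ X ↔ H.succs v ⊆ Y :=
    ⟨fun h' w hw => (h w hw).1 (h' hw), fun h' w hw => (h w hw).2 (h' hw)⟩
  simp [cpre, h1, h2]

/-- The body of the inner loop of `propagate`. -/
def attrStep : Cmd :=
  when (.eq (at1 satA (.reg vR)) (.const 0))
    (put1 cntA (.reg vR) (.succ (at1 cntA (.reg vR))) ;;
      when (.or (.eq (at1 ownA (.reg vR)) (.reg pR)) (.eq (at1 cntA (.reg vR)) (at1 degA (.reg vR))))
        (put1 satA (.reg vR) (.const 1) ;;
        when (.or (le (.reg thR) (at1 colA (.reg vR))) (at1 tgtA (.reg vR)))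
          (put1 attA (.reg vR) (.const 1) ;;
          push (.reg vR))))

/-- The effect of a single edge. As `e w` is new in `R v`, increasing the counter by one keeps it
equal to the number of successors taken into account. The last clauses say that marks are never
deleted and name the only reason for a new one. -/
theorem runs_attrStep (s : Store) (e : ℕ → α) (H : Arena α) (p : Fin 2) (R : ℕ → Set α)
    (hs : Holds s e H) (hsu : HoldsSuccs s e H)
    (hHE : ∀ {u u'}, (u, u') ∈ H.E → u' ∈ H.nodes)
    (hI : AttrInv s e H p (s.reg thR) R) (v w : ℕ) (hv : v < s.reg nR) (hw : w < s.reg nR)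
    (hvw : (e v, e w) ∈ H.E) (hvn : e v ∈ H.nodes) (hwR : e w ∉ R v) (hx : s.reg vR = v) :
    Runs attrStep s 0 fun t s' => t ≤ 70 ∧
      AttrInv s' e H p (s.reg thR) (fun i => if i = v then insert (e w) (R i) else R i) ∧
      (∀ i < s.reg nR, s.arr attA i 0 ≠ 0 → s'.arr attA i 0 ≠ 0) ∧
      (∀ i < s.reg nR, s.arr tgtA i 0 ≠ 0 → s'.arr tgtA i 0 ≠ 0) ∧
      (∀ i < s.reg nR, s'.arr tgtA i 0 ≠ 0 → s.arr tgtA i 0 ≠ 0 ∨ s'.arr attA i 0 ≠ 0) ∧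
      (∀ i < s.reg nR, s'.arr attA i 0 ≠ 0 → s.arr attA i 0 ≠ 0 ∨
        i = v ∧ e v ∈ H.cpre p (insert (e w) (R v)) ∧
          (s.reg thR ≤ s.arr colA v 0 ∨ s.arr tgtA v 0 ≠ 0)) ∧
      (∀ l < s.reg tlR, s'.arr queA l 0 = s.arr queA l 0) ∧ s.reg tlR ≤ s'.reg tlR := by
  have hpl := hI.player
  -- the number of successors that have been counted
  have hfin : {j | j < s.reg nR ∧ (e v, e j) ∈ H.E}.Finite := (hsu v hv hvn).finite
  have hset : {j | (j < s.reg nR ∧ (e v, e j) ∈ H.E) ∧ e j ∈ insert (e w) (R v)} =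
      insert w {j | (j < s.reg nR ∧ (e v, e j) ∈ H.E) ∧ e j ∈ R v} := by
    ext j
    simp only [Set.mem_ofPred_eq, Set.mem_insert_iff]
    constructor
    · rintro ⟨⟨h1, h2⟩, h3 | h3⟩
      · exact Or.inl (hs.inj j h1 w hw h3)
      · exact Or.inr ⟨⟨h1, h2⟩, h3⟩
    · rintro (rfl | ⟨h1, h2⟩)
      · exact ⟨⟨hw, hvw⟩, Or.inl rfl⟩
      · exact ⟨h1, Or.inr h2⟩
  have hcard : {j | (j < s.reg nR ∧ (e v, e j) ∈ H.E) ∧ e j ∈ insert (e w) (R v)}.ncard =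
      {j | (j < s.reg nR ∧ (e v, e j) ∈ H.E) ∧ e j ∈ R v}.ncard + 1 := by
    rw [hset]
    exact Set.ncard_insert_of_notMem (fun h => hwR h.2)
      (hfin.subset fun j hj => hj.1)
  have hmono : e v ∈ H.cpre p (R v) → e v ∈ H.cpre p (insert (e w) (R v)) :=
    fun h => H.cpre_mono p (Set.subset_insert _ _) h
  have hR : ∀ i, i ≠ v → (if i = v then insert (e w) (R i) else R i) = R i :=
    fun i hi => by simp [hi]
  by_cases hsat : s.arr satA v 0 = 0
  swap
  -- The counter of a saturated node is frozen. This is harmless since `cnt` speaks of unsaturated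
  -- nodes only, and saturation persists because `cpre` is monotone.
  · rw [attrStep, runs_ite]
    simp only [Expr.eval, hx, hsat, if_false, ne_eq, not_true, false_implies, forall_const, true_and, runs_skip]
    refine ⟨by simp, { hI with sat := fun i hi => ?_, cnt := fun i hi h0 => ?_ }, fun _ _ h => h,
      fun _ _ h => h, fun _ _ h => Or.inl h, fun _ _ h => Or.inl h, fun _ _ => by trivial, le_rfl⟩
    · by_cases hiv : i = v
      · subst hiv
        simpa [hsat] using hmono ((hI.sat i hi).1 hsat)
      · simpa [hiv] using hI.sat i hi
    · have hiv : i ≠ v := by rintro rfl; exact hsat h0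
      simpa [hiv] using hI.cnt i hi h0
  have hcnt := hI.cnt v hv hsat
  -- The test of the program decides `cpre`: one counted successor suffices for a node of the
  -- attracting player, and otherwise the counter reaches the degree exactly if, by cardinality, all
  -- successors are counted.
  have hC : (s.arr ownA v 0 = s.reg pR ∨ s.arr cntA v 0 + 1 = s.arr degA v 0) ↔
      e v ∈ H.cpre p (insert (e w) (R v)) := by
    have hnot : e v ∉ H.cpre p (R v) := fun h => (hI.sat v hv).2 h hsat
    have hdeg : s.arr cntA v 0 + 1 = s.arr degA v 0 ↔ H.succs (e v) ⊆ insert (e w) (R v) := by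
      rw [hcnt, ← (hsu v hv hvn).ncard, ← hcard]
      constructor
      · intro h u hu
        have heq := Set.eq_of_subset_of_ncard_le (fun j hj => hj.1) h.ge hfin
        have hu' : u ∈ H.nodes := hHE hu
        obtain ⟨j, hj, rfl⟩ := hs.surj u hu'
        have : j ∈ {j | j < s.reg nR ∧ (e v, e j) ∈ H.E} := ⟨hj, hu⟩
        rw [← heq] at this
        exact this.2
      · intro h
        congr 1
        ext j
        exact ⟨fun h' => h'.1, fun h' => ⟨h', h h'.2⟩⟩
    rw [hdeg, hpl, hs.own_iff hv hvn p]
    constructor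
    · rintro (h | h)
      · exact Or.inl ⟨h, e w, hvw, Set.mem_insert _ _⟩
      · exact H.mem_cpre_of_succs hvn ⟨e w, hvw⟩ h
    · rintro (h | h)
      · exact Or.inl h.1
      · exact Or.inr h.2
  have hcntA : ∀ i < s.reg nR, i ≠ v → s.arr satA i 0 = 0 → s.arr cntA i 0 =
      {j | (j < s.reg nR ∧ (e i, e j) ∈ H.E) ∧ e j ∈ if i = v then insert (e w) (R i) else R i}.ncard :=
    fun i hi hiv h0 => by simpa [hiv] using hI.cnt i hi h0
  have hsatA : ∀ i < s.reg nR, i ≠ v → (s.arr satA i 0 ≠ 0 ↔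
      e i ∈ H.cpre p (if i = v then insert (e w) (R i) else R i)) :=
    fun i hi hiv => by simpa [hiv] using hI.sat i hi
  by_cases hCv : s.arr ownA v 0 = s.reg pR ∨ s.arr cntA v 0 + 1 = s.arr degA v 0
  swap
  · have hC' := mt hC.2 hCv
    simp only [not_or] at hCv
    simp [attrStep, hx, hsat, hCv]
    refine ⟨?_, fun i hi h => Or.inl h, fun i hi h => Or.inl h⟩
    refine { hI with sat := fun i hi => ?_, cnt := fun i hi h0 => ?_ }
    · by_cases hiv : i = v
      · subst hiv
        simpa [hsat] using hC'
      · simpa using hsatA i hi hiv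
    · by_cases hiv : i = v
      · subst hiv
        simp [hcnt] at hcard ⊢
        exact hcard.symm
      · simpa [hiv] using hcntA i hi hiv (by simpa using h0)
  · have hC' := hC.1 hCv
    have hsatB : ∀ i < s.reg nR, (¬ (if i = v then 1 else s.arr satA i 0) = 0 ↔
        e i ∈ H.cpre p (if i = v then insert (e w) (R i) else R i)) := by
      intro i hi
      by_cases hiv : i = v
      · subst hiv; simpa using hC'
      · simpa [hiv] using hI.sat i hi
    have hcntB : ∀ i < s.reg nR, (if i = v then 1 else s.arr satA i 0) = 0 →
        (if i = v then s.arr cntA v 0 + 1 else s.arr cntA i 0) =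
        {j | (j < s.reg nR ∧ (e i, e j) ∈ H.E) ∧
          e j ∈ if i = v then insert (e w) (R i) else R i}.ncard := by
      intro i hi h0
      by_cases hiv : i = v
      · simp [hiv] at h0
      · simpa [hiv] using hI.cnt i hi (by simpa [hiv] using h0)
    rw [attrStep]
    refine Runs.ite (P := True) (by simp [hx, hsat]) (fun _ => ?_) (by simp)
    rw [runs_seq, runs_put]
    refine Runs.ite (P := True) (by simp [hx]; tauto) (fun _ => ?_) (by simp)
    rw [runs_seq, runs_put]
    -- If this test fails, the node stays saturated without being attracted; the second alternative
    -- of `closed` allows this for nodes below the threshold that are no targets.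
    refine Runs.ite (P := s.reg thR ≤ s.arr colA v 0 ∨ s.arr tgtA v 0 ≠ 0)
      (by simp [hx]; grind) (fun hD => ?_) (fun hD => ?_)
    · have hq : ∀ l < s.reg tlR, s.arr queA l 0 < s.reg nR := hI.queue_lt
      by_cases htv : s.arr tgtA v 0 = 0
      · have hnq : ∀ l < s.reg tlR, s.arr queA l 0 ≠ v := fun l hl h =>
          (hI.tgt v hv).2 ⟨l, hl, h⟩ htv
        simp [push, hx, htv]
        refine ⟨?_, ?_, ?_, ?_, ?_, ?_⟩
        · constructor
          · simpa using hI.player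
          · simpa using hI.le.trans (Nat.le_succ _)
          · simp; intro l hl; split_ifs <;> grind
          · simp
            intro l hl l' hl'
            have := hI.queue_inj l
            grind
          · simp
            intro i hi
            have h1 := hI.tgt i hi
            by_cases hiv : i = v
            · simp only [hiv, if_true, one_ne_zero, not_false_iff, true_iff]
              exact ⟨s.reg tlR, le_rfl, by simp⟩
            · simp only [hiv, if_false]
              rw [← ne_eq, h1]
              constructor
              · rintro ⟨l, hl, h⟩
                exact ⟨l, by omega, by rw [if_neg hl.ne, h]⟩
              · rintro ⟨l, hl, h⟩
                split_ifs at h with hlt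
                · exact absurd h.symm hiv
                · exact ⟨l, by omega, h⟩
          · simp
            intro i hi
            have := hI.tgt_nodes i hi
            grind
          · simpa using hsatB
          · simpa using hcntB
          · simp
            intro i hi
            have := hI.att i hi
            grind
          · simp
            intro i hi
            have := hI.closed i hi
            grind
        all_goals grind
      · simp [push, hx, htv]
        refine ⟨?_, ?_, ?_, ?_⟩
        · constructor
          · simpa using hI.player
          · simpa using hI.le
          · simpa using hI.queue_lt
          · simpa using hI.queue_inj
          · simpa using hI.tgt
          · simpa using hI.tgt_nodes
          · simpa using hsatB
          · simpa using hcntB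
          · simp
            intro i hi
            have := hI.att i hi
            grind
          · simp
            intro i hi
            have := hI.closed i hi
            grind
        all_goals grind
    · simp only [not_or, not_not, not_le] at hD
      simp [hx]
      refine ⟨?_, fun i hi h => Or.inl h, fun i hi h => Or.inl h⟩
      constructor
      · simpa using hI.player
      · simpa using hI.le
      · simpa using hI.queue_lt
      · simpa using hI.queue_inj
      · simpa using hI.tgt
      · simpa using hI.tgt_nodes
      · simpa using hsatB
      · simpa using hcntB
      · simp
        intro i hi
        have := hI.att i hi
        grind
      · simp
        intro i hi
        have := hI.closed i hi
        grind


theorem AttrInv.congr {s s' : Store} {e : ℕ → α} {H : Arena α} {p : Fin 2} {th : ℕ}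
    {R : ℕ → Set α} (h : AttrInv s e H p th R)
    (hn : s'.reg nR = s.reg nR) (hp : s'.reg pR = s.reg pR) (hh : s'.reg hdR ≤ s.reg tlR)
    (ht : s'.reg tlR = s.reg tlR) (ha : s'.arr = s.arr) : AttrInv s' e H p th R := by
  obtain ⟨h1, h2, h3, h4, h5, h6, h7, h8, h9, h10⟩ := h
  constructor <;> simp only [hn, hp, ht, ha] <;> assumption

/-- Upper bound: `S` is any set that is closed under the attraction step, and attracted nodes stay
in it. Lower bound: at the end all targets are processed, so `sat` and `closed` make the attracted
set closed too. A node that leaves the queue releases its share of `attrPot`, which is proportional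
to its in-degree plus one. The computation may be resumed with processed nodes and attracted nodes
from before. -/
theorem runs_propagate (s : Store) (e : ℕ → α) (H : Arena α) (p : Fin 2) (S T₀ : Set α)
    (hs : Holds s e H) (hsu : HoldsSuccs s e H) (hpr : HoldsPreds s e H) (hH : H.IsParityGame)
    (hI : AttrInv s e H p (s.reg thR) fun _ => processed s e)
    (hT₀ : marked s e tgtA = T₀) (hA₀ : marked s e attA ⊆ S)
    (hS : ∀ v ∈ H.cpre p (T₀ ∪ S), s.reg thR ≤ H.c v ∨ v ∈ T₀ ∪ S → v ∈ S) :
    Runs propagate s 0 fun t s' => t + attrPot s' ≤ attrPot s + 20 ∧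
      AttrInv s' e H p (s.reg thR) (fun _ => marked s' e tgtA) ∧
      processed s' e = marked s' e tgtA ∧
      marked s e attA ⊆ marked s' e attA ∧ marked s' e attA ⊆ S ∧
      marked s' e tgtA = T₀ ∪ marked s' e attA := by
  have hHE : ∀ {u u'}, (u, u') ∈ H.E → u' ∈ H.nodes := fun h => (hH.edges h).2
  refine (runs_while
    (fun s' => AttrInv s' e H p (s.reg thR) (fun _ => processed s' e) ∧
      marked s e attA ⊆ marked s' e attA ∧ marked s' e attA ⊆ S ∧
      marked s' e tgtA = T₀ ∪ marked s' e attA) attrPot ?_ ?_).mono ?_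
  · refine ⟨hI, subset_rfl, hA₀, ?_⟩
    rw [← hT₀]
    refine (Set.union_eq_self_of_subset_right ?_).symm
    rintro _ ⟨i, hi, rfl, h⟩
    exact ⟨i, hi, rfl, (hI.att i hi h).2⟩
  · rintro s₁ ⟨hI₁, hA₁, hS₁, hT₁⟩ hf hb
    have hlt : s₁.reg hdR < s₁.reg tlR := by
      by_contra h; simp [h] at hb
    have hn : s₁.reg nR = s.reg nR := hf.reg nR rfl
    have hth : s₁.reg thR = s.reg thR := hf.reg thR rfl
    have hs₁ : Holds s₁ e H := hs.congr hn (hf.arr _ rfl) (hf.arr _ rfl) (hf.arr _ rfl)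
    have hsu₁ : HoldsSuccs s₁ e H := hsu.congr hn (hf.arr _ rfl) (hf.arr _ rfl)
    have hpr₁ : HoldsPreds s₁ e H := hpr.congr hn (hf.arr _ rfl) (hf.arr _ rfl)
    obtain ⟨w, hw⟩ : ∃ w, s₁.arr queA (s₁.reg hdR) 0 = w := ⟨_, rfl⟩
    have hwn : w < s₁.reg nR := hw ▸ hI₁.queue_lt _ hlt
    -- The queue has no repetitions, so its head has not been processed before.
    have hwP : e w ∉ processed s₁ e := by
      rintro ⟨l, hl, h⟩
      have h1 := hs₁.inj _ (hI₁.queue_lt l (hl.trans hlt)) _ hwn h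
      have := hI₁.queue_inj l (hl.trans hlt) _ hlt (h1.trans hw.symm)
      omega
    have hwT : s₁.arr tgtA w 0 ≠ 0 := (hI₁.tgt w hwn).2 ⟨_, hlt, hw⟩
    have hL := hpr₁ w hwn
    rw [runs_seq, runs_set, runs_seq, runs_set]
    simp only [Expr.eval, Store.setReg_reg, hw, show hdR ≠ wR by decide, if_false]
    set s₂ := (s₁.setReg wR w).setReg hdR (s₁.reg hdR + 1) with hs₂
    have hproc : processed s₂ e = insert (e w) (processed s₁ e) := by
      ext u
      simp only [processed, hs₂, Set.mem_ofPred_eq, Set.mem_insert_iff]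
      simp
      constructor
      · rintro ⟨l, hl, rfl⟩
        rcases hl.lt_or_eq with h | rfl
        · exact Or.inr ⟨l, h, rfl⟩
        · exact Or.inl (by rw [hw])
      · rintro (rfl | ⟨l, hl, rfl⟩)
        · exact ⟨_, le_rfl, by rw [hw]⟩
        · exact ⟨l, hl.le, rfl⟩
    -- While the predecessor list of `w` is traversed, `w` counts as processed exactly for the
    -- predecessors at positions below `j`.
    refine Runs.call (runs_for_const (N := s₁.arr pdgA w 0)
      (fun j s' => AttrInv s' e H p (s.reg thR)
        (fun i => if ∃ l < j, s₁.arr preA w l = i then insert (e w) (processed s₁ e)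
          else processed s₁ e) ∧
        marked s e attA ⊆ marked s' e attA ∧ marked s' e attA ⊆ S ∧
        marked s' e tgtA = T₀ ∪ marked s' e attA ∧
        (∀ l < s₁.reg tlR, s'.arr queA l 0 = s₁.arr queA l 0) ∧ s₁.reg tlR ≤ s'.reg tlR)
      75 rfl ?_ ?_ ?_ ?_) ?_
    · rintro j s' m ⟨h, h'⟩
      exact ⟨h.congr rfl rfl h.le rfl rfl, h'⟩
    · refine ⟨?_, ?_, ?_, ?_, ?_⟩
      · have : AttrInv s₂ e H p (s.reg thR) (fun _ => processed s₁ e) :=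
          hI₁.congr rfl rfl (by simpa [hs₂] using hlt) rfl rfl
        simpa using this
      · exact hA₁
      · exact hS₁
      · exact hT₁
      · exact ⟨fun _ _ => rfl, le_rfl⟩
    · rintro j s₃ - - - hf₃
      have h1 : s₃.reg wR = w := (hf₃.reg wR rfl).trans (by simp [hs₂])
      have h2 : s₃.arr pdgA = s₁.arr pdgA := hf₃.arr pdgA rfl
      simp [h1, h2]
    · rintro j s₃ hj ⟨hI₃, hA₃, hS₃, hT₃, hq₃, htl₃⟩ hjx hf₃
      have h1 : s₃.reg wR = w := (hf₃.reg wR rfl).trans (by simp [hs₂])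
      have h2 : s₃.arr preA = s₁.arr preA := hf₃.arr preA rfl
      have hn₃ : s₃.reg nR = s₁.reg nR := hf₃.reg nR rfl
      have hth₃ : s₃.reg thR = s.reg thR := (hf₃.reg thR rfl).trans hth
      obtain ⟨v, hv⟩ : ∃ v, s₁.arr preA w j = v := ⟨_, rfl⟩
      obtain ⟨hvn, hvw⟩ := (hL.mem v).2 ⟨j, hj, hv⟩
      rw [runs_seq, runs_set]
      simp only [Expr.eval, h1, h2, hjx, hv]
      have hs₃ : Holds (s₃.setReg vR v) e H :=
        hs₁.congr hn₃ (hf₃.arr _ rfl) (hf₃.arr _ rfl) (hf₃.arr _ rfl)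
      -- All nodes taken into account are targets, hence in `T₀ ∪ S`; so the closedness of `S`
      -- applies to each newly attracted node.
      have hmono : ∀ X ⊆ marked s₃ e tgtA, H.cpre p X ⊆ H.cpre p (T₀ ∪ S) := fun X hX =>
        H.cpre_mono p (hX.trans (hT₃.le.trans (Set.union_subset_union_right _ hS₃)))
      have hPT : processed s₁ e ⊆ marked s₃ e tgtA := by
        rintro _ ⟨l, hl, rfl⟩
        have hlt' := hl.trans hlt
        exact ⟨_, hn₃ ▸ hI₁.queue_lt l hlt', rfl, (hI₃.tgt _ (hn₃ ▸ hI₁.queue_lt l hlt')).2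
          ⟨l, hlt'.trans_le htl₃, hq₃ l hlt'⟩⟩
      have hwT₃ : e w ∈ marked s₃ e tgtA :=
        ⟨w, hn₃ ▸ hwn, rfl, (hI₃.tgt w (hn₃ ▸ hwn)).2 ⟨_, hlt.trans_le htl₃, by rw [hq₃ _ hlt, hw]⟩⟩
      have hvnew : ¬ ∃ l < j, s₁.arr preA w l = v := by
        rintro ⟨l, hl, h⟩
        have := hL.injOn l (hl.trans hj) j hj (h.trans hv.symm)
        omega
      have hth₃' : (s₃.setReg vR v).reg thR = s.reg thR := hth₃
      refine (runs_attrStep (s₃.setReg vR v) e H p (fun i => if ∃ l < j, s₁.arr preA w l = i then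
          insert (e w) (processed s₁ e) else processed s₁ e) hs₃
        (hsu₁.congr hn₃ (hf₃.arr _ rfl) (hf₃.arr _ rfl)) hHE
        (by rw [hth₃']; exact hI₃.congr rfl rfl hI₃.le rfl rfl) v w
        (by simpa [hn₃] using hvn) (by simpa [hn₃] using hwn) hvw (hH.edges hvw).1
        (by simpa only [if_neg hvnew] using hwP) (by simp)).call ?_
      rintro t s₄ ⟨ht, hI₄, ha₄, htg₄, htg₄', ha₄', hq₄, htl₄⟩ hf₄
      simp only [Store.setReg_reg, Store.setReg_arr] at ha₄ htg₄ htg₄' ha₄' hq₄ htl₄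
      simp [show nR ≠ vR by decide, show tlR ≠ vR by decide, show thR ≠ vR by decide, hth₃]
        at ha₄ htg₄ htg₄' ha₄' hq₄ htl₄
      have hn₄ : s₄.reg nR = s₃.reg nR := hf₄.reg nR rfl
      have hmA : marked s₃ e attA ⊆ marked s₄ e attA := by
        rintro _ ⟨i, hi, rfl, h⟩
        exact ⟨i, hn₄ ▸ hi, rfl, ha₄ i hi h⟩
      refine ⟨⟨?_, hA₃.trans hmA, ?_, ?_, ?_, ?_⟩, ?_⟩
      · refine (hth₃' ▸ hI₄ : AttrInv s₄ e H p (s.reg thR) _).congr_R ?_ ?_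
        all_goals
          intro i hi
          by_cases hiv : i = v
          · subst hiv
            have : ∃ l < j + 1, s₁.arr preA w l = i := ⟨j, Nat.lt_succ_self j, hv⟩
            simp only [if_true, if_neg hvnew, if_pos this]
            try simp
          · have : (∃ l < j + 1, s₁.arr preA w l = i) ↔ ∃ l < j, s₁.arr preA w l = i := by
              constructor
              · rintro ⟨l, hl, h⟩
                rcases (Nat.lt_succ_iff.1 hl).lt_or_eq with h' | rfl
                · exact ⟨l, h', h⟩
                · exact absurd (h.symm.trans hv) hiv
              · rintro ⟨l, hl, h⟩
                exact ⟨l, by omega, h⟩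
            simp only [if_neg hiv, this]
            try simp
      · rintro _ ⟨i, hi, rfl, h⟩
        rw [hn₄] at hi
        rcases ha₄' i hi h with h | ⟨rfl, h, h'⟩
        · exact hS₃ ⟨i, hi, rfl, h⟩
        · refine hS _ (hmono _ ?_ h) ?_
          · rw [if_neg hvnew]
            exact Set.insert_subset hwT₃ hPT
          · rcases h' with h' | h'
            · left
              have := hs₃.col i (by simpa using hi)
              simp at this
              rwa [← this]
            · right
              have : e i ∈ marked s₃ e tgtA := ⟨i, hi, rfl, h'⟩
              rw [hT₃] at this
              exact this.imp_right fun h => hS₃ h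
      · apply subset_antisymm
        · rintro _ ⟨i, hi, rfl, h⟩
          rw [hn₄] at hi
          rcases htg₄' i hi h with h | h
          · have : e i ∈ marked s₃ e tgtA := ⟨i, hi, rfl, h⟩
            rw [hT₃] at this
            exact this.imp_right fun h => hmA h
          · exact Or.inr ⟨i, hn₄ ▸ hi, rfl, h⟩
        · rintro u (hu | ⟨i, hi, rfl, h⟩)
          · have : u ∈ marked s₃ e tgtA := hT₃ ▸ Or.inl hu
            obtain ⟨i, hi, rfl, h⟩ := this
            exact ⟨i, hn₄ ▸ hi, rfl, htg₄ i hi h⟩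
          · exact ⟨i, hi, rfl, (hI₄.att i hi h).2⟩
      · intro l hl
        rw [hq₄ l (hl.trans_le htl₃), hq₃ l hl]
      · exact htl₃.trans htl₄
      · simp; omega
    · rintro t s₃ ⟨⟨hI₃, hA₃, hS₃, hT₃, hq₃, htl₃⟩, ht⟩ hf₃
      have hhd : s₃.reg hdR = s₁.reg hdR + 1 := hf₃.reg hdR rfl
      have hn₃ : s₃.reg nR = s₁.reg nR := hf₃.reg nR rfl
      have hproc₃ : processed s₃ e = insert (e w) (processed s₁ e) := by
        rw [← hproc]
        ext u
        simp only [processed, Set.mem_ofPred_eq, hhd]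
        refine exists_congr fun l => ?_
        have : s₂.reg hdR = s₁.reg hdR + 1 := by simp [hs₂]
        rw [this]
        constructor
        all_goals
          rintro ⟨hl, h⟩
          refine ⟨hl, ?_⟩
          have := hq₃ l (by omega)
          simp only [hs₂, Store.setReg_arr] at h ⊢
          first | rw [this] at h | rw [this]
          exact h
      refine ⟨⟨?_, hA₃, hS₃, hT₃⟩, ?_⟩
      -- At the end of the list, a node that is not a predecessor of `w` does not notice whether `w`
      -- is processed.
      · refine hI₃.congr_R ?_ ?_
        · intro i hi
          rw [hproc₃]
          split_ifs with hex
          · rfl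
          · refine cpre_congr fun u hu => ?_
            constructor
            · exact fun h => Or.inr h
            · rintro (rfl | h)
              · exact absurd ((hL.mem i).1 ⟨hn₃ ▸ hi, hu⟩) hex
              · exact h
        · intro i hi j hj hij
          rw [hproc₃]
          split_ifs with hex
          · rfl
          · constructor
            · exact fun h => Or.inr h
            · rintro (h | h)
              · have := hs₁.inj j (hn₃ ▸ hj) w hwn h
                subst this
                exact absurd ((hL.mem i).1 ⟨hn₃ ▸ hi, hij⟩) hex
              · exact h
      · have hpdg : s₃.arr pdgA = s₁.arr pdgA := hf₃.arr pdgA rfl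
        have hwmem : w ∈ Finset.range (s₁.reg nR) := Finset.mem_range.2 hwn
        -- The potential drops by exactly the share of `w`, which pays for the traversal of its
        -- predecessor list.
        have hpot : attrPot s₃ + 100 * (s₁.arr pdgA w 0 + 1) = attrPot s₁ := by
          unfold attrPot
          rw [hn₃, ← Finset.add_sum_erase _ _ hwmem, ← Finset.add_sum_erase _ _ hwmem, if_pos,
            if_neg]
          · rw [zero_add, add_comm, hpdg]
            congr 1
            refine Finset.sum_congr rfl fun i hi => ?_
            have hiw : i ≠ w := Finset.ne_of_mem_erase hi
            refine if_congr ?_ rfl rfl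
            rw [hhd]
            constructor
            · rintro ⟨l, hl, h⟩
              rw [hq₃ l (by omega)] at h
              refine ⟨l, ?_, h⟩
              rcases (Nat.lt_succ_iff.1 hl).lt_or_eq with h' | rfl
              · exact h'
              · exact absurd (h.symm.trans hw) hiw
            · rintro ⟨l, hl, h⟩
              exact ⟨l, by omega, by rw [hq₃ l (by omega)]; exact h⟩
          · rintro ⟨l, hl, h⟩
            exact hwP ⟨l, hl, by rw [h]⟩
          · exact ⟨s₁.reg hdR, by omega, by rw [hq₃ _ hlt]; exact hw⟩
        simp at ht ⊢
        omega
  · rintro t s' ⟨⟨hI', hA', hS', hT'⟩, hb, ht⟩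
    have hle : s'.reg tlR ≤ s'.reg hdR := by
      by_contra h; simp [not_le.1 h] at hb
    have heq : s'.reg hdR = s'.reg tlR := le_antisymm hI'.le hle
    have hP : processed s' e = marked s' e tgtA := by
      ext u
      simp only [processed, heq, marked, Set.mem_ofPred_eq]
      constructor
      · rintro ⟨l, hl, rfl⟩
        exact ⟨_, hI'.queue_lt l hl, rfl, (hI'.tgt _ (hI'.queue_lt l hl)).2 ⟨l, hl, rfl⟩⟩
      · rintro ⟨i, hi, rfl, h⟩
        obtain ⟨l, hl, rfl⟩ := (hI'.tgt i hi).1 h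
        exact ⟨l, hl, rfl⟩
    refine ⟨by simp at ht; omega, ?_, hP, hA', hS', hT'⟩
    rw [← hP]
    exact hI'

end ParityGames

namespace ParityGames

/-! ## Attractors -/

namespace Arena

variable {α : Type*} {G : Arena α} {p : Fin 2} {X Y Z : Set α} {d : ℕ}

theorem attr_eq : X ∪ G.cpre p (G.attr p X) = G.attr p X :=
  OrderHom.map_lfp ⟨fun Z => X ∪ G.cpre p Z,
    fun _ _ h => Set.union_subset_union_right _ (G.cpre_mono p h)⟩

theorem subset_attr : X ⊆ G.attr p X := Set.subset_union_left.trans attr_eq.subset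

theorem cpre_attr_subset : G.cpre p (G.attr p X) ⊆ G.attr p X :=
  Set.subset_union_right.trans attr_eq.subset

theorem attr_subset (hX : X ⊆ Z) (hZ : G.cpre p Z ⊆ Z) : G.attr p X ⊆ Z :=
  OrderHom.lfp_le _ (Set.union_subset hX hZ)

theorem attr_mono (h : X ⊆ Y) : G.attr p X ⊆ G.attr p Y :=
  attr_subset (h.trans subset_attr) cpre_attr_subset

theorem attr_subset_nodes (h : X ⊆ G.nodes) : G.attr p X ⊆ G.nodes :=
  attr_subset h cpre_subset_nodes

theorem mattr_eq : G.mpre p (G.mattr p X d) X d = G.mattr p X d :=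
  OrderHom.map_lfp ⟨fun Z => G.mpre p Z X d, G.mpre_mono p X d⟩

theorem mattr_subset (h : G.mpre p Z X d ⊆ Z) : G.mattr p X d ⊆ Z := OrderHom.lfp_le _ h

theorem mem_mpre {A : Set α} {v : α} :
    v ∈ G.mpre p A X d ↔ d ≤ G.c v ∧ v ∈ G.cpre p (A ∪ X) := by
  simp only [mpre, cpre, Set.mem_union, Set.mem_ofPred_eq]; tauto

theorem mem_pmpre {A : Set α} {v : α} :
    v ∈ G.pmpre p A X d ↔ (d ≤ G.c v ∨ v ∈ X) ∧ v ∈ G.cpre p (A ∪ X) := by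
  simp only [pmpre, cpre, Set.mem_union, Set.mem_ofPred_eq]; tauto

theorem mem_mattr {v : α} :
    v ∈ G.mattr p X d ↔ d ≤ G.c v ∧ v ∈ G.cpre p (G.mattr p X d ∪ X) := by
  rw [← mem_mpre, mattr_eq]

/-- Induction for monotone attractors. -/
theorem mattr_induct (h : ∀ v ∈ G.mattr p X d, d ≤ G.c v →
    v ∈ G.cpre p ((G.mattr p X d ∩ Z) ∪ X) → v ∈ Z) : G.mattr p X d ⊆ Z := by
  refine (mattr_subset (Z := G.mattr p X d ∩ Z) ?_).trans Set.inter_subset_right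
  intro v hv
  have hv' := mem_mpre.1 hv
  have hm : v ∈ G.mattr p X d := mem_mattr.2 ⟨hv'.1,
    G.cpre_mono p (Set.union_subset_union_left _ Set.inter_subset_left) hv'.2⟩
  exact ⟨hm, h v hm hv'.1 hv'.2⟩

theorem mattr_mono (h : X ⊆ Y) : G.mattr p X d ⊆ G.mattr p Y d :=
  mattr_subset fun _ hv => mem_mattr.2 ⟨(mem_mpre.1 hv).1,
    G.cpre_mono p (Set.union_subset_union_right _ h) (mem_mpre.1 hv).2⟩

theorem le_of_mem_mattr {v : α} (h : v ∈ G.mattr p X d) : d ≤ G.c v := (mem_mattr.1 h).1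

theorem mattr_subset_nodes : G.mattr p X d ⊆ G.nodes :=
  fun _ h => cpre_subset_nodes (mem_mattr.1 h).2

theorem pmattr_eq : G.pmpre p (G.pmattr p X d) X d = G.pmattr p X d :=
  OrderHom.map_lfp ⟨fun Z => G.pmpre p Z X d, G.pmpre_mono p X d⟩

theorem mem_pmattr {v : α} :
    v ∈ G.pmattr p X d ↔ (d ≤ G.c v ∨ v ∈ X) ∧ v ∈ G.cpre p (G.pmattr p X d ∪ X) := by
  rw [← mem_pmpre, pmattr_eq]

theorem pmattr_subset (h : ∀ v, d ≤ G.c v ∨ v ∈ X → v ∈ G.cpre p (Z ∪ X) → v ∈ Z) :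
    G.pmattr p X d ⊆ Z :=
  OrderHom.lfp_le _ fun _ hv => h _ (mem_pmpre.1 hv).1 (mem_pmpre.1 hv).2

theorem pmattr_subset_nodes : G.pmattr p X d ⊆ G.nodes :=
  fun _ h => cpre_subset_nodes (mem_pmattr.1 h).2

/-- Every node has a successor, so the inclusion required of the opponent's nodes is never vacuous.
-/
theorem IsParityGame.cpre_empty (hG : G.IsParityGame) : G.cpre p ∅ = ∅ := by
  ext v
  simp only [cpre, Set.mem_union, Set.mem_ofPred_eq, Set.inter_empty, Set.not_nonempty_empty,
    and_false, false_or, Set.mem_empty_iff_false, iff_false, not_and, Set.subset_empty_iff]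
  exact fun h h' => (hG.total v (mem_nodes_of_V h)).ne_empty h'

/-- A remaining node that loses all its successors would have all of them in `A`, so it would belong
to `cpre A ⊆ A`. -/
theorem IsParityGame.removeNodes (hG : G.IsParityGame) {A : Set α} (hA : G.cpre p A ⊆ A) :
    (G.removeNodes A).IsParityGame := by
  have hn : (G.removeNodes A).nodes = G.nodes \ A := by
    simp [nodes, Arena.removeNodes, Set.union_sdiff_distrib]
  refine ⟨hn ▸ hG.finite.subset Set.sdiff_subset, hG.disjoint.mono Set.sdiff_subset Set.sdiff_subset,
    ?_, ?_⟩
  · rintro ⟨v, w⟩ ⟨h, h1, h2⟩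
    rw [hn]
    exact ⟨⟨(hG.edges h).1, h1⟩, (hG.edges h).2, h2⟩
  · intro v hv
    rw [hn] at hv
    by_contra hne
    refine hv.2 (hA (mem_cpre_of_succs hv.1 (hG.total v hv.1) fun w hw => ?_))
    by_contra hwA
    exact hne ⟨w, hw, hv.2, hwA⟩

@[simp] theorem removeNodes_nodes {A : Set α} : (G.removeNodes A).nodes = G.nodes \ A := by
  simp [nodes, Arena.removeNodes, Set.union_sdiff_distrib]

theorem removeNodes_removeNodes {A B : Set α} :
    (G.removeNodes A).removeNodes B = G.removeNodes (A ∪ B) := by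
  simp only [removeNodes, mk.injEq, and_true]
  refine ⟨funext fun q => by rw [Set.sdiff_sdiff], ?_⟩
  ext e
  simp only [Set.mem_ofPred_eq, Set.mem_union]
  tauto

/-- The next game in the for-loop of `psol` after a visit to a node `k` that is not fatal. -/
def pruned (G : Arena α) (k : α) : Arena α := G.removeEdges {e | e.1 = k ∧ e.2 ∈ G.fattr k}

/-- If `k` lost all its edges, all its successors would be in `fattr k`, and then `k` itself as
well. -/
theorem IsParityGame.pruned (hG : G.IsParityGame) {k : α} (hk : k ∉ G.fattr k) :
    (G.pruned k).IsParityGame := by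
  refine ⟨hG.finite, hG.disjoint, Set.sdiff_subset.trans hG.edges, ?_⟩
  intro v hv
  by_cases hvk : v = k
  · subst hvk
    by_contra hne
    refine hk (mem_mattr.2 ⟨le_rfl, mem_cpre_of_succs hv (hG.total v hv) fun w hw => ?_⟩)
    by_contra hwA
    exact hne ⟨w, hw, fun h => hwA (Or.inl h.2)⟩
  · obtain ⟨w, hw⟩ := hG.total v hv
    exact ⟨w, hw, fun h => hvk h.1⟩

/-- Sending an edge to its source is surjective onto the nodes. This absorbs all terms in n into the
terms in m. -/
theorem numNodes_le_numEdges (hG : G.IsParityGame) : G.numNodes ≤ G.numEdges := by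
  have hfin : G.E.Finite := (hG.finite.prod hG.finite).subset hG.edges
  refine (Set.ncard_le_ncard ?_ (hfin.image Prod.fst)).trans (Set.ncard_image_le hfin)
  intro v hv
  obtain ⟨w, hw⟩ := hG.total v hv
  exact ⟨_, hw, rfl⟩

/-! ### Layered attractors -/

variable {i j : ℕ}

/-- Nodes of the previous layer are targets of the next one, where the permissive operator admits
them regardless of their color; the set into which they force the play only grows. -/
theorem layer_subset_succ : G.layer p X i ⊆ G.layer p X (i + 1) := by
  induction i with
  | zero => exact Set.empty_subset _
  | succ i ih =>
    intro v hv
    have hv' := mem_pmattr.1 hv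
    refine mem_pmattr.2 ⟨Or.inr (Or.inl hv), G.cpre_mono p ?_ hv'.2⟩
    rintro w (hw | hw | hw)
    · exact Or.inr (Or.inl hw)
    · exact Or.inr (Or.inl (ih hw))
    · exact Or.inr (Or.inr ⟨hw.1, hw.2.trans (by omega)⟩)

/-- If no node of `X` has the new color, there are no new targets, and raising the threshold admits
no new nodes. With `i = 0` the target is empty and nothing can be attracted to it. -/
theorem layer_succ_eq (hG : G.IsParityGame) (hpar : ∀ x ∈ X, G.c x % 2 = p.val)
    (h : ∀ x ∈ X, G.c x ≠ p.val + 2 * i) : G.layer p X (i + 1) = G.layer p X i := by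
  have hp := p.isLt
  refine subset_antisymm (pmattr_subset fun v hv hv' => ?_) layer_subset_succ
  cases i with
  | zero =>
    have h0 : {v ∈ X | G.c v ≤ p.val + 2 * 0} = ∅ := by
      ext x
      simp only [Set.mem_ofPred_eq, Set.mem_empty_iff_false, iff_false, not_and]
      intro hx hle
      have := hpar x hx
      have := h x hx
      omega
    simp only [layer, h0, Set.union_empty] at hv'
    rw [hG.cpre_empty] at hv'
    exact hv'
  | succ i =>
    have h0 : {v ∈ X | G.c v ≤ p.val + 2 * (i + 1)} = {v ∈ X | G.c v ≤ p.val + 2 * i} := by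
      ext x
      simp only [Set.mem_ofPred_eq]
      refine and_congr_right fun hx => ?_
      have := hpar x hx
      have := h x hx
      omega
    rw [h0] at hv hv'
    rw [← Set.union_assoc, Set.union_self] at hv'
    have hmono : v ∈ G.cpre p (G.layer p X (i + 1) ∪
        (G.layer p X i ∪ {v ∈ X | G.c v ≤ p.val + 2 * i})) :=
      G.cpre_mono p (Set.union_subset_union_right _ Set.subset_union_right) hv'
    rcases hv with hv | hv | hv
    · exact mem_pmattr.2 ⟨Or.inl (by omega), hmono⟩
    · exact hv
    · exact mem_pmattr.2 ⟨Or.inr (Or.inr hv), hmono⟩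

theorem layer_eq_of_le (hG : G.IsParityGame) (hpar : ∀ x ∈ X, G.c x % 2 = p.val) (hij : i ≤ j)
    (h : ∀ x ∈ X, G.c x < p.val + 2 * i ∨ p.val + 2 * j ≤ G.c x) :
    G.layer p X j = G.layer p X i := by
  induction j, hij using Nat.le_induction with
  | base => rfl
  | succ j hij ih =>
    rw [layer_succ_eq hG hpar fun x hx => ?_, ih fun x hx => ?_]
    · rcases h x hx with h | h
      · exact Or.inl h
      · exact Or.inr (by omega)
    · rcases h x hx with h | h <;> omega

theorem layer_subset_nodes : G.layer p X i ⊆ G.nodes := by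
  cases i with
  | zero => exact Set.empty_subset _
  | succ i => exact pmattr_subset_nodes

/-- The layers are constant beyond the maximal color of `X`, so any number of rounds that covers all
colors of `X` gives the layered attractor. -/
theorem layeredAttr_eq (hG : G.IsParityGame) (hpar : ∀ x ∈ X, G.c x % 2 = p.val)
    (hfin : X.Finite) (h : ∀ x ∈ X, G.c x < p.val + 2 * i) :
    G.layeredAttr p X = G.layer p X i := by
  have h' : ∀ x ∈ X, G.c x < p.val + 2 * ((sSup (G.c '' X) - p.val) / 2 + 1) := by
    intro x hx
    have := le_csSup (hfin.image G.c).bddAbove (Set.mem_image_of_mem G.c hx)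
    omega
  rcases le_total i ((sSup (G.c '' X) - p.val) / 2 + 1) with hi | hi
  · exact layer_eq_of_le hG hpar hi fun x hx => Or.inl (h x hx)
  · exact (layer_eq_of_le hG hpar hi fun x hx => Or.inl (h' x hx)).symm

end Arena

end ParityGames

namespace ParityGames

open Code Arena

variable {α : Type*} {s : Store} {e : ℕ → α} {H : Arena α} {p : Fin 2}

/-! ## Sizes -/

-- Pairs of node numbers that form an edge embed into the edge set, since different numbers belong
-- to different nodes.
open Classical in
theorem sum_ncard_le_numEdges (hH : H.IsParityGame) {n : ℕ}
    (he : ∀ i < n, ∀ j < n, e i = e j → i = j) :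
    ∑ i ∈ Finset.range n, {j | j < n ∧ (e i, e j) ∈ H.E}.ncard ≤ H.numEdges ∧
    ∑ i ∈ Finset.range n, {j | j < n ∧ (e j, e i) ∈ H.E}.ncard ≤ H.numEdges := by
  have hfin : H.E.Finite := (hH.finite.prod hH.finite).subset hH.edges
  have hE : ((Finset.range n ×ˢ Finset.range n).filter fun x => (e x.1, e x.2) ∈ H.E).card ≤
      H.numEdges := by
    rw [numEdges, ← Set.ncard_coe_finset]
    refine Set.ncard_le_ncard_of_injOn (fun x => (e x.1, e x.2)) (fun x hx => ?_) ?_ hfin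
    · exact (Finset.mem_filter.1 hx).2
    · rintro ⟨a, b⟩ ha ⟨c, d⟩ hc h
      simp only [Finset.coe_filter, Finset.mem_product, Finset.mem_range, Set.mem_ofPred_eq] at ha hc
      simp only [Prod.mk.injEq] at h
      exact Prod.ext (he _ ha.1.1 _ hc.1.1 h.1) (he _ ha.1.2 _ hc.1.2 h.2)
  rw [Finset.card_filter] at hE
  constructor
  · refine le_trans (le_of_eq ?_) hE
    rw [Finset.sum_product]
    refine Finset.sum_congr rfl fun i _ => ?_
    rw [← Finset.card_filter, ← Set.ncard_coe_finset]
    congr 1; ext j; simp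
  · refine le_trans (le_of_eq ?_) hE
    rw [Finset.sum_product_right]
    refine Finset.sum_congr rfl fun i _ => ?_
    rw [← Finset.card_filter, ← Set.ncard_coe_finset]
    congr 1; ext j; simp

theorem HoldsSuccs.size_le (hsu : HoldsSuccs s e H) (hs : Holds s e H) (hH : H.IsParityGame) :
    s.size ≤ H.numEdges := by
  refine le_trans (Finset.sum_le_sum fun i hi => ?_) (sum_ncard_le_numEdges hH hs.inj).1
  split_ifs with h
  · have hi := Finset.mem_range.1 hi
    exact (hsu i hi ((hs.alive i hi).1 h)).ncard.ge
  · exact Nat.zero_le _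

/-- The linear bound for one attractor: the in-degrees add up to at most the number of edges. -/
theorem HoldsPreds.attrPot_le (hpr : HoldsPreds s e H) (hs : Holds s e H) (hH : H.IsParityGame) :
    attrPot s ≤ 100 * (s.reg nR + H.numEdges) := by
  have h : attrPot s ≤ ∑ i ∈ Finset.range (s.reg nR), 100 * (s.arr pdgA i 0 + 1) :=
    Finset.sum_le_sum fun i hi => by split_ifs <;> omega
  have h' : ∑ i ∈ Finset.range (s.reg nR), s.arr pdgA i 0 ≤ H.numEdges := by
    refine le_trans (Finset.sum_le_sum fun i hi => ?_) (sum_ncard_le_numEdges hH hs.inj).2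
    exact (hpr i (Finset.mem_range.1 hi)).ncard.ge
  rw [← Finset.mul_sum, Finset.sum_add_distrib] at h
  simp at h
  omega

theorem numEdges_mono {H' : Arena α} (hH : H.IsParityGame) (h : H'.E ⊆ H.E) :
    H'.numEdges ≤ H.numEdges :=
  Set.ncard_le_ncard h ((hH.finite.prod hH.finite).subset hH.edges)

/-! ## Targets -/

/-- With nothing processed the invariant asks that no node is saturated, which is true because
`cpre` of the empty set is empty. -/
theorem AttrInv.init (hH : H.IsParityGame) (th : ℕ) (hp : s.reg pR = p.val)
    (h : ∀ i < s.reg nR, s.arr tgtA i 0 = 0 ∧ s.arr attA i 0 = 0 ∧ s.arr cntA i 0 = 0 ∧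
      s.arr satA i 0 = 0) (hhd : s.reg hdR = 0) (htl : s.reg tlR = 0) :
    AttrInv s e H p th (fun _ => processed s e) ∧ marked s e tgtA = ∅ ∧ marked s e attA = ∅ ∧
      processed s e = ∅ := by
  have hP : processed s e = ∅ := by ext; simp [processed, hhd]
  rw [hP]
  refine ⟨?_, ?_, ?_, rfl⟩
  · constructor
    · exact hp
    · omega
    · intro l hl; omega
    · intro l hl; omega
    · intro i hi; simp [h i hi, htl]
    · intro i hi; simp [h i hi]
    · intro i hi; simp [h i hi, hH.cpre_empty]
    · intro i hi; simp [h i hi]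
    · intro i hi; simp [h i hi]
    · intro i hi; simp [h i hi]
  · ext v
    simp only [marked, Set.mem_ofPred_eq, Set.mem_empty_iff_false, iff_false, not_exists, not_and]
    intro i hi _; simp [h i hi]
  · ext v
    simp only [marked, Set.mem_ofPred_eq, Set.mem_empty_iff_false, iff_false, not_exists, not_and]
    intro i hi _; simp [h i hi]

/-- A target that is already saturated has to be attracted, or `closed` would fail for it; hence the
condition `hsat`. The potential is unchanged, since it charges for all unprocessed nodes whether
they are queued or not. -/
theorem runs_push (s : Store) (th : ℕ) (hs : Holds s e H) (x v : ℕ) (hxv : s.reg x = v)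
    (hI : AttrInv s e H p th fun _ => processed s e) (hv : v < s.reg nR) (hvn : e v ∈ H.nodes)
    (hsat : s.arr satA v 0 ≠ 0 → s.arr attA v 0 ≠ 0) :
    Runs (push (.reg x)) s 0 fun t s' => t ≤ 30 ∧
      AttrInv s' e H p th (fun _ => processed s' e) ∧ processed s' e = processed s e ∧
      attrPot s' = attrPot s ∧ marked s' e tgtA = insert (e v) (marked s e tgtA) := by
  refine Runs.ite (P := s.arr tgtA v 0 = 0) (by simp [hxv]) (fun htv => ?_) (fun htv => ?_)
  · have hnq : ∀ l < s.reg tlR, s.arr queA l 0 ≠ v := fun l hl h =>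
      (hI.tgt v hv).2 ⟨l, hl, h⟩ htv
    have hle := hI.le
    simp [hxv]
    have hP : ∀ s' : Store, s'.reg hdR = s.reg hdR →
        (∀ l < s.reg tlR, s'.arr queA l 0 = s.arr queA l 0) →
        processed s' e = processed s e := by
      intro s' h1 h2
      ext u
      simp only [processed, Set.mem_ofPred_eq, h1]
      exact exists_congr fun l => and_congr_right fun hl => by rw [h2 l (hl.trans_le hle)]
    rw [hP _ (by simp) (fun l hl => by simp [hl.ne])]
    refine ⟨?_, rfl, ?_, ?_⟩
    · constructor
      · simpa using hI.player
      · simpa using hI.le.trans (Nat.le_succ _)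
      · simp
        have := hI.queue_lt
        intro l hl; split_ifs <;> grind
      · simp
        intro l hl l' hl'
        have := hI.queue_inj l
        grind
      · simp
        intro i hi
        have h1 := hI.tgt i hi
        by_cases hiv : i = v
        · simp only [hiv, if_true, one_ne_zero, not_false_iff, true_iff]
          exact ⟨s.reg tlR, le_rfl, by simp⟩
        · simp only [hiv, if_false]
          rw [← ne_eq, h1]
          constructor
          · rintro ⟨l, hl, h⟩
            exact ⟨l, by omega, by rw [if_neg hl.ne, h]⟩
          · rintro ⟨l, hl, h⟩
            split_ifs at h with hlt
            · exact absurd h.symm hiv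
            · exact ⟨l, by omega, h⟩
      · simp
        intro i hi
        have := hI.tgt_nodes i hi
        grind
      · simpa using hI.sat
      · simpa using hI.cnt
      · simp
        intro i hi
        have := hI.att i hi
        grind
      · simp
        intro i hi
        have := hI.closed i hi
        grind
    · unfold attrPot
      simp
      refine Finset.sum_congr rfl fun i hi => if_congr ?_ rfl rfl
      exact exists_congr fun l => and_congr_right fun hl => by rw [if_neg (by omega)]
    · ext u
      simp only [marked, Set.mem_ofPred_eq, Set.mem_insert_iff]
      simp
      constructor
      · rintro ⟨i, hi, rfl, h⟩
        by_cases hiv : i = v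
        · exact Or.inl (by rw [hiv])
        · exact Or.inr ⟨i, hi, rfl, by simpa [hiv] using h⟩
      · rintro (rfl | ⟨i, hi, rfl, h⟩)
        · exact ⟨v, hv, rfl, by simp⟩
        · exact ⟨i, hi, rfl, by grind⟩
  · rw [runs_skip]
    refine ⟨by simp, hI, rfl, rfl, ?_⟩
    exact (Set.insert_eq_of_mem ((hs.mem_marked hv).2 htv)).symm


/-- All nodes that are marked in `setA` become targets. -/
theorem runs_pushAll (s : Store) (th : ℕ) (hs : Holds s e H)
    (hI : AttrInv s e H p th fun _ => processed s e) (hX : marked s e setA ⊆ H.nodes)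
    (hsat : ∀ i < s.reg nR, s.arr setA i 0 ≠ 0 → s.arr satA i 0 ≠ 0 → s.arr attA i 0 ≠ 0) :
    Runs (for' vR (.reg nR) (when (at1 setA (.reg vR)) (push (.reg vR)))) s 0 fun t s' =>
      t ≤ 100 * (s.reg nR + 1) ∧
      AttrInv s' e H p th (fun _ => processed s' e) ∧ processed s' e = processed s e ∧
      attrPot s' = attrPot s ∧ marked s' e tgtA = marked s e tgtA ∪ marked s e setA := by
  refine (runs_for_const (N := s.reg nR)
    (fun k s' => AttrInv s' e H p th (fun _ => processed s' e) ∧ processed s' e = processed s e ∧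
      attrPot s' = attrPot s ∧
      marked s' e tgtA = marked s e tgtA ∪ {v | ∃ i < k, e i = v ∧ s.arr setA i 0 ≠ 0}) 40 rfl
    ?_ ?_ ?_ ?_).mono ?_
  · rintro k s' m ⟨h1, h2, h3, h4⟩
    exact ⟨h1.congr rfl rfl h1.le rfl rfl, h2, h3, h4⟩
  · exact ⟨hI, rfl, rfl, by ext; simp⟩
  · rintro k s' - - - hf
    exact hf.reg nR rfl
  · rintro k s₁ hk ⟨hI₁, hP₁, hφ₁, hT₁⟩ hx hf
    have hn : s₁.reg nR = s.reg nR := hf.reg nR rfl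
    have hset : s₁.arr setA = s.arr setA := hf.arr setA rfl
    refine Runs.ite (P := s.arr setA k 0 ≠ 0) (by simp [hx, hset]) (fun hk0 => ?_) (fun hk0 => ?_)
    · refine (runs_push s₁ th (hs.congr hn (hf.arr _ rfl) (hf.arr _ rfl) (hf.arr _ rfl)) vR k hx
        hI₁ (hn ▸ hk) (hX ((hs.mem_marked hk).2 hk0)) ?_).call ?_
      · rw [show s₁.arr satA = s.arr satA from hf.arr satA rfl,
          show s₁.arr attA = s.arr attA from hf.arr attA rfl]
        exact hsat k hk hk0
      · rintro t s₂ ⟨ht, hI₂, hP₂, hφ₂, hT₂⟩ hf₂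
        refine ⟨⟨hI₂, hP₂.trans hP₁, hφ₂.trans hφ₁, ?_⟩, by simp; omega⟩
        rw [hT₂, hT₁, ← Set.union_insert]
        congr 1
        ext u
        simp only [Set.mem_insert_iff, Set.mem_ofPred_eq]
        constructor
        · rintro (rfl | ⟨i, hi, h⟩)
          · exact ⟨k, by omega, rfl, hk0⟩
          · exact ⟨i, by omega, h⟩
        · rintro ⟨i, hi, rfl, h⟩
          rcases (Nat.lt_succ_iff.1 hi).lt_or_eq with h' | rfl
          · exact Or.inr ⟨i, h', rfl, h⟩
          · exact Or.inl rfl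
    · rw [runs_skip]
      refine ⟨⟨hI₁, hP₁, hφ₁, ?_⟩, by simp⟩
      rw [hT₁]
      congr 1
      ext u
      simp only [Set.mem_ofPred_eq]
      constructor
      · rintro ⟨i, hi, h⟩
        exact ⟨i, by omega, h⟩
      · rintro ⟨i, hi, rfl, h⟩
        rcases (Nat.lt_succ_iff.1 hi).lt_or_eq with h' | rfl
        · exact ⟨i, h', rfl, h⟩
        · exact absurd h hk0
  · rintro t s' ⟨⟨hI', hP', hφ', hT'⟩, ht⟩
    exact ⟨by simp at ht; omega, hI', hP', hφ', hT'⟩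

/-- Soundness is `runs_propagate` with the monotone attractor itself as closed set; completeness is
leastness of the fixed point. The permissive test of `propagate` does no harm here because all
targets have color `d`, hence pass the threshold anyway. -/
theorem runs_computeMAttr (s : Store) (hs : Holds s e H) (hsu : HoldsSuccs s e H)
    (hpr : HoldsPreds s e H) (hH : H.IsParityGame) (hX : marked s e setA ⊆ H.nodes)
    (hd : ∀ v ∈ marked s e setA, H.c v = s.reg dR) :
    Runs computeMAttr s 0 fun t s' => t ≤ 500 * (s.reg nR + H.numEdges + 1) ∧
      marked s' e attA = H.mattr (player (s.reg dR)) (marked s e setA) (s.reg dR) ∧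
      s'.reg pR = s.reg dR % 2 := by
  set d := s.reg dR with hdd
  set p := player d with hp
  set X := marked s e setA with hXX
  refine Runs.call_seq (runs_clear s) ?_
  rintro t₁ s₁ ⟨ht₁, hz, hhd, htl⟩ hf₁
  have hn₁ : s₁.reg nR = s.reg nR := hf₁.reg nR rfl
  have hd₁ : s₁.reg dR = d := hf₁.reg dR rfl
  rw [runs_seq, runs_set, runs_seq, runs_set]
  simp only [Expr.eval, Store.setReg_reg, show dR ≠ pR by decide, if_false, hd₁]
  set s₂ := (s₁.setReg pR (d % 2)).setReg thR d with hs₂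
  have hs₂' : Holds s₂ e H := hs.congr (by simpa [hs₂] using hn₁) (hf₁.arr _ rfl) (hf₁.arr _ rfl)
    (hf₁.arr _ rfl)
  have hn₂ : s₂.reg nR = s.reg nR := hn₁
  have hth₂ : s₂.reg thR = d := by simp [hs₂]
  have hset₂ : s₂.arr setA = s.arr setA := hf₁.arr setA rfl
  have hX₂ : marked s₂ e setA = X := marked_congr e hn₂ hset₂
  obtain ⟨hI₂, hT₂, hA₂, hP₂⟩ := AttrInv.init (s := s₂) (e := e) (p := p) hH d (by simp [hs₂, hp, player])
    (by intro i hi; exact hz i (by omega)) hhd htl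
  refine Runs.call_seq (runs_pushAll s₂ d hs₂' hI₂ (hX₂ ▸ hX) ?_) ?_
  · intro i hi _ h
    exact absurd (hz i (by omega)).2.2.2 h
  rintro t₃ s₃ ⟨ht₃, hI₃, hP₃, hφ₃, hT₃⟩ hf₃
  have hn₃ : s₃.reg nR = s.reg nR := (hf₃.reg nR rfl).trans hn₂
  have hth₃ : s₃.reg thR = d := (hf₃.reg thR rfl).trans hth₂
  have hs₃ : Holds s₃ e H := hs₂'.congr (hf₃.reg _ rfl) (hf₃.arr _ rfl) (hf₃.arr _ rfl)
    (hf₃.arr _ rfl)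
  have hpr₃ : HoldsPreds s₃ e H := hpr.congr hn₃ ((hf₃.arr _ rfl).trans (hf₁.arr _ rfl))
      ((hf₃.arr _ rfl).trans (hf₁.arr _ rfl))
  rw [hT₂, hX₂, Set.empty_union] at hT₃
  have hA₃ : marked s₃ e attA = ∅ :=
    (marked_congr e (hf₃.reg nR rfl) (hf₃.arr attA rfl)).trans hA₂
  refine (runs_propagate s₃ e H p (H.mattr p X d) X hs₃
    (hsu.congr hn₃ ((hf₃.arr _ rfl).trans (hf₁.arr _ rfl))
      ((hf₃.arr _ rfl).trans (hf₁.arr _ rfl))) hpr₃ hH (hth₃ ▸ hI₃) hT₃ (hA₃ ▸ Set.empty_subset _)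
    ?_).call ?_
  · rintro v hv (h | h | h)
    · exact mem_mattr.2 ⟨hth₃ ▸ h, by rwa [Set.union_comm]⟩
    · exact mem_mattr.2 ⟨(hd v h).ge, by rwa [Set.union_comm]⟩
    · exact h
  rintro t₄ s₄ ⟨ht₄, hI₄, hP₄, -, hS₄, hT₄⟩ hf₄
  have hn₄ : s₄.reg nR = s.reg nR := (hf₄.reg nR rfl).trans hn₃
  have hs₄ : Holds s₄ e H := hs₃.congr (hf₄.reg _ rfl) (hf₄.arr _ rfl) (hf₄.arr _ rfl)
    (hf₄.arr _ rfl)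
  refine ⟨?_, ?_, ?_⟩
  · have := hpr₃.attrPot_le hs₃ hH
    simp at ht₃ ⊢
    omega
  -- A node of the right color that forces the play into the final targets is saturated, so `closed`
  -- leaves attraction as the only possibility.
  · refine subset_antisymm hS₄ (mattr_subset fun v hv => ?_)
    obtain ⟨hdv, hv⟩ := mem_mpre.1 hv
    obtain ⟨i, hi, rfl⟩ := hs₄.surj v (cpre_subset_nodes hv)
    rw [Set.union_comm, ← hT₄, ← hI₄.sat i hi] at hv
    rw [hs₄.mem_marked hi]
    rcases hI₄.closed i hi hv with h | ⟨h, -⟩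
    · exact h
    · rw [hs₄.col i hi, hth₃] at h
      omega
  · exact (hf₄.reg pR rfl).trans ((hf₃.reg pR rfl).trans (by simp [hs₂]))

end ParityGames

namespace ParityGames

open Code Arena

variable {α : Type*} {s : Store} {e : ℕ → α} {H : Arena α} {p : Fin 2}

/-! ### Removal of an attractor from the game in memory -/

theorem Lists.filter {s s' : Store} {a b i : ℕ} {F F' : Set ℕ} {K : ℕ → Prop} [DecidablePred K]
    (h : Lists s a b i F) (hl : s'.list a b i = (s.list a b i).filter (fun w => decide (K w)))
    (hF : ∀ j, j ∈ F' ↔ j ∈ F ∧ K j) : Lists s' a b i F' := by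
  refine ⟨hl ▸ h.1.filter _, fun j => ?_⟩
  rw [hl, List.mem_filter, hF, h.2, decide_eq_true_iff]

/-- Remove all nodes that are not alive from the successor lists. -/
theorem runs_filterAll (s : Store) :
    Runs (for' vR (.reg nR) (when (alive (.reg vR)) (filterSuccs (.reg vR) alive))) s 0 fun t s' =>
      t ≤ 100 * (s.reg nR + s.size + 1) ∧
      ∀ i < s.reg nR, s.arr winA i 0 = 0 → s'.list degA sucA i =
        (s.list degA sucA i).filter (fun w => decide (s.arr winA w 0 = 0)) := by
  refine (runs_for (N := s.reg nR)
    (fun k s' => (∀ i < k, s.arr winA i 0 = 0 → s'.list degA sucA i =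
        (s.list degA sucA i).filter (fun w => decide (s.arr winA w 0 = 0))) ∧
      ∀ i, k ≤ i → s'.arr degA i = s.arr degA i ∧ s'.arr sucA i = s.arr sucA i) (fun _ => 0)
    (fun k => 60 + 50 * (if s.arr winA k 0 = 0 then s.arr degA k 0 else 0)) rfl
    (fun _ _ _ h => h) (fun _ _ => rfl) ?_ ?_ ?_).mono ?_
  · exact ⟨by simp, fun _ _ => ⟨rfl, rfl⟩⟩
  · rintro k s' - - - hf
    exact hf.reg nR rfl
  · rintro k s₁ hk ⟨hI, hI'⟩ hx hf
    have hwin : s₁.arr winA = s.arr winA := hf.arr winA rfl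
    refine Runs.ite (P := s.arr winA k 0 = 0) (by simp [hx, hwin]) (fun hk0 => ?_) (fun hk0 => ?_)
    · refine (runs_filterSuccs s₁ vR alive (fun w => s.arr winA w 0 = 0) (by decide) (by simp)
        ?_).call ?_
      · intro s' h _
        simp [h, hwin]
      · rintro t s₂ ⟨ht, hl, ho⟩ hf₂
        rw [hx] at ht hl ho
        refine ⟨⟨fun i hi hi0 => ?_, fun i hi => ?_⟩, ?_⟩
        · rcases (Nat.lt_succ_iff.1 hi).lt_or_eq with h' | rfl
          · rw [← hI i h' hi0]
            obtain ⟨h1, h2⟩ := ho i h'.ne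
            simp [Store.list, h1, h2]
          · rw [hl]
            obtain ⟨h1, h2⟩ := hI' i le_rfl
            simp [Store.list, h1, h2]
        · obtain ⟨h1, h2⟩ := ho i (by omega)
          obtain ⟨h3, h4⟩ := hI' i (by omega)
          exact ⟨h1.trans h3, h2.trans h4⟩
        · rw [(hI' k le_rfl).1] at ht
          simp [hk0] at ht ⊢
          omega
    · rw [runs_skip]
      refine ⟨⟨fun i hi hi0 => ?_, fun i hi => hI' i (by omega)⟩, by simp; omega⟩
      rcases (Nat.lt_succ_iff.1 hi).lt_or_eq with h' | rfl
      · exact hI i h' hi0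
      · exact absurd hi0 hk0
  · rintro t s' ⟨⟨⟨hI, -⟩, -⟩, ht⟩
    refine ⟨?_, hI⟩
    rw [Finset.sum_add_distrib, ← Finset.mul_sum] at ht
    simp [Store.size] at ht ⊢
    omega

theorem runs_markWon (s : Store) :
    Runs (for' vR (.reg nR) (when (at1 tgtA (.reg vR)) (put1 winA (.reg vR) (.succ (.reg pR))))) s 0
      fun t s' => t ≤ 100 * (s.reg nR + 1) ∧ ∀ i < s.reg nR,
        (s.arr tgtA i 0 ≠ 0 → s'.arr winA i 0 = s.reg pR + 1) ∧
        (s.arr tgtA i 0 = 0 → s'.arr winA i 0 = s.arr winA i 0) := by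
  refine (runs_for_const (N := s.reg nR)
    (fun k s' => (∀ i < k, (s.arr tgtA i 0 ≠ 0 → s'.arr winA i 0 = s.reg pR + 1) ∧
        (s.arr tgtA i 0 = 0 → s'.arr winA i 0 = s.arr winA i 0)) ∧
      ∀ i, k ≤ i → s'.arr winA i 0 = s.arr winA i 0) 30 rfl
    (fun _ _ _ h => h) ?_ ?_ ?_).mono ?_
  · exact ⟨by simp, fun _ _ => rfl⟩
  · rintro k s' - - - hf
    exact hf.reg nR rfl
  · rintro k s₁ hk ⟨hI, hI'⟩ hx hf
    have htgt : s₁.arr tgtA = s.arr tgtA := hf.arr tgtA rfl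
    have hp : s₁.reg pR = s.reg pR := hf.reg pR rfl
    refine Runs.ite (P := s.arr tgtA k 0 ≠ 0) (by simp [hx, htgt]) (fun hk0 => ?_) (fun hk0 => ?_)
    · rw [runs_put]
      simp [hx, hp]
      refine ⟨fun i hi => ?_, fun i hi => ?_⟩
      · have := hI i
        grind
      · rw [if_neg (by omega), hI' i (by omega)]
    · rw [runs_skip]
      simp only [not_not] at hk0
      refine ⟨⟨fun i hi => ?_, fun i hi => hI' i (by omega)⟩, by simp⟩
      have := hI i
      have := hI' i
      grind
  · rintro t s' ⟨⟨hI, -⟩, ht⟩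
    exact ⟨by simp at ht; omega, hI⟩

/-- With threshold 0 the color test always succeeds, so the same routine computes the ordinary
attractor: it is the final set of targets, not just the set of attracted nodes, since its starting
nodes belong to it unconditionally. -/
theorem runs_removeAttr (s : Store) (hs : Holds s e H) (hsu : HoldsSuccs s e H)
    (hpr : HoldsPreds s e H) (hH : H.IsParityGame) (hp : s.reg pR = p.val)
    (hX : marked s e attA ⊆ H.nodes) (A : Set α) (hA : A = H.attr p (marked s e attA)) :
    Runs removeAttr s 0 fun t s' => t ≤ 1000 * (s.reg nR + H.numEdges + 1) ∧
      Holds s' e (H.removeNodes A) ∧ HoldsSuccs s' e (H.removeNodes A) ∧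
      HoldsPreds s' e (H.removeNodes A) ∧
      ∀ i < s.reg nR, (e i ∈ A → s'.arr winA i 0 = p.val + 1) ∧
        (e i ∉ A → s'.arr winA i 0 = s.arr winA i 0) := by
  set n := s.reg nR with hn
  refine Runs.call_seq (runs_fill s setA (at1 attA (.reg vR)) (fun i => s.arr attA i 0) (by simp)
    (fun s' k hk hx _ h _ => by simp [hx, h])) ?_
  rintro t₀ s₀ ⟨ht₀, hset⟩ hf₀
  have hn₀ : s₀.reg nR = n := hf₀.reg nR rfl
  have hset₀ : marked s₀ e setA = marked s e attA := by
    ext u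
    simp only [marked, hn₀, Set.mem_ofPred_eq]
    exact exists_congr fun i => and_congr_right fun hi => by rw [hset i hi]
  refine Runs.call_seq (runs_clear s₀) ?_
  rintro t₁ s₁ ⟨ht₁, hz, hhd, htl⟩ hf₁
  have hn₁ : s₁.reg nR = n := (hf₁.reg nR rfl).trans hn₀
  rw [runs_seq, runs_set]
  simp only [Expr.eval]
  set s₂ := s₁.setReg thR 0 with hs₂
  have hs₂' : Holds s₂ e H := hs.congr hn₁ ((hf₁.arr _ rfl).trans (hf₀.arr _ rfl))
    ((hf₁.arr _ rfl).trans (hf₀.arr _ rfl)) ((hf₁.arr _ rfl).trans (hf₀.arr _ rfl))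
  have hn₂ : s₂.reg nR = n := hn₁
  have hX₂ : marked s₂ e setA = marked s e attA :=
    (marked_congr e (hn₂.trans hn₀.symm) (hf₁.arr setA rfl)).trans hset₀
  have hp₂ : s₂.reg pR = p.val := (hf₁.reg pR rfl).trans ((hf₀.reg pR rfl).trans hp)
  obtain ⟨hI₂, hT₂, hA₂, hP₂⟩ := AttrInv.init (s := s₂) (e := e) (p := p) hH 0 hp₂
    (by intro i hi; exact hz i (by omega)) hhd htl
  refine Runs.call_seq (runs_pushAll s₂ 0 hs₂' hI₂ (hX₂ ▸ hX) ?_) ?_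
  · intro i hi _ h
    exact absurd (hz i (by omega)).2.2.2 h
  rintro t₃ s₃ ⟨ht₃, hI₃, hP₃, hφ₃, hT₃⟩ hf₃
  have hn₃ : s₃.reg nR = n := (hf₃.reg nR rfl).trans hn₂
  have hth₃ : s₃.reg thR = 0 := (hf₃.reg thR rfl).trans (by simp [hs₂])
  have hs₃ : Holds s₃ e H := hs₂'.congr (hf₃.reg _ rfl) (hf₃.arr _ rfl) (hf₃.arr _ rfl)
    (hf₃.arr _ rfl)
  have hsu₃ : HoldsSuccs s₃ e H := hsu.congr hn₃
    ((hf₃.arr _ rfl).trans ((hf₁.arr _ rfl).trans (hf₀.arr _ rfl)))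
    ((hf₃.arr _ rfl).trans ((hf₁.arr _ rfl).trans (hf₀.arr _ rfl)))
  have hpr₃ : HoldsPreds s₃ e H := hpr.congr hn₃
    ((hf₃.arr _ rfl).trans ((hf₁.arr _ rfl).trans (hf₀.arr _ rfl)))
    ((hf₃.arr _ rfl).trans ((hf₁.arr _ rfl).trans (hf₀.arr _ rfl)))
  rw [hT₂, hX₂, Set.empty_union] at hT₃
  have hA₃ : marked s₃ e attA = ∅ :=
    (marked_congr e (hf₃.reg nR rfl) (hf₃.arr attA rfl)).trans hA₂
  refine Runs.call_seq (runs_propagate s₃ e H p A (marked s e attA) hs₃ hsu₃ hpr₃ hH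
    (hth₃ ▸ hI₃) hT₃ (hA₃ ▸ Set.empty_subset _) ?_) ?_
  · intro v hv _
    have hXA : marked s e attA ⊆ A := hA ▸ subset_attr
    rw [Set.union_eq_self_of_subset_left hXA] at hv
    exact hA ▸ cpre_attr_subset (hA ▸ hv)
  rintro t₄ s₄ ⟨ht₄, hI₄, hP₄, -, hS₄, hT₄⟩ hf₄
  have hn₄ : s₄.reg nR = n := (hf₄.reg nR rfl).trans hn₃
  have hs₄ : Holds s₄ e H := hs₃.congr (hf₄.reg _ rfl) (hf₄.arr _ rfl) (hf₄.arr _ rfl)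
    (hf₄.arr _ rfl)
  have hsu₄ : HoldsSuccs s₄ e H := hsu₃.congr (hf₄.reg _ rfl) (hf₄.arr _ rfl) (hf₄.arr _ rfl)
  have hTA : marked s₄ e tgtA = A := by
    apply subset_antisymm
    · rw [hT₄]
      exact Set.union_subset (hA ▸ subset_attr) hS₄
    · rw [hA]
      refine attr_subset (hT₄ ▸ Set.subset_union_left) fun v hv => ?_
      obtain ⟨i, hi, rfl⟩ := hs₄.surj v (cpre_subset_nodes hv)
      rw [← hI₄.sat i hi] at hv
      rw [hs₄.mem_marked hi]
      -- The alternative in `closed` would need a color below the threshold 0.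
      exact (hI₄.att i hi ((hI₄.closed i hi hv).resolve_right (by omega))).2
  refine Runs.call_seq (runs_markWon s₄) ?_
  rintro t₅ s₅ ⟨ht₅, hwin₅⟩ hf₅
  have hn₅ : s₅.reg nR = n := (hf₅.reg nR rfl).trans hn₄
  have hp₄ : s₄.reg pR = p.val := (hf₄.reg pR rfl).trans ((hf₃.reg pR rfl).trans hp₂)
  have hwin₄ : s₄.arr winA = s.arr winA := (hf₄.arr _ rfl).trans ((hf₃.arr _ rfl).trans
    ((hf₁.arr _ rfl).trans (hf₀.arr _ rfl)))
  have hw : ∀ i < n, (e i ∈ A → s₅.arr winA i 0 = p.val + 1) ∧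
      (e i ∉ A → s₅.arr winA i 0 = s.arr winA i 0) := by
    intro i hi
    rw [← hTA, hs₄.mem_marked (hn₄ ▸ hi), not_not, ← hp₄, ← hwin₄]
    exact hwin₅ i (hn₄ ▸ hi)
  have hal : ∀ i < n, s₅.arr winA i 0 = 0 ↔ e i ∈ H.nodes \ A := by
    intro i hi
    by_cases h : e i ∈ A
    · simp [(hw i hi).1 h, h]
    · rw [(hw i hi).2 h, hs.alive i hi]; simp [h]
  have hs₅ : Holds s₅ e (H.removeNodes A) := by
    refine ⟨by rw [hn₅]; exact hs.inj, ?_, by rw [hn₅, removeNodes_nodes]; exact hal, ?_, ?_⟩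
    · rw [hn₅, removeNodes_nodes]; exact fun v hv => hs.surj v hv.1
    · rw [hf₅.arr colA rfl, hn₅, ← hn₄]; exact hs₄.col
    · rw [hf₅.arr ownA rfl, hn₅, ← hn₄]; exact fun i hi q hq => hs₄.own i hi q hq.1
  -- At this point the removed nodes are marked but the lists are still those of the old game; so
  -- the sizes are compared term by term with the state before marking.
  have hsize₅ : s₅.size ≤ H.numEdges := by
    refine le_trans ?_ (hsu₄.size_le hs₄ hH)
    unfold Store.size
    rw [hn₅, hn₄, hf₅.arr degA rfl]
    refine Finset.sum_le_sum fun i hi => ?_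
    have hi := Finset.mem_range.1 hi
    split_ifs with h1 h2
    · exact le_rfl
    · exact absurd ((hs₄.alive i (hn₄ ▸ hi)).2 ((hal i hi).1 h1).1) h2
    · exact Nat.zero_le _
    · exact le_rfl
  refine Runs.call_seq (runs_filterAll s₅) ?_
  rintro t₆ s₆ ⟨ht₆, hl₆⟩ hf₆
  have hn₆ : s₆.reg nR = n := (hf₆.reg nR rfl).trans hn₅
  have hs₆ : Holds s₆ e (H.removeNodes A) := hs₅.congr (hf₆.reg _ rfl) (hf₆.arr _ rfl)
    (hf₆.arr _ rfl) (hf₆.arr _ rfl)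
  have hwin₆ : s₆.arr winA = s₅.arr winA := hf₆.arr winA rfl
  have hsu₆ : HoldsSuccs s₆ e (H.removeNodes A) := by
    intro i hi hv
    rw [hn₆] at hi
    have hi₄ : i < s₄.reg nR := hn₄ ▸ hi
    rw [removeNodes_nodes] at hv
    refine (((hsu₄ i hi₄ hv.1)).congr (s' := s₅)
      (by rw [hf₅.arr degA rfl]) (by rw [hf₅.arr sucA rfl]) rfl).filter
      (hl₆ i (hn₅ ▸ hi) ((hal i hi).2 hv)) ?_
    intro j
    rw [hn₆, hn₄]
    simp only [Set.mem_ofPred_eq, removeNodes]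
    constructor
    · rintro ⟨hj, h1, h2, h3⟩
      exact ⟨⟨hj, h1⟩, (hal j hj).2 ⟨(hH.edges h1).2, h3⟩⟩
    · rintro ⟨⟨hj, h1⟩, h2⟩
      exact ⟨hj, h1, hv.2, ((hal j hj).1 h2).2⟩
  have hH' : (H.removeNodes A).IsParityGame := hH.removeNodes (hA ▸ cpre_attr_subset)
  refine (runs_listPreds s₆ (fun i => {j | j < s₆.reg nR ∧ (e i, e j) ∈ (H.removeNodes A).E})
    (fun i hi h => hsu₆ i hi ((hs₆.alive i hi).1 h)) (fun i _ _ j hj => hj.1)).call ?_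
  rintro t₇ s₇ ⟨ht₇, hp₇⟩ hf₇
  have hn₇ : s₇.reg nR = n := (hf₇.reg nR rfl).trans hn₆
  refine ⟨?_, hs₆.congr (hf₇.reg _ rfl) (hf₇.arr _ rfl) (hf₇.arr _ rfl) (hf₇.arr _ rfl),
    hsu₆.congr (hf₇.reg _ rfl) (hf₇.arr _ rfl) (hf₇.arr _ rfl), ?_, ?_⟩
  · have h1 := hpr₃.attrPot_le hs₃ hH
    have h2 := (hsu₆.size_le hs₆ hH').trans (numEdges_mono hH (fun _ h => h.1))
    simp at ht₃ ⊢
    omega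
  · intro i hi
    rw [hn₇] at hi
    refine (hp₇ i (hn₆ ▸ hi)).congr rfl rfl ?_
    rw [hn₇, hn₆]
    ext u
    simp only [Set.mem_ofPred_eq]
    constructor
    · rintro ⟨hu, h⟩
      exact ⟨hu, (hs₆.alive u (hn₆ ▸ hu)).2 (hH'.edges h).1, hi, h⟩
    · rintro ⟨hu, -, -, h⟩
      exact ⟨hu, h⟩
  · intro i hi
    rw [hf₇.arr winA rfl, hwin₆]
    exact hw i hi

end ParityGames

namespace ParityGames

open Code Arena

variable {α : Type*} {s : Store} {e : ℕ → α} {H : Arena α} {p : Fin 2}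

/-! ## Tests -/

theorem Expr.and_ne_zero {a b : Expr} : (Expr.and a b).eval s ≠ 0 ↔ a.eval s ≠ 0 ∧ b.eval s ≠ 0 := by
  simp

theorem Expr.or_ne_zero {a b : Expr} : (Expr.or a b).eval s ≠ 0 ↔ a.eval s ≠ 0 ∨ b.eval s ≠ 0 := by
  simp only [Expr.eval]; split_ifs <;> simp [*]

theorem Expr.lt_ne_zero {a b : Expr} : (Expr.lt a b).eval s ≠ 0 ↔ a.eval s < b.eval s := by
  simp

theorem Expr.eq_ne_zero {a b : Expr} : (Expr.eq a b).eval s ≠ 0 ↔ a.eval s = b.eval s := by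
  simp

/-! ## Sorting -/

/-- `ordA` lists the nodes, in an order in which their colors are weakly increasing for `r`. -/
structure Ranked (s : Store) (r : ℕ → ℕ → Prop) : Prop where
  lt : ∀ i < s.reg nR, s.arr ordA i 0 < s.reg nR
  inj : ∀ i < s.reg nR, ∀ j < s.reg nR, s.arr ordA i 0 = s.arr ordA j 0 → i = j
  sorted : ∀ i j, i < j → j < s.reg nR →
    r (s.arr colA (s.arr ordA i 0) 0) (s.arr colA (s.arr ordA j 0) 0)

theorem Ranked.congr {s' : Store} {r : ℕ → ℕ → Prop} (h : Ranked s r)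
    (hn : s'.reg nR = s.reg nR) (ho : s'.arr ordA = s.arr ordA) (hc : s'.arr colA = s.arr colA) :
    Ranked s' r := by
  obtain ⟨h1, h2, h3⟩ := h
  constructor <;> simp only [hn, ho, hc] <;> assumption

/-- An injective map of a finite set into itself is surjective. -/
theorem Ranked.surj {r : ℕ → ℕ → Prop} (h : Ranked s r) :
    ∀ i < s.reg nR, ∃ l < s.reg nR, s.arr ordA l 0 = i := by
  have := Finset.surjOn_of_injOn_of_card_le (s := Finset.range (s.reg nR))
    (t := Finset.range (s.reg nR)) (fun i => s.arr ordA i 0)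
    (fun i hi => by simpa using h.lt i (by simpa using hi))
    (fun i hi j hj hij => h.inj i (by simpa using hi) j (by simpa using hj) hij) le_rfl
  intro i hi
  obtain ⟨l, hl, h⟩ := this (by simpa using hi)
  exact ⟨l, by simpa using hl, h⟩

/-- Insertion sort; quadratic time suffices since it runs once. The order relation enters only
through asymmetry and through transitivity of its negation, so equal colors may appear in any order.
-/
theorem runs_sortNodes (s : Store) (before : Expr → Expr → Expr) (bf : ℕ → ℕ → Prop)
    (hcost : ∀ a b, (before a b).cost = a.cost + b.cost + 1)
    (hbf : ∀ a b s, (before a b).eval s ≠ 0 ↔ bf (a.eval s) (b.eval s))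
    (htrans : ∀ a b c, ¬ bf b a → ¬ bf c b → ¬ bf c a) (hasymm : ∀ a b, bf a b → ¬ bf b a) :
    Runs (sortNodes before) s 0 fun t s' => t ≤ 200 * (s.reg nR + 1) * (s.reg nR + 1) ∧
      Ranked s' fun a b => ¬ bf b a := by
  set n := s.reg nR with hn
  set col := fun i => s.arr colA i 0 with hcol
  refine (runs_for_const (N := n)
    (fun k s' => (∀ i < k, s'.arr ordA i 0 < k) ∧
      (∀ i < k, ∀ j < k, s'.arr ordA i 0 = s'.arr ordA j 0 → i = j) ∧
      ∀ i j, i < j → j < k → ¬ bf (col (s'.arr ordA j 0)) (col (s'.arr ordA i 0)))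
    (100 * (n + 1)) rfl (fun _ _ _ h => h) (by simp) ?_ ?_).withFrame.mono ?_
  · rintro k s' - - - hf
    exact hf.reg nR rfl
  · rintro k s₁ hk ⟨hlt, hinj, hsort⟩ hx hf
    have hc₁ : s₁.arr colA = s.arr colA := hf.arr colA rfl
    rw [runs_seq, runs_set, runs_seq, runs_set]
    simp only [Expr.eval, hx]
    set s₂ := (s₁.setReg jR k).setReg xR 1 with hs₂
    -- Register `jR` is a hole that moves to the left: entries before it are untouched, entries
    -- after it are shifted by one and have to come after node `k`. If `xR` is 0, the entry just
    -- before the hole need not be moved.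
    refine Runs.call_seq (runs_while
      (fun s' => s'.reg jR ≤ k ∧ (∀ i < s'.reg jR, s'.arr ordA i 0 = s₁.arr ordA i 0) ∧
        (∀ i, s'.reg jR < i → i ≤ k → s'.arr ordA i 0 = s₁.arr ordA (i - 1) 0) ∧
        (∀ i, s'.reg jR ≤ i → i < k → bf (col k) (col (s₁.arr ordA i 0))) ∧
        (s'.reg xR ≠ 0 ∨ 0 < s'.reg jR ∧ ¬ bf (col k) (col (s₁.arr ordA (s'.reg jR - 1) 0))))
      (fun s' => 50 * (s'.reg jR + (if s'.reg xR = 0 then 0 else 1))) ?_ ?_) ?_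
    · simp [hs₂]
      constructor <;> intros <;> omega
    · rintro s₃ ⟨hj, h1, h2, h3, h4⟩ hf₃ hb
      have hv₃ : s₃.reg vR = k := (hf₃.reg vR rfl).trans (by simp [hs₂, hx])
      have hc₃ : s₃.arr colA = s.arr colA := (hf₃.arr colA rfl).trans hc₁
      have hx0 : s₃.reg xR ≠ 0 ∧ 0 < s₃.reg jR := by
        rw [Expr.and_ne_zero, Expr.lt_ne_zero] at hb
        exact hb
      obtain ⟨j, hj'⟩ : ∃ j, s₃.reg jR = j + 1 := ⟨s₃.reg jR - 1, by omega⟩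
      have hoj : s₃.arr ordA j 0 = s₁.arr ordA j 0 := h1 j (by omega)
      refine Runs.ite (P := bf (col k) (col (s₁.arr ordA j 0))) ?_ (fun hP => ?_) (fun hP => ?_)
      · rw [hbf]; simp [hv₃, hc₃, hj', hoj, hcol]
      · simp [hcost, hj', hoj, hx0.1]
        refine ⟨⟨by omega, fun i hi => ?_, fun i hi hik => ?_, fun i hi hik => ?_⟩, by omega⟩
        · rw [if_neg (by omega), h1 i (by omega)]
        · split_ifs with hij
          · simp [hij]
          · exact h2 i (by omega) hik
        · rcases hi.lt_or_eq with h' | rfl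
          · exact h3 i (by omega) hik
          · exact hP
      · simp [hcost, hj', hx0.1]
        refine ⟨⟨by omega, fun i hi => h1 i (by omega), fun i hi => h2 i (by omega),
          fun i hi => h3 i (by omega), hP⟩, by omega⟩
    · rintro t s₃ ⟨⟨hj, h1, h2, h3, h4⟩, hb, ht⟩ hf₃
      have hv₃ : s₃.reg vR = k := (hf₃.reg vR rfl).trans (by simp [hs₂, hx])
      set j := s₃.reg jR with hjj
      have h4' : j = 0 ∨ ¬ bf (col k) (col (s₁.arr ordA (j - 1) 0)) := by
        rcases h4 with h4 | h4
        · by_contra h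
          refine (?_ : (Expr.and _ _).eval s₃ ≠ 0) hb
          rw [Expr.and_ne_zero, Expr.lt_ne_zero]
          exact ⟨h4, Nat.pos_of_ne_zero fun h' => h (Or.inl h')⟩
        · exact Or.inr h4.2
      simp [hv₃, ← hjj]
      -- The new array consists of the old entries before the hole, node `k` in it, and the old
      -- entries shifted by one behind it.
      have hfin : ∀ i ≤ k, (if i = j then k else s₃.arr ordA i 0) =
          if i < j then s₁.arr ordA i 0 else if i = j then k else s₁.arr ordA (i - 1) 0 := by
        intro i hi
        by_cases h : i = j
        · simp [h]
        · by_cases h' : i < j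
          · simp [h, h', h1 i h']
          · simp [h, h', h2 i (by omega) hi]
      refine ⟨⟨fun i hi => ?_, fun i hi i' hi' => ?_, fun i i' hii hi' => ?_⟩, ?_⟩
      · rw [hfin i (by omega)]
        have a1 := hlt i
        have a2 := hlt (i - 1)
        grind
      · rw [hfin i (by omega), hfin i' (by omega)]
        have a1 := hlt i
        have a2 := hlt (i - 1)
        have a3 := hlt i'
        have a4 := hlt (i' - 1)
        have b1 := hinj i
        have b2 := hinj (i - 1)
        grind
      · rw [hfin i (by omega), hfin i' (by omega)]
        have key : ∀ i < j, ¬ bf (col k) (col (s₁.arr ordA i 0)) := by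
          intro i hi
          have h4 := h4'.resolve_left (by omega)
          rcases Nat.lt_or_ge i (j - 1) with h | h
          · exact htrans _ _ _ (hsort i (j - 1) h (by omega)) h4
          · rwa [show i = j - 1 by omega]
        by_cases c1 : i < j
        · rw [if_pos c1]
          by_cases c2 : i' < j
          · rw [if_pos c2]; exact hsort i i' hii (by omega)
          · rw [if_neg c2]
            by_cases c3 : i' = j
            · rw [if_pos c3]; exact key i c1
            · rw [if_neg c3]; exact hsort i (i' - 1) (by omega) (by omega)
        · rw [if_neg c1, if_neg (by omega), if_neg (show ¬ i' = j by omega)]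
          by_cases c3 : i = j
          · rw [if_pos c3]; exact hasymm _ _ (h3 (i' - 1) (by omega) (by omega))
          · rw [if_neg c3]; exact hsort (i - 1) (i' - 1) (by omega) (by omega)
      · simp [hs₂] at ht
        omega
  · rintro t s' ⟨⟨⟨h1, h2, h3⟩, ht⟩, hf⟩
    have hn' : s'.reg nR = n := hf.reg nR rfl
    have hc : s'.arr colA = s.arr colA := hf.arr colA rfl
    refine ⟨?_, ?_, ?_, ?_⟩
    · simp at ht ⊢
      nlinarith
    · rw [hn']; exact h1
    · rw [hn']; exact h2
    · rw [hn', hc]; exact h3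

/-! ## Layered attractor computation -/

/-- Raising the threshold only weakens `closed`; so marks, counters and queue remain usable for the
next layer. -/
theorem AttrInv.mono_th {th th' : ℕ} {R : ℕ → Set α} (h : AttrInv s e H p th R) (hth : th ≤ th') :
    AttrInv s e H p th' R :=
  { h with closed := fun i hi hs => (h.closed i hi hs).imp_right fun h => ⟨h.1.trans_le hth, h.2⟩ }

/-- The marks are cleared once for all layers, and one potential `attrPot` pays for all calls of
`propagate`. The pass through `ordA` groups the nodes of `X` by color; rounds for other colors are
skipped by `layer_eq_of_le`. -/
theorem runs_computeLayeredAttr (s : Store) (hs : Holds s e H) (hsu : HoldsSuccs s e H)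
    (hpr : HoldsPreds s e H) (hH : H.IsParityGame) (hX : marked s e setA ⊆ H.nodes)
    (hpar : ∀ v ∈ marked s e setA, H.c v % 2 = s.reg dR % 2) (ho : Ranked s (· ≤ ·)) :
    Runs computeLayeredAttr s 0 fun t s' => t ≤ 1000 * (s.reg nR + H.numEdges + 1) ∧
      marked s' e attA = H.layeredAttr (player (s.reg dR)) (marked s e setA) ∧
      s'.reg pR = s.reg dR % 2 := by
  set n := s.reg nR with hn
  set d := s.reg dR with hdd
  set p := player d with hp
  set X := marked s e setA with hXX
  have hpar : ∀ v ∈ X, H.c v % 2 = p.val := hpar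
  refine Runs.call_seq (runs_clear s) ?_
  rintro t₁ s₁ ⟨ht₁, hz, hhd, htl⟩ hf₁
  have hn₁ : s₁.reg nR = n := hf₁.reg nR rfl
  have hd₁ : s₁.reg dR = d := hf₁.reg dR rfl
  rw [runs_seq, runs_set, runs_seq, runs_set]
  simp only [Expr.eval, hd₁]
  set s₂ := (s₁.setReg pR (d % 2)).setReg lR 0 with hs₂
  have hn₂ : s₂.reg nR = n := hn₁
  have hs₂' : Holds s₂ e H := hs.congr hn₁ (hf₁.arr _ rfl) (hf₁.arr _ rfl) (hf₁.arr _ rfl)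
  have hpr₂ : HoldsPreds s₂ e H := hpr.congr hn₁ (hf₁.arr _ rfl) (hf₁.arr _ rfl)
  obtain ⟨hI₂, hT₂, hA₂, hP₂⟩ := AttrInv.init (s := s₂) (e := e) (p := p) hH p.val
    (by simp [hs₂, hp, player]) (by intro i hi; exact hz i (by omega)) hhd htl
  set ord := fun i => s.arr ordA i 0 with hord
  -- The number `m` is the number of rounds of the pseudo-code that are done: positions before `lR`
  -- carry the colors of `X` below `p + 2m`, and positions from `lR` on those not below it.
  refine (runs_while
    (fun s' => s'.reg lR ≤ n ∧ ∃ m, marked s' e attA = H.layer p X m ∧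
      marked s' e tgtA = H.layer p X m ∪ {x ∈ X | H.c x < p.val + 2 * m} ∧
      AttrInv s' e H p (p.val + 2 * m) (fun _ => processed s' e) ∧
      processed s' e = marked s' e tgtA ∧
      (∀ l < s'.reg lR, e (ord l) ∈ X → H.c (e (ord l)) < p.val + 2 * m) ∧
      (∀ l, s'.reg lR ≤ l → l < n → e (ord l) ∈ X → p.val + 2 * m ≤ H.c (e (ord l))))
    (fun s' => attrPot s' + 200 * (n - s'.reg lR)) ?_ ?_).call ?_
  · refine ⟨by simp [hs₂], 0, hA₂, ?_, hI₂, by rw [hP₂, hT₂], by simp [hs₂], ?_⟩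
    · rw [hT₂]
      ext x
      simp only [layer, Set.empty_union, Set.mem_empty_iff_false, Set.mem_ofPred_eq, false_iff,
        not_and, not_lt]
      intro hx
      have := hpar x hx
      omega
    · intro l _ _ hl
      have := hpar _ hl
      omega
  · rintro s₃ ⟨hl, m, hA₃, hT₃, hI₃, hP₃, hlo, hhi⟩ hf₃ hb
    have hn₃ : s₃.reg nR = n := (hf₃.reg nR rfl).trans hn₂
    have hl' : s₃.reg lR < n := by
      by_contra h; simp [hn₃, h] at hb
    have ho₃ : s₃.arr ordA = s.arr ordA := (hf₃.arr _ rfl).trans (hf₁.arr _ rfl)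
    have hset₃ : s₃.arr setA = s.arr setA := (hf₃.arr _ rfl).trans (hf₁.arr _ rfl)
    have hc₃ : s₃.arr colA = s.arr colA := (hf₃.arr _ rfl).trans (hf₁.arr _ rfl)
    set l := s₃.reg lR with hll
    have hcol : ∀ i < n, s.arr colA (ord i) 0 = H.c (e (ord i)) := fun i hi =>
      hs.col _ (ho.lt i hi)
    rw [runs_seq, runs_set]
    refine Runs.ite (P := s.arr setA (ord l) 0 ≠ 0)
      (by simp [hset₃, ho₃, ← hll, hord]) (fun hP => ?_) (fun hP => ?_)
    · have hxl : e (ord l) ∈ X := (hs.mem_marked (ho.lt l hl')).2 hP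
      obtain ⟨i, hi⟩ : ∃ i, H.c (e (ord l)) = p.val + 2 * i := by
        have h1 := hpar _ hxl
        exact ⟨(H.c (e (ord l)) - p.val) / 2, by omega⟩
      have hmi : m ≤ i := by
        have := hhi l le_rfl hl' hxl
        omega
      rw [runs_seq, runs_set]
      simp only [Expr.eval, Store.setReg_reg, if_true, ← hll, ho₃, Store.setReg_arr, hc₃]
      have hcl : s.arr colA (s.arr ordA l 0) 0 = p.val + 2 * i := (hcol l hl').trans hi
      rw [hcl]
      set th := p.val + 2 * i with hth
      set s₄ := (s₃.setReg xR (s.arr ordA l 0)).setReg thR th with hs₄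
      have hI₄ : AttrInv s₄ e H p th (fun _ => processed s₄ e) :=
        (hI₃.mono_th (show p.val + 2 * m ≤ th by omega)).congr rfl rfl hI₃.le rfl rfl
      have hφ₄ : attrPot s₄ = attrPot s₃ := rfl
      refine Runs.call_seq (runs_while
        (fun s' => l ≤ s'.reg lR ∧ s'.reg lR ≤ n ∧
          (∀ a, l ≤ a → a < s'.reg lR → H.c (e (ord a)) = th) ∧
          AttrInv s' e H p th (fun _ => processed s' e) ∧ processed s' e = processed s₃ e ∧
          attrPot s' = attrPot s₃ ∧
          marked s' e tgtA = marked s₃ e tgtA ∪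
            {v | ∃ a, l ≤ a ∧ a < s'.reg lR ∧ e (ord a) = v ∧ v ∈ X})
        (fun s' => 100 * (n - s'.reg lR)) ?_ ?_) ?_
      · refine ⟨le_rfl, hl'.le, ?_, hI₄, rfl, rfl, ?_⟩
        · intro a h1 h2
          change a < l at h2
          omega
        · rw [show marked s₄ e tgtA = marked s₃ e tgtA from rfl]
          refine (Set.union_eq_self_of_subset_right ?_).symm
          rintro v ⟨a, h1, h2, -⟩
          change a < l at h2
          omega
      · rintro s₅ ⟨hl₅, hln₅, hth₅, hI₅, hP₅, hφ₅, hT₅⟩ hf₅ hb₅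
        have hn₅ : s₅.reg nR = n := (hf₅.reg nR rfl).trans hn₃
        have ho₅ : s₅.arr ordA = s.arr ordA := (hf₅.arr _ rfl).trans ho₃
        have hc₅ : s₅.arr colA = s.arr colA := (hf₅.arr _ rfl).trans hc₃
        have hset₅ : s₅.arr setA = s.arr setA := (hf₅.arr _ rfl).trans hset₃
        have hthr : s₅.reg thR = th := (hf₅.reg thR rfl).trans (by simp [hs₄])
        set a := s₅.reg lR with haa
        have hb' : a < n ∧ s.arr colA (ord a) 0 = th := by
          by_contra h
          simp [hn₅, ho₅, hc₅, hthr, ← haa] at hb₅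
          exact h hb₅
        have hca : H.c (e (ord a)) = th := (hcol a hb'.1).symm.trans hb'.2
        have hoa : ord a < n := ho.lt a hb'.1
        rw [runs_seq, runs_set]
        simp only [Expr.eval, ho₅, ← haa]
        rw [runs_seq]
        set s₆ := s₅.setReg xR (s.arr ordA a 0) with hs₆
        have hs₆' : Holds s₆ e H := hs.congr hn₅ ((hf₅.arr _ rfl).trans
          ((hf₃.arr _ rfl).trans (hf₁.arr _ rfl))) hc₅ ((hf₅.arr _ rfl).trans
          ((hf₃.arr _ rfl).trans (hf₁.arr _ rfl)))
        have hI₆ : AttrInv s₆ e H p th (fun _ => processed s₆ e) :=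
          hI₅.congr rfl rfl hI₅.le rfl rfl
        have hset : ∀ v, (∃ b, l ≤ b ∧ b < a + 1 ∧ e (ord b) = v ∧ v ∈ X) ↔
            (∃ b, l ≤ b ∧ b < a ∧ e (ord b) = v ∧ v ∈ X) ∨ (e (ord a) = v ∧ v ∈ X) := by
          intro v
          constructor
          · rintro ⟨b, h1, h2, h3⟩
            rcases (Nat.lt_succ_iff.1 h2).lt_or_eq with h | rfl
            · exact Or.inl ⟨b, h1, h, h3⟩
            · exact Or.inr h3
          · rintro (⟨b, h1, h2, h3⟩ | h)
            · exact ⟨b, h1, by omega, h3⟩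
            · exact ⟨a, hl₅, by omega, h⟩
        have hstep : ∀ b, l ≤ b → b < a + 1 → H.c (e (ord b)) = th := by
          intro b h1 h2
          rcases (Nat.lt_succ_iff.1 h2).lt_or_eq with h | rfl
          · exact hth₅ b h1 h
          · exact hca
        refine Runs.ite (P := s.arr setA (ord a) 0 ≠ 0) (by simp [hs₆, hset₅, hord])
          (fun hPa => ?_) (fun hPa => ?_)
        · have hxa : e (ord a) ∈ X := (hs.mem_marked hoa).2 hPa
          refine (runs_push s₆ th hs₆' xR (ord a) (by simp [hs₆, hord]) hI₆
            (by rw [show s₆.reg nR = n from hn₅]; exact hoa) (hX hxa) ?_).call ?_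
          -- The color of the new target equals the threshold, so it is not below it, and a
          -- saturated node with this color has already been attracted.
          · intro hsat
            refine (hI₆.closed _ (by rw [show s₆.reg nR = n from hn₅]; exact hoa) hsat).resolve_right ?_
            rintro ⟨h, -⟩
            have : s₆.arr colA (ord a) 0 = th := by
              rw [show s₆.arr colA = s.arr colA from hc₅]; exact hb'.2
            omega
          · rintro t s₇ ⟨ht₇, hI₇, hP₇, hφ₇, hT₇⟩ hf₇
            have hl₇ : s₇.reg lR = a := (hf₇.reg lR rfl).trans (by simp [hs₆, ← haa])
            rw [runs_set]
            simp only [Expr.eval, Store.setReg_reg, if_true, hl₇]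
            refine ⟨⟨by omega, by omega, hstep, hI₇.congr rfl rfl hI₇.le rfl rfl,
              hP₇.trans hP₅, hφ₇.trans hφ₅, ?_⟩, by simp; omega⟩
            rw [show marked (s₇.setReg lR (a + 1)) e tgtA = marked s₇ e tgtA from rfl, hT₇,
              show marked s₆ e tgtA = marked s₅ e tgtA from rfl, hT₅]
            ext v
            simp only [Set.mem_insert_iff, Set.mem_union, Set.mem_ofPred_eq, hset]
            constructor
            · rintro (rfl | h | h)
              · exact Or.inr (Or.inr ⟨rfl, hxa⟩)
              · exact Or.inl h
              · exact Or.inr (Or.inl h)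
            · rintro (h | h | h)
              · exact Or.inr (Or.inl h)
              · exact Or.inr (Or.inr h)
              · exact Or.inl h.1.symm
        · have hxa : e (ord a) ∉ X := fun h => hPa ((hs.mem_marked hoa).1 h)
          have hl₆ : s₆.reg lR = a := by simp [hs₆, ← haa]
          rw [runs_skip, runs_set]
          simp only [Expr.eval, Store.setReg_reg, if_true, hl₆]
          refine ⟨⟨by omega, by omega, hstep, hI₆.congr rfl rfl hI₆.le rfl rfl,
              hP₅, hφ₅, ?_⟩, by simp; omega⟩
          rw [show marked (s₆.setReg lR (a + 1)) e tgtA = marked s₅ e tgtA from rfl, hT₅]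
          ext v
          simp only [Set.mem_union, Set.mem_ofPred_eq, hset]
          constructor
          · rintro (h | h)
            · exact Or.inl h
            · exact Or.inr (Or.inl h)
          · rintro (h | h | h)
            · exact Or.inl h
            · exact Or.inr h
            · exact absurd (h.1 ▸ h.2) hxa
      · rintro t₅ s₅ ⟨⟨hl₅, hln₅, hth₅, hI₅, hP₅, hφ₅, hT₅⟩, hb₅, ht₅⟩ hf₅
        have hn₅ : s₅.reg nR = n := (hf₅.reg nR rfl).trans hn₃
        have ho₅ : s₅.arr ordA = s.arr ordA := (hf₅.arr _ rfl).trans ho₃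
        have hc₅ : s₅.arr colA = s.arr colA := (hf₅.arr _ rfl).trans hc₃
        have hthr : s₅.reg thR = th := (hf₅.reg thR rfl).trans (by simp [hs₄])
        have hA₅ : marked s₅ e attA = H.layer p X m :=
          (marked_congr e (hf₅.reg nR rfl) (hf₅.arr attA rfl)).trans hA₃
        set a := s₅.reg lR with haa
        have hb' : ¬ (a < n ∧ s.arr colA (ord a) 0 = th) := by
          intro h
          simp [hn₅, ho₅, hc₅, hthr, ← haa] at hb₅
          exact hb₅ h.1 h.2
        have hla : l < a := by
          rcases hl₅.lt_or_eq with h | h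
          · exact h
          · exact absurd ⟨h ▸ hl', h ▸ hcl⟩ hb'
        -- The list is sorted and the group of color `th` is exhausted at `a`; as colors in `X` have
        -- equal parity, the next one is at least `th + 2`.
        have hbeyond : ∀ b, a ≤ b → b < n → e (ord b) ∈ X → th + 2 ≤ H.c (e (ord b)) := by
          intro b h1 h2 h3
          have ha : a < n := by omega
          have h4 := hpar _ h3
          have h5 : H.c (e (ord l)) ≤ H.c (e (ord a)) := by
            rw [← hcol l hl', ← hcol a ha]; exact ho.sorted l a hla ha
          have h6 : H.c (e (ord a)) ≤ H.c (e (ord b)) := by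
            rcases h1.lt_or_eq with h | rfl
            · rw [← hcol a ha, ← hcol b h2]; exact ho.sorted a b h h2
            · exact le_rfl
          have h7 : H.c (e (ord a)) ≠ th := fun h => hb' ⟨ha, (hcol a ha).trans h⟩
          omega
        have hpos : ∀ x ∈ X, ∃ b < n, e (ord b) = x := by
          rintro x ⟨j, hj, rfl, -⟩
          obtain ⟨b, hb, rfl⟩ := ho.surj j hj
          exact ⟨b, hb, rfl⟩
        -- No node of `X` has a color in the rounds from `m` to `i - 1`, so these rounds change
        -- nothing.
        have hlay : H.layer p X i = H.layer p X m := by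
          refine layer_eq_of_le hH hpar hmi fun x hx => ?_
          obtain ⟨b, hb, rfl⟩ := hpos x hx
          rcases Nat.lt_or_ge b l with h | h
          · exact Or.inl (hlo b h hx)
          · right
            rcases Nat.lt_or_ge b a with h' | h'
            · rw [hth₅ b h h']
            · have := hbeyond b h' hb hx; omega
        have hT₀ : marked s₅ e tgtA = H.layer p X i ∪ {x ∈ X | H.c x ≤ p.val + 2 * i} := by
          rw [hT₅, hT₃, hlay, Set.union_assoc]
          congr 1
          ext x
          simp only [Set.mem_union, Set.mem_ofPred_eq]
          constructor
          · rintro (⟨h1, h2⟩ | ⟨b, h1, h2, rfl, h3⟩)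
            · exact ⟨h1, by omega⟩
            · exact ⟨h3, (hth₅ b h1 h2).le⟩
          · rintro ⟨hx, hle⟩
            obtain ⟨b, hb, rfl⟩ := hpos x hx
            rcases Nat.lt_or_ge b l with h | h
            · exact Or.inl ⟨hx, hlo b h hx⟩
            · right
              rcases Nat.lt_or_ge b a with h' | h'
              · exact ⟨b, h, h', rfl, hx⟩
              · have := hbeyond b h' hb hx; omega
        have hs₅ : Holds s₅ e H := hs.congr hn₅ ((hf₅.arr _ rfl).trans
          ((hf₃.arr _ rfl).trans (hf₁.arr _ rfl))) hc₅ ((hf₅.arr _ rfl).trans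
          ((hf₃.arr _ rfl).trans (hf₁.arr _ rfl)))
        refine (runs_propagate s₅ e H p (H.layer p X (i + 1)) _ hs₅
          (hsu.congr hn₅ ((hf₅.arr _ rfl).trans ((hf₃.arr _ rfl).trans (hf₁.arr _ rfl)))
            ((hf₅.arr _ rfl).trans ((hf₃.arr _ rfl).trans (hf₁.arr _ rfl))))
          (hpr.congr hn₅ ((hf₅.arr _ rfl).trans ((hf₃.arr _ rfl).trans (hf₁.arr _ rfl)))
            ((hf₅.arr _ rfl).trans ((hf₃.arr _ rfl).trans (hf₁.arr _ rfl)))) hH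
          (hthr ▸ hI₅) hT₀ (by rw [hA₅, ← hlay]; exact layer_subset_succ) ?_).call ?_
        · rintro v hv hv'
          rw [hthr] at hv'
          rw [Set.union_comm] at hv
          rcases hv' with h | h | h
          · exact mem_pmattr.2 ⟨Or.inl h, hv⟩
          · exact mem_pmattr.2 ⟨Or.inr h, hv⟩
          · exact h
        · rintro t₆ s₆ ⟨ht₆, hI₆, hP₆, -, hS₆, hT₆⟩ hf₆
          have hn₆ : s₆.reg nR = n := (hf₆.reg nR rfl).trans hn₅
          have hl₆ : s₆.reg lR = a := hf₆.reg lR rfl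
          have hs₆ : Holds s₆ e H := hs₅.congr (hf₆.reg _ rfl) (hf₆.arr _ rfl) (hf₆.arr _ rfl)
            (hf₆.arr _ rfl)
          -- Here the permissive part matters: a saturated node below the threshold may remain
          -- unattracted only if it is no target.
          have hA₆ : marked s₆ e attA = H.layer p X (i + 1) := by
            refine subset_antisymm hS₆ (pmattr_subset fun v hdv hv => ?_)
            obtain ⟨j, hj, rfl⟩ := hs₆.surj v (cpre_subset_nodes hv)
            rw [Set.union_comm, ← hT₆, ← hI₆.sat j hj] at hv
            rw [hs₆.mem_marked hj]
            refine (hI₆.closed j hj hv).resolve_right ?_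
            rintro ⟨h1, h2⟩
            rw [hs₆.col j hj, hthr] at h1
            rcases hdv with h | h
            · omega
            · have : e j ∈ marked s₆ e tgtA := hT₆ ▸ Or.inl h
              exact (hs₆.mem_marked hj).1 this h2
          refine ⟨⟨by omega, i + 1, hA₆, ?_, ?_, hP₆, ?_, ?_⟩, ?_⟩
          · rw [hT₆, hA₆, Set.union_comm, ← Set.union_assoc,
              Set.union_eq_self_of_subset_right layer_subset_succ]
            congr 1
            ext x
            simp only [Set.mem_ofPred_eq]
            refine and_congr_right fun hx => ?_
            have := hpar x hx
            omega
          · rw [hP₆]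
            exact (hthr ▸ hI₆).mono_th (by omega)
          · rw [hl₆]
            intro b hb hx
            rcases Nat.lt_or_ge b l with h | h
            · have := hlo b h hx; omega
            · rw [hth₅ b h hb]; omega
          · rw [hl₆]
            intro b h1 h2 h3
            have := hbeyond b h1 h2 h3
            omega
          · rw [hl₆]
            have h1 : s₄.reg lR = l := by simp [hs₄, ← hll]
            rw [h1] at ht₅
            simp at ht₅ ⊢
            omega
    · have hxl : e (ord l) ∉ X := fun h => hP ((hs.mem_marked (ho.lt l hl')).1 h)
      rw [runs_set]
      simp only [Expr.eval, Store.setReg_reg, if_true, show lR ≠ xR by decide, if_false, ← hll]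
      refine ⟨⟨by omega, m, hA₃, hT₃, hI₃.congr rfl rfl hI₃.le rfl rfl, hP₃, ?_, ?_⟩, ?_⟩
      · intro b hb hx
        rcases (Nat.lt_succ_iff.1 hb).lt_or_eq with h | rfl
        · exact hlo b h hx
        · exact absurd hx hxl
      · intro b h1 h2 h3
        exact hhi b (by omega) h2 h3
      · rw [show attrPot ((s₃.setReg xR (s₃.arr ordA l 0)).setReg lR (l + 1)) = attrPot s₃ from rfl]
        simp
        omega
  · rintro t s₃ ⟨⟨hl, m, hA₃, hT₃, hI₃, hP₃, hlo, hhi⟩, hb, ht⟩ hf₃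
    have hn₃ : s₃.reg nR = n := (hf₃.reg nR rfl).trans hn₂
    refine ⟨?_, ?_, (hf₃.reg pR rfl).trans (by simp [hs₂])⟩
    · have := hpr₂.attrPot_le hs₂' hH
      simp at ht ⊢
      omega
    · rw [hA₃]
      symm
      refine layeredAttr_eq hH hpar (hH.finite.subset hX) ?_
      rintro x ⟨j, hj, rfl, hj'⟩
      obtain ⟨b, hb', rfl⟩ := ho.surj j hj
      refine hlo b ?_ ((hs.mem_marked (ho.lt b hb')).2 hj')
      simp [hn₃] at hb
      omega

end ParityGames

namespace ParityGames

open Code Arena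

variable {α : Type*} {s s' : Store} {e : ℕ → α} {G H : Arena α} {p : Fin 2} {won : Fin 2 → Set α}

/-! ## States of a solver -/

/-- Memory describes the game `G`, with `e i` for node number `i`. -/
structure Input (s : Store) (e : ℕ → α) (G : Arena α) : Prop where
  inj : ∀ i < s.reg nR, ∀ j < s.reg nR, e i = e j → i = j
  mem : ∀ i < s.reg nR, e i ∈ G.nodes
  surj : ∀ v ∈ G.nodes, ∃ i < s.reg nR, e i = v
  col : ∀ i < s.reg nR, s.arr colA i 0 = G.c (e i)
  own : ∀ i < s.reg nR, ∀ p, e i ∈ G.V p → s.arr ownA i 0 = p.val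
  succs : HoldsSuccs s e G

theorem Input.reg_eq (h : Input s e G) : s.reg nR = G.numNodes := by
  have : G.nodes = e '' (Finset.range (s.reg nR) : Set ℕ) := by
    ext v
    constructor
    · intro hv
      obtain ⟨i, hi, rfl⟩ := h.surj v hv
      exact ⟨i, by simpa using hi, rfl⟩
    · rintro ⟨i, hi, rfl⟩
      exact h.mem i (by simpa using hi)
  rw [numNodes, this, Set.InjOn.ncard_image, Set.ncard_coe_finset, Finset.card_range]
  intro i hi j hj
  exact h.inj i (by simpa using hi) j (by simpa using hj)

/-- The current game of a solver is `H`, the nodes in `won p` are recorded as won by `p`. -/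
structure State (s : Store) (e : ℕ → α) (H : Arena α) (won : Fin 2 → Set α) : Prop where
  game : H.IsParityGame
  holds : Holds s e H
  win : ∀ i < s.reg nR, ∀ p : Fin 2, s.arr winA i 0 = p.val + 1 ↔ e i ∈ won p

theorem State.congr (h : State s e H won) (hn : s'.reg nR = s.reg nR)
    (hw : s'.arr winA = s.arr winA) (hc : s'.arr colA = s.arr colA)
    (ho : s'.arr ownA = s.arr ownA) : State s' e H won :=
  ⟨h.game, h.holds.congr hn hw hc ho, by rw [hn, hw]; exact h.win⟩

/-- A state with adjacency lists. -/
structure ListState (s : Store) (e : ℕ → α) (m : ℕ) (H : Arena α) (won : Fin 2 → Set α) : Prop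
    extends State s e H won where
  succs : HoldsSuccs s e H
  preds : HoldsPreds s e H
  edges : H.numEdges ≤ m

theorem ListState.congr {m : ℕ} (h : ListState s e m H won) (hn : s'.reg nR = s.reg nR)
    (h0 : ∀ a ∈ [winA, colA, ownA, degA, sucA, pdgA, preA], s'.arr a = s.arr a) :
    ListState s' e m H won :=
  ⟨h.toState.congr hn (h0 _ (by simp)) (h0 _ (by simp)) (h0 _ (by simp)),
    h.succs.congr hn (h0 _ (by simp)) (h0 _ (by simp)),
    h.preds.congr hn (h0 _ (by simp)) (h0 _ (by simp)), h.edges⟩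

/-- Add `A` to the nodes that are won by `p`. -/
def addWon (won : Fin 2 → Set α) (p : Fin 2) (A : Set α) : Fin 2 → Set α :=
  fun q => {v | v ∈ won q ∨ (q = p ∧ v ∈ A)}

/-- The outcome of a computation that has first reached a state with `won`, and then `r`. -/
def Outcome.after (r : Outcome α) (won : Fin 2 → Set α) : Outcome α where
  residual := r.residual
  won q := r.won q ∪ won q

/-- The pseudo-code records the won nodes after the recursive call returns, the program before it.
This identity translates one into the other. -/
theorem Outcome.record_after (r : Outcome α) (A : Set α) :
    (r.record p A).after won = r.after (addWon won p A) := by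
  simp only [after, record, mk.injEq, true_and]
  ext q v
  simp only [Set.mem_union, Set.mem_ofPred_eq, addWon]
  tauto

theorem State.remove {A : Set α} (h : State s e H won) (hn : s'.reg nR = s.reg nR)
    (hH : H.cpre p A ⊆ A) (hA : A ⊆ H.nodes) (hs : Holds s' e (H.removeNodes A))
    (hw : ∀ i < s.reg nR, (e i ∈ A → s'.arr winA i 0 = p.val + 1) ∧
        (e i ∉ A → s'.arr winA i 0 = s.arr winA i 0)) :
    State s' e (H.removeNodes A) (addWon won p A) := by
  refine ⟨h.game.removeNodes hH, hs, ?_⟩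
  rw [hn]
  intro i hi q
  simp only [addWon, Set.mem_ofPred_eq]
  by_cases hiA : e i ∈ A
  -- Nodes of `A` belong to the current game, so they have not been recorded for any player before.
  · have h0 : s.arr winA i 0 = 0 := (h.holds.alive i hi).2 (hA hiA)
    have := h.win i hi q
    rw [(hw i hi).1 hiA, ← this, h0]
    simp only [Nat.add_right_cancel_iff, Fin.val_inj, hiA, and_true]
    constructor
    · rintro rfl; exact Or.inr rfl
    · rintro (h | rfl)
      · omega
      · rfl
  · rw [(hw i hi).2 hiA, h.win i hi q]
    simp [hiA]

/-- The number of nodes of the current game. -/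
def Store.aliveCount (s : Store) : ℕ :=
  ((Finset.range (s.reg nR)).filter fun i => s.arr winA i 0 = 0).card

theorem Store.aliveCount_le (s : Store) : s.aliveCount ≤ s.reg nR :=
  (Finset.card_filter_le _ _).trans (by simp)

theorem Store.aliveCount_congr (hn : s'.reg nR = s.reg nR) (hw : s'.arr winA = s.arr winA) :
    s'.aliveCount = s.aliveCount := by
  simp [aliveCount, hn, hw]

theorem Holds.aliveCount_lt {H' : Arena α} (h : Holds s e H) (h' : Holds s' e H')
    (hn : s'.reg nR = s.reg nR) (hH : H'.nodes ⊂ H.nodes) : s'.aliveCount < s.aliveCount := by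
  refine Finset.card_lt_card ⟨fun i hi => ?_, fun hsub => ?_⟩
  · simp only [Finset.mem_filter, Finset.mem_range, hn] at hi ⊢
    exact ⟨hi.1, (h.alive i hi.1).2 (hH.1 ((h'.alive i (hn ▸ hi.1)).1 hi.2))⟩
  · obtain ⟨v, hv, hv'⟩ := Set.not_subset.1 hH.2
    obtain ⟨i, hi, rfl⟩ := h.surj v hv
    have : i ∈ (Finset.range (s'.reg nR)).filter fun i => s'.arr winA i 0 = 0 :=
      hsub (by simpa using ⟨hi, (h.alive i hi).2 hv⟩)
    simp only [Finset.mem_filter, Finset.mem_range, hn] at this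
    exact hv' ((h'.alive i (hn ▸ this.1)).1 this.2)

theorem removeNodes_nodes_ssubset {A : Set α} (hA : (A ∩ H.nodes).Nonempty) :
    (H.removeNodes A).nodes ⊂ H.nodes := by
  rw [removeNodes_nodes]
  obtain ⟨v, hv, hv'⟩ := hA
  exact ⟨Set.sdiff_subset, fun h => (h hv').2 hv⟩

/-! ## Simple subprograms -/

theorem Input.holds_of (h : Input s e G) (hn : s'.reg nR = s.reg nR)
    (hw : ∀ i < s.reg nR, s'.arr winA i 0 = 0) (hc : s'.arr colA = s.arr colA)
    (ho : s'.arr ownA = s.arr ownA) (hG : G.IsParityGame) : State s' e G fun _ => ∅ := by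
  refine ⟨hG, ⟨by rw [hn]; exact h.inj, by rw [hn]; exact h.surj, ?_, ?_, ?_⟩, ?_⟩
  · rw [hn]; exact fun i hi => ⟨fun _ => h.mem i hi, fun _ => hw i hi⟩
  · rw [hn, hc]; exact h.col
  · rw [hn, ho]; exact h.own
  · rw [hn]; intro i hi p; simp [hw i hi]

theorem HoldsPreds.of_lists (hs : Holds s e H) (hH : H.IsParityGame) (hn : s'.reg nR = s.reg nR)
    (h : ∀ i < s.reg nR, Lists s' pdgA preA i {u | u < s.reg nR ∧ s.arr winA u 0 = 0 ∧
      i ∈ {j | j < s.reg nR ∧ (e u, e j) ∈ H.E}}) : HoldsPreds s' e H := by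
  intro i hi
  rw [hn] at hi
  refine (h i hi).congr rfl rfl ?_
  rw [hn]
  ext u
  simp only [Set.mem_ofPred_eq]
  constructor
  · rintro ⟨hu, h⟩
    exact ⟨hu, (hs.alive u hu).2 (hH.edges h).1, hi, h⟩
  · rintro ⟨hu, -, -, h⟩
    exact ⟨hu, h⟩

theorem State.runs_listPreds {m : ℕ} (h : State s e H won) (hsu : HoldsSuccs s e H)
    (hm : H.numEdges ≤ m) :
    Runs listPreds s 0 fun t s' => t ≤ 200 * (s.reg nR + m + 1) ∧ ListState s' e m H won := by
  refine (ParityGames.runs_listPreds s (fun i => {j | j < s.reg nR ∧ (e i, e j) ∈ H.E})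
    (fun i hi h' => hsu i hi ((h.holds.alive i hi).1 h')) (fun i _ _ j hj => hj.1)).call ?_
  rintro t s' ⟨ht, hp⟩ hf
  have hn : s'.reg nR = s.reg nR := hf.reg nR rfl
  have := hsu.size_le h.holds h.game
  exact ⟨by omega, h.congr hn (hf.arr _ rfl) (hf.arr _ rfl) (hf.arr _ rfl),
    hsu.congr hn (hf.arr _ rfl) (hf.arr _ rfl), .of_lists h.holds h.game hn hp, hm⟩

theorem Input.runs_start (h : Input s e G) (hG : G.IsParityGame) :
    Runs start s 0 fun t s' => t ≤ 300 * (s.reg nR + G.numEdges + 1) ∧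
      ListState s' e G.numEdges G fun _ => ∅ := by
  refine Runs.call_seq (runs_fill s winA (.const 0) (fun _ => 0) (by simp) (by simp)) ?_
  rintro t₁ s₁ ⟨ht₁, h₁⟩ hf₁
  have hn : s₁.reg nR = s.reg nR := hf₁.reg nR rfl
  refine ((h.holds_of hn h₁ (hf₁.arr _ rfl) (hf₁.arr _ rfl) hG).runs_listPreds
    (h.succs.congr hn (hf₁.arr _ rfl) (hf₁.arr _ rfl)) le_rfl).call ?_
  rintro t s' ⟨ht, hs'⟩ -
  exact ⟨by omega, hs'⟩

theorem runs_testFatal (hs : Holds s e H) :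
    Runs testFatal s 0 fun t s' => t ≤ 100 * (s.reg nR + 1) ∧
      (s'.reg okR ≠ 0 ↔ marked s e setA ⊆ marked s e attA) := by
  rw [testFatal, runs_seq, runs_set]
  refine (runs_for_const (N := s.reg nR)
    (fun k s' => s'.reg okR ≠ 0 ↔ ∀ i < k, s.arr setA i 0 ≠ 0 → s.arr attA i 0 ≠ 0) 40 rfl
    (fun k s m h => ?_) ?_ ?_ ?_).call ?_
  · simpa using h
  · simp
  · rintro k s' - - - hf
    exact hf.reg nR rfl
  · rintro k s₁ hk hI hx hf
    have h1 : s₁.arr setA = s.arr setA := hf.arr _ rfl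
    have h2 : s₁.arr attA = s.arr attA := hf.arr _ rfl
    refine Runs.ite (P := s.arr setA k 0 ≠ 0 ∧ s.arr attA k 0 = 0) (by simp [hx, h1, h2])
      (fun hP => ?_) (fun hP => ?_)
    · rw [runs_set]
      simp
      exact ⟨k, le_rfl, hP⟩
    · rw [runs_skip]
      refine ⟨?_, by simp⟩
      rw [hI]
      constructor
      · intro h i hi hi'
        rcases (Nat.lt_succ_iff.1 hi).lt_or_eq with h' | rfl
        · exact h i h' hi'
        · exact fun h0 => hP ⟨hi', h0⟩
      · exact fun h i hi => h i (by omega)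
  · rintro t s' ⟨hI, ht⟩ hf
    refine ⟨by simp at ht ⊢; omega, hI.trans ⟨?_, ?_⟩⟩
    · rintro h _ ⟨i, hi, rfl, hi'⟩
      exact ⟨i, hi, rfl, h i hi hi'⟩
    · intro h i hi hi'
      exact (hs.mem_marked hi).1 (h ((hs.mem_marked hi).2 hi'))

/-- The program compares entries. This decides equality of the marked sets only because all entries
are 0 or 1. -/
theorem runs_testSet (hs : Holds s e H) (h01 : ∀ i < s.reg nR, s.arr setA i 0 ≤ 1)
    (h01' : ∀ i < s.reg nR, s.arr cchA i 0 ≤ 1) :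
    Runs testSet s 0 fun t s' => t ≤ 100 * (s.reg nR + 1) ∧
      (s'.reg neR ≠ 0 ↔ marked s e setA ≠ ∅) ∧
      (s'.reg nwR ≠ 0 ↔ marked s e setA ≠ marked s e cchA) := by
  rw [testSet, runs_seq, runs_set, runs_seq, runs_set]
  refine (runs_for_const (N := s.reg nR)
    (fun k s' => (s'.reg neR = 0 ↔ ∀ i < k, s.arr setA i 0 = 0) ∧
      (s'.reg nwR = 0 ↔ ∀ i < k, s.arr setA i 0 = s.arr cchA i 0)) 60 rfl
    (fun k s m h => ?_) ?_ ?_ ?_).call ?_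
  · simpa using h
  · simp
  · rintro k s' - - - hf
    exact hf.reg nR rfl
  · rintro k s₁ hk ⟨hI, hI'⟩ hx hf
    have h1 : s₁.arr setA = s.arr setA := hf.arr _ rfl
    have h2 : s₁.arr cchA = s.arr cchA := hf.arr _ rfl
    have hall : ∀ P : ℕ → Prop, (∀ i < k + 1, P i) ↔ (∀ i < k, P i) ∧ P k := fun P =>
      ⟨fun h => ⟨fun i hi => h i (by omega), h k (by omega)⟩, fun h i hi =>
        (Nat.lt_succ_iff.1 hi).lt_or_eq.elim (h.1 i) (fun h' => h' ▸ h.2)⟩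
    rw [hall, hall]
    rw [runs_seq]
    refine Runs.ite (P := s.arr setA k 0 ≠ 0) (by simp [hx, h1]) (fun hP => ?_) (fun hP => ?_)
    · rw [runs_set]
      refine Runs.ite (P := s.arr setA k 0 ≠ s.arr cchA k 0) (by simp [hx, h1, h2])
        (fun hQ => ?_) (fun hQ => ?_)
      · simp [hP, hQ]
      · simp only [not_not] at hQ
        simp [hQ, hI']
        exact fun _ => hQ ▸ hP
    · simp only [not_not] at hP
      rw [runs_skip]
      refine Runs.ite (P := s.arr setA k 0 ≠ s.arr cchA k 0) (by simp [hx, h1, h2])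
        (fun hQ => ?_) (fun hQ => ?_)
      · simp [hP, hI]
        intro _ h
        exact hQ (by rw [hP]; exact h)
      · simp only [not_not] at hQ
        simp [hP, hI, hI']
        intro _
        exact hP.symm.trans hQ
  · rintro t s' ⟨⟨hI, hI'⟩, ht⟩ hf
    refine ⟨by simp at ht ⊢; omega, (not_congr hI).trans ?_, (not_congr hI').trans ?_⟩
    · rw [ne_eq, not_iff_not]
      constructor
      · intro h
        ext v
        simp only [Set.mem_empty_iff_false, iff_false]
        rintro ⟨i, hi, -, hi'⟩
        exact hi' (h i hi)
      · intro h i hi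
        by_contra h'
        have := (hs.mem_marked hi).2 h'
        rw [h] at this
        exact this
    · rw [ne_eq, not_iff_not]
      constructor
      · intro h
        ext v
        simp only [marked, Set.mem_ofPred_eq]
        exact exists_congr fun i => and_congr_right fun hi => by rw [h i hi]
      · intro h i hi
        have h1 := h01 i hi
        have h2 := h01' i hi
        have h3 : s.arr setA i 0 ≠ 0 ↔ s.arr cchA i 0 ≠ 0 := by
          rw [← hs.mem_marked hi, ← hs.mem_marked hi, h]
        omega

end ParityGames

namespace ParityGames

open Code Arena

variable {α : Type*} {s s' : Store} {e : ℕ → α} {G H : Arena α} {p : Fin 2} {won : Fin 2 → Set α}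

/-! ## Recursion -/

/-- The loop that runs the body of a solver until there is no recursive call. Steps may also be
paid by a decrease of the potential `φ`. -/
theorem runs_restarts_of {body : Cmd} {B : ℕ} (I J : Store → Prop) (φ : Store → ℕ) (s : Store)
    (hI : I (s.setReg goR 1)) (hφ : φ (s.setReg goR 1) = φ s)
    (hbody : ∀ s', Frame (.set goR (.const 1) ;; .while (.reg goR) body) s s' → I s' →
      Runs body s' 0 fun t s'' => t + φ s'' ≤ φ s' + B ∧
        (s''.reg goR = 0 ∧ s''.aliveCount ≤ s'.aliveCount ∧ J s'' ∨
          s''.reg goR = 1 ∧ s''.aliveCount < s'.aliveCount ∧ I s'')) :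
    Runs (.set goR (.const 1) ;; .while (.reg goR) body) s 0 fun t s' =>
      t + φ s' ≤ φ s + (s.reg nR + 2) * (B + 10) ∧ J s' := by
  rw [runs_seq, runs_set]
  simp only [Expr.eval]
  -- A restart lowers `aliveCount` and so pays for its pass; the last pass is paid by the drop of
  -- `goR` from 1 to 0.
  refine (runs_while (fun s' => s'.reg goR = 0 ∧ J s' ∨ s'.reg goR = 1 ∧ I s')
    (fun s' => (B + 10) * (s'.aliveCount + s'.reg goR) + φ s') (Or.inr ⟨by simp, hI⟩) ?_).call ?_
  · rintro s₁ h hf hb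
    have hf' : Frame (.set goR (.const 1) ;; .while (.reg goR) body) s s₁ := by
      refine ((Exec.set goR (.const 1) s).frame.of_le ?_ ?_).trans (hf.of_le ?_ ?_) <;>
        intro y hy <;> simp_all [Cmd.writesReg, Cmd.writesArr]
    rcases h with ⟨h, -⟩ | ⟨h, hI₁⟩
    · simp [h] at hb
    · refine (hbody s₁ hf' hI₁).mono ?_
      rintro t s₂ ⟨ht, ⟨h0, hal, hJ⟩ | ⟨h1, hal, hI₂⟩⟩
      · refine ⟨Or.inl ⟨h0, hJ⟩, ?_⟩
        rw [h0, h]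
        simp only [Expr.cost]
        nlinarith
      · refine ⟨Or.inr ⟨h1, hI₂⟩, ?_⟩
        rw [h1, h]
        simp only [Expr.cost]
        nlinarith
  · rintro t s' ⟨h, hb, ht⟩ hf
    refine ⟨?_, ?_⟩
    · have h1 : (s.setReg goR 1).aliveCount ≤ s.reg nR := Store.aliveCount_le _
      rw [hφ] at ht
      simp at ht ⊢
      nlinarith
    · rcases h with ⟨-, h⟩ | ⟨h, -⟩
      · exact h
      · simp [h] at hb

/-- Tail recursion as a loop: outcomes of the current game, extended by the nodes won so far, are
outcomes for `G`. No potential survives a pass here, as every attractor is computed afresh. -/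
theorem runs_restarts {body : Cmd} {m B : ℕ} (solver : Arena α → Outcome α → Prop) (s : Store)
    (hs : ListState s e m G fun _ => ∅)
    (hbody : ∀ s' H won, Frame (.set goR (.const 1) ;; .while (.reg goR) body) s s' →
      ListState s' e m H won → (∀ r, solver H r → solver G (r.after won)) →
      Runs body s' 0 fun t s'' => t ≤ B ∧ ∃ H' won', ListState s'' e m H' won' ∧
        (s''.reg goR = 0 ∧ s''.aliveCount ≤ s'.aliveCount ∧ solver G ⟨H', won'⟩ ∨
          s''.reg goR = 1 ∧ s''.aliveCount < s'.aliveCount ∧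
            ∀ r, solver H' r → solver G (r.after won'))) :
    Runs (.set goR (.const 1) ;; .while (.reg goR) body) s 0 fun t s' =>
      t ≤ (s.reg nR + 2) * (B + 10) ∧ ∃ H won, ListState s' e m H won ∧ solver G ⟨H, won⟩ := by
  refine (runs_restarts_of (B := B)
    (fun s' => ∃ H won, ListState s' e m H won ∧ ∀ r, solver H r → solver G (r.after won))
    (fun s' => ∃ H won, ListState s' e m H won ∧ solver G ⟨H, won⟩) (fun _ => 0) s
    ⟨G, _, hs.congr rfl (fun _ _ => rfl), fun r hr => by simpa [Outcome.after] using hr⟩ rfl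
    ?_).mono ?_
  · rintro s' hf ⟨H, won, hs', h⟩
    refine (hbody s' H won hf hs' h).mono ?_
    rintro t s₂ ⟨ht, H', won', hs₂, ⟨h0, hal, hr⟩ | ⟨h1, hal, hr⟩⟩
    · exact ⟨by simpa using ht, Or.inl ⟨h0, hal, H', won', hs₂, hr⟩⟩
    · exact ⟨by simpa using ht, Or.inr ⟨h1, hal, H', won', hs₂, hr⟩⟩
  · rintro t s' ⟨ht, h⟩
    exact ⟨by simpa using ht, h⟩

/-! ## The solver `psol` -/

open Classical in
/-- The elements `f i, …, f (n - 1)` that are in `S`. -/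
noncomputable def listFrom (f : ℕ → α) (S : Set α) (n i : ℕ) : List α :=
  ((List.range' i (n - i)).map f).filter fun v => decide (v ∈ S)

theorem listFrom_self (f : ℕ → α) (S : Set α) (n : ℕ) : listFrom f S n n = [] := by
  simp [listFrom]

theorem listFrom_of_mem {f : ℕ → α} {S : Set α} {n i : ℕ} (hi : i < n) (h : f i ∈ S) :
    listFrom f S n i = f i :: listFrom f S n (i + 1) := by
  obtain ⟨j, hj⟩ : ∃ j, n - i = j + 1 := ⟨n - i - 1, by omega⟩
  rw [listFrom, listFrom, hj, List.range'_succ, show n - (i + 1) = j by omega]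
  simp [h]

theorem listFrom_of_notMem {f : ℕ → α} {S : Set α} {n i : ℕ} (hi : i < n) (h : f i ∉ S) :
    listFrom f S n i = listFrom f S n (i + 1) := by
  obtain ⟨j, hj⟩ : ∃ j, n - i = j + 1 := ⟨n - i - 1, by omega⟩
  rw [listFrom, listFrom, hj, List.range'_succ, show n - (i + 1) = j by omega]
  simp [h]

/-- Sorting once is enough: colors never change, so the old order restricted to the nodes that are
left is an admissible order for every later game. -/
theorem nodeOrder_listFrom (hs : Holds s e H) {r : ℕ → ℕ → Prop} (ho : Ranked s r)
    (hr : ∀ a b, r a b → b ≤ a) :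
    NodeOrder H (listFrom (fun i => e (s.arr ordA i 0)) H.nodes (s.reg nR) 0) := by
  refine ⟨?_, ?_, ?_⟩
  · refine List.Nodup.filter _ (List.Nodup.map_on ?_ List.nodup_range')
    intro i hi j hj hij
    simp only [List.mem_range'_1, Nat.sub_zero, Nat.zero_add] at hi hj
    exact ho.inj i hi.2 j hj.2 (hs.inj _ (ho.lt i hi.2) _ (ho.lt j hj.2) hij)
  · intro v
    simp only [listFrom, List.mem_filter, List.mem_map, List.mem_range'_1, decide_eq_true_eq,
      Nat.sub_zero, Nat.zero_add, Nat.zero_le, true_and, and_iff_right_iff_imp]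
    intro hv
    obtain ⟨i, hi, rfl⟩ := hs.surj v hv
    obtain ⟨l, hl, rfl⟩ := ho.surj i hi
    exact ⟨l, hl, rfl⟩
  · refine List.Pairwise.filter _ (List.pairwise_map.2 ?_)
    refine (List.pairwise_lt_range').imp_of_mem ?_
    intro i j hi hj hij
    simp only [List.mem_range'_1, Nat.sub_zero, Nat.zero_add] at hi hj
    rw [← hs.col _ (ho.lt i hi.2), ← hs.col _ (ho.lt j hj.2)]
    exact hr _ _ (ho.sorted i j hij hj.2)

theorem State.runs_filterSuccs {k : ℕ} (h : State s e H won) (hsu : HoldsSuccs s e H)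
    (hk : s.reg kR = k) (hkn : k < s.reg nR) (hkH : e k ∈ H.nodes)
    (hA : marked s e attA = H.fattr (e k)) (hkA : e k ∉ H.fattr (e k)) :
    Runs (filterSuccs (.reg kR) (fun w => .eq (at1 attA w) (.const 0))) s 0 fun t s' =>
      t ≤ 50 * (s.reg nR + 1) ∧ State s' e (H.pruned (e k)) won ∧
        HoldsSuccs s' e (H.pruned (e k)) := by
  refine (ParityGames.runs_filterSuccs s kR _ (fun w => s.arr attA w 0 = 0) (by decide) (by simp)
    (fun s' _ h => by simp [h])).call ?_
  rintro t₁ s₁ ⟨ht₁, hl, ho⟩ hf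
  have hn : s₁.reg nR = s.reg nR := hf.reg nR rfl
  rw [hk] at ht₁ hl ho
  have hs₁ : State s₁ e H won := h.congr hn (hf.arr _ rfl) (hf.arr _ rfl) (hf.arr _ rfl)
  have hdeg : s.arr degA k 0 ≤ s.reg nR := by
    rw [← (hsu k hkn hkH).ncard]
    calc _ ≤ (Finset.range (s.reg nR) : Set ℕ).ncard :=
          Set.ncard_le_ncard (fun j hj => by simpa using hj.1) (Finset.finite_toSet _)
      _ = _ := by rw [Set.ncard_coe_finset, Finset.card_range]
  refine ⟨by omega, ⟨h.game.pruned hkA, ⟨hs₁.holds.inj, hs₁.holds.surj, hs₁.holds.alive,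
    hs₁.holds.col, hs₁.holds.own⟩, hs₁.win⟩, ?_⟩
  intro i hi hv
  rw [hn] at hi
  by_cases hik : i = k
  · subst hik
    refine (hsu i hi hv).filter hl ?_
    intro j
    rw [hn]
    simp only [pruned, removeEdges, Set.mem_ofPred_eq, Set.mem_sdiff, true_and]
    rw [and_assoc]
    refine and_congr_right fun hj => and_congr_right fun _ => ?_
    rw [← hA, h.holds.mem_marked hj, not_not]
  · refine (hsu i hi hv).congr (ho i hik).1 (ho i hik).2 ?_
    rw [hn]
    ext j
    simp only [pruned, removeEdges, Set.mem_ofPred_eq, Set.mem_sdiff]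
    refine and_congr_right fun hj => ⟨fun h => h.1, fun h' => ⟨h', fun h'' => hik ?_⟩⟩
    exact h.holds.inj i hi k hkn h''.1

theorem ListState.runs_prune {m k : ℕ} (h : ListState s e m H won) (hk : s.reg kR = k)
    (hkn : k < s.reg nR) (hkH : e k ∈ H.nodes) (hA : marked s e attA = H.fattr (e k))
    (hkA : e k ∉ H.fattr (e k)) :
    Runs (filterSuccs (.reg kR) (fun w => .eq (at1 attA w) (.const 0)) ;; listPreds) s 0 fun t s' =>
      t ≤ 300 * (s.reg nR + m + 1) ∧ ListState s' e m (H.pruned (e k)) won := by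
  refine Runs.call_seq (h.toState.runs_filterSuccs h.succs hk hkn hkH hA hkA) ?_
  rintro t₁ s₁ ⟨ht₁, hs₁, hsu₁⟩ hf
  have hn : s₁.reg nR = s.reg nR := hf.reg nR rfl
  refine (hs₁.runs_listPreds hsu₁ ((numEdges_mono h.game Set.sdiff_subset).trans h.edges)).call ?_
  rintro t₂ s₂ ⟨ht₂, hs₂⟩ -
  exact ⟨by omega, hs₂⟩

theorem ListState.runs_removeAttr {m : ℕ} (h : ListState s e m H won) (hp : s.reg pR = p.val)
    (hX : marked s e attA ⊆ H.nodes) :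
    Runs removeAttr s 0 fun t s' => t ≤ 1000 * (s.reg nR + m + 1) ∧
      ListState s' e m (H.removeNodes (H.attr p (marked s e attA)))
        (addWon won p (H.attr p (marked s e attA))) := by
  refine (ParityGames.runs_removeAttr s h.holds h.succs h.preds h.game hp hX _ rfl).call ?_
  rintro t s' ⟨ht, h1, h2, h3, h4⟩ hf
  have := h.edges
  exact ⟨by omega, h.toState.remove (hf.reg nR rfl) cpre_attr_subset (attr_subset_nodes hX) h1 h4,
    h2, h3, (numEdges_mono h.game (Set.sep_subset _ _)).trans h.edges⟩

theorem Ranked.of_frame {r : ℕ → ℕ → Prop} {c : Cmd} (h : Ranked s r) (hf : Frame c s s')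
    (hn : c.writesReg nR = false) (ho : c.writesArr ordA = false) (hc : c.writesArr colA = false) :
    Ranked s' r :=
  h.congr (hf.reg _ hn) (hf.arr _ ho) (hf.arr _ hc)

/-- A visit of `psol` to a node. -/
def psolVisit : Cmd :=
  .set dR (at1 colA (.reg kR)) ;;
  for' vR (.reg nR) (put1 setA (.reg vR) (.const 0)) ;;
  put1 setA (.reg kR) (.const 1) ;;
  computeMAttr ;;
  .ite (at1 attA (.reg kR))
    (removeAttr ;;
    recurse)
    (filterSuccs (.reg kR) (fun w => .eq (at1 attA w) (.const 0)) ;;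
    listPreds)

theorem ListState.runs_psolVisit {m k : ℕ} (h : ListState s e m H won) (hk : s.reg kR = k)
    (hkn : k < s.reg nR) (hkH : e k ∈ H.nodes) :
    Runs psolVisit s 0 fun t s' => t ≤ 2000 * (s.reg nR + m + 1) ∧
      (e k ∈ H.fattr (e k) ∧ s'.reg goR = 1 ∧ s'.reg iR = s.reg nR ∧
        ListState s' e m
          (H.removeNodes (H.attr (player (H.c (e k))) (H.fattr (e k))))
          (addWon won (player (H.c (e k))) (H.attr (player (H.c (e k))) (H.fattr (e k)))) ∨
       e k ∉ H.fattr (e k) ∧ s'.reg goR = s.reg goR ∧ s'.reg iR = s.reg iR ∧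
        ListState s' e m (H.pruned (e k)) won) := by
  have hck : s.arr colA k 0 = H.c (e k) := h.holds.col k hkn
  rw [psolVisit, runs_seq, runs_set]
  simp only [Expr.eval, hk, hck]
  set s₁ := s.setReg dR (H.c (e k)) with hs₁
  have hn₁ : s₁.reg nR = s.reg nR := rfl
  refine Runs.call_seq (runs_fill s₁ setA (.const 0) (fun _ => 0) (by simp) (by simp)) ?_
  rintro t₂ s₂ ⟨ht₂, hset₂⟩ hf₂
  have hn₂ : s₂.reg nR = s.reg nR := hf₂.reg nR rfl
  have hk₂ : s₂.reg kR = k := (hf₂.reg kR rfl).trans hk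
  rw [runs_seq, runs_put]
  simp only [Expr.eval, hk₂]
  set s₃ := s₂.setArr setA k 0 1 with hs₃
  have hl₃ : ListState s₃ e m H won := h.congr hn₂ (by
    intro a ha
    have h1 : s₂.arr a = s₁.arr a := hf₂.arr a (by simp at ha; rcases ha with rfl | rfl | rfl | rfl | rfl | rfl | rfl <;> rfl)
    have h2 : a ≠ setA := by
      simp at ha; rcases ha with rfl | rfl | rfl | rfl | rfl | rfl | rfl <;> decide
    simp [hs₃, h2, h1, hs₁])
  have hX₃ : marked s₃ e setA = {e k} := by
    ext v
    simp only [marked, Set.mem_ofPred_eq, Set.mem_singleton_iff]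
    constructor
    · rintro ⟨i, hi, rfl, hi'⟩
      by_contra hne
      have hik : i ≠ k := by rintro rfl; exact hne rfl
      have hi2 : i < s₁.reg nR := (show s₃.reg nR = s₁.reg nR from hn₂) ▸ hi
      simp [hs₃, hik, hset₂ i hi2] at hi'
    · rintro rfl
      exact ⟨k, by rw [show s₃.reg nR = s.reg nR from hn₂]; exact hkn, rfl, by simp [hs₃]⟩
  have hd₃ : s₃.reg dR = H.c (e k) := (hf₂.reg dR rfl).trans (by simp [hs₁])
  refine Runs.call_seq (runs_computeMAttr s₃ hl₃.holds hl₃.succs hl₃.preds h.game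
    (by rw [hX₃]; exact Set.singleton_subset_iff.2 hkH) (by rw [hX₃, hd₃]; rintro _ rfl; rfl)) ?_
  rintro t₄ s₄ ⟨ht₄, hA₄, hp₄⟩ hf₄
  rw [hX₃, hd₃] at hA₄
  change marked s₄ e attA = H.fattr (e k) at hA₄
  have hn₄ : s₄.reg nR = s.reg nR := (hf₄.reg nR rfl).trans hn₂
  have hk₄ : s₄.reg kR = k := (hf₄.reg kR rfl).trans hk₂
  have hgo : s₄.reg goR = s.reg goR := (hf₄.reg goR rfl).trans (hf₂.reg goR rfl)
  have hi₄ : s₄.reg iR = s.reg iR := (hf₄.reg iR rfl).trans (hf₂.reg iR rfl)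
  have hl₄ : ListState s₄ e m H won := hl₃.congr (hf₄.reg nR rfl) (by
    intro a ha
    exact hf₄.arr a (by simp at ha; rcases ha with rfl | rfl | rfl | rfl | rfl | rfl | rfl <;> rfl))
  have hm := h.edges
  have hn₃ : s₃.reg nR = s.reg nR := hn₂
  have hP : (at1 attA (.reg kR)).eval s₄ ≠ 0 ↔ e k ∈ H.fattr (e k) := by
    rw [← hA₄, hl₄.holds.mem_marked (hn₄ ▸ hkn)]
    simp [hk₄]
  refine Runs.ite hP (fun hkf => ?_) (fun hkf => ?_)
  · have hsub : marked s₄ e attA ⊆ H.nodes := hA₄ ▸ mattr_subset_nodes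
    refine Runs.call_seq (hl₄.runs_removeAttr (p := player (H.c (e k))) (by rw [hp₄, hd₃]; rfl) hsub) ?_
    rintro t₅ s₅ ⟨ht₅, hl₅⟩ hf₅
    rw [hA₄] at hl₅
    have hn₅ : s₅.reg nR = s.reg nR := (hf₅.reg nR rfl).trans hn₄
    rw [recurse, runs_seq, runs_set, runs_set]
    refine ⟨?_, Or.inl ⟨hkf, by simp, by simp [hn₅], hl₅.congr rfl (fun _ _ => rfl)⟩⟩
    simp at ht₂ ht₄ ⊢
    omega
  · refine (hl₄.runs_prune hk₄ (hn₄ ▸ hkn) hkH hA₄ hkf).call ?_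
    rintro t₅ s₅ ⟨ht₅, hl₅⟩ hf₅
    refine ⟨?_, Or.inr ⟨hkf, (hf₅.reg goR rfl).trans hgo, (hf₅.reg iR rfl).trans hi₄, hl₅⟩⟩
    simp at ht₂ ht₄ ⊢
    omega

/-- The for-loop over the nodes in `psol`, with the recursive call. -/
def psolLoop (visit : Cmd) : Cmd :=
  .set goR (.const 1) ;;
  .while (.reg goR)
    (.set goR (.const 0) ;;
    .set iR (.const 0) ;;
    .while (.lt (.reg iR) (.reg nR))
      (.set kR (at1 ordA (.reg iR)) ;;
      incr iR ;;
      when (alive (.reg kR)) visit))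

/-- `visit` implements a visit of `psol` to a node, where `M` says how memory represents the current
game and the outcome so far. It takes `K` steps, and `R` more for a fatal node, except for those that
are paid by a decrease of the potential `φ`. -/
structure PsolVisit (e : ℕ → α) (visit : Cmd) (n K R : ℕ)
    (M : Store → Arena α → (Fin 2 → Set α) → Prop) (φ : Store → ℕ) : Prop where
  state : ∀ s H won, M s H won → State s e H won
  setReg : ∀ s H won x m, x ∈ [goR, iR, kR] → M s H won → M (s.setReg x m) H won
  potential : ∀ s x m, x ∈ [goR, iR, kR] → φ (s.setReg x m) = φ s
  reg : visit.writesReg nR = false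
  arr : ∀ a ∈ [ordA, colA], visit.writesArr a = false
  runs : ∀ s H won k, M s H won → s.reg nR = n → s.reg kR = k → k < n → e k ∈ H.nodes →
    Runs visit s 0 fun t s' =>
      e k ∈ H.fattr (e k) ∧ s'.reg goR = 1 ∧ s'.reg iR = n ∧ t + φ s' ≤ φ s + (K + R) ∧
        M s' (H.removeNodes (H.attr (player (H.c (e k))) (H.fattr (e k))))
          (addWon won (player (H.c (e k))) (H.attr (player (H.c (e k))) (H.fattr (e k)))) ∨
      e k ∉ H.fattr (e k) ∧ s'.reg goR = s.reg goR ∧ s'.reg iR = s.reg iR ∧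
        t + φ s' ≤ φ s + K ∧ M s' (H.pruned (e k)) won

/-- Shared by both implementations of `psol`. A fatal visit ends its pass, so its surcharge `R`
arises at most once in a pass, while `K` arises for each of the n nodes. -/
theorem PsolVisit.runs_psolLoop {visit : Cmd} {n K R : ℕ}
    {M : Store → Arena α → (Fin 2 → Set α) → Prop} {φ : Store → ℕ}
    (hV : PsolVisit e visit n K R M φ) (s : Store) (hs : M s G fun _ => ∅) (hn : s.reg nR = n)
    (ho : Ranked s fun a b => ¬ a < b) :
    Runs (psolLoop visit) s 0 fun t s' =>
      t + φ s' ≤ φ s + (n + 2) * (n * (K + 50) + R + 110) ∧ ∃ H won, M s' H won ∧ Psol G ⟨H, won⟩ := by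
  have hwn := hV.reg
  have hwa := hV.arr
  rw [← hn]
  refine runs_restarts_of
    (fun s' => ∃ H won, M s' H won ∧ ∀ r, Psol H r → Psol G (r.after won))
    (fun s' => ∃ H won, M s' H won ∧ Psol G ⟨H, won⟩) φ s
    ⟨G, _, hV.setReg _ _ _ _ _ (by simp) hs, fun r hr => by simpa [Outcome.after] using hr⟩
    (hV.potential _ _ _ (by simp)) ?_
  rintro s₃ hf₃ ⟨H, won, hl₃, hc₃⟩
  have hn₃ : s₃.reg nR = n := (hf₃.reg nR (by simp [Cmd.writesReg, hwn])).trans hn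
  have ho₃ : Ranked s₃ _ := ho.of_frame hf₃ (by simp [Cmd.writesReg, hwn])
    (by simp [Cmd.writesArr, hwa]) (by simp [Cmd.writesArr, hwa])
  rw [hn, runs_seq, runs_set, runs_seq, runs_set]
  simp only [Expr.eval]
  set s₄ := (s₃.setReg goR 0).setReg iR 0 with hs₄
  have hφ₄ : φ s₄ = φ s₃ := by rw [hs₄, hV.potential _ _ _ (by simp), hV.potential _ _ _ (by simp)]
  set f := fun i => e (s₃.arr ordA i 0) with hf
  -- Either the loop is still running, and every result for the remaining list of nodes in the
  -- current game is a result for `G`; or a recursive call has been requested on a smaller game.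
  refine (runs_while
    (fun s' => s'.reg iR ≤ n ∧ ∃ H' won', M s' H' won' ∧
      (s'.reg goR = 0 ∧ s'.aliveCount = s₃.aliveCount ∧
          (∀ r, PsolLoop (listFrom f H'.nodes n (s'.reg iR)) H' r → Psol G (r.after won')) ∨
        s'.reg goR = 1 ∧ s'.reg iR = n ∧ s'.aliveCount < s₃.aliveCount ∧
          ∀ r, Psol H' r → Psol G (r.after won')))
    -- The amount `R` is held back until a fatal node sets `goR`.
    (fun s' => (K + 50) * (n - s'.reg iR) + (if s'.reg goR = 0 then R else 0) + φ s') ?_ ?_).call ?_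
  · refine ⟨by simp [hs₄], H, won, hV.setReg _ _ _ _ _ (by simp)
      (hV.setReg _ _ _ _ _ (by simp) hl₃), Or.inl ⟨rfl, rfl, ?_⟩⟩
    intro r hr
    refine hc₃ r ⟨_, ?_, hr⟩
    have := nodeOrder_listFrom (hV.state _ _ _ hl₃).holds ho₃ (by intros; omega)
    rwa [hn₃] at this
  · rintro s₅ ⟨hi₅, H', won', hl₅, hor⟩ hf₅ hb
    have hn₅ : s₅.reg nR = n := (hf₅.reg nR (by simp [Cmd.writesReg, hwn])).trans hn₃
    rw [Expr.lt_ne_zero] at hb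
    simp only [Expr.eval, hn₅] at hb
    rcases hor with ⟨hgo, hal, hc⟩ | ⟨-, h', -⟩
    swap
    · omega
    have hord : s₅.arr ordA = s₃.arr ordA := hf₅.arr ordA (by simp [Cmd.writesArr, hwa])
    set i := s₅.reg iR with hi
    have hoi := ho₃.lt i (hn₃ ▸ hb)
    rw [hn₃] at hoi
    rw [runs_seq, runs_set, runs_seq, runs_set]
    simp only [Expr.eval, Store.setReg_reg, show iR ≠ kR by decide, if_false, ← hi, hord]
    set s₆ := (s₅.setReg kR (s₃.arr ordA i 0)).setReg iR (i + 1) with hs₆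
    have hl₆ : M s₆ H' won' :=
      hV.setReg _ _ _ _ _ (by simp) (hV.setReg _ _ _ _ _ (by simp) hl₅)
    have hφ₆ : φ s₆ = φ s₅ := by
      rw [hs₆, hV.potential _ _ _ (by simp), hV.potential _ _ _ (by simp)]
    have hh₆ := (hV.state _ _ _ hl₆).holds
    have hk₆ : s₆.reg kR = s₃.arr ordA i 0 := by simp [hs₆]
    have hn₆ : s₆.reg nR = n := hn₅
    have hi₆ : s₆.reg iR = i + 1 := by simp [hs₆]
    have hgo₆ : s₆.reg goR = 0 := by rw [← hgo]; simp [hs₆]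
    have hal₆ : s₆.aliveCount = s₅.aliveCount := rfl
    obtain ⟨j, hj⟩ : ∃ j, n - i = j + 1 := ⟨n - i - 1, by omega⟩
    have hj' : n - (i + 1) = j := by omega
    refine Runs.ite (P := f i ∈ H'.nodes) ?_ (fun hP => ?_) (fun hP => ?_)
    · rw [← hh₆.alive _ (hn₆ ▸ hoi)]
      simp [hk₆]
    · rw [listFrom_of_mem hb hP] at hc
      refine (hV.runs s₆ H' won' _ hl₆ hn₆ hk₆ hoi hP).call ?_
      rintro t s₇ (⟨hfat, hgo₇, hi₇, ht, hl₇⟩ | ⟨hfat, hgo₇, hi₇, ht, hl₇⟩) hf₇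
      · have hn₇ : s₇.reg nR = s₆.reg nR := hf₇.reg nR hwn
        refine ⟨⟨hi₇.le, _, _, hl₇, Or.inr ⟨hgo₇, hi₇, ?_, ?_⟩⟩, ?_⟩
        · rw [← hal, ← hal₆]
          refine hh₆.aliveCount_lt (hV.state _ _ _ hl₇).holds hn₇ ?_
          exact removeNodes_nodes_ssubset ⟨f i, subset_attr hfat, hP⟩
        · rintro r ⟨l', hl', hr⟩
          rw [← Outcome.record_after]
          exact hc _ (.fatal hfat rfl hl' hr)
        · rw [hi₇, hgo₇, hgo, hj, Nat.sub_self, Nat.mul_add]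
          simp
          omega
      · have hn₇ : s₇.reg nR = s₆.reg nR := hf₇.reg nR hwn
        refine ⟨⟨?_, _, _, hl₇, Or.inl ⟨hgo₇.trans hgo₆, ?_, ?_⟩⟩, ?_⟩
        · rw [hi₇, hi₆]; omega
        · rw [← hal, ← hal₆]
          unfold Store.aliveCount
          rw [hn₇]
          congr 1
          refine Finset.filter_congr fun j hj => ?_
          have hj := Finset.mem_range.1 hj
          rw [hh₆.alive j hj, (hV.state _ _ _ hl₇).holds.alive j (hn₇ ▸ hj)]
          rfl
        · intro r hr
          rw [hi₇, hi₆] at hr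
          exact hc r (.next hfat hr)
        · rw [hi₇, hi₆, hgo₇, hgo₆, hgo, hj, hj', Nat.mul_add]
          simp
          omega
    · rw [listFrom_of_notMem hb hP] at hc
      rw [runs_skip]
      refine ⟨⟨by rw [hi₆]; omega, _, _, hl₆, Or.inl ⟨hgo₆, hal₆.trans hal, hi₆ ▸ hc⟩⟩, ?_⟩
      rw [hi₆, hgo₆, hgo, hφ₆, hj, hj', Nat.mul_add]
      simp
      omega
  · rintro t s₅ ⟨⟨hi₅, H', won', hl₅, hor⟩, hb, ht⟩ hf₅
    have hn₅ : s₅.reg nR = n := (hf₅.reg nR (by simp [Cmd.writesReg, hwn])).trans hn₃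
    have hi : s₅.reg iR = n := by
      by_contra h
      refine absurd hb ?_
      rw [← ne_eq, Expr.lt_ne_zero]
      simp only [Expr.eval, hn₅]
      omega
    refine ⟨?_, ?_⟩
    · rw [hφ₄] at ht
      simp [hs₄] at ht ⊢
      rw [Nat.mul_comm n (K + 50)]
      omega
    · rcases hor with ⟨hgo, hal, hc⟩ | ⟨hgo, -, hal, hc⟩
      · rw [hi, listFrom_self] at hc
        refine Or.inl ⟨hgo, hal.le, H', won', hl₅, ?_⟩
        have := hc _ (.done H')
        simpa [Outcome.after] using this
      · exact Or.inr ⟨hgo, hal, H', won', hl₅, hc⟩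

/-- No surcharge for fatal nodes is needed: removing an attractor is linear, like computing one. -/
theorem psolVisit_spec (e : ℕ → α) (n m : ℕ) :
    PsolVisit e psolVisit n (2000 * (n + m + 1)) 0 (fun s H won => ListState s e m H won)
      (fun _ => 0) where
  state s H won h := h.toState
  setReg s H won x m hx h := by
    simp only [List.mem_cons, List.not_mem_nil, or_false] at hx
    refine h.congr ?_ (fun _ _ => rfl)
    rcases hx with rfl | rfl | rfl <;> rfl
  potential _ _ _ _ := rfl
  reg := rfl
  arr := by decide
  runs s H won k h hn hk hkn hkH := by
    subst hn
    refine (h.runs_psolVisit hk hkn hkH).mono ?_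
    rintro t s' ⟨ht, ⟨h1, h2, h3, h4⟩ | ⟨h1, h2, h3, h4⟩⟩
    · exact Or.inl ⟨h1, h2, h3, by simpa using ht, h4⟩
    · exact Or.inr ⟨h1, h2, h3, by simpa using ht, h4⟩

theorem Input.runs_psol (h : Input s e G) (hG : G.IsParityGame) :
    Runs psol s 0 fun t s' =>
      t ≤ 10000 * ((s.reg nR + 1) * (s.reg nR + 2) * (s.reg nR + G.numEdges + 1)) ∧
      ∃ H won, ListState s' e G.numEdges H won ∧ Psol G ⟨H, won⟩ := by
  set n := s.reg nR with hn
  set m := G.numEdges with hm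
  refine Runs.call_seq (h.runs_start hG) ?_
  rintro t₁ s₁ ⟨ht₁, hl₁⟩ hf₁
  have hn₁ : s₁.reg nR = n := hf₁.reg nR rfl
  refine Runs.call_seq (runs_sortNodes s₁ (fun e f => .lt f e) (fun a b => b < a)
    (fun a b => by simp; ring) (fun a b s => by simp) (by intros; omega) (by intros; omega)) ?_
  rintro t₂ s₂ ⟨ht₂, ho₂⟩ hf₂
  have hn₂ : s₂.reg nR = n := (hf₂.reg nR rfl).trans hn₁
  have hl₂ : ListState s₂ e m G fun _ => ∅ := hl₁.congr (hf₂.reg nR rfl) (by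
    intro a ha
    exact hf₂.arr a (by simp at ha; rcases ha with rfl | rfl | rfl | rfl | rfl | rfl | rfl <;> rfl))
  refine ((psolVisit_spec e n m).runs_psolLoop s₂ hl₂ hn₂ ho₂).call ?_
  rintro t s' ⟨ht, h'⟩ -
  refine ⟨?_, h'⟩
  rw [hn₁] at ht₂
  have h1 : n * (2000 * (n + m + 1) + 50) + 0 + 110 ≤ 3200 * ((n + 1) * (n + m + 1)) := by nlinarith
  have h2 := Nat.mul_le_mul_left (n + 2) h1
  have h3 : 200 * (n + 1) * (n + 1) ≤ 200 * ((n + 1) * (n + 2) * (n + m + 1)) := by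
    have : (n + 1) * 1 ≤ (n + 2) * (n + m + 1) := Nat.mul_le_mul (by omega) (by omega)
    nlinarith
  have h4 : n + m + 1 ≤ (n + 1) * (n + 2) * (n + m + 1) := by
    nlinarith [Nat.zero_le (n * (n + m + 1))]
  have h5 : (n + 2) * (3200 * ((n + 1) * (n + m + 1))) =
      3200 * ((n + 1) * (n + 2) * (n + m + 1)) := by ring
  rw [h5] at h2
  omega

end ParityGames

namespace ParityGames

open Code Arena

variable {α : Type*} {s s' : Store} {e : ℕ → α} {G H : Arena α} {p : Fin 2} {won : Fin 2 → Set α}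

/-! ## Solvers that explore colors -/

/-- What the ingredients of `colorSolver` have to satisfy: `before` decides the strict linear order
`q`, `member` decides membership in `init H d`, and `attr` computes `F H d X`. -/
structure ColorSpec (before : Expr → Expr → Expr) (member : Expr → Expr) (attr : Cmd)
    (q : ℕ → ℕ → Prop) (init : Arena α → ℕ → Set α) (F : Arena α → ℕ → Set α → Set α) : Prop where
  before_cost : ∀ a b, (before a b).cost = a.cost + b.cost + 1
  before_eval : ∀ a b s, (before a b).eval s ≠ 0 ↔ q (a.eval s) (b.eval s)
  irrefl : ∀ a, ¬ q a a
  trans : ∀ a b c, q a b → q b c → q a c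
  tri : ∀ a b, ¬ q a b → ¬ q b a → a = b
  member_cost : (member (.reg vR)).cost ≤ 20
  member_eval : ∀ (s : Store) (e : ℕ → α) (H : Arena α) (i : ℕ),
    s.arr colA i 0 = H.c (e i) → s.reg vR = i → e i ∈ H.nodes →
      ((member (.reg vR)).eval s ≠ 0 ↔ e i ∈ init H (s.reg dR))
  init_subset : ∀ H d, init H d ⊆ H.nodes
  frame_reg : ∀ x ∈ [nR, dR, iR, goR, lsR], attr.writesReg x = false
  frame_arr : ∀ a ∈ [winA, colA, ownA, degA, sucA, pdgA, preA, ordA, setA, cchA],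
    attr.writesArr a = false
  runs : ∀ (s : Store) (e : ℕ → α) (m : ℕ) (H : Arena α) (won : Fin 2 → Set α),
    ListState s e m H won → Ranked s (fun a b => ¬ q b a) →
    marked s e setA ⊆ init H (s.reg dR) →
    Runs attr s 0 fun t s' => t ≤ 1000 * (s.reg nR + m + 1) ∧
      marked s' e attA = F H (s.reg dR) (marked s e setA) ∧ s'.reg pR = s.reg dR % 2
  subset : ∀ H d X, F H d X ⊆ H.nodes

/-- The body of the while-loop in `colorSolver`. -/
def fatalRound (attr : Cmd) : Cmd :=
  for' vR (.reg nR) (put1 cchA (.reg vR) (at1 setA (.reg vR))) ;;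
  attr ;;
  testFatal ;;
  .ite (.reg okR)
    (removeAttr ;;
    recurse ;;
    .set neR (.const 0))
    (for' vR (.reg nR)
        (put1 setA (.reg vR) (.and (at1 setA (.reg vR)) (at1 attA (.reg vR)))) ;;
    testSet)

theorem fatalRound_writesReg {attr : Cmd} {x : ℕ} (h : attr.writesReg x = false)
    (h' : (fatalRound .skip).writesReg x = false) : (fatalRound attr).writesReg x = false := by
  simp only [fatalRound, Cmd.writesReg, Bool.or_eq_false_iff] at h' ⊢
  tauto

theorem fatalRound_writesArr {attr : Cmd} {x : ℕ} (h : attr.writesArr x = false)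
    (h' : (fatalRound .skip).writesArr x = false) : (fatalRound attr).writesArr x = false := by
  simp only [fatalRound, Cmd.writesArr, Bool.or_eq_false_iff] at h' ⊢
  tauto

theorem ListState.of_frame {m : ℕ} {c : Cmd} (h : ListState s e m H won) (hf : Frame c s s')
    (hn : c.writesReg nR = false)
    (ha : ∀ a ∈ [winA, colA, ownA, degA, sucA, pdgA, preA], c.writesArr a = false) :
    ListState s' e m H won :=
  h.congr (hf.reg _ hn) fun a h' => hf.arr a (ha a h')

/-- The number of nodes that are marked in `setA`. -/
def Store.setCount (s : Store) : ℕ :=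
  ((Finset.range (s.reg nR)).filter fun i => s.arr setA i 0 ≠ 0).card

theorem Store.setCount_pos (h : marked s e setA ≠ ∅) : 0 < s.setCount := by
  obtain ⟨v, i, hi, -, hi'⟩ := Set.nonempty_iff_ne_empty.2 h
  exact Finset.card_pos.2 ⟨i, by simpa using ⟨hi, hi'⟩⟩

variable {before : Expr → Expr → Expr} {member : Expr → Expr} {attr : Cmd}
  {q : ℕ → ℕ → Prop} {init : Arena α → ℕ → Set α} {F : Arena α → ℕ → Set α → Set α} {m : ℕ}

-- Each round that is not fatal drops from X a node outside its attractor, so the number of rounds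
-- is at most the initial size of X, each at linear cost.
set_option maxHeartbeats 1000000 in
theorem ColorSpec.runs_fatalLoop (hS : ColorSpec before member attr q init F) (s : Store)
    (h : ListState s e m H won) (ho : Ranked s fun a b => ¬ q b a)
    (hX : marked s e setA ⊆ init H (s.reg dR)) (h01 : ∀ i < s.reg nR, s.arr setA i 0 ≤ 1)
    (hch : marked s e cchA = ∅) (hch01 : ∀ i < s.reg nR, s.arr cchA i 0 ≤ 1) :
    Runs (testSet ;; .while (.and (.reg neR) (.reg nwR)) (fatalRound attr)) s 0 fun t s' =>
      t ≤ 5000 * (s.reg nR + m + 1) * (s.setCount + 1) ∧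
      (FatalSearch (F H (s.reg dR)) (marked s e setA) ∅ none ∧ s'.reg goR = s.reg goR ∧
          s'.reg iR = s.reg iR ∧ ListState s' e m H won ∨
        ∃ W, FatalSearch (F H (s.reg dR)) (marked s e setA) ∅ (some W) ∧ W.Nonempty ∧
          W ⊆ H.nodes ∧ s'.reg goR = 1 ∧ s'.reg iR = s.reg nR ∧
          ListState s' e m (H.removeNodes (H.attr (player (s.reg dR)) W))
            (addWon won (player (s.reg dR)) (H.attr (player (s.reg dR)) W))) := by
  set n := s.reg nR with hn
  set d := s.reg dR with hd
  set X := marked s e setA with hXX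
  refine Runs.call_seq (runs_testSet h.holds h01 hch01) ?_
  rintro t₁ s₁ ⟨ht₁, hne₁, hnw₁⟩ hf₁
  have hn₁ : s₁.reg nR = n := hf₁.reg nR rfl
  have hset₁ : s₁.arr setA = s.arr setA := hf₁.arr setA rfl
  have hcch₁ : s₁.arr cchA = s.arr cchA := hf₁.arr cchA rfl
  set K := 4000 * (n + m + 1) with hK
  -- Either every result of the search from the current X and cache is a result of the entire
  -- search, or a fatal set has been found and removed, and then `neR = 0` forces the exit.
  refine (runs_while (fun s' =>
      (∀ o, FatalSearch (F H d) (marked s' e setA) (marked s' e cchA) o →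
          FatalSearch (F H d) X ∅ o) ∧ marked s' e setA ⊆ init H d ∧
        (s'.reg neR ≠ 0 ↔ marked s' e setA ≠ ∅) ∧
        (s'.reg nwR ≠ 0 ↔ marked s' e setA ≠ marked s' e cchA) ∧
        (∀ i < n, s'.arr setA i 0 ≤ 1) ∧
        s'.reg goR = s.reg goR ∧ s'.reg iR = s.reg iR ∧ ListState s' e m H won ∨
      s'.reg neR = 0 ∧ ∃ W, FatalSearch (F H d) X ∅ (some W) ∧ W.Nonempty ∧
          W ⊆ H.nodes ∧ s'.reg goR = 1 ∧ s'.reg iR = n ∧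
          ListState s' e m (H.removeNodes (H.attr (player d) W))
            (addWon won (player d) (H.attr (player d) W)))
    (fun s' => K * (if s'.reg neR = 0 then 0 else s'.setCount)) ?_ ?_).call ?_
  · have h1 : marked s₁ e setA = X := marked_congr e hn₁ hset₁
    have h2 : marked s₁ e cchA = ∅ := (marked_congr e hn₁ hcch₁).trans hch
    rw [hch] at hnw₁
    refine Or.inl ⟨?_, ?_, ?_, ?_, ?_, hf₁.reg _ rfl, hf₁.reg _ rfl,
      h.of_frame hf₁ rfl (by decide)⟩
    · rw [h1, h2]; exact fun o ho => ho
    · rw [h1]; exact hX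
    · rw [h1]; exact hne₁
    · rw [h1, h2]; exact hnw₁
    · rw [hset₁]; exact h01
  · rintro s₂ hI hf₂ hb
    rw [Expr.and_ne_zero] at hb
    simp only [Expr.eval] at hb
    rcases hI with ⟨hc, hX₂, hne₂, hnw₂, h01₂, hgo₂, hi₂, hl₂⟩ | ⟨h0, -⟩
    swap
    · exact absurd h0 hb.1
    have hw : ∀ x ∈ [nR, dR], (fatalRound attr).writesReg x = false := fun x hx =>
      fatalRound_writesReg (hS.frame_reg x (by simp at hx ⊢; tauto))
        (by simp at hx; rcases hx with rfl | rfl <;> rfl)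
    have hwa : ∀ x ∈ [ordA, colA], (fatalRound attr).writesArr x = false := fun x hx =>
      fatalRound_writesArr (hS.frame_arr x (by simp at hx ⊢; tauto))
        (by simp at hx; rcases hx with rfl | rfl <;> rfl)
    have hn₂ : s₂.reg nR = n := (hf₂.reg nR (hw _ (by simp))).trans hn₁
    have hd₂ : s₂.reg dR = d := (hf₂.reg dR (hw _ (by simp))).trans (hf₁.reg dR rfl)
    have ho₂ : Ranked s₂ fun a b => ¬ q b a := (ho.of_frame hf₁ rfl rfl rfl).congr
      (hf₂.reg nR (hw _ (by simp))) (hf₂.arr _ (hwa _ (by simp))) (hf₂.arr _ (hwa _ (by simp)))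
    have hXne : marked s₂ e setA ≠ ∅ := hne₂.1 hb.1
    have hXcc : marked s₂ e setA ≠ marked s₂ e cchA := hnw₂.1 hb.2
    set X₂ := marked s₂ e setA with hXX₂
    have hpos : 0 < s₂.setCount := Store.setCount_pos hXne
    refine Runs.call_seq (runs_fill s₂ cchA (at1 setA (.reg vR)) (fun i => s₂.arr setA i 0)
      (by simp) (fun s' k hk hx _ h _ => by simp [hx, h])) ?_
    rintro t₃ s₃ ⟨ht₃, hcch⟩ hf₃
    have hn₃ : s₃.reg nR = n := (hf₃.reg nR rfl).trans hn₂
    have hset₃ : s₃.arr setA = s₂.arr setA := hf₃.arr setA rfl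
    have hX₃ : marked s₃ e setA = X₂ := marked_congr e (hf₃.reg nR rfl) hset₃
    have hcch₃ : marked s₃ e cchA = X₂ := by
      ext u
      simp only [marked, hn₃, hXX₂, hn₂, Set.mem_ofPred_eq]
      exact exists_congr fun i => and_congr_right fun hi => by rw [hcch i (hn₂.symm ▸ hi)]
    have hd₃ : s₃.reg dR = d := (hf₃.reg dR rfl).trans hd₂
    have hl₃ := hl₂.of_frame hf₃ rfl (by decide)
    refine Runs.call_seq (hS.runs s₃ e m H won hl₃ (ho₂.of_frame hf₃ rfl rfl rfl)
      (by rw [hX₃, hd₃]; exact hX₂)) ?_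
    rintro t₄ s₄ ⟨ht₄, hA₄, hp₄⟩ hf₄
    rw [hX₃, hd₃] at hA₄
    rw [hd₃] at hp₄
    have hn₄ : s₄.reg nR = n := (hf₄.reg nR (hS.frame_reg _ (by simp))).trans hn₃
    have hset₄ : s₄.arr setA = s₂.arr setA :=
      (hf₄.arr setA (hS.frame_arr _ (by simp))).trans hset₃
    have hX₄ : marked s₄ e setA = X₂ := marked_congr e (hn₄.trans hn₂.symm) hset₄
    have hl₄ := hl₃.of_frame hf₄ (hS.frame_reg _ (by simp))
      (fun a ha => hS.frame_arr a (by simp at ha ⊢; tauto))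
    refine Runs.call_seq (runs_testFatal hl₄.holds) ?_
    rintro t₅ s₅ ⟨ht₅, hok⟩ hf₅
    rw [hX₄, hA₄] at hok
    have hn₅ : s₅.reg nR = n := (hf₅.reg nR rfl).trans hn₄
    have hl₅ := hl₄.of_frame hf₅ rfl (by decide)
    have hA₅ : marked s₅ e attA = F H d X₂ :=
      (marked_congr e (hf₅.reg nR rfl) (hf₅.arr attA rfl)).trans hA₄
    have hset₅ : s₅.arr setA = s₂.arr setA := (hf₅.arr setA rfl).trans hset₄
    refine Runs.ite (P := X₂ ⊆ F H d X₂) hok (fun hfat => ?_) (fun hfat => ?_)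
    · refine Runs.call_seq (hl₅.runs_removeAttr (p := player d) ?_ ?_) ?_
      · rw [hf₅.reg pR rfl, hp₄]; rfl
      · rw [hA₅]; exact hS.subset _ _ _
      rintro t₆ s₆ ⟨ht₆, hl₆⟩ hf₆
      rw [hA₅] at hl₆
      have hn₆ : s₆.reg nR = n := (hf₆.reg nR rfl).trans hn₅
      rw [recurse, runs_seq, runs_seq, runs_set, runs_set, runs_set]
      refine ⟨Or.inr ⟨by simp, F H d X₂, hc _ (.found ⟨hXne, hXcc⟩ hfat), ?_, hS.subset _ _ _,
        by simp, by simp [hn₆], hl₆.congr rfl (fun _ _ => rfl)⟩, ?_⟩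
      · exact (Set.nonempty_iff_ne_empty.2 hXne).mono hfat
      · simp [hb.1]
        have : K * 1 ≤ K * s₂.setCount := Nat.mul_le_mul_left _ hpos
        rw [hn₂] at ht₃
        rw [hn₃] at ht₄
        rw [hn₄] at ht₅
        rw [hn₅] at ht₆
        omega
    · refine Runs.call_seq (runs_fill s₅ setA (.and (at1 setA (.reg vR)) (at1 attA (.reg vR)))
        (fun i => if s₅.arr setA i 0 ≠ 0 ∧ s₅.arr attA i 0 ≠ 0 then 1 else 0)
        (by simp) (fun s' k hk hx _ h h' => by simp [hx, h, h'])) ?_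
      rintro t₆ s₆ ⟨ht₆, hs₆⟩ hf₆
      have hn₆ : s₆.reg nR = n := (hf₆.reg nR rfl).trans hn₅
      have hl₆ := hl₅.of_frame hf₆ rfl (by decide)
      have h01₆ : ∀ i < s₆.reg nR, s₆.arr setA i 0 ≤ 1 := by
        intro i hi
        rw [hs₆ i (by omega)]
        split_ifs <;> simp
      have hX₆ : marked s₆ e setA = X₂ ∩ F H d X₂ := by
        rw [← hA₅, ← hX₄]
        ext u
        simp only [marked, hn₆, hn₅, hn₄, Set.mem_inter_iff, Set.mem_ofPred_eq, hset₄, ← hset₅]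
        constructor
        · rintro ⟨i, hi, rfl, hi'⟩
          rw [hs₆ i (hn₅.symm ▸ hi)] at hi'
          simp only [ne_eq, ite_eq_right_iff, one_ne_zero, imp_false, not_not] at hi'
          exact ⟨⟨i, hi, rfl, hi'.1⟩, i, hi, rfl, hi'.2⟩
        · rintro ⟨⟨i, hi, rfl, hi'⟩, j, hj, hij, hj'⟩
          have := hl₅.holds.inj j (hn₅.symm ▸ hj) i (hn₅.symm ▸ hi) hij
          subst this
          refine ⟨j, hj, rfl, ?_⟩
          rw [hs₆ j (hn₅.symm ▸ hj)]
          simp [hi', hj']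
      have hcc₅ : s₅.arr cchA = s₃.arr cchA := (hf₅.arr _ rfl).trans
        (hf₄.arr _ (hS.frame_arr _ (by simp)))
      have hcc₆ : s₆.arr cchA = s₃.arr cchA := (hf₆.arr _ rfl).trans hcc₅
      have hC₆ : marked s₆ e cchA = X₂ := (marked_congr e (hn₆.trans hn₃.symm) hcc₆).trans hcch₃
      refine (runs_testSet hl₆.holds h01₆ ?_).call ?_
      · intro i hi
        rw [hn₆] at hi
        rw [hcc₆, hcch i (hn₂.symm ▸ hi)]
        exact h01₂ i hi
      rintro t₇ s₇ ⟨ht₇, hne₇, hnw₇⟩ hf₇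
      rw [hX₆] at hne₇ hnw₇
      rw [hC₆] at hnw₇
      have hn₇ : s₇.reg nR = n := (hf₇.reg nR rfl).trans hn₆
      have hset₇ : s₇.arr setA = s₆.arr setA := hf₇.arr _ rfl
      have hX₇ : marked s₇ e setA = X₂ ∩ F H d X₂ :=
        (marked_congr e (hf₇.reg nR rfl) hset₇).trans hX₆
      have hC₇ : marked s₇ e cchA = X₂ :=
        (marked_congr e (hf₇.reg nR rfl) (hf₇.arr _ rfl)).trans hC₆
      refine ⟨Or.inl ⟨?_, ?_, ?_, ?_, ?_, ?_, ?_, hl₆.of_frame hf₇ rfl (by decide)⟩, ?_⟩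
      · rw [hX₇, hC₇]
        exact fun o ho => hc o (.shrink ⟨hXne, hXcc⟩ hfat ho)
      · rw [hX₇]; exact Set.inter_subset_left.trans hX₂
      · rw [hX₇]; exact hne₇
      · rw [hX₇, hC₇]; exact hnw₇
      · rw [hset₇]; rw [hn₆] at h01₆; exact h01₆
      · rw [hf₇.reg goR rfl, hf₆.reg goR rfl, hf₅.reg goR rfl,
          hf₄.reg goR (hS.frame_reg _ (by simp)), hf₃.reg goR rfl, hgo₂]
      · rw [hf₇.reg iR rfl, hf₆.reg iR rfl, hf₅.reg iR rfl,
          hf₄.reg iR (hS.frame_reg _ (by simp)), hf₃.reg iR rfl, hi₂]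
      -- A node of X outside the attractor witnesses the strict decrease.
      · have hlt : s₇.setCount + 1 ≤ s₂.setCount := by
          refine Finset.card_lt_card ⟨fun i hi => ?_, fun hsub => ?_⟩
          · simp only [Finset.mem_filter, Finset.mem_range, hn₇, hn₂, hset₇] at hi ⊢
            rw [hs₆ i (hn₅.symm ▸ hi.1), hset₅] at hi
            simp only [ne_eq, ite_eq_right_iff, one_ne_zero, imp_false, not_not] at hi
            exact ⟨hi.1, hi.2.1⟩
          · obtain ⟨v, hv, hv'⟩ := Set.not_subset.1 hfat
            obtain ⟨i, hi, rfl, hi'⟩ := hv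
            have : i ∈ (Finset.range (s₇.reg nR)).filter fun i => s₇.arr setA i 0 ≠ 0 :=
              hsub (by simpa using ⟨hi, hi'⟩)
            simp only [Finset.mem_filter, Finset.mem_range, hn₇, hset₇] at this
            rw [hs₆ i (hn₅.symm ▸ this.1)] at this
            simp only [ne_eq, ite_eq_right_iff, one_ne_zero, imp_false, not_not] at this
            rw [← hA₅] at hv'
            exact hv' ((hl₅.holds.mem_marked (hn₅.symm ▸ this.1)).2 this.2.2)
        have h8 : (if s₇.reg neR = 0 then 0 else s₇.setCount) ≤ s₇.setCount := by
          split_ifs <;> omega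
        have h9 := Nat.mul_le_mul_left K (h8.trans (Nat.le_sub_one_of_lt hlt))
        rw [if_neg hb.1]
        obtain ⟨j, hj⟩ : ∃ j, s₂.setCount = j + 1 := ⟨s₂.setCount - 1, by omega⟩
        rw [hj, Nat.add_sub_cancel] at h9
        rw [hj, Nat.mul_add]
        rw [hn₂] at ht₃
        rw [hn₃] at ht₄
        rw [hn₄] at ht₅
        rw [hn₅] at ht₆
        rw [hn₆] at ht₇
        simp only [Expr.cost]
        omega
  · rintro t s₂ ⟨hI, hb, ht⟩ hf₂
    constructor
    · have h1 : (if s₁.reg neR = 0 then 0 else s₁.setCount) ≤ s.setCount := by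
        have : s₁.setCount = s.setCount := by simp [Store.setCount, hn₁, hset₁, hn]
        split_ifs <;> omega
      have h2 := Nat.mul_le_mul_left K h1
      simp only [Expr.cost] at ht
      rw [hK] at ht h2
      have h3 : 5000 * (n + m + 1) * (s.setCount + 1) =
        4000 * (n + m + 1) * s.setCount + 1000 * ((n + m + 1) * s.setCount) + 5000 * (n + m + 1) := by ring
      omega
    · rcases hI with ⟨hc, hX₂, hne₂, hnw₂, h01₂, hgo₂, hi₂, hl₂⟩ | ⟨-, h'⟩
      · refine Or.inl ⟨hc _ (.exit ?_), hgo₂, hi₂, hl₂⟩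
        by_contra hcon
        simp only [not_or] at hcon
        refine absurd hb ?_
        rw [← ne_eq, Expr.and_ne_zero]
        exact ⟨hne₂.2 hcon.1, hnw₂.2 hcon.2⟩
      · exact Or.inr h'

end ParityGames

/-! ### One pass through the colors, and its cost -/

namespace ParityGames

open Code Arena

variable {α : Type*} {s s' : Store} {e : ℕ → α} {G H : Arena α} {p : Fin 2} {won : Fin 2 → Set α}

variable {before : Expr → Expr → Expr} {member : Expr → Expr} {attr : Cmd}
  {q : ℕ → ℕ → Prop} {init : Arena α → ℕ → Set α} {F : Arena α → ℕ → Set α → Set α} {m : ℕ}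

/-- `ds` lists the colors of `G` in the order `q`. -/
def ColorOrder (q : ℕ → ℕ → Prop) (G : Arena α) (ds : List ℕ) : Prop :=
  (∀ d, d ∈ ds ↔ d ∈ G.colors) ∧ ds.Pairwise q

/-- The outcomes of a solver that explores the colors in the order `q`. -/
def ColorSolves (q : ℕ → ℕ → Prop) (init : Arena α → ℕ → Set α)
    (F : Arena α → ℕ → Set α → Set α) (G : Arena α) (r : Outcome α) : Prop :=
  ∃ ds, ColorOrder q G ds ∧ ColorLoop (ColorOrder q) init F ds G r

/-- A visit of `colorSolver` to a node with a new color. -/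
def colorVisit (member : Expr → Expr) (attr : Cmd) : Cmd :=
  .set lsR (.succ (.reg dR)) ;;
  for' vR (.reg nR)
    (put1 setA (.reg vR) (.and (alive (.reg vR)) (member (.reg vR))) ;;
     put1 cchA (.reg vR) (.const 0)) ;;
  testSet ;;
  .while (.and (.reg neR) (.reg nwR)) (fatalRound attr)

-- The bound `b` for the size of the initial set becomes the bound for the number of rounds; `b + 1`
-- also covers the initialization.
open Classical in
theorem ColorSpec.runs_colorVisit (hS : ColorSpec before member attr q init F) (s : Store)
    (h : ListState s e m H won) (ho : Ranked s fun a b => ¬ q b a) {b : ℕ}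
    (hb : ((Finset.range (s.reg nR)).filter fun i => e i ∈ init H (s.reg dR)).card ≤ b) :
    Runs (colorVisit member attr) s 0 fun t s' =>
      t ≤ 6000 * (s.reg nR + m + 1) * (b + 1) ∧ s'.reg lsR = s.reg dR + 1 ∧
        s'.reg nR = s.reg nR ∧
      (FatalSearch (F H (s.reg dR)) (init H (s.reg dR)) ∅ none ∧ s'.reg goR = s.reg goR ∧
          s'.reg iR = s.reg iR ∧ ListState s' e m H won ∨
        ∃ W, FatalSearch (F H (s.reg dR)) (init H (s.reg dR)) ∅ (some W) ∧ W.Nonempty ∧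
          W ⊆ H.nodes ∧ s'.reg goR = 1 ∧ s'.reg iR = s.reg nR ∧
          ListState s' e m (H.removeNodes (H.attr (player (s.reg dR)) W))
            (addWon won (player (s.reg dR)) (H.attr (player (s.reg dR)) W))) := by
  set n := s.reg nR with hn
  set d := s.reg dR with hd
  rw [colorVisit, runs_seq, runs_set]
  simp only [Expr.eval]
  set s₁ := s.setReg lsR (s.reg dR + 1) with hs₁
  have hl₁ : ListState s₁ e m H won := h.congr rfl (fun _ _ => rfl)
  have hn₁ : s₁.reg nR = n := rfl
  have hmc := hS.member_cost
  refine Runs.call_seq (runs_for_const (N := n) (fun k s' => ∀ i < k, s'.arr cchA i 0 = 0 ∧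
      s'.arr setA i 0 ≤ 1 ∧ (s'.arr setA i 0 ≠ 0 ↔ e i ∈ init H d)) 60 rfl
      (fun _ _ _ h => h) (by simp) ?_ ?_) ?_
  · rintro k s' - - - hf
    exact hf.reg nR rfl
  · rintro k s₂ hk hI hx hf₂
    have hl₂ : ListState s₂ e m H won := hl₁.of_frame hf₂ rfl (by
      intro a ha; simp at ha; rcases ha with rfl | rfl | rfl | rfl | rfl | rfl | rfl <;> rfl)
    have hn₂ : s₂.reg nR = n := hf₂.reg nR rfl
    have hd₂ : s₂.reg dR = d := hf₂.reg dR rfl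
    have hev : (Expr.and (alive (.reg vR)) (member (.reg vR))).eval s₂ =
        if e k ∈ init H d then 1 else 0 := by
      have hk₂ : k < s₂.reg nR := by omega
      have h1 : (alive (.reg vR)).eval s₂ ≠ 0 ↔ e k ∈ H.nodes := by
        rw [← hl₂.holds.alive k hk₂]; simp [hx]
      rw [Expr.eval]
      refine if_congr ?_ rfl rfl
      rw [h1]
      constructor
      · rintro ⟨hk, hm⟩
        rw [← hd₂]
        exact (hS.member_eval s₂ e H k (hl₂.holds.col k hk₂) hx hk).1 hm
      · intro hk
        refine ⟨hS.init_subset _ _ hk, ?_⟩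
        rw [hS.member_eval s₂ e H k (hl₂.holds.col k hk₂) hx (hS.init_subset _ _ hk), hd₂]
        exact hk
    rw [runs_seq, runs_put, runs_put, hev]
    refine ⟨?_, ?_⟩
    · intro i hi
      by_cases hik : i = k
      · subst hik
        simp [hx]
        split_ifs <;> simp
      · simpa [hx, hik] using hI i (by omega)
    · simp; omega
  · rintro t₃ s₃ ⟨hI, ht₃⟩ hf₃
    have hl₃ : ListState s₃ e m H won := hl₁.of_frame hf₃ rfl (by
      intro a ha; simp at ha; rcases ha with rfl | rfl | rfl | rfl | rfl | rfl | rfl <;> rfl)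
    have hn₃ : s₃.reg nR = n := hf₃.reg nR rfl
    have hd₃ : s₃.reg dR = d := hf₃.reg dR rfl
    have hX₃ : marked s₃ e setA = init H d := by
      ext v
      constructor
      · rintro ⟨i, hi, rfl, hi'⟩
        exact (hI i (by omega)).2.2.1 hi'
      · intro hv
        obtain ⟨i, hi, rfl⟩ := hl₃.holds.surj v (hS.init_subset _ _ hv)
        exact ⟨i, hi, rfl, (hI i (by omega)).2.2.2 hv⟩
    have hC₃ : marked s₃ e cchA = ∅ := by
      ext v
      simp only [Set.mem_empty_iff_false, iff_false]
      rintro ⟨i, hi, -, hi'⟩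
      exact hi' (hI i (by omega)).1
    have hcnt : s₃.setCount ≤ b := by
      refine le_trans (le_of_eq ?_) hb
      unfold Store.setCount
      rw [hn₃]
      congr 1
      exact Finset.filter_congr fun i hi => (hI i (Finset.mem_range.1 hi)).2.2
    refine (hS.runs_fatalLoop s₃ hl₃ ((ho.congr rfl rfl rfl : Ranked s₁ _).of_frame hf₃ rfl rfl rfl)
      (by rw [hX₃, hd₃]) (fun i hi => (hI i (by omega)).2.1) hC₃
      (fun i hi => by rw [(hI i (by omega)).1]; exact Nat.zero_le _)).call ?_
    rintro t₄ s₄ ⟨ht₄, hres⟩ hf₄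
    have hw : ∀ x ∈ [lsR, nR],
        (testSet ;; .while (.and (.reg neR) (.reg nwR)) (fatalRound attr)).writesReg x = false := by
      intro x hx
      have h1 : (fatalRound attr).writesReg x = false :=
        fatalRound_writesReg (hS.frame_reg x (by simp at hx ⊢; tauto))
          (by simp at hx; rcases hx with rfl | rfl <;> rfl)
      have h2 : testSet.writesReg x = false := by simp at hx; rcases hx with rfl | rfl <;> rfl
      rw [Cmd.writesReg, Cmd.writesReg, h1, h2]; rfl
    rw [hX₃, hd₃, hn₃, show s₃.reg goR = s.reg goR from hf₃.reg goR rfl,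
      show s₃.reg iR = s.reg iR from hf₃.reg iR rfl] at hres
    refine ⟨?_, (hf₄.reg lsR (hw _ (by simp))).trans ((hf₃.reg lsR rfl).trans (by simp [hs₁, hd])),
      (hf₄.reg nR (hw _ (by simp))).trans hn₃, hres⟩
    rw [hn₃] at ht₄
    have h1 : 5000 * (n + m + 1) * (s₃.setCount + 1) ≤ 5000 * (n + m + 1) * (b + 1) :=
      Nat.mul_le_mul_left _ (by omega)
    have h2 : 6000 * (n + m + 1) * (b + 1) =
      5000 * (n + m + 1) * (b + 1) + 1000 * ((n + m + 1) * b) + 1000 * (n + m + 1) := by ring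
    simp at ht₃ ⊢
    omega

/-- The colors that are still to be explored when the for-loop of `colorSolver` is at position `i`,
and `ls - 1` is the last color that was explored. -/
def pending (s : Store) (i ls : ℕ) : Finset ℕ :=
  ((Finset.range (s.reg nR)).image fun i => s.arr colA i 0).filter fun d =>
    (∃ l < s.reg nR, i ≤ l ∧ s.arr colA (s.arr ordA l 0) 0 = d) ∧ ls ≠ d + 1

theorem pending_end (ls : ℕ) : pending s (s.reg nR) ls = ∅ := by
  ext d
  simp only [pending, Finset.mem_filter, Finset.notMem_empty, iff_false, not_and]
  rintro - ⟨l, h1, h2, -⟩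
  omega

theorem mem_pending (ho : Ranked s fun a b => ¬ q b a) {i ls d : ℕ} : d ∈ pending s i ls ↔
    (∃ l < s.reg nR, i ≤ l ∧ s.arr colA (s.arr ordA l 0) 0 = d) ∧ ls ≠ d + 1 := by
  simp only [pending, Finset.mem_filter, Finset.mem_image, Finset.mem_range, and_iff_right_iff_imp]
  rintro ⟨⟨l, hl, -, h⟩, -⟩
  exact ⟨_, ho.lt l hl, h⟩

/-- A color that was explored last does not occur again after a different one. -/
theorem ColorSpec.last_ne (hS : ColorSpec before member attr q init F)
    (ho : Ranked s fun a b => ¬ q b a) {i ls d l : ℕ} (hi : i < s.reg nR)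
    (hls : ls = 0 ∨ ∃ l < i, s.arr colA (s.arr ordA l 0) 0 + 1 = ls)
    (hd : s.arr colA (s.arr ordA i 0) 0 ≠ d) (hl : i ≤ l) (hln : l < s.reg nR)
    (h : s.arr colA (s.arr ordA l 0) 0 = d) : ls ≠ d + 1 := by
  rintro rfl
  rcases hls with h0 | ⟨l', hl', h'⟩
  · omega
  have h1 := ho.sorted l' i hl' hi
  have hil : i ≠ l := by rintro rfl; exact hd h
  have h2 := ho.sorted i l (by omega) hln
  rw [h] at h2
  rw [show s.arr colA (s.arr ordA l' 0) 0 = d by omega] at h1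
  exact hd (hS.tri _ _ h1 h2)

-- A sorted list without its repetitions is strictly sorted. Such a list is needed as a witness for
-- the colors that a pass has not explored.
open Classical in
theorem ColorSpec.exists_colors (hS : ColorSpec before member attr q init F)
    (ho : Ranked s fun a b => ¬ q b a) (P : ℕ → Prop) (i ls : ℕ) :
    ∃ ds : List ℕ, (∀ d, d ∈ ds ↔ (∃ l < s.reg nR, i ≤ l ∧ P l ∧
        s.arr colA (s.arr ordA l 0) 0 = d) ∧ ls ≠ d + 1) ∧ ds.Pairwise q := by
  set l₀ := (((List.range (s.reg nR)).filter fun l => decide (i ≤ l ∧ P l)).map fun l =>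
    s.arr colA (s.arr ordA l 0) 0).filter fun d => decide (ls ≠ d + 1) with hl₀
  refine ⟨l₀.dedup, fun d => ?_, ?_⟩
  · simp only [hl₀, List.mem_dedup, List.mem_filter, List.mem_map, List.mem_range, decide_eq_true_eq]
    refine and_congr_left fun _ => exists_congr fun l => by tauto
  · have h1 : l₀.Pairwise fun a b => ¬ q b a := by
      refine List.Pairwise.filter _ (List.pairwise_map.2 (List.Pairwise.filter _ ?_))
      refine List.pairwise_lt_range.imp_of_mem ?_
      intro a b _ hb hab
      exact ho.sorted a b hab (List.mem_range.1 hb)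
    refine ((h1.sublist (List.dedup_sublist l₀)).and (List.nodup_dedup l₀)).imp ?_
    rintro a b ⟨h1, h2⟩
    by_contra h3
    exact h2 (hS.tri _ _ h3 h1)

/-- One pass of `colorSolver` through the nodes. -/
def colorPass (member : Expr → Expr) (attr : Cmd) : Cmd :=
  .set goR (.const 0) ;;
  .set iR (.const 0) ;;
  .set lsR (.const 0) ;;
  .while (.lt (.reg iR) (.reg nR))
    (.set kR (at1 ordA (.reg iR)) ;;
    incr iR ;;
    .set dR (at1 colA (.reg kR)) ;;
    when (.and (alive (.reg kR)) (.eq (.eq (.reg lsR) (.succ (.reg dR))) (.const 0)))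
      (colorVisit member attr))

theorem colorPass_writesReg {x : ℕ} (h : attr.writesReg x = false)
    (h' : (colorPass member .skip).writesReg x = false) :
    (colorPass member attr).writesReg x = false := by
  simp only [colorPass, colorVisit, fatalRound, Cmd.writesReg, Bool.or_eq_false_iff] at h' ⊢
  tauto

theorem colorPass_writesArr {x : ℕ} (h : attr.writesArr x = false)
    (h' : (colorPass member .skip).writesArr x = false) :
    (colorPass member attr).writesArr x = false := by
  simp only [colorPass, colorVisit, fatalRound, Cmd.writesArr, Bool.or_eq_false_iff] at h' ⊢
  tauto

-- The program runs over nodes, the pseudo-code over colors. Since equal colors are adjacent,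
-- comparing with the last explored color suffices to visit each color once, and the cost of a pass
-- is a sum over colors.
open Classical in
theorem ColorSpec.runs_colorPass (hS : ColorSpec before member attr q init F) (s : Store)
    (h : ListState s e m H won) (ho : Ranked s fun a b => ¬ q b a) (b : ℕ → ℕ) 
    (hb : ∀ d, ((Finset.range (s.reg nR)).filter fun i => e i ∈ init H d).card ≤ b d)
    (hc : ∀ r, ColorSolves q init F H r → ColorSolves q init F G (r.after won)) :
    Runs (colorPass member attr) s 0 fun t s' =>
      t ≤ 7000 * (s.reg nR + m + 1) * ((∑ d ∈ pending s 0 0, (b d + 1)) + 1) ∧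
      ∃ H' won', ListState s' e m H' won' ∧
        (s'.reg goR = 0 ∧ s'.aliveCount ≤ s.aliveCount ∧ ColorSolves q init F G ⟨H', won'⟩ ∨
          s'.reg goR = 1 ∧ s'.aliveCount < s.aliveCount ∧
            ∀ r, ColorSolves q init F H' r → ColorSolves q init F G (r.after won')) := by
  set n := s.reg nR with hn
  set K := 7000 * (n + m + 1) with hK
  set f := fun l => e (s.arr ordA l 0) with hf
  set col := fun l => s.arr colA (s.arr ordA l 0) 0 with hcol
  have hcf : ∀ l < n, col l = H.c (f l) := fun l hl => h.holds.col _ (ho.lt l hl)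
  rw [colorPass, runs_seq, runs_set, runs_seq, runs_set, runs_seq, runs_set]
  simp only [Expr.eval]
  set s₁ := ((s.setReg goR 0).setReg iR 0).setReg lsR 0 with hs₁
  have hw : ∀ x ∈ [nR], (colorPass member attr).writesReg x = false := fun x hx =>
    colorPass_writesReg (hS.frame_reg x (by simp at hx ⊢; tauto)) (by simp at hx; subst hx; rfl)
  have hwa : ∀ x ∈ [ordA, colA], (colorPass member attr).writesArr x = false := fun x hx =>
    colorPass_writesArr (hS.frame_arr x (by simp at hx ⊢; tauto))
      (by simp at hx; rcases hx with rfl | rfl <;> rfl)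
  -- The colors still to be explored are those of the current nodes at positions from `iR` on, apart
  -- from the last explored one. The value `lsR = 0` cannot be confused with a color, as `lsR`
  -- stores successors of colors.
  refine (runs_while (fun s' => s'.reg iR ≤ n ∧
    (s'.reg goR = 0 ∧ ListState s' e m H won ∧
        (s'.reg lsR = 0 ∨ ∃ l < s'.reg iR, col l + 1 = s'.reg lsR) ∧
        (∀ ds r, (∀ d, d ∈ ds ↔ (∃ l < n, s'.reg iR ≤ l ∧ f l ∈ H.nodes ∧ col l = d) ∧
            s'.reg lsR ≠ d + 1) → ds.Pairwise q → ColorLoop (ColorOrder q) init F ds H r →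
          ColorSolves q init F G (r.after won)) ∨
      s'.reg goR = 1 ∧ s'.reg iR = n ∧ s'.aliveCount < s.aliveCount ∧
        ∃ H' won', ListState s' e m H' won' ∧
          ∀ r, ColorSolves q init F H' r → ColorSolves q init F G (r.after won')))
    (fun s' => K * (∑ d ∈ pending s (s'.reg iR) (s'.reg lsR), (b d + 1)) + 100 * (n - s'.reg iR))
    ?_ ?_).call ?_
  · refine ⟨Nat.zero_le _, Or.inl ⟨rfl, h.congr rfl (fun _ _ => rfl), Or.inl rfl, ?_⟩⟩
    intro ds r hds hpw hr
    refine hc r ⟨ds, ⟨fun d => (hds d).trans ?_, hpw⟩, hr⟩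
    constructor
    · rintro ⟨⟨l, hl, -, hf, rfl⟩, -⟩
      exact ⟨_, hf, (hcf l hl).symm⟩
    · rintro ⟨v, hv, rfl⟩
      obtain ⟨i, hi, rfl⟩ := h.holds.surj v hv
      obtain ⟨l, hl, rfl⟩ := ho.surj i hi
      exact ⟨⟨l, hl, Nat.zero_le _, hv, hcf l hl⟩, (Nat.succ_ne_zero _).symm⟩
  · rintro s₂ ⟨hi₂, hI⟩ hf₂ hbt
    have hsub : ∀ x, (colorPass member attr).writesReg x = false →
        (Cmd.while (.lt (.reg iR) (.reg nR))
          (.set kR (at1 ordA (.reg iR)) ;; incr iR ;; .set dR (at1 colA (.reg kR)) ;;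
          when (.and (alive (.reg kR)) (.eq (.eq (.reg lsR) (.succ (.reg dR))) (.const 0)))
            (colorVisit member attr))).writesReg x = false := by
      intro x hx
      simp only [colorPass, Cmd.writesReg, Bool.or_eq_false_iff] at hx ⊢
      tauto
    have hn₂ : s₂.reg nR = n := hf₂.reg nR (hsub _ (hw _ (by simp)))
    have ho₂ : s₂.arr ordA = s.arr ordA := hf₂.arr ordA (hwa ordA (by simp))
    have hc₂ : s₂.arr colA = s.arr colA := hf₂.arr colA (hwa colA (by simp))
    rw [Expr.lt_ne_zero] at hbt
    simp only [Expr.eval, hn₂] at hbt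
    rcases hI with ⟨hgo, hl₂, hls, hcont⟩ | ⟨-, hin, -⟩
    swap
    · omega
    set i := s₂.reg iR with hi
    have hoi := ho.lt i hbt
    rw [runs_seq, runs_set, runs_seq, runs_set, runs_seq, runs_set]
    simp only [Expr.eval, Store.setReg_reg, Store.setReg_arr, if_true, show iR ≠ kR by decide, show kR ≠ iR by decide, if_false, ← hi, ho₂, hc₂]
    set s₃ := ((s₂.setReg kR (s.arr ordA i 0)).setReg iR (i + 1)).setReg dR
      (s.arr colA (s.arr ordA i 0) 0) with hs₃
    have hn₃ : s₃.reg nR = n := hn₂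
    have hk₃ : s₃.reg kR = s.arr ordA i 0 := by simp [hs₃]
    have hi₃ : s₃.reg iR = i + 1 := by simp [hs₃]
    have hd₃ : s₃.reg dR = col i := by simp [hs₃, hcol]
    have hls₃ : s₃.reg lsR = s₂.reg lsR := by simp [hs₃]
    have hgo₃ : s₃.reg goR = 0 := by rw [← hgo]; simp [hs₃]
    have hl₃ : ListState s₃ e m H won := hl₂.congr rfl (fun _ _ => rfl)
    have hal₃ : s₃.aliveCount = s₂.aliveCount := rfl
    set ls := s₂.reg lsR with hlss
    refine Runs.ite (P := f i ∈ H.nodes ∧ ls ≠ col i + 1) ?_ (fun hP => ?_) (fun hP => ?_)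
    · rw [Expr.and_ne_zero, ← hl₃.holds.alive (s.arr ordA i 0) (by omega)]
      simp [hk₃, hls₃, hd₃]
    -- The remaining colors are the color at position `i` followed by those that remain after it; by
    -- `last_ne` a color that was explored earlier does not come back.
    · have hstep : ∀ d, (∃ l < n, i ≤ l ∧ f l ∈ H.nodes ∧ col l = d) ∧ ls ≠ d + 1 ↔
          d = col i ∨ (∃ l < n, i + 1 ≤ l ∧ f l ∈ H.nodes ∧ col l = d) ∧ col i + 1 ≠ d + 1 := by
        intro d
        constructor
        · rintro ⟨⟨l, h1, h2, h3, h4⟩, h5⟩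
          by_cases hd : d = col i
          · exact Or.inl hd
          · refine Or.inr ⟨⟨l, h1, ?_, h3, h4⟩, by omega⟩
            rcases h2.lt_or_eq with h | rfl
            · exact h
            · exact absurd h4.symm hd
        · rintro (rfl | ⟨⟨l, h1, h2, h3, h4⟩, h5⟩)
          · exact ⟨⟨i, hbt, le_rfl, hP.1, rfl⟩, hP.2⟩
          · refine ⟨⟨l, h1, by omega, h3, h4⟩, ?_⟩
            exact hS.last_ne ho hbt hls (fun h => h5 (by rw [← h])) (by omega) h1 h4
      have hcons : ∀ ds, (∀ d, d ∈ ds ↔ (∃ l < n, i + 1 ≤ l ∧ f l ∈ H.nodes ∧ col l = d) ∧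
          col i + 1 ≠ d + 1) → ds.Pairwise q → ∀ r,
          ColorLoop (ColorOrder q) init F (col i :: ds) H r → 
          ColorSolves q init F G (r.after won) := by
        intro ds hds hpw r hr
        refine hcont (col i :: ds) r (fun d => ?_) (List.pairwise_cons.2 ⟨fun d hd => ?_, hpw⟩) hr
        · rw [List.mem_cons, hds, hstep]
        · obtain ⟨⟨l, h1, h2, -, rfl⟩, h5⟩ := (hds d).1 hd
          by_contra hq
          exact h5 (congrArg (· + 1) (hS.tri _ _ hq (ho.sorted i l h2 h1)))
      have hpend : insert (col i) (pending s (i + 1) (col i + 1)) ⊆ pending s i ls := by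
        intro d hd
        rw [mem_pending ho]
        rcases Finset.mem_insert.1 hd with rfl | hd
        · exact ⟨⟨i, hbt, le_rfl, rfl⟩, hP.2⟩
        · obtain ⟨⟨l, h1, h2, h3⟩, h4⟩ := (mem_pending ho).1 hd
          refine ⟨⟨l, h1, by omega, h3⟩, ?_⟩
          exact hS.last_ne ho hbt hls (fun h => h4 (by rw [← h])) (by omega) h1 h3
      -- An explored color leaves `pending`, so its share of the sum pays for its search. Colors of
      -- removed nodes are counted as well, which only enlarges the bound.
      have hsum : (b (col i) + 1) + ∑ d ∈ pending s (i + 1) (col i + 1), (b d + 1) ≤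
          ∑ d ∈ pending s i ls, (b d + 1) := by
        rw [← Finset.sum_insert (f := fun d => b d + 1)]
        · exact Finset.sum_le_sum_of_subset hpend
        · rw [mem_pending ho]
          exact fun h => h.2 rfl
      have hKs := Nat.mul_le_mul_left K hsum
      rw [Nat.mul_add] at hKs
      have hKe : K * (b (col i) + 1) = 6000 * (n + m + 1) * (b (col i) + 1) +
        1000 * ((n + m + 1) * b (col i)) + 1000 * (n + m + 1) := by rw [hK]; ring
      refine (hS.runs_colorVisit s₃ hl₃ (ho.congr hn₂ ho₂ hc₂ : Ranked s₃ _) (b := b (col i)) ?_).call ?_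
      · rw [hn₃, hd₃]; exact hb _
      rintro t s₄ ⟨ht, hls₄, hn₄, ⟨hW, hgo₄, hi₄, hl₄⟩ | ⟨W, hW, hWne, hWH, hgo₄, hi₄, hl₄⟩⟩ -
      · rw [hd₃] at hW hls₄
        rw [hi₃] at hi₄
        refine ⟨⟨by omega, Or.inl ⟨hgo₄.trans hgo₃, hl₄, ?_, ?_⟩⟩, ?_⟩
        · rw [hi₄, hls₄]
          exact Or.inr ⟨i, by omega, rfl⟩
        · rw [hi₄, hls₄]
          intro ds r hds hpw hr
          exact hcons ds hds hpw r (.next hW hr)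
        · rw [hi₄, hls₄]
          rw [hn₃] at ht
          simp only [Expr.cost]
          omega
      · rw [hd₃] at hW hl₄
        rw [hn₃] at hi₄
        refine ⟨⟨hi₄.le, Or.inr ⟨hgo₄, hi₄, ?_, _, _, hl₄, ?_⟩⟩, ?_⟩
        · refine (hl₃.holds.aliveCount_lt hl₄.holds hn₄ (removeNodes_nodes_ssubset ?_)).trans_eq ?_
          · obtain ⟨w, hw⟩ := hWne
            exact ⟨w, subset_attr hw, hWH hw⟩
          · have hwin := h.holds.alive
            unfold Store.aliveCount
            rw [hn₃, ← hn]
            refine congrArg _ (Finset.filter_congr fun j hj => ?_)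
            have hj := Finset.mem_range.1 hj
            rw [h.holds.alive j hj, hl₃.holds.alive j (by omega)]
        · rintro r ⟨ds', hds', hr⟩
          rw [← Outcome.record_after]
          -- After the recursive call the rest of the color list is never looked at, but the loop
          -- rule needs some list that fits.
          obtain ⟨ds, h1, h2⟩ := hS.exists_colors ho (fun l => f l ∈ H.nodes) (i + 1) (col i + 1)
          exact hcons ds h1 h2 _ (.fatal hW rfl hds' hr)
        · rw [hi₄, hn, pending_end, ← hn]
          rw [hn₃] at ht
          simp only [Expr.cost, Finset.sum_empty]
          omega
    · rw [runs_skip]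
      have hsum : ∑ d ∈ pending s (i + 1) ls, (b d + 1) ≤ ∑ d ∈ pending s i ls, (b d + 1) := by
        refine Finset.sum_le_sum_of_subset fun d hd => ?_
        rw [mem_pending ho] at hd ⊢
        obtain ⟨⟨l, h1, h2, h3⟩, h4⟩ := hd
        exact ⟨⟨l, h1, by omega, h3⟩, h4⟩
      have hKs := Nat.mul_le_mul_left K hsum
      refine ⟨⟨by omega, Or.inl ⟨hgo₃, hl₃, ?_, ?_⟩⟩, ?_⟩
      · rw [hi₃, hls₃]
        exact hls.imp_right fun ⟨l, hl, h⟩ => ⟨l, by omega, h⟩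
      · rw [hi₃, hls₃]
        intro ds r hds
        refine hcont ds r fun d => (hds d).trans ?_
        constructor
        · rintro ⟨⟨l, h1, h2, h3⟩, h4⟩
          exact ⟨⟨l, h1, by omega, h3⟩, h4⟩
        · rintro ⟨⟨l, h1, h2, h3, rfl⟩, h4⟩
          refine ⟨⟨l, h1, ?_, h3, rfl⟩, h4⟩
          rcases h2.lt_or_eq with h | rfl
          · exact h
          · exact absurd ⟨h3, h4⟩ hP
      · rw [hi₃, hls₃]
        simp only [Expr.cost]
        omega
  · rintro t s₂ ⟨⟨hi₂, hI⟩, hbt, ht⟩ hf₂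
    have hsub : ∀ x, (colorPass member attr).writesReg x = false →
        (Cmd.while (.lt (.reg iR) (.reg nR))
          (.set kR (at1 ordA (.reg iR)) ;; incr iR ;; .set dR (at1 colA (.reg kR)) ;;
          when (.and (alive (.reg kR)) (.eq (.eq (.reg lsR) (.succ (.reg dR))) (.const 0)))
            (colorVisit member attr))).writesReg x = false := by
      intro x hx
      simp only [colorPass, Cmd.writesReg, Bool.or_eq_false_iff] at hx ⊢
      tauto
    have hn₂ : s₂.reg nR = n := hf₂.reg nR (hsub _ (hw _ (by simp)))
    have hin : s₂.reg iR = n := by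
      by_contra hne
      refine absurd hbt ?_
      rw [← ne_eq, Expr.lt_ne_zero]
      simp only [Expr.eval, hn₂]
      omega
    constructor
    · rw [show s₁.reg iR = 0 by simp [hs₁], show s₁.reg lsR = 0 by simp [hs₁]] at ht
      simp only [Expr.cost] at ht ⊢
      rw [Nat.mul_add]
      omega
    · rcases hI with ⟨hgo, hl₂, -, hcont⟩ | ⟨hgo, -, hal, H', won', hl', hc'⟩
      · refine ⟨H, won, hl₂, Or.inl ⟨hgo, le_of_eq ?_, ?_⟩⟩
        · unfold Store.aliveCount
          rw [hn₂, ← hn]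
          refine congrArg _ (Finset.filter_congr fun j hj => ?_)
          have hj := Finset.mem_range.1 hj
          rw [h.holds.alive j hj, hl₂.holds.alive j (by omega)]
        · have := hcont [] ⟨H, fun _ => ∅⟩ (fun d => ?_) List.Pairwise.nil (.done H)
          · simpa [Outcome.after] using this
          · simp only [List.not_mem_nil, false_iff, hin]
            rintro ⟨⟨l, h1, h2, -⟩, -⟩
            omega
      · exact ⟨H', won', hl', Or.inr ⟨hgo, hal, hc'⟩⟩

-- The number `S` bounds the rounds of a pass uniformly in all later games, because the initial sets
-- are bounded by `b` in every game that memory can hold.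
open Classical in
theorem ColorSpec.runs_colorSolver (hS : ColorSpec before member attr q init F) (s : Store)
    (h : Input s e G) (hG : G.IsParityGame) (b : ℕ → ℕ) {S : ℕ}
    (hb : ∀ (s' : Store) (H : Arena α), Holds s' e H → s'.reg nR = s.reg nR →
      s'.arr colA = s.arr colA → ∀ d,
      ((Finset.range (s.reg nR)).filter fun i => e i ∈ init H d).card ≤ b d)
    (hbS : ∑ d ∈ (Finset.range (s.reg nR)).image fun i => s.arr colA i 0, (b d + 1) ≤ S) :
    Runs (colorSolver before member attr) s 0 fun t s' =>
      t ≤ 10000 * ((s.reg nR + 2) * (s.reg nR + G.numEdges + 1) * (S + 1)) ∧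
      ∃ H won, ListState s' e G.numEdges H won ∧ ColorSolves q init F G ⟨H, won⟩ := by
  set n := s.reg nR with hn
  set m := G.numEdges with hm
  refine Runs.call_seq (h.runs_start hG) ?_
  rintro t₁ s₁ ⟨ht₁, hl₁⟩ hf₁
  have hn₁ : s₁.reg nR = n := hf₁.reg nR rfl
  refine Runs.call_seq (runs_sortNodes s₁ before q hS.before_cost hS.before_eval
    (fun a b c h1 h2 h3 => ?_) (fun a b h1 h2 => hS.irrefl _ (hS.trans _ _ _ h1 h2))) ?_
  · by_cases hab : q a b
    · exact h2 (hS.trans _ _ _ h3 hab)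
    · exact h2 (hS.tri _ _ hab h1 ▸ h3)
  rintro t₂ s₂ ⟨ht₂, ho₂⟩ hf₂
  have hsw : ∀ x, (sortNodes before).writesArr x = (x == ordA) := by
    intro x; simp [sortNodes, Cmd.writesArr]
  have hsr : (sortNodes before).writesReg nR = false := by
    simp [sortNodes, Cmd.writesReg]
  have hn₂ : s₂.reg nR = n := (hf₂.reg nR hsr).trans hn₁
  have hl₂ : ListState s₂ e m G fun _ => ∅ := hl₁.of_frame hf₂ hsr (by
    intro a ha; rw [hsw]; simp at ha; rcases ha with rfl | rfl | rfl | rfl | rfl | rfl | rfl <;> rfl)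
  have hc₂ : s₂.arr colA = s.arr colA := (hf₂.arr _ (by rw [hsw]; rfl)).trans (hf₁.arr _ rfl)
  have hw : ∀ x ∈ [nR], (colorPass member attr).writesReg x = false := fun x hx =>
    colorPass_writesReg (hS.frame_reg x (by simp at hx ⊢; tauto)) (by simp at hx; subst hx; rfl)
  have hwa : ∀ x ∈ [ordA, colA], (colorPass member attr).writesArr x = false := fun x hx =>
    colorPass_writesArr (hS.frame_arr x (by simp at hx ⊢; tauto))
      (by simp at hx; rcases hx with rfl | rfl <;> rfl)
  refine (runs_restarts (body := colorPass member attr) (B := 7000 * (n + m + 1) * (S + 1))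
    (ColorSolves q init F) s₂ hl₂ ?_).call ?_
  · intro s₃ H won hf₃ hl₃ hc₃
    have hn₃' : s₃.reg nR = s₂.reg nR := hf₃.reg nR (by
      have := hw nR (by simp); simpa [Cmd.writesReg] using this)
    have hn₃ : s₃.reg nR = n := hn₃'.trans hn₂
    have hcol₃ : s₃.arr colA = s₂.arr colA := hf₃.arr colA (by
      have := hwa colA (by simp); simpa [Cmd.writesArr] using this)
    have hord₃ : s₃.arr ordA = s₂.arr ordA := hf₃.arr ordA (by
      have := hwa ordA (by simp); simpa [Cmd.writesArr] using this)
    refine (hS.runs_colorPass s₃ hl₃ (ho₂.congr hn₃' hord₃ hcol₃) b ?_ hc₃).mono ?_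
    · rw [hn₃]
      exact hb s₃ H hl₃.holds hn₃ (hcol₃.trans hc₂)
    · rintro t s₄ ⟨ht, h₄⟩
      refine ⟨ht.trans ?_, h₄⟩
      rw [hn₃]
      refine Nat.mul_le_mul_left _ (Nat.add_le_add_right (le_trans ?_ hbS) 1)
      refine Finset.sum_le_sum_of_subset fun d hd => ?_
      have := Finset.mem_of_mem_filter d hd
      rwa [hn₃, hcol₃, hc₂] at this
  · rintro t s' ⟨ht, h'⟩ -
    refine ⟨?_, h'⟩
    rw [hn₂] at ht
    rw [hn₁] at ht₂
    have e1 : (n + 2) * (7000 * (n + m + 1) * (S + 1) + 10) =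
      7000 * ((n + 2) * (n + m + 1) * (S + 1)) + 10 * (n + 2) := by ring
    have e2 : (n + 2) * 1 ≤ (n + 2) * ((n + m + 1) * (S + 1)) :=
      Nat.mul_le_mul_left _ (Nat.mul_pos (by omega) (by omega))
    have e3 : (n + 1) * (n + 1) ≤ (n + 2) * (n + m + 1) * (S + 1) :=
      le_trans (Nat.mul_le_mul (by omega) (by omega)) (Nat.le_mul_of_pos_right _ (by omega))
    have e4 : n + m + 1 ≤ (n + 2) * (n + m + 1) * (S + 1) :=
      le_trans (Nat.le_mul_of_pos_left _ (by omega)) (Nat.le_mul_of_pos_right _ (by omega))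
    rw [← mul_assoc] at e2
    rw [e1] at ht
    rw [mul_assoc] at ht₂
    omega

end ParityGames

namespace ParityGames

open Code Arena

variable {α : Type*} {s s' : Store} {e : ℕ → α} {G H : Arena α} {p : Fin 2} {won : Fin 2 → Set α}

/-! ## The solvers `psolB` and `psolQ` -/

theorem colorSpec_psolB : ColorSpec (α := α) (fun e f => .lt f e)
    (fun v => .eq (at1 colA v) (.reg dR)) computeMAttr (fun a b => b < a)
    (fun G d => {v ∈ G.nodes | G.c v = d}) (fun G d X => G.mattr (player d) X d) where
  before_cost a b := by simp; ring
  before_eval a b s := by simp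
  irrefl a := lt_irrefl a
  trans a b c h h' := h'.trans h
  tri a b h h' := by omega
  member_cost := by simp
  member_eval s e H i hc hv hi := by simp [hv, hc, hi]
  init_subset H d v hv := hv.1
  frame_reg := by decide
  frame_arr := by decide
  runs s e m H won h ho hX := by
    refine (runs_computeMAttr s h.holds h.succs h.preds h.game (fun v hv => (hX hv).1)
      (fun v hv => (hX hv).2)).mono ?_
    rintro t s' ⟨ht, h'⟩
    have := h.edges
    exact ⟨by omega, h'⟩
  subset H d X := mattr_subset_nodes

theorem colorSpec_psolQ : ColorSpec (α := α) (fun e f => .lt e f)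
    (fun v => .and (le (at1 colA v) (.reg dR)) (.eq (.parity (at1 colA v)) (.parity (.reg dR))))
    computeLayeredAttr (fun a b => a < b)
    (fun G b => {v ∈ G.nodes | G.c v ≤ b ∧ G.c v % 2 = b % 2})
    (fun G b X => G.layeredAttr (player b) X) where
  before_cost a b := by simp
  before_eval a b s := by simp
  irrefl a := lt_irrefl a
  trans a b c h h' := h.trans h'
  tri a b h h' := by omega
  member_cost := by simp
  member_eval s e H i hc hv hi := by
    rw [Expr.and_ne_zero, Expr.lt_ne_zero, Expr.eq_ne_zero]
    simp [hv, hc, hi]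
  init_subset H d v hv := hv.1
  frame_reg := by decide
  frame_arr := by decide
  runs s e m H won h ho hX := by
    refine (runs_computeLayeredAttr s h.holds h.succs h.preds h.game (fun v hv => (hX hv).1)
      (fun v hv => (hX hv).2.2) ⟨ho.lt, ho.inj, fun i j h1 h2 => not_lt.1 (ho.sorted i j h1 h2)⟩).mono ?_
    rintro t s' ⟨ht, h'⟩
    have := h.edges
    exact ⟨by omega, h'⟩
  subset H d X := layer_subset_nodes

theorem Input.image_col (h : Input s e G) :
    ((Finset.range (s.reg nR)).image fun i => s.arr colA i 0).card = G.numColors := by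
  rw [numColors, ← Set.ncard_coe_finset]
  congr 1
  ext d
  simp only [Finset.coe_image, Finset.coe_range, Set.mem_image, Set.mem_Iio, colors]
  constructor
  · rintro ⟨i, hi, rfl⟩
    exact ⟨e i, h.mem i hi, (h.col i hi).symm⟩
  · rintro ⟨v, hv, rfl⟩
    obtain ⟨i, hi, rfl⟩ := h.surj v hv
    exact ⟨i, hi, h.col i hi⟩

theorem Input.runs_psolB (h : Input s e G) (hG : G.IsParityGame) :
    Runs psolB s 0 fun t s' =>
      t ≤ 10000 * ((s.reg nR + 2) * (s.reg nR + G.numEdges + 1) * (2 * s.reg nR + 1)) ∧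
      ∃ H won, ListState s' e G.numEdges H won ∧ PsolB G ⟨H, won⟩ := by
  refine colorSpec_psolB.runs_colorSolver s h hG
    (fun d => ((Finset.range (s.reg nR)).filter fun i => s.arr colA i 0 = d).card) ?_ ?_
  · intro s' H hs' hn hc d
    refine Finset.card_le_card fun i hi => ?_
    simp only [Finset.mem_filter, Finset.mem_range] at hi ⊢
    refine ⟨hi.1, ?_⟩
    rw [← hc, hs'.col i (by omega)]
    exact hi.2.2
  -- The color classes partition the n nodes, and there are at most n colors; so a pass has at most
  -- 2n rounds.
  · rw [Finset.sum_add_distrib, ← Finset.card_eq_sum_card_image]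
    have := Finset.card_image_le (s := Finset.range (s.reg nR)) (f := fun i => s.arr colA i 0)
    simp at this ⊢
    omega

/-- The initial set for a color contains nodes of smaller colors too, so a node can take part in the
searches of many colors, and each search is only bounded by n. -/
theorem Input.runs_psolQ (h : Input s e G) (hG : G.IsParityGame) :
    Runs psolQ s 0 fun t s' =>
      t ≤ 10000 * ((s.reg nR + 2) * (s.reg nR + G.numEdges + 1) *
        (G.numColors * (s.reg nR + 1) + 1)) ∧
      ∃ H won, ListState s' e G.numEdges H won ∧ PsolQ G ⟨H, won⟩ := by
  refine colorSpec_psolQ.runs_colorSolver s h hG (fun _ => s.reg nR) ?_ ?_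
  · intro s' H hs' hn hc d
    exact (Finset.card_le_card (@Finset.filter_subset _ _ (_) _)).trans (by simp)
  · rw [Finset.sum_const, h.image_col, smul_eq_mul]

/-! ## Running times -/

/-- The game without nodes. -/
def emptyGame : Arena Unit := ⟨fun _ => ∅, ∅, fun _ => 0⟩

theorem emptyGame_isParityGame : emptyGame.IsParityGame := by
  constructor <;> simp [emptyGame, nodes]

/-- The analysis works with an inverse `e` of the numbering. Its values outside the range are
arbitrary, hence the nonemptiness of `α`. -/
theorem exists_input [Nonempty α] {ν : α → ℕ} (hG : G.IsParityGame) (h : IsInput s ν G) :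
    ∃ e : ℕ → α, Input s e G ∧ (∀ i < s.reg nR, ν (e i) = i) ∧ ∀ v ∈ G.nodes, ν v < s.reg nR := by
  obtain ⟨⟨hmaps, hinj, hsurj⟩, hcol, hown, hnd, hsucc⟩ := h
  have hsurj' : ∀ i : ℕ, ∃ v, i < s.reg nR → v ∈ G.nodes ∧ ν v = i := by
    intro i
    by_cases hi : i < s.reg nR
    · obtain ⟨v, hv, h⟩ := hsurj hi
      exact ⟨v, fun _ => ⟨hv, h⟩⟩
    · exact ⟨Classical.arbitrary α, fun h => absurd h hi⟩
  choose e he using hsurj'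
  have hν : ∀ v ∈ G.nodes, ν v < s.reg nR := fun v hv => hmaps hv
  have heν : ∀ v ∈ G.nodes, e (ν v) = v := fun v hv =>
    hinj (he _ (hν v hv)).1 hv (he _ (hν v hv)).2
  refine ⟨e, ⟨fun i hi j hj hij => ?_, fun i hi => (he i hi).1, fun v hv => ⟨_, hν v hv, heν v hv⟩,
    fun i hi => ?_, fun i hi p hp => ?_, fun i hi hv => ?_⟩, fun i hi => (he i hi).2, hν⟩
  · rw [← (he i hi).2, hij, (he j hj).2]
  · rw [← hcol _ (he i hi).1, (he i hi).2]
  · rw [← hown p _ hp, (he i hi).2]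
  · have h1 := hnd _ hv
    have h2 := hsucc _ hv
    rw [(he i hi).2] at h1 h2
    refine ⟨h1, fun j => (h2 j).trans ?_⟩
    constructor
    · rintro ⟨w, hw, rfl⟩
      have hwn : w ∈ G.nodes := (hG.edges hw).2
      exact ⟨hν w hwn, by rw [heν w hwn]; exact hw⟩
    · rintro ⟨hj, hj'⟩
      exact ⟨e j, hj', (he j hj).2⟩

theorem State.isOutput {ν : α → ℕ} (h : State s e H won) (hsu : HoldsSuccs s e H)
    (hG : ∀ v ∈ G.nodes, ∃ i < s.reg nR, e i = v) (hν : ∀ i < s.reg nR, ν (e i) = i) :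
    IsOutput s ν G ⟨H, won⟩ := by
  refine ⟨⟨fun v hv => ?_, fun p v hv => ?_, fun v hv => ?_, fun v hv j => ?_⟩, fun v hv => ?_,
    fun p v hv => ?_⟩
  · obtain ⟨i, hi, rfl⟩ := h.holds.surj v hv
    rw [hν i hi]; exact h.holds.col i hi
  · obtain ⟨i, hi, rfl⟩ := h.holds.surj v (mem_nodes_of_V hv)
    rw [hν i hi]; exact h.holds.own i hi p hv
  · obtain ⟨i, hi, rfl⟩ := h.holds.surj v hv
    rw [hν i hi]; exact (hsu i hi hv).1
  · obtain ⟨i, hi, rfl⟩ := h.holds.surj v hv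
    rw [hν i hi]
    refine ((hsu i hi hv).2 j).trans ?_
    constructor
    · rintro ⟨hj, hj'⟩
      exact ⟨e j, hj', hν j hj⟩
    · rintro ⟨w, hw, rfl⟩
      obtain ⟨j, hj, rfl⟩ := h.holds.surj w (h.game.edges hw).2
      rw [hν j hj]
      exact ⟨hj, hw⟩
  · obtain ⟨i, hi, rfl⟩ := hG v hv
    rw [hν i hi]; exact h.holds.alive i hi
  · obtain ⟨i, hi, rfl⟩ := hG v hv
    rw [hν i hi]; exact h.win i hi p

/-- A program computes an outcome of a solver, for every game in memory. -/
theorem RunsWithin.of_runs {P : Cmd} {solver : Arena α → Outcome α → Prop} {T T₀ : ℕ}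
    (hG : G.IsParityGame) (hP : P.writesReg nR = false)
    (h : ∀ s e, Input s e G → Runs P s 0 fun t s' => t ≤ T ∧
      ∃ H won, State s' e H won ∧ HoldsSuccs s' e H ∧ solver G ⟨H, won⟩)
    (h₀ : ∀ s e, Input s e emptyGame → Runs P s 0 fun t _ => t ≤ T₀) (hT : T₀ ≤ T)
    (hs : G.nodes = ∅ → solver G ⟨G, fun _ => ∅⟩) : RunsWithin P solver G T := by
  intro ν s hin
  rcases isEmpty_or_nonempty α with hα | hα
  -- If `α` is empty there is no map from `ℕ` to `α`. The program sees zero nodes, so its running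
  -- time is taken from the empty game on the one-point type.
  · have hn : s.reg 0 = 0 := by
      by_contra hne
      obtain ⟨v, -⟩ := hin.1.2.2 (Set.mem_Iio.2 (Nat.pos_of_ne_zero hne))
      exact hα.elim v
    obtain ⟨t, s', hx, ht⟩ := h₀ s (fun _ => ()) ⟨by simp [hn], by simp [hn],
      by simp [emptyGame, nodes], by simp [hn], by simp [hn], fun i hi => by simp [hn] at hi⟩
    refine ⟨t, s', hx, by omega, _, hs (Set.eq_empty_of_isEmpty _), ⟨?_, ?_, ?_, ?_⟩, ?_, ?_⟩
    · exact fun v => hα.elim v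
    · exact fun _ v => hα.elim v
    · exact fun v => hα.elim v
    · exact fun v => hα.elim v
    · exact fun v => hα.elim v
    · exact fun _ v => hα.elim v
  · obtain ⟨e, he, hν, hν'⟩ := exists_input hG hin
    obtain ⟨t, s', hx, ht, H, won, hst, hsu, hr⟩ := h s e he
    have hn : s'.reg nR = s.reg nR := hx.frame.reg _ hP
    exact ⟨t, s', hx, by omega, _, hr, hst.isOutput hsu (by rw [hn]; exact he.surj)
      (by rw [hn]; exact hν)⟩

theorem psol_of_nodes_empty (h : G.nodes = ∅) : Psol G ⟨G, fun _ => ∅⟩ :=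
  ⟨[], ⟨List.nodup_nil, by simp [h], List.Pairwise.nil⟩, .done G⟩

theorem psolB_of_nodes_empty (h : G.nodes = ∅) : PsolB G ⟨G, fun _ => ∅⟩ :=
  ⟨[], ⟨by simp [colors, h], List.Pairwise.nil⟩, .done G⟩

theorem psolQ_of_nodes_empty (h : G.nodes = ∅) : PsolQ G ⟨G, fun _ => ∅⟩ :=
  ⟨[], ⟨by simp [colors, h], List.Pairwise.nil⟩, .done G⟩

theorem Input.numColors_pos (h : Input s e G) (hn : 0 < s.reg nR) : 0 < G.numColors := by
  rw [← h.image_col]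
  exact Finset.card_pos.2 ⟨_, Finset.mem_image_of_mem _ (Finset.mem_range.2 hn)⟩

theorem Input.numEdges_eq_zero (h : Input s e G) (hG : G.IsParityGame) (hn : s.reg nR = 0) :
    G.numEdges = 0 := by
  have : G.nodes = ∅ := by
    ext v
    simp only [Set.mem_empty_iff_false, iff_false]
    intro hv
    obtain ⟨i, hi, -⟩ := h.surj v hv
    omega
  have hE : G.E = ∅ := by
    have := hG.edges
    simpa [‹G.nodes = ∅›] using this
  simp [numEdges, hE]

/-- `psol` and `psolB` run in time `O(|V|² |E|)`. -/
theorem bound_psol {n m K : ℕ} (h : n ≤ m) (h0 : n = 0 → m = 0) (hK : K ≤ 2 * n + 2) :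
    10000 * ((n + 2) * (n + m + 1) * K) ≤ 400000 * (n ^ 2 * m + 1) := by
  rcases Nat.eq_zero_or_pos n with rfl | hn
  · rw [h0 rfl]; omega
  · have h1 : n + 2 ≤ 3 * n := by omega
    have h2 : n + m + 1 ≤ 3 * m := by omega
    have h3 : K ≤ 4 * n := by omega
    -- For n > 0 the factors are at most 3n, 3m and 4n, so 10000 · 36 = 360000 is below the
    -- constant.
    have := Nat.mul_le_mul (Nat.mul_le_mul h1 h2) h3
    nlinarith

theorem bound_psolQ {n m k : ℕ} (h : n ≤ m) (h0 : n = 0 → m = 0 ∧ k = 0) (hk : 0 < n → 0 < k) :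
    10000 * ((n + 2) * (n + m + 1) * (k * (n + 1) + 1)) ≤ 400000 * (n ^ 2 * m * k + 1) := by
  rcases Nat.eq_zero_or_pos n with rfl | hn
  · obtain ⟨rfl, rfl⟩ := h0 rfl; omega
  · have hk := hk hn
    have h1 : n + 2 ≤ 3 * n := by omega
    have h2 : n + m + 1 ≤ 3 * m := by omega
    have h3 : k * (n + 1) + 1 ≤ 3 * (k * n) := by nlinarith
    have := Nat.mul_le_mul (Nat.mul_le_mul h1 h2) h3
    have e1 : 3 * n * (3 * m) * (3 * (k * n)) = 27 * (n ^ 2 * m * k) := by ring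
    omega

theorem Input.numNodes_le (h : Input s e G) (hG : G.IsParityGame) : s.reg nR ≤ G.numEdges :=
  h.reg_eq ▸ numNodes_le_numEdges hG

theorem runsWithin_psol (hG : G.IsParityGame) :
    RunsWithin psol Psol G (400000 * (G.numNodes ^ 2 * G.numEdges + 1)) := by
  refine .of_runs (T₀ := 400000) hG rfl (fun s e h => (h.runs_psol hG).mono ?_)
    (fun s e h => (h.runs_psol emptyGame_isParityGame).mono ?_) (by omega) psol_of_nodes_empty
  · rintro t s' ⟨ht, H, won, hl, hr⟩
    refine ⟨ht.trans ?_, H, won, hl.toState, hl.succs, hr⟩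
    rw [← h.reg_eq]
    refine le_trans (le_of_eq ?_) (bound_psol (h.numNodes_le hG) (h.numEdges_eq_zero hG)
      (show s.reg nR + 1 ≤ _ by omega))
    ring
  · rintro t s' ⟨ht, -⟩
    rw [h.reg_eq] at ht
    simp [emptyGame, numNodes, numEdges, nodes] at ht
    omega

theorem runsWithin_psolB (hG : G.IsParityGame) :
    RunsWithin psolB PsolB G (400000 * (G.numNodes ^ 2 * G.numEdges + 1)) := by
  refine .of_runs (T₀ := 400000) hG rfl (fun s e h => (h.runs_psolB hG).mono ?_)
    (fun s e h => (h.runs_psolB emptyGame_isParityGame).mono ?_) (by omega) psolB_of_nodes_empty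
  · rintro t s' ⟨ht, H, won, hl, hr⟩
    refine ⟨ht.trans ?_, H, won, hl.toState, hl.succs, hr⟩
    rw [← h.reg_eq]
    exact bound_psol (h.numNodes_le hG) (h.numEdges_eq_zero hG) (by omega)
  · rintro t s' ⟨ht, -⟩
    rw [h.reg_eq] at ht
    simp [emptyGame, numNodes, numEdges, nodes] at ht
    omega

theorem runsWithin_psolQ (hG : G.IsParityGame) :
    RunsWithin psolQ PsolQ G (400000 * (G.numNodes ^ 2 * G.numEdges * G.numColors + 1)) := by
  refine .of_runs (T₀ := 400000) hG rfl (fun s e h => (h.runs_psolQ hG).mono ?_)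
    (fun s e h => (h.runs_psolQ emptyGame_isParityGame).mono ?_) (by omega) psolQ_of_nodes_empty
  · rintro t s' ⟨ht, H, won, hl, hr⟩
    refine ⟨ht.trans ?_, H, won, hl.toState, hl.succs, hr⟩
    rw [← h.reg_eq]
    refine bound_psolQ (h.numNodes_le hG) (fun hn => ⟨h.numEdges_eq_zero hG hn, ?_⟩)
      h.numColors_pos
    rw [← h.image_col, hn]; simp
  · rintro t s' ⟨ht, -⟩
    rw [h.reg_eq] at ht
    simp [emptyGame, numNodes, numEdges, nodes, numColors, colors] at ht
    omega

end ParityGames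

/-! ### Monotone attractors in the later games of a run -/

namespace ParityGames

namespace Arena

variable {α : Type*} {G H : Arena α} {p : Fin 2} {X Y Z A B T : Set α} {d : ℕ}

/-! ## Attractors in smaller games -/

theorem mem_cpre {v : α} : v ∈ G.cpre p X ↔ v ∈ G.V p ∧ (∃ w, (v, w) ∈ G.E ∧ w ∈ X) ∨
    v ∈ G.V (1 - p) ∧ ∀ w, (v, w) ∈ G.E → w ∈ X := Iff.rfl

theorem mem_cpre_removeNodes {v : α} : v ∈ (G.removeNodes A).cpre p X ↔ v ∉ A ∧
    (v ∈ G.V p ∧ (∃ w, (v, w) ∈ G.E ∧ w ∉ A ∧ w ∈ X) ∨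
      v ∈ G.V (1 - p) ∧ ∀ w, (v, w) ∈ G.E → w ∉ A → w ∈ X) := by
  simp only [mem_cpre, removeNodes, Set.mem_sdiff, Set.mem_ofPred_eq]
  grind -ring

/-- The owner of the node decides: one player picks a successor in one set, while the other has all
successors in the other set. -/
theorem IsParityGame.not_mem_cpre (hG : G.IsParityGame) {v : α} (h : v ∈ G.cpre p X)
    (h' : v ∈ G.cpre (1 - p) Y) (hXY : Disjoint X Y) : False := by
  have h1 : v ∈ G.V p → v ∉ G.V (1 - p) := hG.not_mem_V
  rw [mem_cpre] at h h'
  rw [fin2_sub_sub] at h'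
  have := Set.disjoint_left.1 hXY
  grind -ring

/-- An ordinary attractor is a monotone one without color restriction, plus its target; so facts
about `mattr` carry over. -/
theorem attr_eq_union : G.attr p X = X ∪ G.mattr p X 0 := by
  apply subset_antisymm
  · refine attr_subset Set.subset_union_left fun v hv => Or.inr ?_
    rw [Set.union_comm] at hv
    exact mem_mattr.2 ⟨Nat.zero_le _, hv⟩
  · refine Set.union_subset subset_attr (mattr_subset fun v hv => ?_)
    have := (mem_mpre.1 hv).2
    rw [Set.union_eq_self_of_subset_right subset_attr] at this
    exact cpre_attr_subset this

theorem mattr_subset_attr : G.mattr p X d ⊆ G.attr p X :=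
  mattr_subset fun _ hv => cpre_attr_subset
    (G.cpre_mono p (Set.union_subset le_rfl subset_attr) (mem_mpre.1 hv).2)

theorem attr_mattr (h : X ⊆ G.mattr p X d) : G.attr p (G.mattr p X d) = G.attr p X :=
  subset_antisymm (attr_subset mattr_subset_attr cpre_attr_subset) (attr_mono h)

/-- Removing a set that is closed for player `p` preserves monotone attractors of `p`. -/
theorem mattr_sdiff_subset (hA : G.cpre p A ⊆ A) :
    G.mattr p X d \ A ⊆ (G.removeNodes A).mattr p (X \ A) d := by
  rw [Set.sdiff_subset_iff]
  refine mattr_subset fun v hv => ?_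
  obtain ⟨hd, hv⟩ := mem_mpre.1 hv
  by_cases hvA : v ∈ A
  · exact Or.inl hvA
  refine Or.inr (mem_mattr.2 ⟨hd, mem_cpre_removeNodes.2 ⟨hvA, ?_⟩⟩)
  have := mt (@hA v) hvA
  rw [mem_cpre] at this hv
  simp only [Set.mem_union, Set.mem_sdiff] at hv ⊢
  grind -ring

/-- If neither the attractor nor its target meets `A`, the player's moves towards the target survive
the removal, and the opponent can only lose moves. -/
theorem mattr_subset_removeNodes (h : Disjoint (G.mattr p X d) A) (hX : Disjoint X A) :
    G.mattr p X d ⊆ (G.removeNodes A).mattr p X d := by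
  refine mattr_induct fun v hv hd hv' => mem_mattr.2 ⟨hd, mem_cpre_removeNodes.2 ?_⟩
  have h1 := Set.disjoint_left.1 h
  have h2 := Set.disjoint_left.1 hX
  refine ⟨h1 hv, ?_⟩
  rw [mem_cpre] at hv'
  simp only [Set.mem_union, Set.mem_inter_iff] at hv' ⊢
  grind -ring

/-- A remaining node of the opponent of `p` has no edge into a set that is closed for this opponent,
so it regains no escape when the set is put back. -/
theorem mattr_removeNodes_subset (hG : G.IsParityGame) (hA : G.cpre (1 - p) A ⊆ A) :
    (G.removeNodes A).mattr p X d ⊆ G.mattr p X d := by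
  refine mattr_subset fun v hv => ?_
  obtain ⟨hd, hv⟩ := mem_mpre.1 hv
  refine mem_mattr.2 ⟨hd, ?_⟩
  rw [mem_cpre_removeNodes] at hv
  have h1 := mt (@hA v) hv.1
  have h2 : v ∈ G.V p → v ∉ G.V (1 - p) := hG.not_mem_V
  rw [mem_cpre, fin2_sub_sub] at h1
  rw [mem_cpre]
  grind -ring

/-! ## Persistence of the sets that are computed by `psol` -/

/-- Pruning at `k'` removes only moves from `k'` into its own attractor. This could harm `fattr k`
only if the attracting player owns `k'` and uses such a move, which is shown to be impossible. -/
theorem fattr_subset_pruned (hG : G.IsParityGame) {k k' : α} (hk' : k' ∉ G.fattr k') :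
    G.fattr k ⊆ (G.pruned k').fattr k := by
  set p := player (G.c k) with hp
  set Z := (G.pruned k').fattr k with hZ
  have hZm : ∀ v, v ∈ Z ↔ G.c k ≤ G.c v ∧ v ∈ (G.pruned k').cpre p (Z ∪ {k}) :=
    fun v => mem_mattr
  have hne : ∀ v X, v ≠ k' → (v ∈ (G.pruned k').cpre p X ↔ v ∈ G.cpre p X) := by
    intro v X hv
    simp [mem_cpre, pruned, removeEdges, hv]
  refine mattr_subset fun v hv => ?_
  obtain ⟨hd, hv⟩ := mem_mpre.1 hv
  by_contra hvZ
  refine mt (hZm v).2 hvZ ⟨hd, ?_⟩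
  by_cases hvk : v = k'
  swap
  · exact (hne v _ hvk).2 hv
  subst hvk
  -- If the opponent owns the node, fewer moves make attraction easier.
  rcases hv with ⟨hvp, w, hw, hwZ⟩ | ⟨hvp, hw⟩
  swap
  · exact Or.inr ⟨hvp, fun w hw' => hw hw'.1⟩
  refine Or.inl ⟨hvp, w, ⟨hw, fun hwM => ?_⟩, hwZ⟩
  have hwM : w ∈ G.fattr v := hwM.2
  rcases fin2_eq_or p (player (G.c v)) with hpp | hpp
  -- If both nodes have the same parity, the owner of `k'` could move to `w` in `fattr k'`, and `k'`
  -- would attract itself.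
  · exact hk' (mem_mattr.2 ⟨le_rfl, Or.inl ⟨hpp ▸ hvp, w, hw, Or.inl hwM⟩⟩)
  have hlt : G.c k < G.c v := by
    refine hd.lt_of_ne fun h => fin2_sub_ne p ?_
    rw [← hpp, ← h]
  -- For different parities `c k < c k'`. Nodes of the opponent's attractor to `k'` have colors
  -- above `c k`, so `k` is not among them. Nor is a node of `Z`: there the opponent would force the
  -- play out of `Z ∪ {k}` while the player forces it in. So `w` cannot lie in both sets.
  have : G.fattr v ⊆ (Z ∪ {k})ᶜ := by
    refine mattr_induct fun u hu hdu huc hu' => ?_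
    have huk : u ≠ k := by rintro rfl; omega
    have huZ : u ∈ Z := hu'.resolve_right huk
    have huv : u ≠ v := by rintro rfl; exact hvZ huZ
    have h1 := (hne u _ huv).1 ((hZm u).1 huZ).2
    rw [hpp] at huc
    refine hG.not_mem_cpre h1 huc (Set.disjoint_left.2 ?_)
    rintro x hx (hx' | rfl)
    · exact hx'.2 hx
    · rcases hx with hx | rfl
      · exact hvZ hx
      · omega
  exact this hwM hwZ

end Arena
end ParityGames

namespace ParityGames

namespace Arena

variable {α : Type*} {G H : Arena α} {p q : Fin 2} {X Y Z A B D T : Set α} {d e : ℕ}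

/-! ## Fatal sets -/

/-- `B` is a nonempty set of nodes of color `d` that is contained in its own monotone attractor. -/
structure IsFatal (G : Arena α) (p : Fin 2) (d : ℕ) (B : Set α) : Prop where
  player_eq : player d = p
  nonempty : B.Nonempty
  color : ∀ v ∈ B, G.c v = d
  subset : B ⊆ G.mattr p B d

theorem IsFatal.mattr_subset_cpre (hB : G.IsFatal p d B) :
    G.mattr p B d ⊆ G.cpre p (G.mattr p B d) := by
  intro v hv
  have := (mem_mattr.1 hv).2
  rwa [Set.union_eq_self_of_subset_right hB.subset] at this

/-- The player can stay forever in the attractor of a fatal set. Hence the opponent cannot attract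
any node of it to a target outside. -/
theorem IsFatal.attr_subset_cpre (hB : G.IsFatal p d B) :
    G.attr p B ⊆ G.cpre p (G.attr p B) := by
  nth_rw 1 [attr_eq_union]
  refine Set.union_subset (hB.subset.trans (hB.mattr_subset_cpre.trans
    (G.cpre_mono p mattr_subset_attr))) fun v hv => ?_
  have := (mem_mattr.1 hv).2
  rwa [Set.union_comm, ← attr_eq_union] at this

/-- If `k` and `k'` have the same parity, the removed set is closed for the attracting player and
its loss is no disadvantage. Otherwise the removed set is one in which the opponent can stay, so
`fattr k` does not meet it at all. -/
theorem fattr_sdiff_subset (hG : G.IsParityGame) {k k' : α} (hk' : k' ∈ G.fattr k')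
    (hA : A = G.attr (player (G.c k')) (G.fattr k')) (hk : k ∉ A) :
    G.fattr k \ A ⊆ (G.removeNodes A).fattr k := by
  have hB : G.IsFatal (player (G.c k')) (G.c k') {k'} :=
    ⟨rfl, Set.singleton_nonempty _, fun _ hv => hv ▸ rfl, Set.singleton_subset_iff.2 hk'⟩
  have hcl : G.cpre (player (G.c k')) A ⊆ A := hA ▸ cpre_attr_subset
  have hself : A ⊆ G.cpre (player (G.c k')) A := by
    rw [hA, fattr, attr_mattr hB.subset]
    exact hB.attr_subset_cpre
  rcases fin2_eq_or (player (G.c k')) (player (G.c k)) with h | h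
  · rw [← h] at hcl
    have := mattr_sdiff_subset (X := {k}) (d := G.c k) hcl
    rwa [show ({k} : Set α) \ A = {k} by simpa using hk] at this
  · have hdis : G.fattr k ⊆ Aᶜ := by
      refine mattr_induct fun v _ _ hv hvA => ?_
      rw [h] at hv
      refine hG.not_mem_cpre (hself hvA) hv (Set.disjoint_left.2 ?_)
      rintro x hx (hx' | rfl)
      · exact hx'.2 hx
      · exact hk hx
    exact Set.sdiff_subset.trans (mattr_subset_removeNodes
      (Set.disjoint_left.2 fun v hv => hdis hv) (by simpa using hk))

/-- Fatal sets of different players have different colors, so the monotone attractor of the higher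
color avoids the target of the lower one and its player can stay in it. Closing under `attr` keeps
disjointness since the opponent can stay in the monotone attractor of `D`. -/
theorem IsFatal.disjoint (hG : G.IsParityGame) (hB : G.IsFatal p d B)
    (hD : G.IsFatal (1 - p) e D) : Disjoint (G.attr p B) (G.mattr (1 - p) D e) := by
  have hne : d ≠ e := by
    rintro rfl
    exact fin2_sub_ne p (hD.player_eq.symm.trans hB.player_eq)
  -- A node of `B` in the attractor of `D` gives `e ≤ d`, hence `e < d`; then the attractor of `B`
  -- contains no node of `D`, and the attractor of `D` cannot enter it.
  have key : B ⊆ (G.mattr (1 - p) D e)ᶜ := by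
    intro v hv hvD
    have h1 := le_of_mem_mattr hvD
    rw [hB.color v hv] at h1
    have : G.mattr (1 - p) D e ⊆ (G.mattr p B d)ᶜ := by
      refine mattr_induct fun u _ _ hu hu' => ?_
      refine hG.not_mem_cpre (hB.mattr_subset_cpre hu') hu (Set.disjoint_left.2 ?_)
      rintro x hx (hx' | hx')
      · exact hx'.2 hx
      · have := le_of_mem_mattr hx
        rw [hD.color x hx'] at this
        omega
    exact this hvD (hB.subset hv)
  have := attr_subset key fun v hv hvD =>
    hG.not_mem_cpre hv (hD.mattr_subset_cpre hvD) disjoint_compl_left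
  exact Set.disjoint_left.2 fun v hv => this hv

theorem IsFatal.removeNodes (hB : G.IsFatal p d B) (h : Disjoint (G.mattr p B d) A) :
    (G.removeNodes A).IsFatal p d B :=
  ⟨hB.player_eq, hB.nonempty, hB.color,
    hB.subset.trans (mattr_subset_removeNodes h (h.mono_left hB.subset))⟩

/-- Removing a set that is closed for one player never creates a fatal set of the other. This is
what makes it possible to finish one player before the other. -/
theorem IsFatal.of_removeNodes (hG : G.IsParityGame) (hA : G.cpre (1 - p) A ⊆ A)
    (hB : (G.removeNodes A).IsFatal p d B) : G.IsFatal p d B :=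
  ⟨hB.player_eq, hB.nonempty, hB.color, hB.subset.trans (mattr_removeNodes_subset hG hA)⟩

/-- Closed sets of nodes for player `p` without whose nodes there is no fatal set for `p`. -/
structure IsHitting (G : Arena α) (p : Fin 2) (T : Set α) : Prop where
  subset : T ⊆ G.nodes
  closed : G.cpre p T ⊆ T
  not_fatal : ∀ d B, ¬ (G.removeNodes T).IsFatal p d B

/-- The nodes that are classified as won by player `p` if fatal sets for `p` are removed together
with their attractors as long as possible. -/
def fatalRegion (G : Arena α) (p : Fin 2) : Set α := ⋂₀ {T | G.IsHitting p T}

theorem removeNodes_empty : G.removeNodes ∅ = G := by simp [removeNodes]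

theorem fatalRegion_eq_empty (hG : G.IsParityGame) (h : ∀ d B, ¬ G.IsFatal p d B) :
    G.fatalRegion p = ∅ :=
  Set.subset_empty_iff.1 (Set.sInter_subset_of_mem ⟨Set.empty_subset _,
    hG.cpre_empty.subset, by rwa [removeNodes_empty]⟩)

/-- A fatal set that is not inside `T` would leave a fatal set outside of it. -/
theorem IsFatal.attr_subset (hB : G.IsFatal p d B) (hT : G.IsHitting p T) : G.attr p B ⊆ T := by
  refine Arena.attr_subset (by_contra fun h => ?_) hT.closed
  refine hT.not_fatal d (B \ T) ⟨hB.player_eq, Set.sdiff_nonempty.2 h,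
    fun v hv => hB.color v hv.1, ?_⟩
  exact (Set.sdiff_subset_sdiff_left hB.subset).trans (mattr_sdiff_subset hT.closed)

theorem removeNodes_sdiff (h : A ⊆ T) :
    (G.removeNodes A).removeNodes (T \ A) = G.removeNodes T := by
  rw [removeNodes_removeNodes, Set.union_sdiff_cancel h]

/-- Hitting sets of the two games correspond: `A ∪ T` is hitting in the large game if `T` is in the
small one; conversely a hitting set `T` of the large game contains `A`, and `T \ A` is hitting in
the small one. -/
theorem IsFatal.fatalRegion_eq (hB : G.IsFatal p d B) (hA : A = G.attr p B) (hAn : A ⊆ G.nodes) :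
    G.fatalRegion p = A ∪ (G.removeNodes A).fatalRegion p := by
  have hcl : G.cpre p A ⊆ A := hA ▸ cpre_attr_subset
  apply subset_antisymm
  · intro v hv
    by_contra hvn
    rw [Set.mem_union, not_or] at hvn
    refine hvn.2 (Set.mem_sInter.2 fun T hT => ?_)
    refine (hv (A ∪ T) ⟨Set.union_subset hAn (hT.subset.trans (by simp)),
      fun u hu => ?_, ?_⟩).resolve_left hvn.1
    · by_cases huA : u ∈ A
      · exact Or.inl huA
      refine Or.inr (hT.closed (mem_cpre_removeNodes.2 ⟨huA, ?_⟩))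
      have := mt (@hcl u) huA
      rw [mem_cpre] at this hu
      simp only [Set.mem_union] at hu
      grind -ring
    · rw [← removeNodes_removeNodes]
      exact hT.not_fatal
  · refine Set.subset_sInter fun T hT => ?_
    have hAT : A ⊆ T := hA ▸ hB.attr_subset hT
    have : (G.removeNodes A).IsHitting p (T \ A) := by
      refine ⟨?_, ?_, ?_⟩
      · rw [removeNodes_nodes]
        exact Set.sdiff_subset_sdiff_left hT.subset
      · intro v hv
        rw [mem_cpre_removeNodes] at hv
        refine ⟨hT.closed ?_, hv.1⟩
        rw [mem_cpre]
        simp only [Set.mem_sdiff] at hv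
        have := @hAT
        grind -ring
      · rw [removeNodes_sdiff hAT]
        exact hT.not_fatal
    exact Set.union_subset hAT ((Set.sInter_subset_of_mem this).trans Set.sdiff_subset)

/-- The removal of a fatal attractor of `p` neither creates nor destroys fatal sets of the opponent:
`A` is closed for `p`, and it is disjoint from the monotone attractors of fatal sets of the
opponent. Both properties persist when a hitting set of the opponent is removed. -/
theorem IsFatal.fatalRegion_opponent (hG : G.IsParityGame) (hB : G.IsFatal p d B)
    (hA : A = G.attr p B) :
    (G.removeNodes A).fatalRegion (1 - p) = G.fatalRegion (1 - p) := by
  have hcl : G.cpre p A ⊆ A := hA ▸ cpre_attr_subset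
  have hV : ∀ v, v ∈ G.V p → v ∉ G.V (1 - p) := fun v => hG.not_mem_V
  apply subset_antisymm
  · refine Set.subset_sInter fun T hT => ?_
    have : (G.removeNodes A).IsHitting (1 - p) (T \ A) := by
      refine ⟨?_, ?_, ?_⟩
      · rw [removeNodes_nodes]
        exact Set.sdiff_subset_sdiff_left hT.subset
      · intro v hv
        rw [mem_cpre_removeNodes, fin2_sub_sub] at hv
        refine ⟨hT.closed ?_, hv.1⟩
        have := mt (@hcl v) hv.1
        rw [mem_cpre] at this
        rw [mem_cpre, fin2_sub_sub]
        simp only [Set.mem_sdiff] at hv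
        grind -ring
      · intro e D hD
        have hGT := hG.removeNodes hT.closed
        -- The order of the removals is exchanged, so that `A \ T` is removed from the game without
        -- `T`, in which it is closed for `p`.
        rw [removeNodes_removeNodes, show A ∪ T \ A = T ∪ A \ T by
          rw [Set.union_sdiff_self, Set.union_sdiff_self, Set.union_comm],
          ← removeNodes_removeNodes] at hD
        refine hT.not_fatal e D (hD.of_removeNodes hGT ?_)
        intro v hv
        rw [fin2_sub_sub, mem_cpre_removeNodes] at hv
        refine ⟨hcl ?_, hv.1⟩
        have := mt (@hT.closed v) hv.1
        rw [mem_cpre, fin2_sub_sub] at this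
        rw [mem_cpre]
        simp only [Set.mem_sdiff] at hv
        grind -ring
    exact (Set.sInter_subset_of_mem this).trans Set.sdiff_subset
  · refine Set.subset_sInter fun T hT => Set.sInter_subset_of_mem ?_
    have hdis : Disjoint T A := Set.disjoint_left.2 fun v hv => by
      have := hT.subset hv
      rw [removeNodes_nodes] at this
      exact this.2
    have hcl' : G.cpre (1 - p) T ⊆ T := by
      intro v hv
      -- Player `p` can stay in `A`, so the opponent cannot force a node of `A` into the disjoint
      -- set `T`.
      have hvA : v ∉ A := fun hvA => hG.not_mem_cpre
        (hA ▸ hB.attr_subset_cpre (hA ▸ hvA) : v ∈ G.cpre p A) hv hdis.symm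
      refine hT.closed (mem_cpre_removeNodes.2 ⟨hvA, ?_⟩)
      rw [mem_cpre, fin2_sub_sub] at hv
      rw [fin2_sub_sub]
      have := Set.disjoint_left.1 hdis
      grind -ring
    refine ⟨hT.subset.trans (by simp), hcl', fun e D hD => hT.not_fatal e D ?_⟩
    have hGT := hG.removeNodes hcl'
    have hAd : ∀ d', G.mattr p B d' ⊆ A := fun _ => hA ▸ mattr_subset_attr
    have hBT : Disjoint B T := hdis.symm.mono_left (hA ▸ subset_attr)
    -- `T` does not meet `A`, so `B` keeps its attractor; disjointness can then be applied in the
    -- game without `T`.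
    have hAA : A ⊆ (G.removeNodes T).attr p B := by
      rw [hA, attr_eq_union, attr_eq_union]
      exact Set.union_subset_union_right _
        (mattr_subset_removeNodes (hdis.symm.mono_left (hAd _)) hBT)
    rw [removeNodes_removeNodes, Set.union_comm, ← removeNodes_removeNodes]
    exact hD.removeNodes (((hB.removeNodes (hdis.symm.mono_left (hAd _))).disjoint hGT hD).symm.mono_right hAA)

/-- What `psolB` computes, whatever the order in which it removes fatal sets. -/
structure Solved (G : Arena α) (r : Outcome α) : Prop where
  won : ∀ p, r.won p = G.fatalRegion p
  residual : r.residual = G.removeNodes (G.fatalRegion 0 ∪ G.fatalRegion 1)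

theorem Solved.of_not_fatal (hG : G.IsParityGame) (h : ∀ p d B, ¬ G.IsFatal p d B) :
    G.Solved ⟨G, fun _ => ∅⟩ := by
  refine ⟨fun p => (fatalRegion_eq_empty hG (h p)).symm, ?_⟩
  rw [fatalRegion_eq_empty hG (h 0), fatalRegion_eq_empty hG (h 1), Set.union_empty,
    removeNodes_empty]

/-- The induction step of confluence: the region of `p` loses exactly `A`, that of the opponent
stays the same. -/
theorem IsFatal.solved (hG : G.IsParityGame) (hB : G.IsFatal p d B) (hA : A = G.attr p B)
    {r : Outcome α} (hr : (G.removeNodes A).Solved r) : G.Solved (r.record p A) := by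
  have h1 := hB.fatalRegion_eq hA
    (hA ▸ attr_subset_nodes (hB.subset.trans mattr_subset_nodes))
  have h2 := hB.fatalRegion_opponent hG hA
  have h3 : ∀ q, (r.record p A).won q = G.fatalRegion q := by
    intro q
    ext v
    simp only [Outcome.record, Set.mem_ofPred_eq, hr.won]
    rcases fin2_eq_or p q with rfl | rfl
    · rw [h1]; simp [or_comm]
    · rw [h2]; simp [fin2_sub_ne]
  refine ⟨h3, ?_⟩
  change r.residual = _
  rw [hr.residual, removeNodes_removeNodes]
  congr 1
  rw [← h3, ← h3, ← hr.won, ← hr.won]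
  ext v
  fin_cases p <;> simp [Outcome.record] <;> tauto

theorem FatalSearch.some_spec {F : Set α → Set α} {X cache : Set α} {o : Option (Set α)}
    (h : FatalSearch F X cache o) : ∀ W, o = some W → ∃ B ⊆ X, B.Nonempty ∧ B ⊆ F B ∧ W = F B := by
  induction h with
  | exit => simp
  | @found X _ h hX =>
    rintro W ⟨⟩
    exact ⟨X, le_rfl, Set.nonempty_iff_ne_empty.2 h.1, hX, rfl⟩
  | shrink _ _ _ ih =>
    rintro W hW
    obtain ⟨B, hB, h⟩ := ih W hW
    exact ⟨B, hB.trans Set.inter_subset_left, h⟩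

/-- By monotonicity a subset contained in its own image survives every shrinking step. The search
cannot stop because of an unchanged X, as this would mean that X is contained in its image. -/
theorem FatalSearch.none_spec {F : Set α → Set α} (hF : Monotone F) {X cache : Set α}
    {o : Option (Set α)} (h : FatalSearch F X cache o) :
    o = none → X ≠ cache → ∀ B ⊆ X, B ⊆ F B → B = ∅ := by
  induction h with
  | exit h =>
    rintro - hne B hB -
    rcases h with rfl | h
    · exact Set.subset_empty_iff.1 hB
    · exact absurd h hne
  | found => simp
  | shrink _ hX _ ih =>
    intro ho _ B hB hBF
    refine ih ho (fun h => hX ?_) B (Set.subset_inter hB (hBF.trans (hF hB))) hBF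
    exact Set.inter_eq_left.1 h

/-- The invariant is that the colors of all fatal sets are still in the list: a color is dropped
only after an unsuccessful search, and the recursive call restarts with all colors. -/
theorem psolB_solved_aux {ds : List ℕ} {r : Outcome α}
    (h : ColorLoop Descending (fun G d => {v ∈ G.nodes | G.c v = d})
      (fun G d X => G.mattr (player d) X d) ds G r) (hG : G.IsParityGame)
    (hds : ∀ p d B, G.IsFatal p d B → d ∈ ds) : G.Solved r := by
  induction h with
  | done G => exact .of_not_fatal hG fun p d B hB => by simpa using hds p d B hB
  | @fatal d ds ds' G r W A hW hA hds' _ ih =>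
    obtain ⟨B, hBX, hBn, hBF, rfl⟩ := FatalSearch.some_spec hW W rfl
    have hB : G.IsFatal (player d) d B := ⟨rfl, hBn, fun v hv => (hBX hv).2, hBF⟩
    rw [attr_mattr hBF] at hA
    refine hB.solved hG hA (ih (hG.removeNodes (hA ▸ cpre_attr_subset)) fun p e D hD => ?_)
    obtain ⟨v, hv⟩ := hD.nonempty
    exact (hds'.1 e).2 ⟨v, mattr_subset_nodes (hD.subset hv), hD.color v hv⟩
  | @next d ds G r hW _ ih =>
    refine ih hG fun p e D hD => ?_
    rcases List.mem_cons.1 (hds p e D hD) with rfl | h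
    · exfalso
      have hDX : D ⊆ {v ∈ G.nodes | G.c v = e} :=
        fun v hv => ⟨mattr_subset_nodes (hD.subset hv), hD.color v hv⟩
      obtain ⟨v, hv⟩ := hD.nonempty
      have := FatalSearch.none_spec (fun _ _ h => mattr_mono h) hW rfl
        (fun h => by have := hDX hv; rw [h] at this; exact this) D hDX
        (hD.player_eq ▸ hD.subset)
      rw [this] at hv
      exact hv
    · exact h

theorem psolB_solved (hG : G.IsParityGame) {r : Outcome α} (h : PsolB G r) : G.Solved r := by
  obtain ⟨ds, hds, h⟩ := h
  refine psolB_solved_aux h hG fun p d B hB => ?_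
  obtain ⟨v, hv⟩ := hB.nonempty
  exact (hds.1 d).2 ⟨v, mattr_subset_nodes (hB.subset hv), hB.color v hv⟩

/-! ## The sets that `psolB` examines -/

/-- The value of the variable `X` of `psolB` after `j` iterations of the search for a fatal set. -/
def levelSet (G : Arena α) (d : ℕ) : ℕ → Set α
  | 0 => {v ∈ G.nodes | G.c v = d}
  | j + 1 => G.levelSet d j ∩ G.mattr (player d) (G.levelSet d j) d

theorem levelSet_subset (j : ℕ) : G.levelSet d j ⊆ {v ∈ G.nodes | G.c v = d} := by
  induction j with
  | zero => exact le_rfl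
  | succ j ih => exact Set.inter_subset_left.trans ih

/-- At every level the surviving nodes are kept, by monotonicity, if the removed set is closed for
the player of `d`. For this reason the rows are used for one player at a time. -/
theorem levelSet_sdiff_subset (hA : G.cpre (player d) A ⊆ A) (j : ℕ) :
    G.levelSet d j \ A ⊆ (G.removeNodes A).levelSet d j := by
  induction j with
  | zero =>
    rintro v ⟨hv, hvA⟩
    exact ⟨by rw [removeNodes_nodes]; exact ⟨hv.1, hvA⟩, hv.2⟩
  | succ j ih =>
    rintro v ⟨hv, hvA⟩
    exact ⟨ih ⟨hv.1, hvA⟩, mattr_mono ih (mattr_sdiff_subset hA ⟨hv.2, hvA⟩)⟩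

/-- A fatal set of color `d` is contained in every set that the search examines, so it suffices to
examine these sets. -/
theorem IsFatal.subset_levelSet (hB : G.IsFatal p d B) (j : ℕ) : B ⊆ G.levelSet d j := by
  induction j with
  | zero => exact fun v hv => ⟨mattr_subset_nodes (hB.subset hv), hB.color v hv⟩
  | succ j ih =>
    refine Set.subset_inter ih (hB.subset.trans ?_)
    rw [hB.player_eq]
    exact mattr_mono ih

/-- If no set that is examined is fatal, then the last one is empty. -/
theorem levelSet_eq_empty (hG : G.IsParityGame) {N : ℕ}
    (hN : {v ∈ G.nodes | G.c v = d}.ncard ≤ N)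
    (h : ∀ j < N, ¬ G.IsFatal (player d) d (G.levelSet d j)) : G.levelSet d N = ∅ := by
  have hfin : ∀ j, (G.levelSet d j).Finite := fun j =>
    hG.finite.subset fun v hv => (levelSet_subset j hv).1
  -- A nonempty set that is not fatal loses a node in the next step.
  have key : ∀ j ≤ N, (G.levelSet d j).ncard ≤ N - j := by
    intro j
    induction j with
    | zero => exact fun _ => hN
    | succ j ih =>
      intro hj
      have h1 := ih (by omega)
      rcases (G.levelSet d j).eq_empty_or_nonempty with h0 | hne
      · simp [levelSet, h0]
      · have : G.levelSet d (j + 1) ⊂ G.levelSet d j := by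
          refine ⟨Set.inter_subset_left, fun hsub => h j (by omega) ⟨rfl, hne,
            fun v hv => (levelSet_subset j hv).2, hsub.trans Set.inter_subset_right⟩⟩
        have := Set.ncard_lt_ncard this (hfin j)
        omega
  have := key N le_rfl
  rw [Nat.sub_self, Nat.le_zero, Set.ncard_eq_zero (hfin N)] at this
  exact this

end Arena
end ParityGames

namespace ParityGames

open Code Arena

variable {α : Type*} {s s' : Store} {e : ℕ → α} {G H : Arena α} {p : Fin 2} {d r v n : ℕ}
  {X : Set α} {T P : ℕ → ℕ} {won : Fin 2 → Set α}

/-! ## Incremental computation of monotone attractors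

For the cubic time bounds the data of each attractor computation are kept, in row `r` of two arrays,
and they are resumed when the attractor is needed again in a later game. -/

namespace Code

open ParityGames.Expr

/-- `rowT[r, v]`: node `v` is a target or has been attracted. -/
abbrev rowT : ℕ := 15

/-- `rowP[r, v]`: the number of nodes that have been found to be no reason against the attraction of
node `v`. -/
abbrev rowP : ℕ := 16

/-- The adjacency matrix. -/
abbrev adjA : ℕ := 17

/-- The current row. -/
abbrev rowR : ℕ := 18

/-- The pointer of node `vR`. -/
abbrev ptr : Expr := get rowP (reg rowR) (reg vR)

/-- Add `vR` to the targets. -/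
def addTarget : Cmd :=
  .put rowT (reg rowR) (reg vR) (const 1) ;;
  for' wR (reg nR)
    (when (and (eq (at1 ownA (reg wR)) (reg pR)) (get adjA (reg wR) (reg vR)))
      (.put rowP (reg rowR) (reg wR) (reg nR)))

/-- Advance the pointer of an opponent's node `vR` to its next successor that is no target. -/
def advance : Cmd :=
  .while (and (eq (eq (at1 ownA (reg vR)) (reg pR)) (const 0)) (and (lt ptr (reg nR))
      (or (eq (alive ptr) (const 0))
        (or (eq (get adjA (reg vR) ptr) (const 0)) (get rowT (reg rowR) ptr)))))
    (.put rowP (reg rowR) (reg vR) (succ ptr))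

/-- Attract `vR` if possible. -/
def tryNode : Cmd :=
  when (and (alive (reg vR)) (le (reg dR) (at1 colA (reg vR))))
    (advance ;;
     when (and (eq ptr (reg nR)) (eq (get rowT (reg rowR) (reg vR)) (const 0)))
       (addTarget ;;
        .set nwR (const 1)))

/-- Compute the monotone attractor of `setA` for player `pR` and color `dR` into `attA`, with the data
in row `rowR`. -/
def refresh : Cmd :=
  for' vR (reg nR)
    (when (and (at1 setA (reg vR)) (eq (get rowT (reg rowR) (reg vR)) (const 0))) addTarget) ;;
  .set nwR (const 1) ;;
  .while (reg nwR)
    (.set nwR (const 0) ;;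
     for' vR (reg nR) tryNode) ;;
  for' vR (reg nR) (put1 attA (reg vR)
    (and (alive (reg vR)) (and (le (reg dR) (at1 colA (reg vR))) (eq ptr (reg nR)))))

end Code

/-- The data of a computation of the monotone attractor of `X`: targets `T` and pointers `P`. -/
structure RowInv (n : ℕ) (e : ℕ → α) (H : Arena α) (p : Fin 2) (d : ℕ) (X : Set α) (T P : ℕ → ℕ) :
    Prop where
  tgt : ∀ i < n, e i ∈ H.nodes → T i ≠ 0 → e i ∈ H.mattr p X d ∪ X
  le : ∀ i < n, P i ≤ n
  att : ∀ i < n, e i ∈ H.nodes → P i = n → d ≤ H.c (e i) → e i ∈ H.mattr p X d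
  own : ∀ i < n, ∀ j < n, e i ∈ H.V p → (e i, e j) ∈ H.E → T j ≠ 0 → P i = n
  opp : ∀ i < n, e i ∈ H.V (1 - p) → ∀ j < P i, (e i, e j) ∈ H.E → T j ≠ 0

/-- A row remains valid if the attractor loses removed nodes only. The two clauses about edges are
inherited since edges only disappear; a pointer equal to `n` keeps its meaning even if the edge that
caused it is gone. -/
theorem RowInv.mono {H' : Arena α} {X' : Set α} (h : RowInv n e H p d X T P)
    (hV : ∀ q, H'.V q ⊆ H.V q) (hE : H'.E ⊆ H.E) (hc : H'.c = H.c)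
    (hX : X ∩ H'.nodes ⊆ X') (hM : H.mattr p X d ∩ H'.nodes ⊆ H'.mattr p X' d) :
    RowInv n e H' p d X' T P := by
  have hn : H'.nodes ⊆ H.nodes := Set.union_subset_union (hV 0) (hV 1)
  refine ⟨fun i hi hv hT => ?_, h.le, fun i hi hv hP hd => ?_, fun i hi j hj hv he =>
    h.own i hi j hj (hV _ hv) (hE he), fun i hi hv j hj he => h.opp i hi (hV _ hv) j hj (hE he)⟩
  · rcases h.tgt i hi (hn hv) hT with h | h
    · exact Or.inl (hM ⟨h, hv⟩)
    · exact Or.inr (hX ⟨h, hv⟩)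
  · exact hM ⟨h.att i hi (hn hv) hP (hc ▸ hd), hv⟩

/-- There is nothing to be done for node `i`. -/
def Settled (n : ℕ) (e : ℕ → α) (H : Arena α) (p : Fin 2) (d : ℕ) (T P : ℕ → ℕ) (i : ℕ) : Prop :=
  e i ∈ H.nodes → d ≤ H.c (e i) → (P i = n → T i ≠ 0) ∧
    (P i < n → e i ∈ H.V (1 - p) → (e i, e (P i)) ∈ H.E ∧ T (P i) = 0)

/-- Pointers equal to `n` are sound by `att`. When all nodes are settled, these nodes are closed
under the attraction step: an unfinished pointer of the opponent shows a successor that is no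
target. -/
theorem RowInv.mem_mattr_iff (h : RowInv n e H p d X T P) (hH : H.IsParityGame)
    (hsurj : ∀ v ∈ H.nodes, ∃ i < n, e i = v) (hinj : ∀ i < n, ∀ j < n, e i = e j → i = j)
    (hX : ∀ i < n, e i ∈ X → T i ≠ 0) (hs : ∀ i < n, Settled n e H p d T P i) {i : ℕ} (hi : i < n) :
    e i ∈ H.mattr p X d ↔ e i ∈ H.nodes ∧ d ≤ H.c (e i) ∧ P i = n := by
  refine ⟨fun hm => ?_, fun ⟨h1, h2, h3⟩ => h.att i hi h1 h3 h2⟩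
  suffices H.mattr p X d ⊆ {v | ∃ i < n, e i = v ∧ e i ∈ H.nodes ∧ d ≤ H.c (e i) ∧ P i = n} by
    obtain ⟨j, hj, hji, h⟩ := this hm
    rwa [← hinj j hj i hi hji]
  intro v hv
  revert v
  refine mattr_subset fun v hv => ?_
  obtain ⟨hd, hv⟩ := mem_mpre.1 hv
  have hvn := cpre_subset_nodes hv
  obtain ⟨i, hi, rfl⟩ := hsurj v hvn
  refine ⟨i, hi, rfl, hvn, hd, ?_⟩
  by_contra hP
  have hZ : ∀ j < n, e j ∈ {v | ∃ i < n, e i = v ∧ e i ∈ H.nodes ∧ d ≤ H.c (e i) ∧ P i = n} ∪ X →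
      T j ≠ 0 := by
    rintro j hj (⟨l, hl, hlj, h1, h2, h3⟩ | hj')
    · rw [← hinj l hl j hj hlj]
      exact (hs l hl h1 h2).1 h3
    · exact hX j hj hj'
  rcases hv with ⟨hvp, w, hw, hwZ⟩ | ⟨hvp, hw⟩
  · obtain ⟨j, hj, rfl⟩ := hsurj w (hH.edges hw).2
    exact hP (h.own i hi j hj hvp hw (hZ j hj hwZ))
  · have hlt := lt_of_le_of_ne (h.le i hi) hP
    obtain ⟨h1, h2⟩ := (hs i hi hvn hd).2 hlt hvp
    exact hZ _ hlt (hw h1) h2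

/-- The number of steps that may still be needed for a row. -/
def rowPot (n : ℕ) (T P : ℕ → ℕ) : ℕ :=
  -- Advancing a pointer by one costs at most 100. A new target is worth 500(n + 1): at most 100(n +
  -- 1) for the scan of its column, the rest for the additional round of attraction that it
  -- triggers.
  ∑ i ∈ Finset.range n, (100 * (n - P i) + if T i = 0 then 500 * (n + 1) else 0)

theorem sum_range_add_le {n v a : ℕ} {f g : ℕ → ℕ} (h : ∀ i < n, f i ≤ g i) (hv : v < n)
    (ha : f v + a ≤ g v) : ∑ i ∈ Finset.range n, f i + a ≤ ∑ i ∈ Finset.range n, g i := by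
  rw [← Finset.add_sum_erase _ f (Finset.mem_range.2 hv),
    ← Finset.add_sum_erase _ g (Finset.mem_range.2 hv)]
  have := Finset.sum_le_sum (s := (Finset.range n).erase v)
    fun i hi => h i (Finset.mem_range.1 (Finset.mem_of_mem_erase hi))
  omega

theorem rowPot_add_le {T' P' : ℕ → ℕ} {a : ℕ} (hP : ∀ i < n, P i ≤ P' i)
    (hT : ∀ i, T i ≠ 0 → T' i ≠ 0) (hv : v < n)
    (ha : 100 * (n - P' v) + (if T' v = 0 then 500 * (n + 1) else 0) + a ≤
      100 * (n - P v) + if T v = 0 then 500 * (n + 1) else 0) :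
    rowPot n T' P' + a ≤ rowPot n T P := by
  refine sum_range_add_le (fun i hi => ?_) hv ha
  have h1 := hP i hi
  have h2 := hT i
  by_cases h3 : T' i = 0
  · have h4 : T i = 0 := by by_contra h; exact h2 h h3
    simp only [h3, h4, if_true]; omega
  · simp only [h3, if_false]; omega

theorem rowPot_le : rowPot n T P ≤ n * (600 * (n + 1)) := by
  refine (Finset.sum_le_card_nsmul _ _ (600 * (n + 1)) fun i _ => ?_).trans (by simp)
  split_ifs <;> omega

attribute [irreducible] rowPot

/-- The adjacency matrix of the current game. -/
def HoldsAdj (s : Store) (e : ℕ → α) (H : Arena α) : Prop :=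
  ∀ i < s.reg nR, ∀ j < s.reg nR, e i ∈ H.nodes → e j ∈ H.nodes →
    (s.arr adjA i j ≠ 0 ↔ (e i, e j) ∈ H.E)

theorem HoldsAdj.congr (h : HoldsAdj s e H) (hn : s'.reg nR = s.reg nR)
    (ha : s'.arr adjA = s.arr adjA) : HoldsAdj s' e H := by
  intro i hi j hj
  rw [hn] at hi hj
  rw [ha]
  exact h i hi j hj

/-- The context of a computation of a monotone attractor. -/
structure RowCtx (s : Store) (e : ℕ → α) (H : Arena α) (p : Fin 2) (d r : ℕ) : Prop where
  game : H.IsParityGame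
  holds : Holds s e H
  adj : HoldsAdj s e H
  player : s.reg pR = p.val
  color : s.reg dR = d
  row : s.reg rowR = r

theorem RowCtx.of_frame {c : Cmd} (h : RowCtx s e H p d r) (hf : Frame c s s')
    (hr : ∀ x ∈ [nR, pR, dR, rowR], c.writesReg x = false)
    (ha : ∀ a ∈ [winA, colA, ownA, adjA], c.writesArr a = false) : RowCtx s' e H p d r := by
  have hr' : ∀ x ∈ [nR, pR, dR, rowR], s'.reg x = s.reg x := fun x hx => hf.reg x (hr x hx)
  have ha' : ∀ a ∈ [winA, colA, ownA, adjA], s'.arr a = s.arr a := fun a hx => hf.arr a (ha a hx)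
  exact ⟨h.game, h.holds.congr (hr' _ (by simp)) (ha' _ (by simp)) (ha' _ (by simp)) (ha' _ (by simp)),
    h.adj.congr (hr' _ (by simp)) (ha' _ (by simp)), (hr' _ (by simp)).trans h.player,
    (hr' _ (by simp)).trans h.color, (hr' _ (by simp)).trans h.row⟩

/-- The other rows are the same in `s` and `s'`. -/
def SameRows (s s' : Store) (r : ℕ) : Prop :=
  ∀ q, q ≠ r → s'.arr rowT q = s.arr rowT q ∧ s'.arr rowP q = s.arr rowP q

theorem SameRows.refl (s : Store) (r : ℕ) : SameRows s s r := fun _ _ => ⟨rfl, rfl⟩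

theorem SameRows.trans {s'' : Store} (h : SameRows s s' r) (h' : SameRows s' s'' r) :
    SameRows s s'' r :=
  fun q hq => ⟨(h' q hq).1.trans (h q hq).1, (h' q hq).2.trans (h q hq).2⟩

theorem SameRows.of_eq (hT : s'.arr rowT = s.arr rowT) (hP : s'.arr rowP = s.arr rowP) :
    SameRows s s' r := fun q _ => ⟨by rw [hT], by rw [hP]⟩

/-- A new target settles all its predecessors that belong to the attracting player, by a jump of
their pointers to `n`; so only the opponent's pointers have to be moved step by step. -/
theorem runs_addTarget (hc : RowCtx s e H p d r)
    (h : RowInv (s.reg nR) e H p d X (s.arr rowT r) (s.arr rowP r)) (hv : s.reg vR = v)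
    (hvn : v < s.reg nR) (hT : s.arr rowT r v = 0)
    (hvH : e v ∈ H.nodes) (hX : e v ∈ H.mattr p X d ∪ X) :
    Runs addTarget s 0 fun t s' => RowInv (s.reg nR) e H p d X (s'.arr rowT r) (s'.arr rowP r) ∧
      s'.arr rowT r = Function.update (s.arr rowT r) v 1 ∧ SameRows s s' r ∧
      t + rowPot (s.reg nR) (s'.arr rowT r) (s'.arr rowP r) + 400 * (s.reg nR + 1) ≤
        rowPot (s.reg nR) (s.arr rowT r) (s.arr rowP r) := by
  set n := s.reg nR with hn
  rw [addTarget, runs_seq, runs_put]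
  simp only [Expr.eval, hc.row, hv]
  set s₁ := s.setArr rowT r v 1 with hs₁
  refine (runs_for_const (N := n)
    (fun k s' => (∀ i, s'.arr rowP r i = if i < k ∧ s.arr ownA i 0 = p.val ∧ s.arr adjA i v ≠ 0
        then n else s.arr rowP r i) ∧ ∀ q, q ≠ r → s'.arr rowP q = s.arr rowP q) 20 rfl
    (fun _ _ _ h => h) ?_ ?_ ?_).call ?_
  · simp [hs₁]
  · rintro k s' - - - hf
    exact hf.reg nR rfl
  · rintro k s₂ hk ⟨hI, hI'⟩ hx hf
    have ho : s₂.arr ownA = s.arr ownA := hf.arr ownA rfl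
    have ha : s₂.arr adjA = s.arr adjA := hf.arr adjA rfl
    have hp : s₂.reg pR = p.val := (hf.reg pR rfl).trans hc.player
    have hv₂ : s₂.reg vR = v := (hf.reg vR rfl).trans hv
    have hr : s₂.reg rowR = r := (hf.reg rowR rfl).trans hc.row
    have hn₂ : s₂.reg nR = n := hf.reg nR rfl
    refine Runs.ite (P := s.arr ownA k 0 = p.val ∧ s.arr adjA k v ≠ 0) ?_ (fun hP => ?_)
      (fun hP => ?_)
    · rw [Expr.and_ne_zero, Expr.eq_ne_zero]
      simp [hx, ho, ha, hp, hv₂]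
    · rw [runs_put]
      simp only [Expr.eval, hr, hx, hn₂]
      refine ⟨⟨fun i => ?_, fun q hq => ?_⟩, by simp⟩
      · by_cases hik : i = k
        · subst hik; simp [hP]
        · simp only [Store.setArr_arr, if_true, true_and, hik, if_false, hI]
          have : i < k + 1 ↔ i < k := by omega
          simp only [this]
      · simp [hq, hI' q hq]
    · rw [runs_skip]
      refine ⟨⟨fun i => ?_, hI'⟩, by simp⟩
      rw [hI]
      by_cases hik : i = k
      · subst hik; simp only [lt_irrefl, if_false, hP, and_false]
      · have : i < k + 1 ↔ i < k := by omega
        simp only [this]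
  · rintro t s₂ ⟨⟨hI, hI'⟩, ht⟩ hf
    have hTT : s₂.arr rowT = s₁.arr rowT := hf.arr rowT rfl
    have hTu : s₂.arr rowT r = Function.update (s.arr rowT r) v 1 := by
      rw [hTT]; ext j; simp [hs₁, Function.update_apply]
    have hTm : ∀ j, s.arr rowT r j ≠ 0 → s₂.arr rowT r j ≠ 0 := by
      intro j hj
      rw [hTu, Function.update_apply]
      split_ifs <;> simp_all
    have hPn : ∀ i, s.arr rowP r i = n → s₂.arr rowP r i = n := by
      intro i hi
      rw [hI]
      split_ifs <;> simp_all
    refine ⟨⟨?_, ?_, ?_, ?_, ?_⟩, hTu, ?_, ?_⟩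
    · intro i hi hiH hiT
      rw [hTu, Function.update_apply] at hiT
      split_ifs at hiT with hiv
      · exact hiv ▸ hX
      · exact h.tgt i hi hiH hiT
    · intro i hi
      rw [hI]
      split_ifs
      · exact le_rfl
      · exact h.le i hi
    · intro i hi hiH hiP hd
      rw [hI] at hiP
      split_ifs at hiP with hc'
      · have hE := (hc.adj i hi v hvn hiH hvH).1 hc'.2.2
        exact mem_mattr.2 ⟨hd, Or.inl ⟨(hc.holds.own_iff hi hiH p).1 hc'.2.1, e v, hE, hX⟩⟩
      · exact h.att i hi hiH hiP hd
    · intro i hi j hj hiV hE hjT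
      rw [hTu, Function.update_apply] at hjT
      split_ifs at hjT with hjv
      · subst hjv
        have hEn := hc.game.edges hE
        rw [hI, if_pos ⟨hi, hc.holds.own i hi p hiV, (hc.adj i hi j hj hEn.1 hEn.2).2 hE⟩]
      · exact hPn i (h.own i hi j hj hiV hE hjT)
    · intro i hi hiV j hj hE
      rw [hI, if_neg] at hj
      · exact hTm j (h.opp i hi hiV j hj hE)
      · rintro ⟨-, ho, -⟩
        exact hc.game.not_mem_V ((hc.holds.own_iff hi (mem_nodes_of_V hiV) p).1 ho) hiV
    · intro q hq
      exact ⟨by rw [hTT]; simp [hs₁, hq], hI' q hq⟩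
    · have hPle : ∀ i < n, s.arr rowP r i ≤ s₂.arr rowP r i := by
        intro i hi
        rw [hI]; split_ifs
        · exact h.le i hi
        · exact le_rfl
      -- The new mark releases 500(n + 1), and the jumping pointers only lower the potential
      -- further.
      have := rowPot_add_le (T := s.arr rowT r) (T' := s₂.arr rowT r) (a := 500 * (n + 1))
        hPle hTm hvn (by simp [hTu, hT]; have := hPle v hvn; omega)
      have h4 : t ≤ n * 20 + (n + 1) * 7 := ht
      have h5 : 4 + t ≤ 100 * (n + 1) := by linarith
      have h6 : Expr.cost (.reg rowR) + Expr.cost (.reg vR) + Expr.cost (.const 1) + 1 = 4 := rfl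
      rw [h6]
      linarith

end ParityGames

/-! ### Amortized cost of a resumed attractor computation -/

namespace ParityGames

open Code Arena

variable {α : Type*} {s s' : Store} {e : ℕ → α} {G H : Arena α} {p : Fin 2} {d r v n : ℕ}
  {X : Set α} {T P : ℕ → ℕ} {won : Fin 2 → Set α}

theorem Expr.eq_eq_zero {a b : Expr} : (Expr.eq a b).eval s = 0 ↔ a.eval s ≠ b.eval s := by
  simp

/-- A pointer may pass a number that is no successor or is a target. If it reaches `n` in this way,
all successors are targets, and the node is attracted if its color permits. -/
theorem RowInv.advance {P' : ℕ → ℕ} (h : RowInv n e H p d X T P) (hH : H.IsParityGame)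
    (hsurj : ∀ v ∈ H.nodes, ∃ i < n, e i = v) (hv : e v ∈ H.V (1 - p)) (hlt : P v < n)
    (hj : (e v, e (P v)) ∈ H.E → T (P v) ≠ 0) (hP : ∀ i, P' i = if i = v then P v + 1 else P i) :
    RowInv n e H p d X T P' := by
  have hopp : ∀ i < n, e i ∈ H.V (1 - p) → ∀ j < P' i, (e i, e j) ∈ H.E → T j ≠ 0 := by
    intro i hi hiV j hjP hE
    rw [hP] at hjP
    split_ifs at hjP with hiv
    · subst hiv
      rcases (Nat.lt_succ_iff.1 hjP).lt_or_eq with h' | rfl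
      · exact h.opp i hi hiV j h' hE
      · exact hj hE
    · exact h.opp i hi hiV j hjP hE
  refine ⟨h.tgt, fun i hi => ?_, fun i hi hiH hiP hd => ?_, fun i hi j hj' hiV hE hjT => ?_, hopp⟩
  · rw [hP]
    split_ifs
    · exact hlt
    · exact h.le i hi
  · by_cases hiv : i = v
    · subst hiv
      refine mem_mattr.2 ⟨hd, Or.inr ⟨hv, fun w hw => ?_⟩⟩
      obtain ⟨j, hj', rfl⟩ := hsurj w (hH.edges hw).2
      exact h.tgt j hj' (hH.edges hw).2 (hopp i hi hv j (by omega) hw)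
    · rw [hP, if_neg hiv] at hiP
      exact h.att i hi hiH hiP hd
  · rw [hP, if_neg]
    · exact h.own i hi j hj' hiV hE hjT
    · rintro rfl
      exact hH.not_mem_V hiV hv

theorem runs_advance (hc : RowCtx s e H p d r)
    (h : RowInv (s.reg nR) e H p d X (s.arr rowT r) (s.arr rowP r)) (hv : s.reg vR = v)
    (hvn : v < s.reg nR) (hvH : e v ∈ H.nodes) :
    Runs advance s 0 fun t s' => RowInv (s.reg nR) e H p d X (s'.arr rowT r) (s'.arr rowP r) ∧
      s'.arr rowT = s.arr rowT ∧ SameRows s s' r ∧ (∀ i, i ≠ v → s'.arr rowP r i = s.arr rowP r i) ∧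
      (s'.arr rowP r v < s.reg nR → e v ∈ H.V (1 - p) →
        (e v, e (s'.arr rowP r v)) ∈ H.E ∧ s'.arr rowT r (s'.arr rowP r v) = 0) ∧
      t + rowPot (s.reg nR) (s'.arr rowT r) (s'.arr rowP r) ≤
        rowPot (s.reg nR) (s.arr rowT r) (s.arr rowP r) + 60 := by
  set n := s.reg nR with hn
  have hcond : ∀ s', Frame Code.advance s s' →
      ((Expr.and (.eq (.eq (at1 ownA (.reg vR)) (.reg pR)) (.const 0)) (.and (.lt ptr (.reg nR))
      (.or (.eq (alive ptr) (.const 0))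
        (.or (.eq (.get adjA (.reg vR) ptr) (.const 0)) (.get rowT (.reg rowR) ptr))))).eval s' ≠ 0 ↔
      e v ∈ H.V (1 - p) ∧ s'.arr rowP r v < n ∧ ((e v, e (s'.arr rowP r v)) ∈ H.E →
        s.arr rowT r (s'.arr rowP r v) ≠ 0)) := by
    intro s' hf
    have hv' : s'.reg vR = v := (hf.reg vR rfl).trans hv
    have hr' : s'.reg rowR = r := (hf.reg rowR rfl).trans hc.row
    have hp' : s'.reg pR = p.val := (hf.reg pR rfl).trans hc.player
    have hn' : s'.reg nR = n := hf.reg nR rfl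
    have ho : s'.arr ownA = s.arr ownA := hf.arr ownA rfl
    have hw : s'.arr winA = s.arr winA := hf.arr winA rfl
    have ha : s'.arr adjA = s.arr adjA := hf.arr adjA rfl
    have hT : s'.arr rowT = s.arr rowT := hf.arr rowT rfl
    simp only [Expr.and_ne_zero, Expr.or_ne_zero, Expr.eq_ne_zero, Expr.lt_ne_zero, Expr.eval.eq_1,
      Expr.eq_eq_zero]
    simp only [Expr.eval, hv', hr', hp', hn', ho, hw, ha, hT]
    rw [show (s.arr ownA v 0 ≠ p.val ↔ e v ∈ H.V (1 - p)) from ?_]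
    · refine and_congr_right fun _ => and_congr_right fun hlt => ?_
      have h1 := hc.holds.alive _ hlt
      -- Matrix entries of removed nodes are stale, therefore the program tests for removed nodes
      -- first; there can be no edge to such a node.
      by_cases hjH : e (s'.arr rowP r v) ∈ H.nodes
      · rw [← hc.adj v hvn _ hlt hvH hjH]
        have := h1.2 hjH
        tauto
      · have h2 : (e v, e (s'.arr rowP r v)) ∉ H.E := fun hE => hjH (hc.game.edges hE).2
        tauto
    · rw [ne_eq, hc.holds.own_iff hvn hvH p]
      exact ⟨fun h' => (mem_V_or hvH p).resolve_left h', fun h1 h2 => hc.game.not_mem_V h2 h1⟩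
  refine (runs_while
    (fun s' => RowInv n e H p d X (s.arr rowT r) (s'.arr rowP r) ∧
      (∀ q, q ≠ r → s'.arr rowP q = s.arr rowP q) ∧ ∀ i, i ≠ v → s'.arr rowP r i = s.arr rowP r i)
    (fun s' => rowPot n (s.arr rowT r) (s'.arr rowP r)) ⟨h, fun _ _ => rfl, fun _ _ => rfl⟩ ?_).call ?_
  · rintro s₁ ⟨h₁, ho₁, hi₁⟩ hf hb
    obtain ⟨hvV, hlt, hT⟩ := (hcond s₁ hf).1 hb
    have hv' : s₁.reg vR = v := (hf.reg vR rfl).trans hv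
    have hr' : s₁.reg rowR = r := (hf.reg rowR rfl).trans hc.row
    rw [runs_put]
    simp only [Expr.eval, hv', hr']
    set P' := (s₁.setArr rowP r v (s₁.arr rowP r v + 1)).arr rowP r with hP'
    have hPP : ∀ i, P' i = if i = v then s₁.arr rowP r v + 1 else s₁.arr rowP r i := by
      intro i; simp [hP']
    refine ⟨⟨h₁.advance hc.game hc.holds.surj hvV hlt hT hPP, fun q hq => ?_, fun i hi => ?_⟩, ?_⟩
    · simp [hq, ho₁ q hq]
    · rw [hPP, if_neg hi, hi₁ i hi]
    · have := rowPot_add_le (n := n) (T := s.arr rowT r) (T' := s.arr rowT r) (P := s₁.arr rowP r)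
        (P' := P') (v := v) (a := 100) (fun i _ => ?_) (fun _ h => h) hvn
        (by rw [hPP, if_pos rfl]; omega)
      · simp only [Expr.cost]
        omega
      · rw [hPP]
        split_ifs with hiv
        · subst hiv; omega
        · exact le_rfl
  · rintro t s₁ ⟨⟨h₁, ho₁, hi₁⟩, hb, ht⟩ hf
    have hT : s₁.arr rowT = s.arr rowT := hf.arr rowT rfl
    refine ⟨by rw [hT]; exact h₁, hT, fun q hq => ⟨by rw [hT], ho₁ q hq⟩, hi₁, fun hlt hvV => ?_, ?_⟩
    · rw [hT]
      by_contra h'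
      exact (hcond s₁ hf).2 ⟨hvV, hlt, fun hE h0 => h' ⟨hE, h0⟩⟩ hb
    · rw [hT, Nat.zero_add]
      exact ht.trans (Nat.add_le_add_left (by decide) _)

/-- Either the node becomes a target, and 200(n + 1) is left over to pay for another round, or it is
settled and no mark has changed. -/
theorem runs_tryNode (hc : RowCtx s e H p d r)
    (h : RowInv (s.reg nR) e H p d X (s.arr rowT r) (s.arr rowP r)) (hv : s.reg vR = v)
    (hvn : v < s.reg nR) :
    Runs tryNode s 0 fun t s' => RowInv (s.reg nR) e H p d X (s'.arr rowT r) (s'.arr rowP r) ∧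
      SameRows s s' r ∧ (∀ i, s.arr rowT r i ≠ 0 → s'.arr rowT r i ≠ 0) ∧
      (s'.reg nwR = 1 ∧ t + rowPot (s.reg nR) (s'.arr rowT r) (s'.arr rowP r) +
          200 * (s.reg nR + 1) ≤ rowPot (s.reg nR) (s.arr rowT r) (s.arr rowP r) ∨
        s'.reg nwR = s.reg nwR ∧ s'.arr rowT r = s.arr rowT r ∧
          (∀ i, i ≠ v → s'.arr rowP r i = s.arr rowP r i) ∧
          Settled (s.reg nR) e H p d (s'.arr rowT r) (s'.arr rowP r) v ∧
          t + rowPot (s.reg nR) (s'.arr rowT r) (s'.arr rowP r) ≤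
            rowPot (s.reg nR) (s.arr rowT r) (s.arr rowP r) + 150) := by
  set n := s.reg nR with hn
  refine Runs.ite (P := e v ∈ H.nodes ∧ d ≤ H.c (e v)) ?_ (fun hP => ?_) (fun hP => ?_)
  · rw [Expr.and_ne_zero, Expr.eq_ne_zero, Expr.lt_ne_zero]
    simp only [Expr.eval, hv, hc.color, hc.holds.alive v hvn, hc.holds.col v hvn, Nat.lt_succ_iff]
  · refine Runs.call_seq (runs_advance hc h hv hvn hP.1) ?_
    rintro t₁ s₁ ⟨h₁, hT₁, hS₁, hP₁, hset, ht₁⟩ hf₁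
    rw [← hn] at h₁ hset ht₁
    have hc₁ : RowCtx s₁ e H p d r := hc.of_frame hf₁ (by decide) (by decide)
    have hn₁ : s₁.reg nR = n := hf₁.reg nR rfl
    have hv₁ : s₁.reg vR = v := (hf₁.reg vR rfl).trans hv
    refine Runs.ite (P := s₁.arr rowP r v = n ∧ s₁.arr rowT r v = 0) ?_ (fun hQ => ?_) (fun hQ => ?_)
    · rw [Expr.and_ne_zero, Expr.eq_ne_zero, Expr.eq_ne_zero]
      simp only [Expr.eval, hv₁, hc₁.row, hn₁]
    · rw [← hn₁] at h₁
      refine Runs.call_seq (runs_addTarget hc₁ h₁ hv₁ (hn₁ ▸ hvn) hQ.2 hP.1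
        (Or.inl (h₁.att v (hn₁ ▸ hvn) hP.1 (hQ.1.trans hn₁.symm) hP.2))) ?_
      rintro t₂ s₂ ⟨h₂, hT₂, hS₂, ht₂⟩ hf₂
      rw [hn₁] at h₂ ht₂
      rw [runs_set]
      refine ⟨h₂, hS₁.trans hS₂, fun i hi => ?_, Or.inl ⟨rfl, ?_⟩⟩
      · change s₂.arr rowT r i ≠ 0
        rw [hT₂, Function.update_apply, hT₁]
        split_ifs <;> simp_all
      · simp only [Expr.cost, Store.setReg_arr]
        omega
    · rw [runs_skip]
      refine ⟨h₁, hS₁, fun i hi => by rw [hT₁]; exact hi, Or.inr ⟨hf₁.reg nwR rfl, by rw [hT₁], hP₁,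
        fun _ _ => ⟨fun hPv hTv => hQ ⟨hPv, hTv⟩, hset⟩, ?_⟩⟩
      simp only [Expr.cost]
      omega
  · rw [runs_skip]
    refine ⟨h, .refl _ _, fun _ h => h, Or.inr ⟨rfl, rfl, fun _ _ => rfl, fun h1 h2 => absurd ⟨h1, h2⟩ hP,
      ?_⟩⟩
    simp only [Expr.cost]
    omega

/-- A round of the attractor computation. -/
theorem runs_attractRound (hc : RowCtx s e H p d r)
    (h : RowInv (s.reg nR) e H p d X (s.arr rowT r) (s.arr rowP r)) (hnw : s.reg nwR = 0) :
    Runs (for' vR (.reg nR) tryNode) s 0 fun t s' =>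
      RowInv (s.reg nR) e H p d X (s'.arr rowT r) (s'.arr rowP r) ∧
      SameRows s s' r ∧ (∀ i, s.arr rowT r i ≠ 0 → s'.arr rowT r i ≠ 0) ∧ s'.reg nwR ≤ 1 ∧
      (s'.reg nwR = 0 →
        ∀ i < s.reg nR, Settled (s.reg nR) e H p d (s'.arr rowT r) (s'.arr rowP r) i) ∧
      t + rowPot (s.reg nR) (s'.arr rowT r) (s'.arr rowP r) + 200 * (s.reg nR + 1) * s'.reg nwR ≤
        rowPot (s.reg nR) (s.arr rowT r) (s.arr rowP r) + 160 * (s.reg nR + 1) := by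
  set n := s.reg nR with hn
  refine (runs_for (N := n)
    (fun k s' => RowInv n e H p d X (s'.arr rowT r) (s'.arr rowP r) ∧
      SameRows s s' r ∧ (∀ i, s.arr rowT r i ≠ 0 → s'.arr rowT r i ≠ 0) ∧ s'.reg nwR ≤ 1 ∧
      (s'.reg nwR = 0 → ∀ i < k, Settled n e H p d (s'.arr rowT r) (s'.arr rowP r) i))
    (fun s' => rowPot n (s'.arr rowT r) (s'.arr rowP r) + 200 * (n + 1) * s'.reg nwR)
    (fun _ => 150) rfl ?_ ?_ ?_ ?_ ?_).mono ?_
  · exact fun k s' m h => h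
  · exact fun s' m => rfl
  · exact ⟨h, .refl _ _, fun _ h => h, by omega, by simp⟩
  · rintro k s' - - - hf
    exact hf.reg nR rfl
  · rintro k s₁ hk ⟨h₁, hS₁, hT₁, hnw₁, hset⟩ hx hf
    have hc₁ : RowCtx s₁ e H p d r := hc.of_frame hf (by decide) (by decide)
    have hn₁ : s₁.reg nR = n := hf.reg nR rfl
    have hspec := runs_tryNode hc₁ (by rw [hn₁]; exact h₁) hx (by omega)
    rw [hn₁] at hspec
    refine hspec.mono ?_
    rintro t s₂ ⟨h₂, hS₂, hT₂, ⟨hnw₂, ht⟩ | ⟨hnw₂, hTT, hP, hs, ht⟩⟩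
    · refine ⟨⟨h₂, hS₁.trans hS₂, fun i hi => hT₂ i (hT₁ i hi), by omega, fun h0 => by omega⟩, ?_⟩
      rw [hnw₂]
      omega
    -- Without a new target, only the pointer of node `k` may have moved; so the nodes treated
    -- before remain settled.
    · refine ⟨⟨h₂, hS₁.trans hS₂, fun i hi => hT₂ i (hT₁ i hi), by omega, fun h0 i hi => ?_⟩, ?_⟩
      · by_cases hik : i = k
        · exact hik ▸ hs
        · have := hset (by omega) i (by omega)
          unfold Settled at this ⊢
          rwa [hTT, hP i hik]
      · rw [hnw₂]
        omega
  · rintro t s' ⟨⟨⟨h1, h2, h3, h4, h5⟩, -⟩, ht⟩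
    refine ⟨h1, h2, h3, h4, h5, ?_⟩
    rw [hnw] at ht
    simp only [Expr.cost, Finset.sum_const, Finset.card_range, smul_eq_mul] at ht
    omega

/-- The targets are added before the attractor computation. -/
theorem runs_addTargets (hc : RowCtx s e H p d r) (hX : marked s e setA = X) (hXn : X ⊆ H.nodes)
    (h : RowInv (s.reg nR) e H p d X (s.arr rowT r) (s.arr rowP r)) :
    Runs (for' vR (.reg nR) (when
        (.and (at1 setA (.reg vR)) (.eq (.get rowT (.reg rowR) (.reg vR)) (.const 0))) addTarget))
      s 0 fun t s' => RowInv (s.reg nR) e H p d X (s'.arr rowT r) (s'.arr rowP r) ∧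
      SameRows s s' r ∧ (∀ i < s.reg nR, e i ∈ X → s'.arr rowT r i ≠ 0) ∧
      t + rowPot (s.reg nR) (s'.arr rowT r) (s'.arr rowP r) ≤
        rowPot (s.reg nR) (s.arr rowT r) (s.arr rowP r) + 30 * (s.reg nR + 1) := by
  set n := s.reg nR with hn
  refine (runs_for (N := n)
    (fun k s' => RowInv n e H p d X (s'.arr rowT r) (s'.arr rowP r) ∧
      SameRows s s' r ∧ ∀ i < k, e i ∈ X → s'.arr rowT r i ≠ 0)
    (fun s' => rowPot n (s'.arr rowT r) (s'.arr rowP r)) (fun _ => 20) rfl ?_ ?_ ?_ ?_ ?_).mono ?_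
  · exact fun k s' m h => h
  · exact fun s' m => rfl
  · exact ⟨h, .refl _ _, by simp⟩
  · rintro k s' - - - hf
    exact hf.reg nR rfl
  · rintro k s₁ hk ⟨h₁, hS₁, hX₁⟩ hx hf
    have hc₁ : RowCtx s₁ e H p d r := hc.of_frame hf (by decide) (by decide)
    have hn₁ : s₁.reg nR = n := hf.reg nR rfl
    have hset : s₁.arr setA = s.arr setA := hf.arr setA rfl
    refine Runs.ite (P := e k ∈ X ∧ s₁.arr rowT r k = 0) ?_ (fun hP => ?_) (fun hP => ?_)
    · rw [Expr.and_ne_zero, Expr.eq_ne_zero, ← hX, hc.holds.mem_marked hk]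
      simp only [Expr.eval, hx, hc₁.row, hset]
    · have hspec := runs_addTarget hc₁ (by rw [hn₁]; exact h₁) hx (by omega) hP.2 (hXn hP.1)
        (Or.inr hP.1)
      rw [hn₁] at hspec
      refine hspec.call ?_
      rintro t s₂ ⟨h₂, hT₂, hS₂, ht⟩ -
      refine ⟨⟨h₂, hS₁.trans hS₂, fun i hi hiX => ?_⟩, ?_⟩
      · rw [hT₂, Function.update_apply]
        split_ifs with hik
        · exact one_ne_zero
        · exact hX₁ i (by omega) hiX
      · simp only [Expr.cost]
        omega
    · rw [runs_skip]
      refine ⟨⟨h₁, hS₁, fun i hi hiX => ?_⟩, ?_⟩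
      · by_cases hik : i = k
        · exact fun h0 => hP ⟨hik ▸ hiX, hik ▸ h0⟩
        · exact hX₁ i (by omega) hiX
      · simp only [Expr.cost]
        omega
  · rintro t s' ⟨⟨⟨h1, h2, h3⟩, -⟩, ht⟩
    refine ⟨h1, h2, h3, ?_⟩
    simp only [Expr.cost, Finset.sum_const, Finset.card_range, smul_eq_mul] at ht
    omega

/-- Apart from a linear overhead, all steps are paid from the potential of the row; so resuming a
row costs O(n²) altogether, however often it is refreshed. -/
theorem runs_refresh (hc : RowCtx s e H p d r) (hX : marked s e setA = X) (hXn : X ⊆ H.nodes)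
    (h : RowInv (s.reg nR) e H p d X (s.arr rowT r) (s.arr rowP r)) :
    Runs refresh s 0 fun t s' => RowInv (s.reg nR) e H p d X (s'.arr rowT r) (s'.arr rowP r) ∧
      SameRows s s' r ∧ marked s' e attA = H.mattr p X d ∧
      t + rowPot (s.reg nR) (s'.arr rowT r) (s'.arr rowP r) ≤
        rowPot (s.reg nR) (s.arr rowT r) (s.arr rowP r) + 1000 * (s.reg nR + 1) := by
  set n := s.reg nR with hn
  refine Runs.call_seq (runs_addTargets hc hX hXn h) ?_
  rintro t₁ s₁ ⟨h₁, hS₁, hX₁, ht₁⟩ hf₁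
  rw [← hn] at h₁ hX₁ ht₁
  have hc₁ : RowCtx s₁ e H p d r := hc.of_frame hf₁ (by decide) (by decide)
  have hn₁ : s₁.reg nR = n := hf₁.reg nR rfl
  rw [runs_seq, runs_set]
  simp only [Expr.eval]
  set s₂ := s₁.setReg nwR 1 with hs₂
  have hf₂ : Frame (.set nwR (.const 1)) s₁ s₂ := (Exec.set nwR (.const 1) s₁).frame
  have hc₂ : RowCtx s₂ e H p d r := hc₁.of_frame hf₂ (by decide) (by decide)
  refine Runs.call_seq (runs_while
    (fun s' => RowInv n e H p d X (s'.arr rowT r) (s'.arr rowP r) ∧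
      SameRows s s' r ∧ (∀ i < n, e i ∈ X → s'.arr rowT r i ≠ 0) ∧ s'.reg nwR ≤ 1 ∧
      (s'.reg nwR = 0 → ∀ i < n, Settled n e H p d (s'.arr rowT r) (s'.arr rowP r) i))
    -- A further round has been prepaid by a target found in the round before; the first one belongs
    -- to the linear overhead.
    (fun s' => rowPot n (s'.arr rowT r) (s'.arr rowP r) + 200 * (n + 1) * s'.reg nwR) ?_ ?_) ?_
  · exact ⟨h₁, hS₁, hX₁, by simp [hs₂], by simp [hs₂]⟩
  · rintro s₃ ⟨h₃, hS₃, hX₃, hnw₃, -⟩ hf₃ hb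
    have hnw : s₃.reg nwR = 1 := by
      have : s₃.reg nwR ≠ 0 := hb
      omega
    have hc₃ : RowCtx s₃ e H p d r := hc₂.of_frame hf₃ (by decide) (by decide)
    have hn₃ : s₃.reg nR = n := (hf₃.reg nR rfl).trans hn₁
    rw [runs_seq, runs_set]
    simp only [Expr.eval]
    set s₄ := s₃.setReg nwR 0 with hs₄
    have hc₄ : RowCtx s₄ e H p d r :=
      hc₃.of_frame (Exec.set nwR (.const 0) s₃).frame (by decide) (by decide)
    have hn₄ : s₄.reg nR = n := hn₃
    have hspec := runs_attractRound hc₄ (by rw [hn₄]; exact h₃) (by simp [hs₄])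
    rw [hn₄] at hspec
    refine hspec.call ?_
    rintro t s₅ ⟨h₅, hS₅, hT₅, hnw₅, hset₅, ht⟩ -
    refine ⟨⟨h₅, hS₃.trans hS₅, fun i hi hiX => hT₅ i (hX₃ i hi hiX), hnw₅, hset₅⟩, ?_⟩
    rw [hnw]
    rw [show s₄.arr = s₃.arr from rfl] at ht
    simp only [Expr.cost]
    omega
  rintro t₃ s₃ ⟨⟨h₃, hS₃, hX₃, -, hset₃⟩, hb, ht₃⟩ hf₃
  have hset₃ := hset₃ hb
  have hc₃ : RowCtx s₃ e H p d r := hc₂.of_frame hf₃ (by decide) (by decide)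
  have hn₃ : s₃.reg nR = n := (hf₃.reg nR rfl).trans hn₁
  refine (runs_fill s₃ attA _ (fun i => if s₃.arr winA i 0 = 0 ∧ d ≤ s₃.arr colA i 0 ∧
    s₃.arr rowP r i = n then 1 else 0) (by simp) ?_).call ?_
  · intro s' k hk hx hr ha _
    have h1 : s'.reg nR = n := (hr nR (by decide)).trans hn₃
    have h2 : s'.reg dR = d := (hr dR (by decide)).trans hc₃.color
    have h3 : s'.reg rowR = r := (hr rowR (by decide)).trans hc₃.row
    have h4 := ha winA (by decide)
    have h5 := ha colA (by decide)
    have h6 := ha rowP (by decide)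
    simp [hx, h1, h2, h3, h4, h5, h6]
  · rintro t₄ s₄ ⟨ht₄, hA⟩ hf₄
    have hT₄ : s₄.arr rowT = s₃.arr rowT := hf₄.arr rowT rfl
    have hP₄ : s₄.arr rowP = s₃.arr rowP := hf₄.arr rowP rfl
    have hn₄ : s₄.reg nR = n := (hf₄.reg nR rfl).trans hn₃
    refine ⟨by rw [hT₄, hP₄]; exact h₃, hS₃.trans (.of_eq hT₄ hP₄), ?_, ?_⟩
    · have key : ∀ i < n, s₄.arr attA i 0 ≠ 0 ↔ e i ∈ H.mattr p X d := by
        intro i hi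
        rw [hA i (by omega), h₃.mem_mattr_iff hc.game hc.holds.surj hc.holds.inj hX₃ hset₃ hi,
          ← hc₃.holds.alive i (by omega), ← hc₃.holds.col i (by omega)]
        split_ifs with h <;> simp [h]
      ext v
      constructor
      · rintro ⟨i, hi, rfl, hi'⟩
        exact (key i (by omega)).1 hi'
      · intro hv
        obtain ⟨i, hi, rfl⟩ := hc.holds.surj v (mattr_subset_nodes hv)
        exact ⟨i, by omega, rfl, (key i hi).2 hv⟩
    · rw [hT₄, hP₄]
      rw [show s₂.reg nwR = 1 by simp [hs₂], show s₂.arr = s₁.arr from rfl] at ht₃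
      simp only [Expr.cost] at ht₃ ⊢
      omega

end ParityGames

namespace ParityGames

open Code Arena

variable {α : Type*} {s s' : Store} {e : ℕ → α} {G H : Arena α} {p : Fin 2} {d r v n : ℕ}
  {X : Set α} {T P : ℕ → ℕ} {won : Fin 2 → Set α}

/-! ## States with adjacency matrix -/

namespace Code

open ParityGames.Expr

/-- Set all entries of a matrix to `0`. -/
def zeroMatrix (a : ℕ) : Cmd :=
  for' vR (reg nR) (for' wR (reg nR) (.put a (reg vR) (reg wR) (const 0)))

/-- All nodes in the current game, no result of the solver so far. -/
def startMatrix : Cmd :=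
  for' vR (reg nR) (put1 winA (reg vR) (const 0)) ;;
  zeroMatrix adjA ;;
  for' vR (reg nR)
    (for' jR (at1 degA (reg vR)) (.put adjA (reg vR) (get sucA (reg vR) (reg jR)) (const 1)))

/-- Forget all rows. -/
def zeroRows : Cmd := zeroMatrix rowT ;; zeroMatrix rowP

/-- Remove the attractor of `attA` from the current game. -/
def removeStep : Cmd := listPreds ;; removeAttr

/-- Remove the edges from `kR` to `attA`. -/
def pruneMatrix : Cmd :=
  filterSuccs (reg kR) (fun w => eq (at1 attA w) (const 0)) ;;
  for' wR (reg nR) (when (at1 attA (reg wR)) (.put adjA (reg kR) (reg wR) (const 0)))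

end Code

theorem runs_zeroMatrix (s : Store) (a : ℕ) :
    Runs (zeroMatrix a) s 0 fun t s' => t ≤ 30 * ((s.reg nR + 1) * (s.reg nR + 1)) ∧
      ∀ i < s.reg nR, ∀ j < s.reg nR, s'.arr a i j = 0 := by
  set n := s.reg nR with hn
  refine (runs_for_const (N := n) (fun k s' => ∀ i < k, ∀ j < n, s'.arr a i j = 0)
    (20 * (n + 1)) rfl (fun _ _ _ h => h) (by simp) ?_ ?_).mono ?_
  · rintro k s' - - - hf
    exact hf.reg nR rfl
  · rintro k s₁ hk hI hx hf
    have hn₁ : s₁.reg nR = n := hf.reg nR rfl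
    refine (runs_for_const (N := n)
      (fun l s' => (∀ j < l, s'.arr a k j = 0) ∧ ∀ i < k, ∀ j < n, s'.arr a i j = 0) 10 rfl
      (fun _ _ _ h => h) ⟨by simp, hI⟩ ?_ ?_).mono ?_
    · rintro l s' - - - hf'
      exact (hf'.reg nR rfl).trans hn₁
    · rintro l s₂ hl ⟨hJ, hJ'⟩ hy hf'
      have hx₂ : s₂.reg vR = k := (hf'.reg vR rfl).trans hx
      rw [runs_put]
      simp only [Expr.eval, hx₂, hy]
      refine ⟨⟨fun j hj => ?_, fun i hi j hj => ?_⟩, by simp⟩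
      · by_cases hjl : j = l
        · simp [hjl]
        · simp [hjl, hJ j (by omega)]
      · simp [hi.ne, hJ' i hi j hj]
    · rintro t s₂ ⟨⟨hJ, hJ'⟩, ht⟩
      refine ⟨fun i hi => ?_, by simp only [Expr.cost] at ht; omega⟩
      rcases (Nat.lt_succ_iff.1 hi).lt_or_eq with h | rfl
      · exact hJ' i h
      · exact hJ
  · rintro t s' ⟨hI, ht⟩
    refine ⟨?_, hI⟩
    simp only [Expr.cost] at ht
    nlinarith

/-- A state with successor lists and adjacency matrix. -/
structure MatState (s : Store) (e : ℕ → α) (H : Arena α) (won : Fin 2 → Set α) : Prop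
    extends State s e H won where
  succs : HoldsSuccs s e H
  adj : HoldsAdj s e H
  edges : H.numEdges ≤ s.reg nR * s.reg nR

theorem MatState.congr (h : MatState s e H won) (hn : s'.reg nR = s.reg nR)
    (h0 : ∀ a ∈ [winA, colA, ownA, degA, sucA, adjA], s'.arr a = s.arr a) :
    MatState s' e H won :=
  ⟨h.toState.congr hn (h0 _ (by simp)) (h0 _ (by simp)) (h0 _ (by simp)),
    h.succs.congr hn (h0 _ (by simp)) (h0 _ (by simp)), h.adj.congr hn (h0 _ (by simp)),
    by rw [hn]; exact h.edges⟩

theorem MatState.of_frame {c : Cmd} (h : MatState s e H won) (hf : Frame c s s')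
    (hn : c.writesReg nR = false)
    (ha : ∀ a ∈ [winA, colA, ownA, degA, sucA, adjA], c.writesArr a = false) :
    MatState s' e H won :=
  h.congr (hf.reg _ hn) fun a h => hf.arr a (ha a h)

theorem Input.runs_startMatrix (h : Input s e G) (hG : G.IsParityGame) :
    Runs startMatrix s 0 fun t s' => t ≤ 300 * ((s.reg nR + 1) * (s.reg nR + 1)) ∧
      MatState s' e G fun _ => ∅ := by
  set n := s.reg nR with hn
  refine Runs.call_seq (runs_fill s winA (.const 0) (fun _ => 0) (by simp) (by simp)) ?_
  rintro t₁ s₁ ⟨ht₁, h₁⟩ hf₁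
  have hn₁ : s₁.reg nR = n := hf₁.reg nR rfl
  refine Runs.call_seq (runs_zeroMatrix s₁ adjA) ?_
  rintro t₂ s₂ ⟨ht₂, h₂⟩ hf₂
  have hn₂ : s₂.reg nR = n := (hf₂.reg nR rfl).trans hn₁
  rw [hn₁] at ht₂ h₂
  have hdeg : s₂.arr degA = s.arr degA := (hf₂.arr _ rfl).trans (hf₁.arr _ rfl)
  have hsuc : s₂.arr sucA = s.arr sucA := (hf₂.arr _ rfl).trans (hf₁.arr _ rfl)
  have hle : ∀ i < n, s.arr degA i 0 ≤ n := by
    intro i hi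
    rw [← (h.succs i hi (h.mem i hi)).ncard]
    calc _ ≤ (Finset.range n : Set ℕ).ncard :=
          Set.ncard_le_ncard (fun j hj => by simpa using hj.1) (Finset.finite_toSet _)
      _ = _ := by rw [Set.ncard_coe_finset, Finset.card_range]
  refine (runs_for_const (N := n)
    (fun k s' => ∀ i < n, ∀ j < n, s'.arr adjA i j ≠ 0 ↔ i < k ∧ (e i, e j) ∈ G.E) (20 * (n + 1)) rfl
    (fun _ _ _ h => h) ?_ ?_ ?_).call ?_
  · intro i hi j hj
    simp [h₂ i hi j hj]
  · rintro k s' - - - hf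
    exact (hf.reg nR rfl).trans hn₂
  · rintro k s₃ hk hI hx hf₃
    have hd₃ : s₃.arr degA = s.arr degA := (hf₃.arr _ rfl).trans hdeg
    have hL := h.succs k hk (h.mem k hk)
    refine (runs_for_const (N := s.arr degA k 0)
      (fun l s' => ∀ i < n, ∀ j < n, s'.arr adjA i j ≠ 0 ↔ i < k ∧ (e i, e j) ∈ G.E ∨
        i = k ∧ ∃ l' < l, s.arr sucA k l' = j) 10 rfl (fun _ _ _ h => h) ?_ ?_ ?_).mono ?_
    · intro i hi j hj
      simp [hI i hi j hj]
    · rintro l s' - - - hf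
      have h1 : s'.reg vR = k := (hf.reg vR rfl).trans hx
      have h2 : s'.arr degA = s.arr degA := (hf.arr degA rfl).trans hd₃
      simp [h1, h2]
    · rintro l s₄ hl hJ hy hf
      have h1 : s₄.reg vR = k := (hf.reg vR rfl).trans hx
      have h2 : s₄.arr sucA = s.arr sucA := (hf.arr _ rfl).trans ((hf₃.arr _ rfl).trans hsuc)
      rw [runs_put]
      simp only [Expr.eval, h1, hy, h2]
      refine ⟨fun i hi j hj => ?_, by simp⟩
      have hJ := hJ i hi j hj
      simp only [Store.setArr_arr, if_true]
      split_ifs with hc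
      · simp only [ne_eq, one_ne_zero, not_false_eq_true, true_iff]
        exact Or.inr ⟨hc.1, l, by omega, hc.2.symm⟩
      · rw [hJ]
        refine or_congr_right (and_congr_right fun hik => ⟨?_, ?_⟩)
        · rintro ⟨l', hl', h⟩
          exact ⟨l', by omega, h⟩
        · rintro ⟨l', hl', h⟩
          rcases (Nat.lt_succ_iff.1 hl').lt_or_eq with h'' | rfl
          · exact ⟨l', h'', h⟩
          · exact absurd ⟨hik, h.symm⟩ hc
    · rintro t s₄ ⟨hJ, ht⟩
      refine ⟨fun i hi j hj => ?_, ?_⟩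
      · rw [hJ i hi j hj, ← hL.mem]
        simp only [Set.mem_ofPred_eq]
        constructor
        · rintro (⟨h1, h2⟩ | ⟨rfl, -, h2⟩)
          · exact ⟨by omega, h2⟩
          · exact ⟨by omega, h2⟩
        · rintro ⟨h1, h2⟩
          rcases (Nat.lt_succ_iff.1 h1).lt_or_eq with h' | rfl
          · exact Or.inl ⟨h', h2⟩
          · exact Or.inr ⟨rfl, hj, h2⟩
      · have := hle k hk
        simp only [Expr.cost] at ht
        nlinarith
  · rintro t₃ s₃ ⟨hI, ht₃⟩ hf₃
    have hn₃ : s₃.reg nR = n := (hf₃.reg nR rfl).trans hn₂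
    have hst : State s₁ e G fun _ => ∅ := h.holds_of hn₁ h₁ (hf₁.arr _ rfl) (hf₁.arr _ rfl) hG
    refine ⟨?_, hst.congr (by rw [hn₃, hn₁]) ?_ ?_ ?_, h.succs.congr hn₃ ?_ ?_, ?_, ?_⟩
    · simp only [Expr.cost] at ht₃
      nlinarith
    · exact (hf₃.arr _ rfl).trans (hf₂.arr _ rfl)
    · exact (hf₃.arr _ rfl).trans (hf₂.arr _ rfl)
    · exact (hf₃.arr _ rfl).trans (hf₂.arr _ rfl)
    · exact (hf₃.arr _ rfl).trans hdeg
    · exact (hf₃.arr _ rfl).trans hsuc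
    · intro i hi j hj _ _
      rw [hI i (by omega) j (by omega)]
      exact and_iff_right (by omega)
    · rw [hn₃, hn, h.reg_eq, numNodes, numEdges, ← Set.ncard_prod]
      exact Set.ncard_le_ncard hG.edges (hG.finite.prod hG.finite)

/-- Predecessor lists are not maintained during visits but rebuilt here. Quadratic cost is
affordable since each removal takes away a node. The matrix need not change, as `HoldsAdj` speaks of
the remaining nodes only. -/
theorem MatState.runs_removeStep (h : MatState s e H won) (hp : s.reg pR = p.val)
    (hX : marked s e attA = X) (hXn : X ⊆ H.nodes) :
    Runs removeStep s 0 fun t s' => t ≤ 1200 * ((s.reg nR + 1) * (s.reg nR + 1)) ∧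
      MatState s' e (H.removeNodes (H.attr p X)) (addWon won p (H.attr p X)) := by
  refine Runs.call_seq (h.toState.runs_listPreds h.succs h.edges) ?_
  rintro t₁ s₁ ⟨ht₁, hl₁⟩ hf₁
  have hn₁ : s₁.reg nR = s.reg nR := hf₁.reg nR rfl
  have hX₁ : marked s₁ e attA = X := (marked_congr e hn₁ (hf₁.arr _ rfl)).trans hX
  refine (hl₁.runs_removeAttr ((hf₁.reg pR rfl).trans hp) (hX₁ ▸ hXn)).call ?_
  rintro t₂ s₂ ⟨ht₂, hl₂⟩ hf₂
  have hn₂ : s₂.reg nR = s.reg nR := (hf₂.reg nR rfl).trans hn₁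
  rw [hX₁] at hl₂
  rw [hn₁] at ht₂
  refine ⟨by nlinarith, hl₂.toState, hl₂.succs, fun i hi j hj hiH hjH => ?_, hn₂ ▸ hl₂.edges⟩
  rw [hn₂] at hi hj
  rw [removeNodes_nodes] at hiH hjH
  rw [hf₂.arr adjA rfl, hf₁.arr adjA rfl, h.adj i hi j hj hiH.1 hjH.1]
  exact ⟨fun h => ⟨h, hiH.2, hjH.2⟩, fun h => h.1⟩

/-- Only row `k` of the matrix and one successor list change, so pruning is linear in n. -/
theorem MatState.runs_pruneMatrix {k : ℕ} (h : MatState s e H won) (hk : s.reg kR = k)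
    (hkn : k < s.reg nR) (hkH : e k ∈ H.nodes) (hA : marked s e attA = H.fattr (e k))
    (hkA : e k ∉ H.fattr (e k)) :
    Runs pruneMatrix s 0 fun t s' => t ≤ 100 * (s.reg nR + 1) ∧
      MatState s' e (H.pruned (e k)) won := by
  set n := s.reg nR with hn
  refine Runs.call_seq (h.toState.runs_filterSuccs h.succs hk hkn hkH hA hkA) ?_
  rintro t₁ s₁ ⟨ht₁, hs₁, hsu₁⟩ hf₁
  have hn₁ : s₁.reg nR = n := hf₁.reg nR rfl
  have hA₁ : s₁.arr attA = s.arr attA := hf₁.arr _ rfl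
  refine (runs_for_const (N := n)
    (fun l s' => ∀ i < n, ∀ j < n, s'.arr adjA i j ≠ 0 ↔ s.arr adjA i j ≠ 0 ∧
      ¬ (i = k ∧ j < l ∧ s.arr attA j 0 ≠ 0)) 10 rfl (fun _ _ _ h => h) ?_ ?_ ?_).call ?_
  · intro i _ j _
    rw [hf₁.arr adjA rfl]; simp
  · rintro l s' - - - hf
    exact (hf.reg nR rfl).trans hn₁
  · rintro l s₂ hl hI hx hf
    have hA₂ : s₂.arr attA = s.arr attA := (hf.arr _ rfl).trans hA₁
    have hk₂ : s₂.reg kR = k := (hf.reg kR rfl).trans ((hf₁.reg kR rfl).trans hk)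
    refine Runs.ite (P := s.arr attA l 0 ≠ 0) (by simp [hx, hA₂]) (fun hP => ?_) (fun hP => ?_)
    · rw [runs_put]
      simp only [Expr.eval, hk₂, hx]
      refine ⟨fun i hi j hj => ?_, by simp⟩
      have := hI i hi j hj
      simp only [Store.setArr_arr, if_true]
      split_ifs with hc
      · obtain ⟨rfl, rfl⟩ := hc
        simp only [ne_eq, not_true_eq_false, false_iff, not_and, not_not]
        exact fun _ h => hP (h trivial (by omega))
      · rw [this]
        have h1 : i = k → (j < l + 1 ↔ j < l) := fun hik => by
          have : j ≠ l := fun hjl => hc ⟨hik, hjl⟩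
          omega
        refine and_congr_right fun _ => not_congr (and_congr_right fun hik => ?_)
        rw [h1 hik]
    · rw [runs_skip]
      refine ⟨fun i hi j hj => ?_, by simp⟩
      rw [hI i hi j hj]
      refine and_congr_right fun _ => not_congr (and_congr_right fun _ => ⟨?_, ?_⟩)
      · exact fun h => ⟨by omega, h.2⟩
      · rintro ⟨h1, h2⟩
        have : j ≠ l := by rintro rfl; exact hP h2
        exact ⟨by omega, h2⟩
  · rintro t₂ s₂ ⟨hI, ht₂⟩ hf₂
    have hn₂ : s₂.reg nR = n := (hf₂.reg nR rfl).trans hn₁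
    refine ⟨?_, hs₁.congr (by rw [hn₂, hn₁]) (hf₂.arr _ rfl) (hf₂.arr _ rfl) (hf₂.arr _ rfl),
      hsu₁.congr (by rw [hn₂, hn₁]) (hf₂.arr _ rfl) (hf₂.arr _ rfl), ?_, ?_⟩
    · simp only [Expr.cost] at ht₂
      omega
    · intro i hi j hj hiH hjH
      rw [hn₂] at hi hj
      rw [hI i hi j hj, h.adj i hi j hj hiH hjH]
      refine and_congr_right fun _ => not_congr ⟨?_, ?_⟩
      · rintro ⟨rfl, -, hj'⟩
        exact ⟨rfl, hA ▸ (h.holds.mem_marked hj).2 hj'⟩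
      · rintro ⟨h1, h2⟩
        exact ⟨h.holds.inj i hi k hkn h1, hj, (h.holds.mem_marked hj).1 (hA ▸ h2)⟩
    · rw [hn₂]
      exact (numEdges_mono h.game Set.sdiff_subset).trans h.edges

/-- The number of steps that may still be needed for all rows. -/
def Store.rowsPot (s : Store) : ℕ :=
  ∑ q ∈ Finset.range (s.reg nR), rowPot (s.reg nR) (s.arr rowT q) (s.arr rowP q)

theorem Store.rowsPot_le (s : Store) :
    s.rowsPot ≤ 600 * ((s.reg nR + 1) * (s.reg nR + 1) * (s.reg nR + 1)) := by
  refine (Finset.sum_le_card_nsmul _ _ _ fun i _ => rowPot_le).trans ?_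
  rw [Finset.card_range, smul_eq_mul]
  nlinarith [Nat.zero_le (s.reg nR), Nat.zero_le (s.reg nR * s.reg nR)]

theorem Store.rowsPot_congr (hn : s'.reg nR = s.reg nR) (hT : s'.arr rowT = s.arr rowT)
    (hP : s'.arr rowP = s.arr rowP) : s'.rowsPot = s.rowsPot := by
  simp [rowsPot, hn, hT, hP]

/-- Refreshing a row draws on its own potential only, so a bound for one row is a bound for all rows
together. -/
theorem SameRows.rowsPot_le {t c : ℕ} (h : SameRows s s' r) (hn : s'.reg nR = s.reg nR)
    (hr : r < s.reg nR)
    (ht : t + rowPot (s.reg nR) (s'.arr rowT r) (s'.arr rowP r) ≤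
      rowPot (s.reg nR) (s.arr rowT r) (s.arr rowP r) + c) :
    t + s'.rowsPot ≤ s.rowsPot + c := by
  unfold Store.rowsPot
  rw [hn, ← Finset.add_sum_erase _ _ (Finset.mem_range.2 hr),
    ← Finset.add_sum_erase _ _ (Finset.mem_range.2 hr)]
  have : ∑ q ∈ (Finset.range (s.reg nR)).erase r, rowPot (s.reg nR) (s'.arr rowT q) (s'.arr rowP q) =
      ∑ q ∈ (Finset.range (s.reg nR)).erase r, rowPot (s.reg nR) (s.arr rowT q) (s.arr rowP q) := by
    refine Finset.sum_congr rfl fun q hq => ?_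
    obtain ⟨h1, h2⟩ := h q (Finset.ne_of_mem_erase hq)
    rw [h1, h2]
  omega

/-- A row without marks and with all pointers at the start claims nothing, so it is valid for every
attractor. -/
theorem RowInv.zero (hT : ∀ i < n, T i = 0) (hP : ∀ i < n, P i = 0) : RowInv n e H p d X T P := by
  refine ⟨fun i hi _ h => absurd (hT i hi) h, fun i hi => by rw [hP i hi]; omega,
    fun i hi _ h => ?_, fun i _ j hj _ _ h => absurd (hT j hj) h, fun i hi _ j hj => ?_⟩
  · have := hP i hi; omega
  · have := hP i hi; omega

theorem runs_zeroRows (s : Store) :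
    Runs zeroRows s 0 fun t s' => t ≤ 60 * ((s.reg nR + 1) * (s.reg nR + 1)) ∧
      ∀ q < s.reg nR, ∀ (e : ℕ → α) (H : Arena α) (p : Fin 2) (d : ℕ) (X : Set α),
        RowInv (s.reg nR) e H p d X (s'.arr rowT q) (s'.arr rowP q) := by
  refine Runs.call_seq (runs_zeroMatrix s rowT) ?_
  rintro t₁ s₁ ⟨ht₁, h₁⟩ hf₁
  have hn₁ : s₁.reg nR = s.reg nR := hf₁.reg nR rfl
  refine (runs_zeroMatrix s₁ rowP).call ?_
  rintro t₂ s₂ ⟨ht₂, h₂⟩ hf₂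
  rw [hn₁] at ht₂ h₂
  refine ⟨by omega, fun q hq e H p d X => .zero ?_ (h₂ q hq)⟩
  rw [hf₂.arr rowT rfl]
  exact h₁ q hq

end ParityGames

namespace ParityGames

open Code Arena

variable {α : Type*} {s s' : Store} {e : ℕ → α} {G H : Arena α} {p : Fin 2} {d r v n : ℕ}
  {X : Set α} {won : Fin 2 → Set α}

/-! ## The solver `psol` in cubic time -/

/-- A visit of `psol` to a node; row `k` of the matrices belongs to node number `k`. -/
def psolRowVisit : Cmd :=
  .set rowR (.reg kR) ;;
  .set dR (at1 colA (.reg kR)) ;;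
  .set pR (.parity (.reg dR)) ;;
  for' vR (.reg nR) (put1 setA (.reg vR) (.eq (.reg vR) (.reg kR))) ;;
  refresh ;;
  .ite (at1 attA (.reg kR))
    (removeStep ;;
    recurse)
    pruneMatrix

/-- The solver `psol`, with rows. -/
def psolRows : Cmd :=
  startMatrix ;;
  zeroRows ;;
  sortNodes (fun e f => .lt f e) ;;
  psolLoop psolRowVisit

/-- A state of `psolRows`. -/
structure PsolRowState (s : Store) (e : ℕ → α) (H : Arena α) (won : Fin 2 → Set α) : Prop
    extends MatState s e H won where
  rows : ∀ q < s.reg nR, e q ∈ H.nodes →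
    RowInv (s.reg nR) e H (player (H.c (e q))) (H.c (e q)) {e q} (s.arr rowT q) (s.arr rowP q)

/-- A visit is linear and a removal quadratic, beyond what the rows pay. All rows remain valid in
the next game by `fattr_sdiff_subset` after a removal and by `fattr_subset_pruned` after pruning. -/
theorem psolRowVisit_spec (e : ℕ → α) (n : ℕ) :
    PsolVisit e psolRowVisit n (1500 * (n + 1)) (1200 * ((n + 1) * (n + 1)))
      (fun s H won => PsolRowState s e H won) Store.rowsPot where
  state s H won h := h.toState
  setReg s H won x m hx h := by
    simp only [List.mem_cons, List.not_mem_nil, or_false] at hx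
    have hn : (s.setReg x m).reg nR = s.reg nR := by
      rcases hx with rfl | rfl | rfl <;> rfl
    exact ⟨h.toMatState.congr hn (fun _ _ => rfl), by rw [hn]; exact h.rows⟩
  potential s x m hx := by
    simp only [List.mem_cons, List.not_mem_nil, or_false] at hx
    refine Store.rowsPot_congr ?_ rfl rfl
    rcases hx with rfl | rfl | rfl <;> rfl
  reg := rfl
  arr := by decide
  runs s H won k h hn hk hkn hkH := by
    have hck : s.arr colA k 0 = H.c (e k) := h.holds.col k (hn ▸ hkn)
    rw [psolRowVisit, runs_seq, runs_set, runs_seq, runs_set, runs_seq, runs_set]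
    simp only [Expr.eval, hk, Store.setReg_reg, Store.setReg_arr, show kR ≠ rowR by decide,
      if_false, if_true, hck]
    set s₁ := ((s.setReg rowR k).setReg dR (H.c (e k))).setReg pR (H.c (e k) % 2) with hs₁
    have hn₁ : s₁.reg nR = n := hn
    have hk₁ : s₁.reg kR = k := hk
    refine Runs.call_seq (runs_fill s₁ setA _ (fun i => if i = k then 1 else 0) (by simp) ?_) ?_
    · intro s' i _ hx hr _ _
      have h1 : s'.reg kR = k := (hr kR (by decide)).trans hk₁
      simp [hx, h1]
    rintro t₂ s₂ ⟨ht₂, hset⟩ hf₂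
    have hn₂ : s₂.reg nR = n := (hf₂.reg nR rfl).trans hn₁
    have hm₂ : MatState s₂ e H won :=
      h.toMatState.congr (by rw [hn₂, hn]) fun a ha => hf₂.arr a (by
        simp at ha; rcases ha with rfl | rfl | rfl | rfl | rfl | rfl <;> rfl)
    have hT₂ : s₂.arr rowT = s.arr rowT := hf₂.arr rowT rfl
    have hP₂ : s₂.arr rowP = s.arr rowP := hf₂.arr rowP rfl
    have hX₂ : marked s₂ e setA = {e k} := by
      ext v
      simp only [marked, Set.mem_ofPred_eq, Set.mem_singleton_iff, hn₂]
      constructor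
      · rintro ⟨i, hi, rfl, hi'⟩
        rw [hset i (by omega)] at hi'
        by_contra hne
        rw [if_neg (fun hik => hne (by rw [hik]))] at hi'
        exact hi' rfl
      · rintro rfl
        exact ⟨k, hkn, rfl, by rw [hset k (by omega)]; simp⟩
    have hc₂ : RowCtx s₂ e H (player (H.c (e k))) (H.c (e k)) k :=
      ⟨hm₂.game, hm₂.holds, hm₂.adj, (hf₂.reg pR rfl).trans (by simp [hs₁, player]),
        (hf₂.reg dR rfl).trans (by simp [hs₁]), (hf₂.reg rowR rfl).trans (by simp [hs₁])⟩
    have hrow := h.rows k (by omega) hkH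
    rw [hn] at hrow
    have hspec := runs_refresh hc₂ hX₂ (Set.singleton_subset_iff.2 hkH)
      (by rw [hn₂, hT₂, hP₂]; exact hrow)
    refine Runs.call_seq hspec ?_
    rintro t₃ s₃ ⟨hrow₃, hS₃, hA₃, ht₃⟩ hf₃
    have hn₃ : s₃.reg nR = n := (hf₃.reg nR rfl).trans hn₂
    have hk₃ : s₃.reg kR = k := (hf₃.reg kR rfl).trans ((hf₂.reg kR rfl).trans hk₁)
    have hpot := hS₃.rowsPot_le (by rw [hn₃, hn₂]) (by omega) ht₃
    rw [hn₂] at hrow₃ hpot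
    rw [show s₂.rowsPot = s.rowsPot from Store.rowsPot_congr (by rw [hn₂, hn]) hT₂ hP₂] at hpot
    have hm₃ : MatState s₃ e H won := hm₂.of_frame hf₃ rfl (by decide)
    change marked s₃ e attA = H.fattr (e k) at hA₃
    have hrows₃ : ∀ q < n, e q ∈ H.nodes → RowInv n e H (player (H.c (e q))) (H.c (e q)) {e q}
        (s₃.arr rowT q) (s₃.arr rowP q) := by
      intro q hq hqH
      by_cases hqk : q = k
      · subst hqk; exact hrow₃
      · rw [(hS₃ q hqk).1, (hS₃ q hqk).2, hT₂, hP₂]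
        have := h.rows q (by omega) hqH
        rwa [hn] at this
    -- Common to both transitions: if no surviving node drops out of the attractor of a remaining
    -- node, every row carries over by `RowInv.mono`.
    have hmono : ∀ s' H' won', MatState s' e H' won' → s'.reg nR = n → s'.arr rowT = s₃.arr rowT →
        s'.arr rowP = s₃.arr rowP → (∀ q, H'.V q ⊆ H.V q) → H'.E ⊆ H.E → H'.c = H.c →
        (∀ q < n, e q ∈ H'.nodes → H.fattr (e q) ∩ H'.nodes ⊆ H'.fattr (e q)) →
        PsolRowState s' e H' won' := by
      intro s' H' won' hm' hn' hT' hP' hV hE hc hM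
      refine ⟨hm', fun q hq hqH => ?_⟩
      rw [hn'] at hq ⊢
      have := hM q hq hqH
      rw [hT', hP']
      unfold fattr at this
      rw [hc] at this ⊢
      exact (hrows₃ q hq (Set.union_subset_union (hV 0) (hV 1) hqH)).mono hV hE hc
        Set.inter_subset_left this
    refine Runs.ite (P := e k ∈ H.fattr (e k)) ?_ (fun hfat => ?_) (fun hfat => ?_)
    · rw [← hA₃, hm₃.holds.mem_marked (by omega)]
      simp [hk₃]
    · refine Runs.call_seq (hm₃.runs_removeStep (p := player (H.c (e k)))
        ((hf₃.reg pR rfl).trans hc₂.player) hA₃ mattr_subset_nodes) ?_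
      rintro t₄ s₄ ⟨ht₄, hm₄⟩ hf₄
      have hn₄ : s₄.reg nR = n := (hf₄.reg nR rfl).trans hn₃
      rw [recurse, runs_seq, runs_set, runs_set]
      set s₅ := (s₄.setReg goR (Expr.eval s₄ (.const 1))).setReg iR
        (Expr.eval (s₄.setReg goR (Expr.eval s₄ (.const 1))) (.reg nR)) with hs₅
      have hpot₅ : s₅.rowsPot = s₃.rowsPot :=
        Store.rowsPot_congr (hf₄.reg nR rfl) (hf₄.arr rowT rfl) (hf₄.arr rowP rfl)
      refine Or.inl ⟨hfat, by simp [hs₅], by simp [hs₅, hn₄], ?_, ?_⟩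
      · rw [hpot₅]
        simp only [Expr.cost]
        rw [hn₃] at ht₄
        omega
      · refine hmono s₅ _ _ (hm₄.congr rfl fun _ _ => rfl) hn₄ (hf₄.arr rowT rfl) (hf₄.arr rowP rfl)
          (fun q => Set.sdiff_subset) (Set.sep_subset _ _) rfl fun q hq hqH => ?_
        rw [removeNodes_nodes] at hqH ⊢
        rintro v ⟨hv, hv'⟩
        exact fattr_sdiff_subset h.game hfat rfl hqH.2 ⟨hv, hv'.2⟩
    · refine (hm₃.runs_pruneMatrix hk₃ (by omega) hkH hA₃ hfat).call ?_
      rintro t₄ s₄ ⟨ht₄, hm₄⟩ hf₄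
      have hn₄ : s₄.reg nR = n := (hf₄.reg nR rfl).trans hn₃
      have hpot₄ : s₄.rowsPot = s₃.rowsPot :=
        Store.rowsPot_congr (hf₄.reg nR rfl) (hf₄.arr rowT rfl) (hf₄.arr rowP rfl)
      refine Or.inr ⟨hfat, (hf₄.reg goR rfl).trans ((hf₃.reg goR rfl).trans (hf₂.reg goR rfl)),
        (hf₄.reg iR rfl).trans ((hf₃.reg iR rfl).trans (hf₂.reg iR rfl)), ?_, ?_⟩
      · rw [hpot₄]
        simp only [Expr.cost]
        rw [hn₃] at ht₄
        omega
      · exact hmono s₄ _ _ hm₄ hn₄ (hf₄.arr rowT rfl) (hf₄.arr rowP rfl) (fun q => le_rfl)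
          Set.sdiff_subset rfl fun q hq _ =>
            Set.inter_subset_left.trans (fattr_subset_pruned h.game hfat)

theorem Input.runs_psolRows (h : Input s e G) (hG : G.IsParityGame) :
    Runs psolRows s 0 fun t s' =>
      t ≤ 6000 * ((s.reg nR + 2) * (s.reg nR + 2) * (s.reg nR + 2)) ∧
      ∃ H won, MatState s' e H won ∧ Psol G ⟨H, won⟩ := by
  set n := s.reg nR with hn
  refine Runs.call_seq (h.runs_startMatrix hG) ?_
  rintro t₁ s₁ ⟨ht₁, hm₁⟩ hf₁
  rw [← hn] at ht₁
  have hn₁ : s₁.reg nR = n := hf₁.reg nR rfl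
  refine Runs.call_seq (runs_zeroRows (α := α) s₁) ?_
  rintro t₂ s₂ ⟨ht₂, hrow₂⟩ hf₂
  have hn₂ : s₂.reg nR = n := (hf₂.reg nR rfl).trans hn₁
  refine Runs.call_seq (runs_sortNodes s₂ (fun e f => .lt f e) (fun a b => b < a)
    (fun a b => by simp; ring) (fun a b s => by simp) (by intros; omega) (by intros; omega)) ?_
  rintro t₃ s₃ ⟨ht₃, ho₃⟩ hf₃
  have hn₃ : s₃.reg nR = n := (hf₃.reg nR rfl).trans hn₂
  have hs₃ : PsolRowState s₃ e G fun _ => ∅ := by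
    refine ⟨(hm₁.of_frame hf₂ rfl (by decide)).of_frame hf₃ rfl (by decide), fun q hq _ => ?_⟩
    rw [hn₃] at hq ⊢
    rw [hf₃.arr rowT rfl, hf₃.arr rowP rfl]
    rw [hn₁] at hrow₂
    exact hrow₂ q hq _ _ _ _ _
  refine ((psolRowVisit_spec e n).runs_psolLoop s₃ hs₃ hn₃ ho₃).call ?_
  rintro t s' ⟨ht, H, won, hs', hr⟩ -
  refine ⟨?_, H, won, hs'.toMatState, hr⟩
  have hpot := s₃.rowsPot_le
  rw [hn₃] at hpot
  rw [hn₁] at ht₂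
  rw [hn₂] at ht₃
  have h1 : (n + 1) * (n + 1) ≤ (n + 2) * (n + 2) * (n + 2) := by nlinarith
  have h2 : (n + 1) * (n + 1) * (n + 1) ≤ (n + 2) * (n + 2) * (n + 2) := by
    gcongr <;> omega
  -- A pass costs O(n²): n linear visits and at most one quadratic removal. The potential of the
  -- rows adds O(n³) once.
  have h3 : n * (1500 * (n + 1) + 50) + 1200 * ((n + 1) * (n + 1)) + 110 ≤
      2900 * ((n + 2) * (n + 2)) := by nlinarith
  have h4 := Nat.mul_le_mul_left (n + 2) h3
  have h5 : (n + 2) * (2900 * ((n + 2) * (n + 2))) = 2900 * ((n + 2) * (n + 2) * (n + 2)) := by ring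
  rw [h5] at h4
  rw [mul_assoc] at ht₃
  omega

end ParityGames

namespace ParityGames

open Code Arena

variable {α : Type*} {s s' : Store} {e : ℕ → α} {G H : Arena α} {p : Fin 2} {d r v n : ℕ}
  {X : Set α} {won : Fin 2 → Set α} {f : ℕ → ℕ} {i : ℕ}

/-! ## The solver `psolB` in cubic time -/

/-- The set that belongs to position `i` of the sorted list of nodes, if `f i` is the color of the node
at this position: of the sets that are examined for this color, there is one for each node. -/
def Arena.levelAt (H : Arena α) (f : ℕ → ℕ) (i : ℕ) : Set α :=
  H.levelSet (f i) (Nat.count (fun l => f l = f i) i)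

theorem Arena.levelAt_subset_nodes : H.levelAt f i ⊆ H.nodes := fun _ hv => (levelSet_subset _ hv).1

/-- Neighbouring positions of equal color hold consecutive sets of the same search, so one is
obtained from the other without recomputation. -/
theorem Arena.levelAt_succ (h : f i = f (i + 1)) :
    H.levelAt f (i + 1) = H.levelAt f i ∩ H.mattr (player (f i)) (H.levelAt f i) (f i) := by
  unfold levelAt
  rw [Nat.count_succ, ← h, if_pos rfl]
  rfl

/-- In a weakly decreasing sequence a position whose left neighbour has another color is the first
of its color, so its search is at the start. -/
theorem Arena.levelAt_of_ne (hf : ∀ l < i, f i ≤ f l) (h : ∀ l, i = l + 1 → f l ≠ f i)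
    (hs : ∀ j l, j ≤ l → l < i → f l ≤ f j) :
    H.levelAt f i = {v ∈ H.nodes | H.c v = f i} := by
  unfold levelAt
  rw [Nat.count_iff_forall_not.2]
  · rfl
  · intro l hl hfl
    obtain ⟨j, rfl⟩ : ∃ j, i = j + 1 := ⟨i - 1, by omega⟩
    have h1 := hs l j (by omega) (by omega)
    have h2 := hf j (by omega)
    exact h j rfl (by omega)

/-- The count grows in steps of one, so every smaller value is the count at a position that
satisfies `P`. -/
theorem exists_count_eq (P : ℕ → Prop) [DecidablePred P] {j n : ℕ} (h : j < Nat.count P n) :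
    ∃ l < n, P l ∧ Nat.count P l = j := by
  induction n with
  | zero => simp at h
  | succ n ih =>
    rw [Nat.count_succ] at h
    by_cases hj : j < Nat.count P n
    · obtain ⟨l, hl, h⟩ := ih hj
      exact ⟨l, by omega, h⟩
    · split_ifs at h with hP
      · exact ⟨n, by omega, hP, by omega⟩
      · omega

/-- If no set that belongs to a position is fatal, then there is no fatal set. -/
theorem Arena.not_isFatal_of_levelAt (hH : H.IsParityGame) {g : ℕ → α}
    (hg : ∀ v ∈ H.nodes, ∃ l < n, g l = v ∧ H.c v = f l)
    (h : ∀ l < n, player (f l) = p → ¬ H.IsFatal p (f l) (H.levelAt f l)) (d : ℕ) (B : Set α) :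
    ¬ H.IsFatal p d B := by
  intro hB
  have hp := hB.player_eq
  -- The positions of color `d` are at least as many as the current nodes of this color, since
  -- removed nodes keep their positions; so the search has enough levels to end with the empty set.
  have hempty := levelSet_eq_empty (d := d) (N := Nat.count (fun l => f l = d) n) hH ?_ ?_
  · have := hB.subset_levelSet (Nat.count (fun l => f l = d) n)
    rw [hempty] at this
    exact hB.nonempty.ne_empty (Set.subset_empty_iff.1 this)
  · rw [Nat.count_eq_card_filter_range, ← Set.ncard_coe_finset]
    refine (Set.ncard_le_ncard ?_ ((Finset.finite_toSet _).image g)).trans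
      (Set.ncard_image_le (Finset.finite_toSet _))
    rintro v ⟨hv, rfl⟩
    obtain ⟨l, hl, rfl, hc⟩ := hg v hv
    exact ⟨l, by simp [hl, hc], rfl⟩
  · intro j hj
    obtain ⟨l, hl, rfl, rfl⟩ := exists_count_eq _ hj
    rw [hp]
    exact h l hl hp

namespace Code

open ParityGames.Expr

/-- `neR := [setA ≠ ∅]`. -/
def testNonempty : Cmd :=
  .set neR (const 0) ;;
  for' vR (reg nR) (when (at1 setA (reg vR)) (.set neR (const 1)))

/-- Put the set for position `iR` of the sorted list into `setA`. -/
def levelTarget : Cmd :=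
  .ite (and (lt (const 0) (reg iR)) (eq (at1 colA (at1 ordA (pred (reg iR)))) (reg dR)))
    (for' vR (reg nR) (put1 setA (reg vR) (and (at1 setA (reg vR)) (at1 attA (reg vR)))))
    (for' vR (reg nR) (put1 setA (reg vR) (and (alive (reg vR)) (eq (at1 colA (reg vR)) (reg dR)))))

/-- Look for a fatal set at position `iR` of the sorted list; row `i` of the matrices belongs to
position `i`. -/
def levelVisit : Cmd :=
  .set rowR (reg iR) ;;
  levelTarget ;;
  refresh ;;
  testFatal ;;
  testNonempty ;;
  .ite (and (reg okR) (reg neR))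
    (removeStep ;;
    recurse)
    .skip

/-- Look for a fatal set of player `p`. -/
def levelPass (p : Fin 2) : Cmd :=
  .set goR (const 0) ;;
  .set iR (const 0) ;;
  .while (lt (reg iR) (reg nR))
    (.set dR (at1 colA (at1 ordA (reg iR))) ;;
    .set pR (parity (reg dR)) ;;
    when (eq (reg pR) (const p.val)) levelVisit ;;
    incr iR)

/-- Remove the attractors of fatal sets of player `p` until there is none. -/
def levelPhase (p : Fin 2) : Cmd :=
  zeroRows ;;
  .set goR (const 1) ;;
  .while (reg goR) (levelPass p)

/-- The solver `psolB`, with rows. -/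
def psolBRows : Cmd :=
  startMatrix ;;
  sortNodes (fun e f => lt f e) ;;
  levelPhase 0 ;;
  levelPhase 1

end Code

theorem runs_testNonempty (s : Store) (e : ℕ → α) :
    Runs testNonempty s 0 fun t s' => t ≤ 100 * (s.reg nR + 1) ∧
      (s'.reg neR ≠ 0 ↔ (marked s e setA).Nonempty) := by
  rw [testNonempty, runs_seq, runs_set]
  refine (runs_for_const (N := s.reg nR)
    (fun k s' => s'.reg neR ≠ 0 ↔ ∃ i < k, s.arr setA i 0 ≠ 0) 40 rfl
    (fun k s m h => ?_) ?_ ?_ ?_).call ?_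
  · simpa using h
  · simp
  · rintro k s' - - - hf
    exact hf.reg nR rfl
  · rintro k s₁ hk hI hx hf
    have hA : s₁.arr setA = s.arr setA := hf.arr setA rfl
    refine Runs.ite (P := s.arr setA k 0 ≠ 0) (by simp [hx, hA]) (fun hP => ?_) (fun hP => ?_)
    · rw [runs_set]
      refine ⟨?_, by simp⟩
      simp only [Store.setReg_reg, if_true, Expr.eval, ne_eq, one_ne_zero, not_false_eq_true, true_iff]
      exact ⟨k, by omega, hP⟩
    · rw [runs_skip]
      refine ⟨hI.trans ⟨?_, ?_⟩, by simp⟩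
      · rintro ⟨i, hi, h⟩
        exact ⟨i, by omega, h⟩
      · rintro ⟨i, hi, h⟩
        rcases (Nat.lt_succ_iff.1 hi).lt_or_eq with h' | rfl
        · exact ⟨i, h', h⟩
        · exact absurd h hP
  · rintro t s' ⟨h, ht⟩ -
    simp only [Expr.cost] at ht ⊢
    refine ⟨by omega, h.trans ⟨?_, ?_⟩⟩
    · rintro ⟨i, hi, h⟩
      exact ⟨e i, i, hi, rfl, h⟩
    · rintro ⟨_, i, hi, rfl, h⟩
      exact ⟨i, hi, h⟩

/-- A state of `psolBRows` when it looks for fatal sets of player `p`; the colors of the nodes in the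
sorted list are `f 0, f 1, …`. -/
structure LevelState (s : Store) (e : ℕ → α) (p : Fin 2) (f : ℕ → ℕ) (H : Arena α)
    (won : Fin 2 → Set α) : Prop extends MatState s e H won where
  order : Ranked s fun a b => ¬ a < b
  col : ∀ i, s.arr colA (s.arr ordA i 0) 0 = f i
  rows : ∀ q < s.reg nR, player (f q) = p →
    RowInv (s.reg nR) e H p (f q) (H.levelAt f q) (s.arr rowT q) (s.arr rowP q)

/-- The target of a row may change along with the game. The row survives because the surviving part
of the old target and that of the old attractor are contained in the new ones. -/
theorem RowInv.levelAt_removeNodes {A : Set α} {T P : ℕ → ℕ}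
    (h : RowInv n e H p (f i) (H.levelAt f i) T P) (hp : player (f i) = p) (hA : H.cpre p A ⊆ A) :
    RowInv n e (H.removeNodes A) p (f i) ((H.removeNodes A).levelAt f i) T P := by
  subst hp
  have hsub : H.levelAt f i \ A ⊆ (H.removeNodes A).levelAt f i := levelSet_sdiff_subset hA _
  refine h.mono (fun q => Set.sdiff_subset) (Set.sep_subset _ _) rfl ?_ ?_ <;>
    rw [removeNodes_nodes] <;> rintro v ⟨hv, hv'⟩
  · exact hsub ⟨hv, hv'.2⟩
  · exact mattr_mono hsub (mattr_sdiff_subset hA ⟨hv, hv'.2⟩)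

theorem LevelState.congr (h : LevelState s e p f H won) (hn : s'.reg nR = s.reg nR)
    (h0 : s'.arr = s.arr) : LevelState s' e p f H won :=
  ⟨h.toMatState.congr hn fun _ _ => by rw [h0], h.order.congr hn (by rw [h0]) (by rw [h0]),
    by rw [h0]; exact h.col, by rw [h0, hn]; exact h.rows⟩

theorem LevelState.le (h : LevelState s e p f H won) {j l : ℕ} (hjl : j ≤ l) (hl : l < s.reg nR) :
    f l ≤ f j := by
  rcases hjl.lt_or_eq with hjl | rfl
  · have := h.order.sorted j l hjl hl
    rw [h.col, h.col] at this
    omega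
  · exact le_rfl

/-- If the previous position has the same color, hence the same player, then `setA` and `attA` still
hold its set and its attractor, and their intersection is the next set. -/
theorem LevelState.runs_levelTarget (h : LevelState s e p f H won) (hi : s.reg iR = i)
    (hin : i < s.reg nR) (hd : s.reg dR = f i) (hp : player (f i) = p)
    (hprev : ∀ j, i = j + 1 → player (f j) = p →
      marked s e setA ∩ marked s e attA = H.levelAt f j ∩ H.mattr p (H.levelAt f j) (f j)) :
    Runs levelTarget s 0 fun t s' => t ≤ 200 * (s.reg nR + 1) ∧
      marked s' e setA = H.levelAt f i := by
  set n := s.reg nR with hn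
  refine Runs.ite (P := 0 < i ∧ f (i - 1) = f i) ?_ (fun hP => ?_) (fun hP => ?_)
  · simp [hi, hd, h.col]
  · obtain ⟨j, rfl⟩ : ∃ j, i = j + 1 := ⟨i - 1, by omega⟩
    have hj : f j = f (j + 1) := hP.2
    refine (runs_fill s setA _
      (fun k => if s.arr setA k 0 ≠ 0 ∧ s.arr attA k 0 ≠ 0 then 1 else 0) (by simp) ?_).call ?_
    · intro s' k _ hx _ ha hk
      simp [hx, ha attA (by decide), hk]
    · rintro t s' ⟨ht, hset⟩ hf
      have hn' : s'.reg nR = n := hf.reg nR rfl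
      refine ⟨by simp only [Expr.cost]; omega, ?_⟩
      rw [levelAt_succ hj, hj, hp, ← hj, ← hprev j rfl (hj ▸ hp)]
      ext v
      simp only [marked, Set.mem_inter_iff, Set.mem_ofPred_eq, hn', ← hn]
      constructor
      · rintro ⟨k, hk, rfl, hk'⟩
        rw [hset k hk] at hk'
        split_ifs at hk' with hc
        · exact ⟨⟨k, hk, rfl, hc.1⟩, k, hk, rfl, hc.2⟩
        · exact absurd rfl hk'
      · rintro ⟨⟨k, hk, rfl, hk'⟩, l, hl, hlk, hl'⟩
        obtain rfl := h.holds.inj l hl k hk hlk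
        exact ⟨l, hl, rfl, by rw [hset l hl, if_pos ⟨hk', hl'⟩]; exact one_ne_zero⟩
  · refine (runs_fill s setA _
      (fun k => if s.arr winA k 0 = 0 ∧ s.arr colA k 0 = f i then 1 else 0) (by simp) ?_).call ?_
    · intro s' k _ hx hr ha _
      simp [hx, ha winA (by decide), ha colA (by decide), hr dR (by decide), hd]
    · rintro t s' ⟨ht, hset⟩ hf
      have hn' : s'.reg nR = n := hf.reg nR rfl
      refine ⟨by simp only [Expr.cost]; omega, ?_⟩
      rw [levelAt_of_ne (fun l hl => h.le hl.le hin) (fun l hl hfl => hP (by subst hl; exact ⟨by omega, hfl⟩))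
        (fun j l hjl hl => h.le hjl (by omega))]
      ext v
      simp only [marked, Set.mem_ofPred_eq, hn']
      constructor
      · rintro ⟨k, hk, rfl, hk'⟩
        rw [hset k hk] at hk'
        split_ifs at hk' with hc
        · exact ⟨(h.holds.alive k hk).1 hc.1, (h.holds.col k hk).symm.trans hc.2⟩
        · exact absurd rfl hk'
      · rintro ⟨hv, hc⟩
        obtain ⟨k, hk, rfl⟩ := h.holds.surj v hv
        refine ⟨k, hk, rfl, ?_⟩
        rw [hset k hk, if_pos ⟨(h.holds.alive k hk).2 hv, (h.holds.col k hk).trans hc⟩]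
        exact one_ne_zero

theorem Arena.isFatal_levelAt_iff (hp : player (f i) = p) :
    H.IsFatal p (f i) (H.levelAt f i) ↔
      H.levelAt f i ⊆ H.mattr p (H.levelAt f i) (f i) ∧ (H.levelAt f i).Nonempty :=
  ⟨fun h => ⟨h.subset, h.nonempty⟩, fun h => ⟨hp, h.2, fun _ hv => (levelSet_subset _ hv).2, h.1⟩⟩

theorem LevelState.runs_levelVisit (h : LevelState s e p f H won) (hi : s.reg iR = i)
    (hn : s.reg nR = n) (hin : i < n) (hd : s.reg dR = f i) (hpr : s.reg pR = p.val)
    (hp : player (f i) = p)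
    (hprev : ∀ j, i = j + 1 → player (f j) = p →
      marked s e setA ∩ marked s e attA = H.levelAt f j ∩ H.mattr p (H.levelAt f j) (f j)) :
    Runs levelVisit s 0 fun t s' =>
      H.IsFatal p (f i) (H.levelAt f i) ∧ s'.reg goR = 1 ∧ s'.reg iR = n ∧
        t + s'.rowsPot ≤ s.rowsPot + (1500 * (n + 1) + 1200 * ((n + 1) * (n + 1))) ∧
        LevelState s' e p f (H.removeNodes (H.attr p (H.levelAt f i)))
          (addWon won p (H.attr p (H.levelAt f i))) ∨
      ¬ H.IsFatal p (f i) (H.levelAt f i) ∧ s'.reg goR = s.reg goR ∧ s'.reg iR = i ∧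
        t + s'.rowsPot ≤ s.rowsPot + 1500 * (n + 1) ∧ s'.aliveCount = s.aliveCount ∧
        LevelState s' e p f H won ∧
        marked s' e setA ∩ marked s' e attA = H.levelAt f i ∩ H.mattr p (H.levelAt f i) (f i) := by
  subst hn
  set n := s.reg nR with hn
  rw [levelVisit, runs_seq, runs_set]
  simp only [Expr.eval, hi]
  set s₁ := s.setReg rowR i with hs₁
  have hl₁ : LevelState s₁ e p f H won := h.congr rfl rfl
  refine Runs.call_seq (hl₁.runs_levelTarget hi hin hd hp hprev) ?_
  rintro t₂ s₂ ⟨ht₂, hX₂⟩ hf₂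
  have hn₂ : s₂.reg nR = n := hf₂.reg nR rfl
  have hT₂ : s₂.arr rowT = s.arr rowT := hf₂.arr rowT rfl
  have hP₂ : s₂.arr rowP = s.arr rowP := hf₂.arr rowP rfl
  have hm₂ : MatState s₂ e H won := hl₁.toMatState.of_frame hf₂ rfl (by decide)
  have hc₂ : RowCtx s₂ e H p (f i) i :=
    ⟨hm₂.game, hm₂.holds, hm₂.adj, (hf₂.reg pR rfl).trans hpr, (hf₂.reg dR rfl).trans hd,
      (hf₂.reg rowR rfl).trans (by simp [hs₁])⟩
  refine Runs.call_seq (runs_refresh hc₂ hX₂ levelAt_subset_nodes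
    (by rw [hn₂, hT₂, hP₂]; exact h.rows i hin hp)) ?_
  rintro t₃ s₃ ⟨hrow₃, hS₃, hA₃, ht₃⟩ hf₃
  have hn₃ : s₃.reg nR = n := (hf₃.reg nR rfl).trans hn₂
  have hpot₃ := hS₃.rowsPot_le (by rw [hn₃, hn₂]) (by omega) ht₃
  rw [hn₂] at hrow₃ hpot₃
  rw [show s₂.rowsPot = s.rowsPot from Store.rowsPot_congr hn₂ hT₂ hP₂] at hpot₃
  have hm₃ : MatState s₃ e H won := hm₂.of_frame hf₃ rfl (by decide)
  have hX₃ : marked s₃ e setA = H.levelAt f i :=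
    (marked_congr e (by rw [hn₃, hn₂]) (hf₃.arr _ rfl)).trans hX₂
  refine Runs.call_seq (runs_testFatal hm₃.holds) ?_
  rintro t₄ s₄ ⟨ht₄, hok₄⟩ hf₄
  rw [hX₃, hA₃] at hok₄
  have hn₄ : s₄.reg nR = n := (hf₄.reg nR rfl).trans hn₃
  have hm₄ : MatState s₄ e H won := hm₃.of_frame hf₄ rfl (by decide)
  refine Runs.call_seq (runs_testNonempty s₄ e) ?_
  rintro t₅ s₅ ⟨ht₅, hne₅⟩ hf₅
  rw [show marked s₄ e setA = H.levelAt f i from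
    (marked_congr e (by rw [hn₄, hn₃]) (hf₄.arr _ rfl)).trans hX₃] at hne₅
  have hn₅ : s₅.reg nR = n := (hf₅.reg nR rfl).trans hn₄
  have hm₅ : MatState s₅ e H won := hm₄.of_frame hf₅ rfl (by decide)
  have hT₅ : s₅.arr rowT = s₃.arr rowT := (hf₅.arr _ rfl).trans (hf₄.arr _ rfl)
  have hP₅ : s₅.arr rowP = s₃.arr rowP := (hf₅.arr _ rfl).trans (hf₄.arr _ rfl)
  have hX₅ : marked s₅ e setA = H.levelAt f i :=
    (marked_congr e (by rw [hn₅, hn₃]) ((hf₅.arr _ rfl).trans (hf₄.arr _ rfl))).trans hX₃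
  have hA₅ : marked s₅ e attA = H.mattr p (H.levelAt f i) (f i) :=
    (marked_congr e (by rw [hn₅, hn₃]) ((hf₅.arr _ rfl).trans (hf₄.arr _ rfl))).trans hA₃
  have hpot₅ : s₅.rowsPot = s₃.rowsPot := Store.rowsPot_congr (by rw [hn₅, hn₃]) hT₅ hP₅
  have hrows₅ : ∀ q < n, player (f q) = p →
      RowInv n e H p (f q) (H.levelAt f q) (s₅.arr rowT q) (s₅.arr rowP q) := by
    intro q hq hpq
    rw [hT₅, hP₅]
    by_cases hqi : q = i
    · subst hqi; exact hrow₃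
    · rw [(hS₃ q hqi).1, (hS₃ q hqi).2, hT₂, hP₂]
      exact h.rows q hq hpq
  have ho₅ : s₅.arr ordA = s.arr ordA := (hf₅.arr _ rfl).trans ((hf₄.arr _ rfl).trans
    ((hf₃.arr _ rfl).trans (hf₂.arr _ rfl)))
  have hco₅ : s₅.arr colA = s.arr colA := (hf₅.arr _ rfl).trans ((hf₄.arr _ rfl).trans
    ((hf₃.arr _ rfl).trans (hf₂.arr _ rfl)))
  have hok₅ : s₅.reg okR = s₄.reg okR := hf₅.reg okR rfl
  rw [show s₁.reg nR = n from rfl] at ht₂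
  rw [hn₃] at ht₄
  rw [hn₄] at ht₅
  refine Runs.ite (P := H.IsFatal p (f i) (H.levelAt f i)) ?_ (fun hfat => ?_) (fun hfat => ?_)
  · rw [isFatal_levelAt_iff hp, ← hok₄, ← hne₅, Expr.and_ne_zero]
    simp [hok₅]
  · refine Runs.call_seq (hm₅.runs_removeStep (p := p)
      ((hf₅.reg pR rfl).trans ((hf₄.reg pR rfl).trans ((hf₃.reg pR rfl).trans hc₂.player)))
      hA₅ mattr_subset_nodes) ?_
    rintro t₆ s₆ ⟨ht₆, hm₆⟩ hf₆
    -- The program removes the attractor of the monotone attractor, which equals the attractor of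
    -- the fatal set itself.
    rw [attr_mattr hfat.subset] at hm₆
    have hn₆ : s₆.reg nR = n := (hf₆.reg nR rfl).trans hn₅
    rw [hn₅] at ht₆
    rw [recurse, runs_seq, runs_set, runs_set]
    set s₇ := (s₆.setReg goR (Expr.eval s₆ (.const 1))).setReg iR
      (Expr.eval (s₆.setReg goR (Expr.eval s₆ (.const 1))) (.reg nR)) with hs₇
    have hpot₇ : s₇.rowsPot = s₅.rowsPot :=
      Store.rowsPot_congr (hf₆.reg nR rfl) (hf₆.arr rowT rfl) (hf₆.arr rowP rfl)
    refine Or.inl ⟨hfat, by simp [hs₇], by simp [hs₇, hn₆], ?_, ?_⟩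
    · rw [hpot₇, hpot₅]
      simp only [Expr.cost]
      omega
    · refine ⟨hm₆.congr rfl fun _ _ => rfl, h.order.congr hn₆ ((hf₆.arr _ rfl).trans ho₅)
        ((hf₆.arr _ rfl).trans hco₅), ?_, ?_⟩
      · rw [show s₇.arr colA = s.arr colA from (hf₆.arr _ rfl).trans hco₅,
          show s₇.arr ordA = s.arr ordA from (hf₆.arr _ rfl).trans ho₅]
        exact h.col
      · rw [show s₇.reg nR = n from hn₆]
        intro q hq hpq
        rw [show s₇.arr rowT = s₅.arr rowT from hf₆.arr _ rfl,
          show s₇.arr rowP = s₅.arr rowP from hf₆.arr _ rfl]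
        exact (hrows₅ q hq hpq).levelAt_removeNodes hpq cpre_attr_subset
  · rw [runs_skip]
    refine Or.inr ⟨hfat, ?_, ?_, ?_, ?_, ?_, by rw [hX₅, hA₅]⟩
    · exact (hf₅.reg _ rfl).trans ((hf₄.reg _ rfl).trans ((hf₃.reg _ rfl).trans (hf₂.reg _ rfl)))
    · exact (hf₅.reg _ rfl).trans ((hf₄.reg _ rfl).trans ((hf₃.reg _ rfl).trans
        ((hf₂.reg _ rfl).trans hi)))
    · rw [hpot₅]
      simp only [Expr.cost]
      omega
    · exact Store.aliveCount_congr hn₅ ((hf₅.arr _ rfl).trans ((hf₄.arr _ rfl).trans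
        ((hf₃.arr _ rfl).trans (hf₂.arr _ rfl))))
    · refine ⟨hm₅, h.order.congr hn₅ ho₅ hco₅, by rw [ho₅, hco₅]; exact h.col, ?_⟩
      rw [hn₅]
      exact hrows₅

/-- Positions of removed nodes are visited too, since the levels are indexed by the original list. A
pass that finds nothing has examined every level of every color of `p`, so no fatal set of `p` is
left. -/
theorem LevelState.runs_levelPass (h : LevelState s e p f H won) (hn : s.reg nR = n) :
    Runs (levelPass p) s 0 fun t s' =>
      t + s'.rowsPot ≤ s.rowsPot +
        (n * (1500 * (n + 1) + 60) + 1200 * ((n + 1) * (n + 1)) + 60) ∧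
      (s'.reg goR = 0 ∧ s'.aliveCount = s.aliveCount ∧ LevelState s' e p f H won ∧
          (∀ d B, ¬ H.IsFatal p d B) ∨
        s'.reg goR = 1 ∧ s'.aliveCount < s.aliveCount ∧ ∃ d B, H.IsFatal p d B ∧
          LevelState s' e p f (H.removeNodes (H.attr p B)) (addWon won p (H.attr p B))) := by
  set K := 1500 * (n + 1) with hK
  set R := 1200 * ((n + 1) * (n + 1)) with hR
  rw [levelPass, runs_seq, runs_set, runs_seq, runs_set]
  simp only [Expr.eval]
  set s₁ := (s.setReg goR 0).setReg iR 0 with hs₁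
  have hpot₁ : s₁.rowsPot = s.rowsPot := Store.rowsPot_congr rfl rfl rfl
  refine (runs_while
    (fun s' => s'.reg goR = 0 ∧ s'.reg iR ≤ n ∧ s'.aliveCount = s.aliveCount ∧
        LevelState s' e p f H won ∧
        (∀ j, s'.reg iR = j + 1 → player (f j) = p →
          marked s' e setA ∩ marked s' e attA = H.levelAt f j ∩ H.mattr p (H.levelAt f j) (f j)) ∧
        (∀ l < s'.reg iR, player (f l) = p → ¬ H.IsFatal p (f l) (H.levelAt f l)) ∨
      s'.reg goR = 1 ∧ n ≤ s'.reg iR ∧ s'.aliveCount < s.aliveCount ∧ ∃ d B, H.IsFatal p d B ∧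
        LevelState s' e p f (H.removeNodes (H.attr p B)) (addWon won p (H.attr p B)))
    (fun s' => (K + 60) * (n - s'.reg iR) + (if s'.reg goR = 0 then R else 0) + s'.rowsPot)
    ?_ ?_).call ?_
  · refine Or.inl ⟨rfl, by simp [hs₁], rfl, h.congr rfl rfl, ?_, ?_⟩
    · simp [hs₁]
    · simp [hs₁]
  · rintro s₂ hor hf₂ hb
    have hn₂ : s₂.reg nR = n := (hf₂.reg nR rfl).trans hn
    rw [Expr.lt_ne_zero] at hb
    simp only [Expr.eval, hn₂] at hb
    rcases hor with ⟨hgo₂, -, hal₂, hl₂, hprev, hnf⟩ | ⟨-, h', -⟩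
    swap
    · omega
    set i := s₂.reg iR with hi
    rw [runs_seq, runs_set, runs_seq, runs_set]
    simp only [Expr.eval, ← hi, hl₂.col, Store.setReg_reg, if_true]
    set s₃ := (s₂.setReg dR (f i)).setReg pR (f i % 2) with hs₃
    have hl₃ : LevelState s₃ e p f H won := hl₂.congr rfl rfl
    have hn₃ : s₃.reg nR = n := hn₂
    have hi₃ : s₃.reg iR = i := rfl
    have hgo₃ : s₃.reg goR = 0 := hgo₂
    have hpot₃ : s₃.rowsPot = s₂.rowsPot := Store.rowsPot_congr rfl rfl rfl
    have hal₃ : s₃.aliveCount = s₂.aliveCount := rfl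
    have hp₃ : s₃.reg pR = (player (f i)).val := by simp [hs₃, player]
    obtain ⟨j, hj⟩ : ∃ j, n - i = j + 1 := ⟨n - i - 1, by omega⟩
    have hj' : n - (i + 1) = j := by omega
    rw [runs_seq]
    refine Runs.ite (P := player (f i) = p) ?_ (fun hP => ?_) (fun hP => ?_)
    · rw [Expr.eq_ne_zero]
      simp only [Expr.eval, hp₃]
      exact Fin.ext_iff.symm
    · refine (hl₃.runs_levelVisit hi₃ hn₃ hb (by simp [hs₃]) (hP ▸ hp₃) hP hprev).call ?_
      rintro t₄ s₄ (⟨hfat, hgo₄, hi₄, ht₄, hl₄⟩ | ⟨hfat, hgo₄, hi₄, ht₄, hal₄, hl₄, hprev₄⟩) hf₄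
      · have hn₄ : s₄.reg nR = n := (hf₄.reg nR rfl).trans hn₃
        rw [runs_set]
        simp only [Expr.eval, hi₄]
        have hpot₅ : (s₄.setReg iR (n + 1)).rowsPot = s₄.rowsPot := Store.rowsPot_congr rfl rfl rfl
        -- The recursive call sets `iR` to `n` and the loop still increments it, so the final value
        -- is `n + 1`; the invariant asks only for `n ≤ iR`.
        refine ⟨Or.inr ⟨hgo₄, by simp, ?_, _, _, hfat, hl₄.congr rfl rfl⟩, ?_⟩
        · rw [← hal₂, ← hal₃]
          refine hl₃.holds.aliveCount_lt (hl₄.congr (s' := s₄.setReg iR (n + 1)) rfl rfl).holds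
            (hn₄.trans hn₃.symm) (removeNodes_nodes_ssubset ?_)
          obtain ⟨v, hv⟩ := hfat.nonempty
          exact ⟨v, subset_attr hv, levelAt_subset_nodes hv⟩
        · have hgo₅ : (s₄.setReg iR (n + 1)).reg goR = 1 := hgo₄
          rw [hpot₅, hgo₅, hgo₂, hj, Nat.mul_add]
          simp [Expr.cost]
          omega
      · rw [runs_set]
        simp only [Expr.eval, hi₄]
        have hpot₅ : (s₄.setReg iR (i + 1)).rowsPot = s₄.rowsPot := Store.rowsPot_congr rfl rfl rfl
        have hgo₅ : (s₄.setReg iR (i + 1)).reg goR = 0 := hgo₄.trans hgo₃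
        refine ⟨Or.inl ⟨hgo₅, by simp; omega, hal₄.trans (hal₃.trans hal₂),
          hl₄.congr rfl rfl, ?_, ?_⟩, ?_⟩
        · intro l hl _
          have hl : i + 1 = l + 1 := by simpa using hl
          obtain rfl : i = l := by omega
          exact hprev₄
        · intro l hl hpl
          have hl : l < i + 1 := by simpa using hl
          rcases (Nat.lt_succ_iff.1 hl).lt_or_eq with hl | rfl
          · exact hnf l hl hpl
          · exact hfat
        · rw [hpot₅, hgo₅, hgo₂, hj]
          simp only [Store.setReg_reg, if_true, hj', Nat.mul_add, Expr.cost]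
          omega
    · rw [runs_skip, runs_set]
      simp only [Expr.eval, hi₃]
      have hpot₅ : (s₃.setReg iR (i + 1)).rowsPot = s₂.rowsPot := Store.rowsPot_congr rfl rfl rfl
      have hgo₅ : (s₃.setReg iR (i + 1)).reg goR = 0 := hgo₃
      refine ⟨Or.inl ⟨hgo₅, by simp; omega, hal₃.trans hal₂, hl₃.congr rfl rfl, ?_, ?_⟩, ?_⟩
      · intro l hl hpl
        have hl : i + 1 = l + 1 := by simpa using hl
        obtain rfl : i = l := by omega
        exact absurd hpl hP
      · intro l hl hpl
        have hl : l < i + 1 := by simpa using hl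
        rcases (Nat.lt_succ_iff.1 hl).lt_or_eq with hl | rfl
        · exact hnf l hl hpl
        · exact absurd hpl hP
      · rw [hpot₅, hgo₅, hgo₂, hj]
        simp only [Store.setReg_reg, if_true, hj', Nat.mul_add, Expr.cost]
        omega
  · rintro t s' ⟨hor, hb, ht⟩ hf'
    have hn' : s'.reg nR = n := (hf'.reg nR rfl).trans hn
    refine ⟨?_, ?_⟩
    · have hi₁ : s₁.reg iR = 0 := by simp [hs₁]
      have hgo₁ : s₁.reg goR = 0 := by simp [hs₁]
      rw [hpot₁, hi₁, hgo₁] at ht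
      simp only [Expr.cost, if_true, Nat.sub_zero] at ht ⊢
      rw [Nat.mul_comm (K + 60) n] at ht
      omega
    · rcases hor with ⟨hgo, hi, hal, hl, -, hnf⟩ | ⟨hgo, -, hal, h⟩
      · refine Or.inl ⟨hgo, hal, hl, not_isFatal_of_levelAt hl.game
          (g := fun l => e (s'.arr ordA l 0)) (n := n) (f := f) ?_ ?_⟩
        · intro v hv
          obtain ⟨k, hk, rfl⟩ := hl.holds.surj v hv
          obtain ⟨l, hln, rfl⟩ := hl.order.surj k hk
          exact ⟨l, hn' ▸ hln, rfl, by rw [← hl.holds.col _ hk, hl.col]⟩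
        · have : ¬ s'.reg iR < n := by
            have := mt Expr.lt_ne_zero.2 (not_not.2 hb)
            simpa [hn'] using this
          exact fun l hln => hnf l (by omega)
      · exact Or.inr ⟨hgo, hal, h⟩

/-- The rows are emptied at the start of a phase, as the removals of the other player do not
preserve them. The property `Q` is carried along to the end of the phase. -/
theorem MatState.runs_levelPhase (h : MatState s e H won) (ho : Ranked s fun a b => ¬ a < b)
    (hn : s.reg nR = n) (Q : Arena α → Prop) (hQ : Q H)
    (hQA : ∀ H A, H.IsParityGame → H.cpre p A ⊆ A → Q H → Q (H.removeNodes A))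
    (hG : ∀ r, H.Solved r → G.Solved (r.after won)) :
    Runs (levelPhase p) s 0 fun t s' => t ≤ 5000 * ((n + 2) * (n + 2) * (n + 2)) ∧
      ∃ H won, MatState s' e H won ∧ Q H ∧ (∀ d B, ¬ H.IsFatal p d B) ∧
        ∀ r, H.Solved r → G.Solved (r.after won) := by
  refine Runs.call_seq (runs_zeroRows (α := α) s) ?_
  rintro t₁ s₁ ⟨ht₁, hrow₁⟩ hf₁
  have hn₁ : s₁.reg nR = n := (hf₁.reg nR rfl).trans hn
  set f := fun i => s₁.arr colA (s₁.arr ordA i 0) 0 with hf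
  have hl₁ : LevelState s₁ e p f H won := by
    refine ⟨h.of_frame hf₁ rfl (by decide), ho.of_frame hf₁ rfl rfl rfl, fun _ => rfl, ?_⟩
    rw [hn₁]
    rw [hn] at hrow₁
    exact fun q hq _ => hrow₁ q hq _ _ _ _ _
  refine (runs_restarts_of
    (B := n * (1500 * (n + 1) + 60) + 1200 * ((n + 1) * (n + 1)) + 60)
    (fun s' => ∃ H won, LevelState s' e p f H won ∧ Q H ∧
      ∀ r, H.Solved r → G.Solved (r.after won))
    (fun s' => ∃ H won, MatState s' e H won ∧ Q H ∧ (∀ d B, ¬ H.IsFatal p d B) ∧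
      ∀ r, H.Solved r → G.Solved (r.after won))
    Store.rowsPot s₁ ⟨H, won, hl₁.congr rfl rfl, hQ, hG⟩ (Store.rowsPot_congr rfl rfl rfl) ?_).call ?_
  · rintro s₂ hf₂ ⟨H, won, hl₂, hQ, hG⟩
    refine (hl₂.runs_levelPass ((hf₂.reg nR rfl).trans hn₁)).mono ?_
    rintro t s₃ ⟨ht, hor⟩
    refine ⟨ht, ?_⟩
    rcases hor with ⟨hgo, hal, hl, hnf⟩ | ⟨hgo, hal, d, B, hB, hl⟩
    · exact Or.inl ⟨hgo, hal.le, H, won, hl.toMatState, hQ, hnf, hG⟩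
    · refine Or.inr ⟨hgo, hal, _, _, hl, hQA _ _ hl₂.game cpre_attr_subset hQ, fun r hr => ?_⟩
      rw [← Outcome.record_after]
      exact hG _ (hB.solved hl₂.game rfl hr)
  · rintro t s₂ ⟨ht, h⟩ -
    refine ⟨?_, h⟩
    have hpot := s₁.rowsPot_le
    rw [hn] at ht₁
    rw [hn₁] at hpot ht
    have h1 : (n + 1) * (n + 1) ≤ (n + 2) * (n + 2) * (n + 2) := by nlinarith
    have h2 : (n + 1) * (n + 1) * (n + 1) ≤ (n + 2) * (n + 2) * (n + 2) := by
      gcongr <;> omega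
    have h3 : n * (1500 * (n + 1) + 60) + 1200 * ((n + 1) * (n + 1)) + 60 + 10 ≤
        2900 * ((n + 2) * (n + 2)) := by nlinarith
    have h4 := Nat.mul_le_mul_left (n + 2) h3
    have h5 : (n + 2) * (2900 * ((n + 2) * (n + 2))) =
      2900 * ((n + 2) * (n + 2) * (n + 2)) := by ring
    rw [h5] at h4
    omega

theorem Arena.Solved.unique {r r' : Outcome α} (h : G.Solved r) (h' : G.Solved r') : r = r' := by
  cases r
  cases r'
  obtain ⟨h1, h2⟩ := h
  obtain ⟨h1', h2'⟩ := h'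
  simp only at h1 h1' h2 h2'
  rw [h2, h2', funext h1, funext h1']

/-- This program removes fatal sets in another order than the pseudo-code, so its result is compared
with that of `psolB` through the order-free description `Solved`. -/
theorem Input.runs_psolBRows (h : Input s e G) (hG : G.IsParityGame) :
    Runs psolBRows s 0 fun t s' =>
      t ≤ 12000 * ((s.reg nR + 2) * (s.reg nR + 2) * (s.reg nR + 2)) ∧
      ∃ H won, MatState s' e H won ∧ PsolB G ⟨H, won⟩ := by
  set n := s.reg nR with hn
  refine Runs.call_seq (h.runs_startMatrix hG) ?_
  rintro t₁ s₁ ⟨ht₁, hm₁⟩ hf₁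
  rw [← hn] at ht₁
  have hn₁ : s₁.reg nR = n := hf₁.reg nR rfl
  refine Runs.call_seq (runs_sortNodes s₁ (fun e f => .lt f e) (fun a b => b < a)
    (fun a b => by simp; ring) (fun a b s => by simp) (by intros; omega) (by intros; omega)) ?_
  rintro t₂ s₂ ⟨ht₂, ho₂⟩ hf₂
  have hn₂ : s₂.reg nR = n := (hf₂.reg nR rfl).trans hn₁
  have hm₂ : MatState s₂ e G fun _ => ∅ := hm₁.of_frame hf₂ rfl (by decide)
  refine Runs.call_seq (hm₂.runs_levelPhase (p := 0) (G := G) ho₂ hn₂ (fun _ => True) trivial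
    (fun _ _ _ _ _ => trivial) (fun r hr => by simpa [Outcome.after] using hr)) ?_
  rintro t₃ s₃ ⟨ht₃, H₃, won₃, hm₃, -, hnf₃, hG₃⟩ hf₃
  have hn₃ : s₃.reg nR = n := (hf₃.reg nR rfl).trans hn₂
  -- The second phase removes sets that are closed for player 1, which create no fatal sets of
  -- player 0; so at the end neither player has one.
  refine (hm₃.runs_levelPhase (p := 1) (G := G) (ho₂.of_frame hf₃ rfl rfl rfl) hn₃
    (fun H => ∀ d B, ¬ H.IsFatal 0 d B) hnf₃
    (fun H A hH hA hnf d B hB => hnf d B (hB.of_removeNodes hH hA)) hG₃).call ?_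
  rintro t₄ s₄ ⟨ht₄, H₄, won₄, hm₄, hnf₄, hnf₄', hG₄⟩ -
  refine ⟨?_, H₄, won₄, hm₄, ?_⟩
  · have h1 : (n + 1) * (n + 1) ≤ (n + 2) * (n + 2) * (n + 2) := by nlinarith
    rw [hn₁, mul_assoc] at ht₂
    omega
  · have hsol := hG₄ _ (Solved.of_not_fatal hm₄.game fun p => by
      rcases fin2_eq_or 0 p with rfl | rfl
      · exact hnf₄
      · exact hnf₄')
    -- That `psolB` has an outcome at all is known from the first program, which computes one;
    -- uniqueness shows that it is the present one.
    obtain ⟨-, -, -, -, H', won', -, hr⟩ := h.runs_psolB hG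
    rw [(psolB_solved hG hr).unique hsol] at hr
    simpa [Outcome.after] using hr

end ParityGames

/-! ### Cubic bounds and conclusion -/

namespace ParityGames

open Code Arena

variable {α : Type*} {G : Arena α}

theorem cube_le (n : ℕ) : (n + 2) * (n + 2) * (n + 2) ≤ 27 * (n ^ 3 + 1) := by
  rcases Nat.eq_zero_or_pos n with rfl | hn
  · norm_num
  · calc (n + 2) * (n + 2) * (n + 2) ≤ (3 * n) * (3 * n) * (3 * n) := by gcongr <;> omega
      _ = 27 * n ^ 3 := by ring
      _ ≤ _ := by omega

theorem runsWithin_psolRows (hG : G.IsParityGame) :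
    RunsWithin psolRows Psol G (400000 * (G.numNodes ^ 3 + 1)) := by
  refine .of_runs (T₀ := 400000) hG rfl (fun s e h => (h.runs_psolRows hG).mono ?_)
    (fun s e h => (h.runs_psolRows emptyGame_isParityGame).mono ?_) (by omega)
    psol_of_nodes_empty
  · rintro t s' ⟨ht, H, won, hm, hr⟩
    refine ⟨ht.trans ?_, H, won, hm.toState, hm.succs, hr⟩
    rw [← h.reg_eq]
    have := cube_le (s.reg nR)
    omega
  · rintro t s' ⟨ht, -⟩
    rw [h.reg_eq] at ht
    simp [emptyGame, numNodes, nodes] at ht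
    omega

theorem runsWithin_psolBRows (hG : G.IsParityGame) :
    RunsWithin psolBRows PsolB G (400000 * (G.numNodes ^ 3 + 1)) := by
  refine .of_runs (T₀ := 400000) hG rfl (fun s e h => (h.runs_psolBRows hG).mono ?_)
    (fun s e h => (h.runs_psolBRows emptyGame_isParityGame).mono ?_) (by omega)
    psolB_of_nodes_empty
  · rintro t s' ⟨ht, H, won, hm, hr⟩
    refine ⟨ht.trans ?_, H, won, hm.toState, hm.succs, hr⟩
    rw [← h.reg_eq]
    have := cube_le (s.reg nR)
    omega
  · rintro t s' ⟨ht, -⟩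
    rw [h.reg_eq] at ht
    simp [emptyGame, numNodes, nodes] at ht
    omega

end ParityGames

theorem mainTheorem4 :
    (∃ C : ℕ, ∀ {α : Type*} (G : Arena α), G.IsParityGame →
      RunsWithin Code.psol Psol G (C * (G.numNodes ^ 2 * G.numEdges + 1)) ∧
      RunsWithin Code.psolB PsolB G (C * (G.numNodes ^ 2 * G.numEdges + 1))) ∧
    (∃ (P P' : Cmd) (C : ℕ), ∀ {α : Type*} (G : Arena α), G.IsParityGame →
      RunsWithin P Psol G (C * (G.numNodes ^ 3 + 1)) ∧
      RunsWithin P' PsolB G (C * (G.numNodes ^ 3 + 1))) ∧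
    (∃ C : ℕ, ∀ {α : Type*} (G : Arena α), G.IsParityGame →
      RunsWithin Code.psolQ PsolQ G (C * (G.numNodes ^ 2 * G.numEdges * G.numColors + 1))) := by
  -- One constant serves everywhere: 36 · 10000 for `psol` and `psolB`, 27 · 10000 for `psolQ`, and
  -- 27 · 6000 and 27 · 12000 for the cubic programs are all smaller.
  exact ⟨⟨400000, fun G hG => ⟨runsWithin_psol hG, runsWithin_psolB hG⟩⟩,
    ⟨psolRows, Code.psolBRows, 400000, fun G hG => ⟨runsWithin_psolRows hG, runsWithin_psolBRows hG⟩⟩,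
    ⟨400000, fun G hG => runsWithin_psolQ hG⟩⟩
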